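/- Let $X$ be a compact (connected) Riemann surface of genus $g>1$, let $\omega$ be a holomorphic one-form on $X$ with $2g-2$ simple zeros $P_1,\dots,P_{2g-2}$, and let $C$ be a holomorphic line bundle on $X$ with $C\otimes C=K$, the canonical bundle. Equip $X$ with the flat conical metric $|\omega|^2$, with area form $dS$, and $C$ with the Hermitian metric $h=|\omega|^{-1}$; let $L_2(X;C)$ be the space of sections of $C$ with scalar product $(u,v)=\int_X u\,h\,\bar v\,dS$. Put $\dot X=X\setminus\{P_1,\dots,P_{2g-2}\}$. Let $\Delta_{min}$ be the closure in $L_2(X;C)$ of the operator $\Delta u=-|\omega|^{-2}h^{-1}\partial(h\,\bar\partial u)$ with domain $C_c^\infty(\dot X;C)$, let $\Delta_{min}^*$ be its adjoint, and let $\bar{\mathcal D}_\omega$ be the closure in $L_2(X;C)$ of the operator $u\mapsto\bar\omega^{-1}\bar\partial u$ with domain $C_c^\infty(\dot X;C)$. Let $\Delta_F$ be the Friedrichs extension of $\Delta_{min}$, that is, the operator associated with the closure of the quadratic form $f\mapsto(\Delta_{min}f,f)$, $f\in\mathrm{Dom}\,\Delta_{min}$. Near $P_k$ let $x_k(Q)=\big(2\int_{P_k}^Q\omega\big)^{1/2}$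 be the distinguished holomorphic coordinate, and write $u(x_k)$ for the representative of a section $u=u(x_k)(dx_k)^{1/2}$ of $C$ in this coordinate. Then: (i) $\Delta_F$ is a self-adjoint extension of $\Delta_{min}$, and its domain consists of exactly those $u\in\mathrm{Dom}\,\Delta_{min}^*$ for which there are $\tilde u\in\mathrm{Dom}\,\Delta_{min}$ and complex constants $c_{k,0},c_{k,1},c_{k,2},c_{k,-1}$ such that, for every $k$, $$u(x_k)=-\frac{2}{\pi}c_{k,0}|x_k|+c_{k,1}x_k+c_{k,2}x_k^2-\frac{2}{3\pi}c_{k,-1}\bar x_k|x_k|+\tilde u(x_k)$$ almost everywhere in a neighbourhood of $P_k$. (ii) $\Delta_F=\bar{\mathcal D}_\omega^*\bar{\mathcal D}_\omega$, where the product has its natural domain $\{u\in\mathrm{Dom}\,\bar{\mathcal D}_\omega:\bar{\mathcal D}_\omega u\in\mathrm{Dom}\,\bar{\mathcal D}_\omega^*\}$. (iii) $\Delta_F$ is positive definite: there is a constant $c>0$ with $(\Delta_Fu,u)\ge c\,\|u\|^2$ for all $u\in\mathrm{Dom}\,\Delta_F$. -/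

import Mathlib

open MeasureTheory Filter Topology
open scoped Manifold ENNReal

noncomputable section

/-! ### Unbounded operators in a Hilbert space -/

namespace UnboundedOp

variable {H : Type*} [NormedAddCommGroup H] [InnerProductSpace ℂ H]

/-- The product `S T` on its natural domain `{x ∈ Dom T : T x ∈ Dom S}`. -/
def prod (S T : H →ₗ.[ℂ] H) : H →ₗ.[ℂ] H where
  domain :=
    { carrier := {x | ∃ h : x ∈ T.domain, T ⟨x, h⟩ ∈ S.domain}
      zero_mem' := ⟨T.domain.zero_mem, by
        have h0 : T ⟨0, T.domain.zero_mem⟩ = 0 := T.map_zero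
        rw [h0]; exact S.domain.zero_mem⟩
      add_mem' := by
        rintro x y ⟨hx, hx'⟩ ⟨hy, hy'⟩
        refine ⟨T.domain.add_mem hx hy, ?_⟩
        have h1 : T ⟨x + y, T.domain.add_mem hx hy⟩ = T ⟨x, hx⟩ + T ⟨y, hy⟩ :=
          T.map_add ⟨x, hx⟩ ⟨y, hy⟩
        rw [h1]; exact S.domain.add_mem hx' hy'
      smul_mem' := by
        rintro c x ⟨hx, hx'⟩
        refine ⟨T.domain.smul_mem c hx, ?_⟩
        have h1 : T ⟨c • x, T.domain.smul_mem c hx⟩ = c • T ⟨x, hx⟩ := T.map_smul c ⟨x, hx⟩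
        rw [h1]; exact S.domain.smul_mem c hx' }
  toFun :=
    { toFun := fun x => S ⟨T ⟨x.1, x.2.choose⟩, x.2.choose_spec⟩
      map_add' := by
        intro x y
        rw [← S.map_add]
        congr 1
        apply Subtype.ext
        exact T.map_add ⟨x.1, x.2.choose⟩ ⟨y.1, y.2.choose⟩
      map_smul' := by
        intro c x
        rw [RingHom.id_apply, ← S.map_smul]
        congr 1
        apply Subtype.ext
        exact T.map_smul c ⟨x.1, x.2.choose⟩ }

/-- `x n → u` in the sense of the quadratic form `a[f] = (T f, f)`: the sequence `x` in `Dom T`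
converges to `u` in `H` and `a[x n - x m] → 0`. The `u` admitting such a sequence form the domain
of the closure `a_F` of `a` (for every shift `a - μ ‖·‖²` the notion is the same). -/
def FormTendsto (T : H →ₗ.[ℂ] H) (x : ℕ → T.domain) (u : H) : Prop :=
  Tendsto (fun n => (x n : H)) atTop (𝓝 u) ∧
  Tendsto (fun q : ℕ × ℕ => inner ℂ ((x q.1 - x q.2 : T.domain) : H) (T (x q.1 - x q.2)))
    atTop (𝓝 0)

/-- `u ∈ Dom a_F` and `a_F(u, v) = (w, v)` for every `v ∈ Dom a_F`, where the closed form is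
`a_F(u, v) = lim (T (x n), y n)` for `x → u`, `y → v` in the sense of the form. -/
def FriedrichsPair (T : H →ₗ.[ℂ] H) (u w : H) : Prop :=
  ∃ x : ℕ → T.domain, FormTendsto T x u ∧
    ∀ (v : H) (y : ℕ → T.domain), FormTendsto T y v →
      Tendsto (fun n => inner ℂ (y n : H) (T (x n))) atTop (𝓝 (inner ℂ v w))

/-- The Friedrichs extension of a densely defined non-negative symmetric operator: the operator
associated with the closure of the form `(T f, f)`. (For such `T` the set of pairs below is already
a linear subspace and the graph of an operator.) -/
def friedrichs (T : H →ₗ.[ℂ] H) : H →ₗ.[ℂ] H :=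
  (Submodule.span ℂ {q : H × H | FriedrichsPair T q.1 q.2}).toLinearPMap

end UnboundedOp

/-! ### Wirtinger derivatives -/

/-- `∂f/∂z`. -/
def wirtD (f : ℂ → ℂ) (z : ℂ) : ℂ :=
  (1 / 2) * (fderiv ℝ f z 1 - Complex.I * fderiv ℝ f z Complex.I)

/-- `∂f/∂z̄`. -/
def wirtDbar (f : ℂ → ℂ) (z : ℂ) : ℂ :=
  (1 / 2) * (fderiv ℝ f z 1 + Complex.I * fderiv ℝ f z Complex.I)

/-! ### Riemann surfaces and holomorphic one-forms -/

namespace RiemannSurface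

variable {X : Type*} [TopologicalSpace X] [ChartedSpace ℂ X]

/-- The coefficient `f` of a one-form `ω = f(z) dz` in the coordinate `φ`, as a function of the
coordinate. -/
def coeff (ω : ∀ p : X, TangentSpace 𝓘(ℂ) p →L[ℂ] ℂ) (φ : OpenPartialHomeomorph X ℂ) (z : ℂ) : ℂ :=
  ω (φ.symm z) (mfderiv 𝓘(ℂ) 𝓘(ℂ) φ.symm z (1 : ℂ))

variable (X) in
/-- The space of holomorphic one-forms on `X`. -/
def holomorphicOneForms : Submodule ℂ (∀ p : X, TangentSpace 𝓘(ℂ) p →L[ℂ] ℂ) where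
  carrier := {ω | ∀ φ ∈ IsManifold.maximalAtlas 𝓘(ℂ) 1 X, DifferentiableOn ℂ (coeff ω φ) φ.target}
  zero_mem' := fun _ _ => differentiableOn_const (0 : ℂ)
  add_mem' := fun h h' φ hφ => (h φ hφ).add (h' φ hφ)
  smul_mem' := fun c _ h φ hφ => (h φ hφ).const_mul c

variable (X) in
/-- The genus of a compact Riemann surface: the dimension of the space of holomorphic one-forms. -/
def genus : ℕ := Module.finrank ℂ (holomorphicOneForms X)

/-- The set of zeros of a one-form. -/
def zeros (ω : ∀ p : X, TangentSpace 𝓘(ℂ) p →L[ℂ] ℂ) : Set X := {p | ω p = 0}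

/-- All zeros of the holomorphic one-form `ω` are simple. -/
def HasSimpleZeros (ω : ∀ p : X, TangentSpace 𝓘(ℂ) p →L[ℂ] ℂ) : Prop :=
  ∀ p ∈ zeros ω, ∀ φ ∈ IsManifold.maximalAtlas 𝓘(ℂ) 1 X, p ∈ φ.source →
    deriv (coeff ω φ) (φ p) ≠ 0

/-- `ξ` is a distinguished coordinate at the zero `P`, that is `ξ(Q) = (2 ∫_P^Q ω)^{1/2}` on a
coordinate disc centred at `P`: `ξ(P) = 0` and `ω = d(ξ²/2) = ξ dξ`. -/
def IsDistinguished (ω : ∀ p : X, TangentSpace 𝓘(ℂ) p →L[ℂ] ℂ) (P : X)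
    (ξ : OpenPartialHomeomorph X ℂ) : Prop :=
  ξ ∈ IsManifold.maximalAtlas 𝓘(ℂ) 1 X ∧ P ∈ ξ.source ∧ ξ P = 0 ∧
  (∃ r > 0, ξ.target = Metric.ball 0 r) ∧ ∀ z ∈ ξ.target, coeff ω ξ z = z

variable (X) in
/-- A holomorphic line bundle `C` with `C ⊗ C = K`, given by a finite cover of `X` by coordinate
neighbourhoods and transition functions `trans i j` which are holomorphic square roots
`(dx_i/dx_j)^{1/2}` of the transition functions of the canonical bundle `K` and satisfy the cocycle
condition. The representatives of a section `u = u_i (dx_i)^{1/2}` satisfy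
`u_j = (dx_i/dx_j)^{1/2} u_i`. -/
structure SpinBundle where
  n : ℕ
  chart : Fin n → OpenPartialHomeomorph X ℂ
  chart_mem : ∀ i, chart i ∈ IsManifold.maximalAtlas 𝓘(ℂ) 1 X
  cover : ∀ p, ∃ i, p ∈ (chart i).source
  trans : Fin n → Fin n → X → ℂ
  trans_holo : ∀ i j, MDifferentiableOn 𝓘(ℂ) 𝓘(ℂ) (trans i j) ((chart i).source ∩ (chart j).source)
  trans_sq : ∀ i j, ∀ p ∈ (chart i).source ∩ (chart j).source,
    trans i j p ^ 2 = deriv (chart i ∘ (chart j).symm) (chart j p)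
  cocycle : ∀ i j k, ∀ p ∈ (chart i).source ∩ (chart j).source ∩ (chart k).source,
    trans j k p * trans i j p = trans i k p

namespace SpinBundle

variable (C : SpinBundle X) (ω : ∀ p : X, TangentSpace 𝓘(ℂ) p →L[ℂ] ℂ)

open scoped Classical in
/-- The least index of a coordinate neighbourhood of the cover containing `p`. The fibre of `C` at
`p` is identified with `ℂ` by means of the trivialization with this index; a section of `C` is then
a function `u : X → ℂ`. -/
def idx (p : X) : Fin C.n :=
  (Finset.univ.filter fun i => p ∈ (C.chart i).source).min' <| by
    obtain ⟨i, hi⟩ := C.cover p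
    exact ⟨i, by simp [hi]⟩

/-- The representative `u_j` of the section `u` in the coordinate `x_j`, as a function of the
coordinate. -/
def rep (u : X → ℂ) (j : Fin C.n) (z : ℂ) : ℂ :=
  C.trans (C.idx ((C.chart j).symm z)) j ((C.chart j).symm z) * u ((C.chart j).symm z)

/-- `u` belongs to `C_c^∞(Ẋ; C)`, where `Ẋ` is `X` without the zeros of `ω` (`X` is compact). -/
def IsTestSection (u : X → ℂ) : Prop :=
  (∀ j, ContDiffOn ℝ ((⊤ : ℕ∞) : WithTop ℕ∞) (C.rep u j) (C.chart j).target) ∧ Disjoint (tsupport u) (zeros ω)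

/-- The section `ω̄⁻¹ ∂̄u` of `C`. -/
def dbarOmega (u : X → ℂ) (p : X) : ℂ :=
  let i := C.idx p
  let z := C.chart i p
  (starRingEnd ℂ (coeff ω (C.chart i) z))⁻¹ * wirtDbar (C.rep u i) z

/-- The section `Δu = -ρ² h⁻¹ ∂(h ∂̄u)` of `C`, where `ρ⁻² = |ω|²` is the metric on `X` and
`h = |ω|⁻¹` is the metric on `C`. -/
def laplacian (u : X → ℂ) (p : X) : ℂ :=
  let i := C.idx p
  let z := C.chart i p
  let rhoInvSq : ℂ → ℂ := fun y => ((‖coeff ω (C.chart i) y‖ ^ 2 : ℝ) : ℂ)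
  let h : ℂ → ℂ := fun y => ((‖coeff ω (C.chart i) y‖⁻¹ : ℝ) : ℂ)
  (rhoInvSq z)⁻¹ * (h z)⁻¹ * (-wirtD (fun y => h y * wirtDbar (C.rep u i) y) z)

section Hilbert

variable [MeasurableSpace X]

/-- The area measure `dS` of the conical metric `|ω|²`: in each coordinate `x` with `ω = f(x) dx`
it is `|f(x)|²` times Lebesgue measure. (The coordinate neighbourhoods are cut into the disjoint
pieces on which `idx` is constant.) -/
def area : Measure X :=
  ∑ i, ((((volume : Measure ℂ).restrict (C.chart i).target).withDensity
    fun z => ‖coeff ω (C.chart i) z‖ₑ ^ 2).map (C.chart i).symm).restrict (C.idx ⁻¹' {i})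

/-- The measure `h dS`, with the metric `h = |ω|⁻¹` of `C` written in the trivialization `idx p`. -/
def hArea : Measure X :=
  (C.area ω).withDensity fun p => (‖coeff ω (C.chart (C.idx p)) (C.chart (C.idx p) p)‖ₑ)⁻¹

/-- The Hilbert space `L_2(X; C)` with the scalar product `(u, v) = ∫ u h v̄ dS`
(which is `inner ℂ v u`). -/
abbrev L2 : Type _ := Lp ℂ 2 (C.hArea ω)

/-- The operator in `L_2(X; C)` with domain `C_c^∞(Ẋ; C)` acting by `A`. (For the two linear
differential operators to which it is applied, the set of pairs below is already a linear subspace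
and the graph of an operator.) -/
def testOperator (A : (X → ℂ) → X → ℂ) : C.L2 ω →ₗ.[ℂ] C.L2 ω :=
  (Submodule.span ℂ {q : C.L2 ω × C.L2 ω | ∃ u : X → ℂ, C.IsTestSection ω u ∧
    q.1 =ᵐ[C.hArea ω] u ∧ q.2 =ᵐ[C.hArea ω] A u}).toLinearPMap

/-- The minimal Laplacian: the closure in `L_2(X; C)` of `Δ` on `C_c^∞(Ẋ; C)`. -/
def laplaceMin : C.L2 ω →ₗ.[ℂ] C.L2 ω := (C.testOperator ω (C.laplacian ω)).closure

/-- The closure in `L_2(X; C)` of `u ↦ ω̄⁻¹ ∂̄u` on `C_c^∞(Ẋ; C)`. -/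
def dbarOp : C.L2 ω →ₗ.[ℂ] C.L2 ω := (C.testOperator ω (C.dbarOmega ω)).closure

/-- The Friedrichs extension of the minimal Laplacian. -/
def laplaceF : C.L2 ω →ₗ.[ℂ] C.L2 ω := UnboundedOp.friedrichs (C.laplaceMin ω)

end Hilbert

/-- `s` is a trivialization `(dξ)^{1/2}` of `C` over the domain of the coordinate `ξ`: the
representative of a section `u` in the coordinate `ξ` is `s i · u_i` with
`s i = (dx_i/dξ)^{1/2}` holomorphic and compatible with the transition functions of `C`. -/
def IsSpinFrame (ξ : OpenPartialHomeomorph X ℂ) (s : Fin C.n → X → ℂ) : Prop :=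
  (∀ i, MDifferentiableOn 𝓘(ℂ) 𝓘(ℂ) (s i) ((C.chart i).source ∩ ξ.source)) ∧
  (∀ i, ∀ p ∈ (C.chart i).source ∩ ξ.source, s i p ^ 2 = deriv (C.chart i ∘ ξ.symm) (ξ p)) ∧
  (∀ i j, ∀ p ∈ (C.chart i).source ∩ (C.chart j).source ∩ ξ.source,
    s j p * C.trans i j p = s i p)

/-- The representative at the point `p` of the section `u` in the coordinate with spin frame `s`. -/
def frameRep (s : Fin C.n → X → ℂ) (u : X → ℂ) (p : X) : ℂ := s (C.idx p) p * u p

/-- Near each zero `P` of `ω`, in the distinguished coordinate `x` at `P`,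
`u(x) = -(2/π) c₀ |x| + c₁ x + c₂ x² - (2/(3π)) d x̄ |x| + ũ(x)`
with a remainder `ũ ∈ Dom Δ_min`. (The pair of `x` and `(dx)^{1/2}` is determined by `P` up to
signs, which only affect the signs of the coefficients.) -/
def HasFriedrichsAsymptotics [MeasurableSpace X] (u : C.L2 ω) : Prop :=
  ∃ v ∈ (C.laplaceMin ω).domain, ∀ P ∈ zeros ω,
    ∃ (ξ : OpenPartialHomeomorph X ℂ) (s : Fin C.n → X → ℂ),
      IsDistinguished ω P ξ ∧ C.IsSpinFrame ξ s ∧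
      ∃ c₀ c₁ c₂ d : ℂ, ∃ V ∈ 𝓝 P, V ⊆ ξ.source ∧ ∀ᵐ p ∂(C.hArea ω), p ∈ V →
        C.frameRep s u p =
          -(2 / (Real.pi : ℂ)) * c₀ * ((‖ξ p‖ : ℝ) : ℂ) + c₁ * ξ p + c₂ * ξ p ^ 2
            - (2 / (3 * (Real.pi : ℂ))) * d * starRingEnd ℂ (ξ p) * ((‖ξ p‖ : ℝ) : ℂ)
            + C.frameRep s v p

end SpinBundle

end RiemannSurface

end

noncomputable section

/-! ### Factorised non-negative operators and their Friedrichs extensions -/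

namespace UnboundedOp

variable {H : Type*} [NormedAddCommGroup H] [InnerProductSpace ℂ H]

/-! Write D for ω̄⁻¹∂̄ and L for Δ, both on C_c^∞(Ẋ; C). Off its zeros ω equals dz in a suitable
coordinate; in the frame (dz)^{1/2} one has h = 1, D = ∂/∂z̄ and L = -∂²/∂z∂z̄. Integration by parts
gives (u, Lv) = (Du, Dv), so the form of L is ‖Du‖².

Self-adjointness, the factorisation and positivity need only one estimate, c‖u‖ ≤ ‖Du‖ on test
sections (`exists_poincare`, `nsq_dOmega`). At a zero, ω = x dx, and the flat representative
x^{-1/2} u(x) changes sign when x goes once round a circle. Hence u is controlled by its derivative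
along the circle, with no boundary condition and no constant to subtract. Translations in flat
coordinates carry the estimate to neighbouring points, and connectedness carries it to all of X.
This uses both ∂u and ∂̄u, but the two have equal norms because ∂ and ∂̄ commute in flat
coordinates. From here on Hilbert space theory suffices (`IsCoerciveFactor`). The operator D̄*D̄ is
symmetric and onto, hence self-adjoint. Convergence in the form of L̄ is graph convergence for D̄,
so D̄*D̄ is the Friedrichs extension. It is also the restriction of L* to Dom D̄.

For the domain, consider the solutions xⁿ|x|^{2e} of Δu = 0 at a zero, with e = 0 or e = 1/2 - n.
For each n = -1, 0, 1, 2 one of the two is regular (x̄|x|, |x|, x, x²) and, after a cutoff, lies in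
Dom D̄. The other (x⁻¹, 1, x/|x|, x²/|x|³) is square integrable and singular. The boundary form
(L*u, v) - (u, L*v) couples each singular model with its regular partner and with no other regular
model (`IsAdapted.boundary_form`). An element of ker L* is smooth and harmonic off the zeros by
Weyl's lemma. Interior estimates on flat discs bound it near a zero by a power of |x|, and a Laurent
expansion of conj(|x|⁻¹∂̄k) then shows that it is a combination of singular models modulo Dom D̄
(`exists_asymptotics`, `IsAdapted.exists_sub_mem_dbarOp`).

Two duality arguments conclude. An element of Dom D̄*D̄ corrected by regular models, so that its
boundary form with the singular models vanishes, lies in Dom L̄ (`exists_sub_mem_closure`).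
Conversely, an element of Dom L* whose boundary form with the regular models vanishes lies in Dom D̄
(`dom_of_pairing`). The converse is applied to a section which vanishes near the zeros, the adjoint
being a local operator. -/

theorem mem_graph_prod_iff {S T : H →ₗ.[ℂ] H} {u w : H} :
    (u, w) ∈ (prod S T).graph ↔ ∃ t, (u, t) ∈ T.graph ∧ (t, w) ∈ S.graph := by
  simp only [LinearPMap.mem_graph_iff]
  constructor
  · rintro ⟨⟨x, hx⟩, rfl, rfl⟩
    exact ⟨T ⟨x, hx.choose⟩, ⟨⟨x, hx.choose⟩, rfl, rfl⟩, ⟨⟨_, hx.choose_spec⟩, rfl, rfl⟩⟩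
  · rintro ⟨_, ⟨⟨x, hx⟩, rfl, rfl⟩, ⟨⟨y, hy⟩, hxy, rfl⟩⟩
    simp only at hxy
    subst hxy
    exact ⟨⟨x, hx, hy⟩, rfl, rfl⟩

theorem mem_domain_iff_graph {T : H →ₗ.[ℂ] H} {u : H} : u ∈ T.domain ↔ ∃ t, (u, t) ∈ T.graph :=
  LinearPMap.mem_domain_iff

theorem mem_graph_closure_iff_seq {T : H →ₗ.[ℂ] H} (hT : T.IsClosable) {u t : H} :
    (u, t) ∈ T.closure.graph ↔ ∃ x y : ℕ → H, (∀ n, (x n, y n) ∈ T.graph) ∧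
      Tendsto x atTop (𝓝 u) ∧ Tendsto y atTop (𝓝 t) := by
  rw [← hT.graph_closure_eq_closure_graph, ← SetLike.mem_coe, Submodule.topologicalClosure_coe,
    mem_closure_iff_seq_limit]
  constructor
  · rintro ⟨z, hz, hz'⟩
    refine ⟨fun n => (z n).1, fun n => (z n).2, fun n => hz n, ?_, ?_⟩
    · exact (continuous_fst.tendsto _).comp hz'
    · exact (continuous_snd.tendsto _).comp hz'
  · rintro ⟨x, y, h, hx, hy⟩
    exact ⟨fun n => (x n, y n), h, hx.prodMk_nhds hy⟩

/-- `L = D† D` on a common dense domain, with `D` closable and bounded below. -/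
structure IsCoerciveFactor (D L : H →ₗ.[ℂ] H) : Prop where
  dense : Dense (D.domain : Set H)
  domain_eq : L.domain = D.domain
  form : ∀ {x x' y y' y'' : H}, (x, x') ∈ D.graph → (y, y') ∈ D.graph → (y, y'') ∈ L.graph →
    inner ℂ x y'' = inner ℂ x' y'
  closable : D.IsClosable
  coercive : ∃ c : ℝ, 0 < c ∧ ∀ {x x' : H}, (x, x') ∈ D.graph → c * ‖x‖ ≤ ‖x'‖

namespace IsCoerciveFactor

variable {D L : H →ₗ.[ℂ] H} (h : IsCoerciveFactor D L)
include h

theorem dense' : Dense (L.domain : Set H) := h.domain_eq ▸ h.dense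

theorem dense_closure : Dense (D.closure.domain : Set H) :=
  h.dense.mono (D.le_closure.1)

theorem coercive_closure : ∃ c : ℝ, 0 < c ∧ ∀ {x x' : H}, (x, x') ∈ D.closure.graph →
    c * ‖x‖ ≤ ‖x'‖ := by
  obtain ⟨c, hc, hD⟩ := h.coercive
  refine ⟨c, hc, fun {x x'} hx => ?_⟩
  obtain ⟨a, b, hab, ha, hb⟩ := (mem_graph_closure_iff_seq h.closable).1 hx
  exact le_of_tendsto_of_tendsto' (ha.norm.const_mul c) hb.norm fun n => hD (hab n)

theorem exists_graph_of_graph_right {y y'' : H} (hy : (y, y'') ∈ L.graph) :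
    ∃ y', (y, y') ∈ D.graph := by
  rw [← mem_domain_iff_graph, ← h.domain_eq]
  exact LinearPMap.mem_domain_iff.2 ⟨_, hy⟩

theorem exists_graph_of_graph_left {y y' : H} (hy : (y, y') ∈ D.graph) :
    ∃ y'', (y, y'') ∈ L.graph := by
  rw [← mem_domain_iff_graph, h.domain_eq]
  exact LinearPMap.mem_domain_iff.2 ⟨_, hy⟩

theorem form_closure_left {x x' y y' y'' : H} (hx : (x, x') ∈ D.closure.graph)
    (hy : (y, y') ∈ D.graph) (hy' : (y, y'') ∈ L.graph) : inner ℂ x y'' = inner ℂ x' y' := by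
  obtain ⟨a, b, hab, ha, hb⟩ := (mem_graph_closure_iff_seq h.closable).1 hx
  exact tendsto_nhds_unique (ha.inner tendsto_const_nhds)
    ((hb.inner tendsto_const_nhds).congr fun n => (h.form (hab n) hy hy').symm)

end IsCoerciveFactor

variable [CompleteSpace H]

theorem mem_graph_adjoint_iff {T : H →ₗ.[ℂ] H} (hT : Dense (T.domain : Set H)) {y z : H} :
    (y, z) ∈ T.adjoint.graph ↔ ∀ {x x' : H}, (x, x') ∈ T.graph → inner ℂ x' y = inner ℂ x z := by
  rw [LinearPMap.adjoint_graph_eq_graph_adjoint hT, Submodule.mem_adjoint_iff]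
  simp only [sub_eq_zero]

namespace IsCoerciveFactor

variable {D L : H →ₗ.[ℂ] H} (h : IsCoerciveFactor D L)
include h

/-- `D̄† D̄` is the restriction of `L†` to the domain of `D̄`. -/
theorem mem_graph_prod_iff {u w : H} : (u, w) ∈ (prod D.closure.adjoint D.closure).graph ↔
    (u ∈ D.closure.domain) ∧ (u, w) ∈ L.adjoint.graph := by
  rw [UnboundedOp.mem_graph_prod_iff, mem_domain_iff_graph]
  constructor
  · rintro ⟨t, hu, ht⟩
    refine ⟨⟨t, hu⟩, (mem_graph_adjoint_iff h.dense').2 fun {y y''} hy => ?_⟩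
    obtain ⟨y', hy'⟩ := h.exists_graph_of_graph_right hy
    rw [← inner_conj_symm, h.form_closure_left hu hy' hy, inner_conj_symm]
    exact (mem_graph_adjoint_iff h.dense_closure).1 ht
      ((LinearPMap.le_graph_iff.2 D.le_closure) hy')
  · rintro ⟨⟨t, hu⟩, hw⟩
    refine ⟨t, hu, (mem_graph_adjoint_iff h.dense_closure).2 fun {x x'} hx => ?_⟩
    obtain ⟨a, b, hab, ha, hb⟩ := (mem_graph_closure_iff_seq h.closable).1 hx
    refine tendsto_nhds_unique (hb.inner tendsto_const_nhds)
      ((ha.inner tendsto_const_nhds).congr fun n => ?_)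
    obtain ⟨y'', hy''⟩ := h.exists_graph_of_graph_left (hab n)
    rw [← (mem_graph_adjoint_iff h.dense').1 hw hy'', ← inner_conj_symm,
      h.form_closure_left hu (hab n) hy'', inner_conj_symm]

theorem inner_prod {u t w v t' : H} (hu : (u, t) ∈ D.closure.graph)
    (hw : (u, w) ∈ (prod D.closure.adjoint D.closure).graph) (hv : (v, t') ∈ D.closure.graph) :
    inner ℂ v w = inner ℂ t' t := by
  obtain ⟨t₁, h1, h2⟩ := UnboundedOp.mem_graph_prod_iff.1 hw
  obtain rfl : t = t₁ := LinearPMap.mem_graph_snd_inj _ hu h1 rfl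
  exact ((mem_graph_adjoint_iff h.dense_closure).1 h2 hv).symm

/-- Coercivity makes D̄ injective with closed range G and bounded inverse. The functional y ↦ (f,
D̄⁻¹y) on G is represented by some t = D̄u in G, and this representation says exactly that D̄*t = f.
-/
theorem surjective_prod (f : H) : ∃ u, (u, f) ∈ (prod D.closure.adjoint D.closure).graph := by
  obtain ⟨c, hc, hD⟩ := h.coercive_closure
  set G : Submodule ℂ H := D.closure.graph.map (LinearMap.snd ℂ H H) with hG
  -- A convergent sequence of images has Cauchy preimages by coercivity; the graph of D̄ being
  -- closed, the limit is again an image.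
  have hGc : IsClosed (G : Set H) := by
    rw [← isSeqClosed_iff_isClosed]
    intro y t hy ht
    choose x hx using fun n => hy n
    have hx1 : ∀ n, ((x n).1, y n) ∈ D.closure.graph := fun n => by
      have := (hx n).2; simp only [LinearMap.snd_apply] at this; rw [← this]; exact (hx n).1
    have hcau : CauchySeq fun n => (x n).1 := by
      refine Metric.cauchySeq_iff'.2 fun ε hε => ?_
      obtain ⟨N, hN⟩ := Metric.cauchySeq_iff'.1 ht.cauchySeq (c * ε) (by positivity)
      refine ⟨N, fun n hn => ?_⟩
      have h1 := hN n hn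
      have h2 := hD (D.closure.graph.sub_mem (hx1 n) (hx1 N))
      rw [dist_eq_norm] at h1 ⊢
      exact lt_of_mul_lt_mul_left (h2.trans_lt h1) hc.le
    obtain ⟨u, hu⟩ := cauchySeq_tendsto_of_complete hcau
    refine ⟨(u, t), ?_, rfl⟩
    exact h.closable.closure_isClosed.mem_of_tendsto (hu.prodMk_nhds ht)
      (Eventually.of_forall hx1)
  have : CompleteSpace G := hGc.completeSpace_coe
  have hex : ∀ y : G, ∃ x, (x, (y : H)) ∈ D.closure.graph := fun y => by
    obtain ⟨⟨x, y'⟩, hx, hy⟩ := y.2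
    exact ⟨x, by simp only [LinearMap.snd_apply] at hy; rwa [← hy]⟩
  have huniq : ∀ {x₁ x₂ y : H}, (x₁, y) ∈ D.closure.graph → (x₂, y) ∈ D.closure.graph →
      x₁ = x₂ := fun {x₁ x₂ y} h1 h2 => by
    have := hD (D.closure.graph.sub_mem h1 h2)
    rw [sub_self, norm_zero] at this
    have h3 : ‖x₁ - x₂‖ ≤ 0 := by nlinarith [norm_nonneg (x₁ - x₂)]
    exact sub_eq_zero.1 (norm_le_zero_iff.1 h3)
  choose g hg using hex
  let ℓ : G →ₗ[ℂ] ℂ :=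
    { toFun := fun y => inner ℂ f (g y)
      map_add' := fun y z => by
        rw [← inner_add_right]; congr 1
        exact huniq (hg (y + z)) (D.closure.graph.add_mem (hg y) (hg z))
      map_smul' := fun a y => by
        rw [RingHom.id_apply, smul_eq_mul, ← inner_smul_right]; congr 1
        exact huniq (hg (a • y)) (D.closure.graph.smul_mem a (hg y)) }
  let ℓ' : StrongDual ℂ G := ℓ.mkContinuous (‖f‖ / c) fun y => by
    have h1 : ‖inner ℂ f (g y)‖ ≤ ‖f‖ * ‖g y‖ := norm_inner_le_norm _ _
    have h2 := hD (hg y)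
    have h3 : ‖g y‖ ≤ ‖(y : H)‖ / c := by rw [le_div_iff₀ hc]; linarith
    calc ‖inner ℂ f (g y)‖ ≤ ‖f‖ * (‖(y : H)‖ / c) :=
          h1.trans (mul_le_mul_of_nonneg_left h3 (norm_nonneg _))
      _ = ‖f‖ / c * ‖y‖ := by rw [Submodule.coe_norm]; ring
  let t : G := (InnerProductSpace.toDual ℂ G).symm ℓ'
  have ht : ∀ y : G, inner ℂ (t : H) (y : H) = inner ℂ f (g y) := fun y =>
    InnerProductSpace.toDual_symm_apply (x := y) (y := ℓ')
  refine ⟨g t, UnboundedOp.mem_graph_prod_iff.2 ⟨t, hg t, ?_⟩⟩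
  refine (mem_graph_adjoint_iff h.dense_closure).2 fun {x x'} hx => ?_
  have h1 := ht ⟨x', (x, x'), hx, rfl⟩
  rw [huniq (hg ⟨x', (x, x'), hx, rfl⟩) hx] at h1
  rw [← inner_conj_symm, h1, inner_conj_symm]

theorem symmetric_prod {u w u' w' : H} (hu : (u, w) ∈ (prod D.closure.adjoint D.closure).graph)
    (hu' : (u', w') ∈ (prod D.closure.adjoint D.closure).graph) :
    inner ℂ w u' = inner ℂ u w' := by
  obtain ⟨t, ht, -⟩ := UnboundedOp.mem_graph_prod_iff.1 hu
  obtain ⟨t', ht', -⟩ := UnboundedOp.mem_graph_prod_iff.1 hu'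
  rw [h.inner_prod ht' hu' ht, ← inner_conj_symm, h.inner_prod ht hu ht', inner_conj_symm]

theorem coercive_prod : ∃ c : ℝ, 0 < c ∧
    ∀ {u w : H}, (u, w) ∈ (prod D.closure.adjoint D.closure).graph →
      c * ‖u‖ ^ 2 ≤ (inner ℂ u w).re := by
  obtain ⟨c, hc, hD⟩ := h.coercive_closure
  refine ⟨c ^ 2, by positivity, fun {u w} hu => ?_⟩
  obtain ⟨t, ht, -⟩ := UnboundedOp.mem_graph_prod_iff.1 hu
  rw [h.inner_prod ht hu ht, ← mul_pow, inner_self_eq_norm_sq_to_K]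
  have := pow_le_pow_left₀ (by positivity) (hD ht) 2
  norm_cast at this ⊢

theorem le_prod : L ≤ prod D.closure.adjoint D.closure := by
  rw [← LinearPMap.le_graph_iff]
  rintro ⟨y, y''⟩ hy
  refine h.mem_graph_prod_iff.2 ⟨?_, (mem_graph_adjoint_iff h.dense').2 fun {x x''} hx => ?_⟩
  · obtain ⟨y', hy'⟩ := h.exists_graph_of_graph_right hy
    exact mem_domain_iff_graph.2 ⟨y', (LinearPMap.le_graph_iff.2 D.le_closure) hy'⟩
  · obtain ⟨y', hy'⟩ := h.exists_graph_of_graph_right hy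
    obtain ⟨x', hx'⟩ := h.exists_graph_of_graph_right hx
    rw [h.form hx' hy' hy, ← inner_conj_symm, h.form hy' hx' hx, inner_conj_symm]

theorem dense_prod : Dense ((prod D.closure.adjoint D.closure).domain : Set H) :=
  h.dense'.mono h.le_prod.1

/-- A symmetric operator which is onto is self-adjoint: if F*v = w, solve Fu = w and then Fz = v -
u; pairing with z gives ‖v - u‖² = 0. -/
theorem isSelfAdjoint_prod : IsSelfAdjoint (prod D.closure.adjoint D.closure) := by
  rw [LinearPMap.isSelfAdjoint_def]
  refine LinearPMap.eq_of_eq_graph (le_antisymm ?_ ?_)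
  · rintro ⟨v, w⟩ hv
    obtain ⟨u, hu⟩ := h.surjective_prod w
    suffices v = u by rwa [this]
    refine sub_eq_zero.1 ?_
    obtain ⟨z, hz⟩ := h.surjective_prod (v - u)
    have h1 := (mem_graph_adjoint_iff h.dense_prod).1 hv hz
    have h2 := h.symmetric_prod hz hu
    have h3 : inner ℂ (v - u) (v - u) = 0 := by
      rw [inner_sub_right, h1, h2, sub_self]
    exact inner_self_eq_zero.1 h3
  · rintro ⟨v, w⟩ hv
    exact (mem_graph_adjoint_iff h.dense_prod).2 fun {x x'} hx => h.symmetric_prod hx hv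

theorem closable' : L.IsClosable :=
  h.isSelfAdjoint_prod.isClosed.isClosable.leIsClosable h.le_prod

theorem closure_le_prod : L.closure ≤ prod D.closure.adjoint D.closure := by
  rw [← LinearPMap.le_graph_iff, ← h.closable'.graph_closure_eq_closure_graph]
  exact Submodule.topologicalClosure_minimal _ (LinearPMap.le_graph_iff.2 h.le_prod)
    h.isSelfAdjoint_prod.isClosed

/-- Membership in Dom Δ_min* can therefore be tested on smooth compactly supported sections alone.
-/
theorem adjoint_closure : L.closure.adjoint = L.adjoint := by
  have hd : Dense (L.closure.domain : Set H) := h.dense'.mono L.le_closure.1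
  refine LinearPMap.eq_of_eq_graph (le_antisymm ?_ ?_)
  · rintro ⟨v, w⟩ hv
    exact (mem_graph_adjoint_iff h.dense').2 fun {x x'} hx =>
      (mem_graph_adjoint_iff hd).1 hv (LinearPMap.le_graph_iff.2 L.le_closure hx)
  · rintro ⟨v, w⟩ hv
    refine (mem_graph_adjoint_iff hd).2 fun {x x'} hx => ?_
    obtain ⟨a, b, hab, ha, hb⟩ := (mem_graph_closure_iff_seq h.closable').1 hx
    exact tendsto_nhds_unique (hb.inner tendsto_const_nhds)
      ((ha.inner tendsto_const_nhds).congr fun n =>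
        ((mem_graph_adjoint_iff h.dense').1 hv (hab n)).symm)

/-- On Dom L̄ the quadratic form is ‖D̄x‖². A sequence that is Cauchy in the form thus has D̄x
Cauchy, and closedness of D̄ identifies the limit: form convergence is graph convergence for D̄. -/
theorem formTendsto_iff {x : ℕ → L.closure.domain} {u : H} :
    FormTendsto L.closure x u ↔ ∃ (y : ℕ → H) (t : H), (∀ n, ((x n : H), y n) ∈ D.closure.graph) ∧
      (u, t) ∈ D.closure.graph ∧ Tendsto (fun n => (x n : H)) atTop (𝓝 u) ∧
      Tendsto y atTop (𝓝 t) := by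
  have hF : ∀ x : L.closure.domain, ((x : H), L.closure x) ∈
      (prod D.closure.adjoint D.closure).graph := fun x =>
    LinearPMap.le_graph_iff.2 h.closure_le_prod (L.closure.mem_graph x)
  have hex : ∀ x : L.closure.domain, ∃ t, ((x : H), t) ∈ D.closure.graph := fun x => by
    obtain ⟨t, ht, -⟩ := UnboundedOp.mem_graph_prod_iff.1 (hF x); exact ⟨t, ht⟩
  choose τ hτ using hex
  have key : ∀ m n, inner ℂ ((x m - x n : L.closure.domain) : H) (L.closure (x m - x n)) =
      ((‖τ (x m) - τ (x n)‖ ^ 2 : ℝ) : ℂ) := fun m n => by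
    have h1 := D.closure.graph.sub_mem (hτ (x m)) (hτ (x n))
    have h2 := hF (x m - x n)
    rw [h.inner_prod (t := τ (x m) - τ (x n)) (t' := τ (x m) - τ (x n)) (by simpa using h1) h2
      (by simpa using h1), inner_self_eq_norm_sq_to_K]
    norm_cast
  constructor
  · rintro ⟨h1, h2⟩
    have hcau : CauchySeq fun n => τ (x n) := by
      rw [cauchySeq_iff_tendsto_dist_atTop_0]
      simp only [key] at h2
      have h3 := (Complex.continuous_re.tendsto _).comp h2
      have h4 := h3.sqrt
      simp only [Function.comp_def, Complex.ofReal_re, Complex.zero_re, Real.sqrt_zero] at h4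
      refine h4.congr fun q => ?_
      rw [Real.sqrt_sq (norm_nonneg _), dist_eq_norm]
    obtain ⟨t, ht⟩ := cauchySeq_tendsto_of_complete hcau
    refine ⟨fun n => τ (x n), t, fun n => hτ _, ?_, h1, ht⟩
    exact h.closable.closure_isClosed.mem_of_tendsto (h1.prodMk_nhds ht)
      (Eventually.of_forall fun n => hτ _)
  · rintro ⟨y, t, hxy, -, hx, hy⟩
    refine ⟨hx, ?_⟩
    simp only [key]
    have hy' : ∀ n, τ (x n) = y n := fun n =>
      LinearPMap.mem_graph_snd_inj _ (hτ (x n)) (hxy n) rfl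
    simp only [hy']
    have h3 := cauchySeq_iff_tendsto_dist_atTop_0.1 hy.cauchySeq
    have h4 := (Complex.continuous_ofReal.tendsto _).comp (h3.pow 2)
    simpa [Function.comp_def, dist_eq_norm] using h4

/-- The closed form is (D̄u, D̄v) on Dom D̄, so the operator which represents it is D̄*D̄. -/
theorem friedrichsPair_iff {u w : H} : FriedrichsPair L.closure u w ↔
    (u, w) ∈ (prod D.closure.adjoint D.closure).graph := by
  have hF : ∀ x : L.closure.domain, ((x : H), L.closure x) ∈
      (prod D.closure.adjoint D.closure).graph := fun x =>
    LinearPMap.le_graph_iff.2 h.closure_le_prod (L.closure.mem_graph x)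
  -- Since L and D have the same domain, graph approximants for D̄ may be taken in Dom L; thus Dom L
  -- is a core for the form.
  have approx : ∀ {v t : H}, (v, t) ∈ D.closure.graph → ∃ (x : ℕ → L.closure.domain) (y : ℕ → H),
      (∀ n, ((x n : H), y n) ∈ D.closure.graph) ∧ Tendsto (fun n => (x n : H)) atTop (𝓝 v) ∧
      Tendsto y atTop (𝓝 t) := fun {v t} hv => by
    obtain ⟨a, b, hab, ha, hb⟩ := (mem_graph_closure_iff_seq h.closable).1 hv
    have hmem : ∀ n, a n ∈ L.closure.domain := fun n => L.le_closure.1 (by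
      rw [h.domain_eq]; exact LinearPMap.mem_domain_iff.2 ⟨_, hab n⟩)
    exact ⟨fun n => ⟨a n, hmem n⟩, b, fun n => LinearPMap.le_graph_iff.2 D.le_closure (hab n),
      ha, hb⟩
  constructor
  · rintro ⟨x, hx, hxy⟩
    obtain ⟨y, t, h1, h2, h3, h4⟩ := h.formTendsto_iff.1 hx
    refine UnboundedOp.mem_graph_prod_iff.2 ⟨t, h2,
      (mem_graph_adjoint_iff h.dense_closure).2 fun {v t'} hv => ?_⟩
    obtain ⟨z, b, hz, hz1, hz2⟩ := approx hv
    have h5 := hxy v z (h.formTendsto_iff.2 ⟨b, t', hz, hv, hz1, hz2⟩)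
    refine tendsto_nhds_unique ((hz2.inner h4).congr fun n => ?_) h5
    exact (h.inner_prod (h1 n) (hF (x n)) (hz n)).symm
  · intro huw
    obtain ⟨t, ht, -⟩ := UnboundedOp.mem_graph_prod_iff.1 huw
    obtain ⟨x, y, hxy, hx, hy⟩ := approx ht
    refine ⟨x, h.formTendsto_iff.2 ⟨y, t, hxy, ht, hx, hy⟩, fun v z hz => ?_⟩
    obtain ⟨b, t', h1, h2, h3, h4⟩ := h.formTendsto_iff.1 hz
    rw [h.inner_prod ht huw h2]
    exact (h4.inner hy).congr fun n => (h.inner_prod (hxy n) (hF (x n)) (h1 n)).symm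

/-- The set of Friedrichs pairs is already the graph of an operator, so the span in the definition
adds nothing. -/
theorem friedrichs_eq : friedrichs L.closure = prod D.closure.adjoint D.closure := by
  have : {q : H × H | FriedrichsPair L.closure q.1 q.2} =
      ((prod D.closure.adjoint D.closure).graph : Set (H × H)) := by
    ext ⟨u, w⟩
    exact h.friedrichsPair_iff
  rw [friedrichs, this, Submodule.span_eq, (LinearPMap.eq_of_eq_graph (Submodule.toLinearPMap_graph_eq _
    fun x hx hx' => LinearPMap.graph_fst_eq_zero_snd _ hx hx'))]

/-- Solve Fy = z' with F = D̄*D̄. Then z - y lies in ker L*, hence is Σ aᵢσᵢ modulo Dom D̄. The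
boundary form of z with wⱼ vanishes by hypothesis, and so does that of every element of Dom F;
diagonality of the pairing leaves aⱼ = 0. -/
theorem dom_of_pairing {ι : Type*} [Fintype ι] {w w' σ σ' : ι → H}
    (hw : ∀ j, w j ∈ D.closure.domain) (hw' : ∀ j, (w j, w' j) ∈ L.adjoint.graph)
    (hpair : ∀ i j, inner ℂ (σ' i) (w j) - inner ℂ (σ i) (w' j) ≠ 0 ↔ i = j)
    (hker : ∀ k, (k, 0) ∈ L.adjoint.graph → ∃ a : ι → ℂ, k - ∑ i, a i • σ i ∈ D.closure.domain)
    (hσ : ∀ i, (σ i, σ' i) ∈ L.adjoint.graph)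
    {z z' : H} (hz : (z, z') ∈ L.adjoint.graph)
    (hzw : ∀ j, inner ℂ z' (w j) = inner ℂ z (w' j)) : z ∈ D.closure.domain := by
  classical
  obtain ⟨y, hy⟩ := h.surjective_prod z'
  obtain ⟨hyD, hyL⟩ := h.mem_graph_prod_iff.1 hy
  have hk : (z - y, (0 : H)) ∈ L.adjoint.graph := by
    simpa using L.adjoint.graph.sub_mem hz hyL
  obtain ⟨a, ha⟩ := hker _ hk
  -- The remainder lies in Dom D̄ and in Dom L*, hence in Dom F, where the boundary form with the wⱼ
  -- is zero by symmetry.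
  set y₁ := z - y - ∑ i, a i • σ i with hy₁
  have hy₁L : (y₁, (0 : H) - ∑ i, a i • σ' i) ∈ L.adjoint.graph := by
    have := L.adjoint.graph.sub_mem hk
      (L.adjoint.graph.sum_mem (t := Finset.univ) fun i _ => L.adjoint.graph.smul_mem (a i) (hσ i))
    convert this using 1
    ext <;> simp [hy₁, Prod.fst_sum, Prod.snd_sum]
  have hy₁F := h.mem_graph_prod_iff.2 ⟨ha, hy₁L⟩
  have hwF := fun j => h.mem_graph_prod_iff.2 ⟨hw j, hw' j⟩
  have h1 := fun j => h.symmetric_prod hy (hwF j)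
  have h2 := fun j => h.symmetric_prod hy₁F (hwF j)
  have hz' : z = y + y₁ + ∑ i, a i • σ i := by rw [hy₁]; abel
  have ha0 : ∀ j, a j = 0 := fun j => by
    have h3 := hzw j
    have h2' := h2 j
    rw [inner_sub_left, inner_zero_left, zero_sub, sum_inner] at h2'
    rw [hz', inner_add_left, inner_add_left, sum_inner, h1 j, add_assoc] at h3
    have h4 : ∑ i, starRingEnd ℂ (a i) * (inner ℂ (σ' i) (w j) - inner ℂ (σ i) (w' j)) = 0 := by
      have h5 := add_eq_left.1 h3.symm
      rw [← h2'] at h5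
      simp only [inner_smul_left, mul_sub, Finset.sum_sub_distrib] at h5 ⊢
      linear_combination -h5
    rw [Finset.sum_eq_single j] at h4
    · have := (mul_eq_zero.1 h4).resolve_right ((hpair j j).2 rfl)
      simpa using this
    · intro i _ hij
      have : ¬ (inner ℂ (σ' i) (w j) - inner ℂ (σ i) (w' j) ≠ 0) := fun h' => hij ((hpair i j).1 h')
      rw [not_not.1 this, mul_zero]
    · simp
  rw [hz']
  simp only [ha0, zero_smul, Finset.sum_const_zero, add_zero]
  refine D.closure.domain.add_mem hyD ?_
  exact ha

/-- Subtract from u the combination of the wᵢ that makes its boundary form with every σᵢ vanish. The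
image f₁ of the difference is then orthogonal to ker L*, that is, it lies in the closure of the
range of L. Coercivity makes the range of L̄ closed, so f₁ = L̄v; injectivity of F gives u₁ = v. -/
theorem exists_sub_mem_closure {ι : Type*} [Fintype ι] {w w' σ σ' : ι → H}
    (hw : ∀ j, w j ∈ D.closure.domain) (hw' : ∀ j, (w j, w' j) ∈ L.adjoint.graph)
    (hpair : ∀ i j, inner ℂ (σ' i) (w j) - inner ℂ (σ i) (w' j) ≠ 0 ↔ i = j)
    (hker : ∀ k, (k, 0) ∈ L.adjoint.graph → ∃ a : ι → ℂ, k - ∑ i, a i • σ i ∈ D.closure.domain)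
    (hσ : ∀ i, (σ i, σ' i) ∈ L.adjoint.graph)
    {u f : H} (hu : (u, f) ∈ (prod D.closure.adjoint D.closure).graph) :
    ∃ a : ι → ℂ, u - ∑ i, a i • w i ∈ L.closure.domain := by
  classical
  set F := prod D.closure.adjoint D.closure with hFdef
  have hwF : ∀ j, (w j, w' j) ∈ F.graph := fun j => h.mem_graph_prod_iff.2 ⟨hw j, hw' j⟩
  set d : ι → ℂ := fun j => inner ℂ (σ' j) (w j) - inner ℂ (σ j) (w' j) with hd
  have hd0 : ∀ j, d j ≠ 0 := fun j => (hpair j j).2 rfl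
  have hoff : ∀ i j, i ≠ j → inner ℂ (σ' i) (w j) - inner ℂ (σ i) (w' j) = 0 := fun i j hij => by
    by_contra h'; exact hij ((hpair i j).1 h')
  let a : ι → ℂ := fun j => (inner ℂ (σ' j) u - inner ℂ (σ j) f) / d j
  refine ⟨a, ?_⟩
  set u₁ := u - ∑ i, a i • w i with hu₁
  set f₁ := f - ∑ i, a i • w' i with hf₁
  have hu₁F : (u₁, f₁) ∈ F.graph := by
    have := F.graph.sub_mem hu
      (F.graph.sum_mem (t := Finset.univ) fun i _ => F.graph.smul_mem (a i) (hwF i))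
    convert this using 1
    ext <;> simp [hu₁, hf₁, Prod.fst_sum, Prod.snd_sum]
  have hσu : ∀ i, inner ℂ (σ' i) u₁ - inner ℂ (σ i) f₁ = 0 := fun i => by
    have h1 : ∑ j, a j * (inner ℂ (σ' i) (w j) - inner ℂ (σ i) (w' j)) =
        inner ℂ (σ' i) u - inner ℂ (σ i) f := by
      rw [Finset.sum_eq_single i]
      · exact div_mul_cancel₀ _ (hd0 i)
      · intro j _ hj; rw [hoff i j hj.symm, mul_zero]
      · simp
    simp only [hu₁, hf₁, inner_sub_right, inner_sum, inner_smul_right]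
    simp only [mul_sub, Finset.sum_sub_distrib] at h1
    linear_combination -h1
  obtain ⟨c, hc, hcoer⟩ := h.coercive_prod
  have hcl := h.closable'
  have hLF := LinearPMap.le_graph_iff.2 h.closure_le_prod
  -- The lower bound of the form and Cauchy–Schwarz bound L̄ from below; preimages of a Cauchy
  -- sequence under L̄ are then Cauchy.
  have hb : ∀ {v g : H}, (v, g) ∈ L.closure.graph → c * ‖v‖ ≤ ‖g‖ := fun {v g} hv => by
    rcases (norm_nonneg v).eq_or_lt' with h0 | h0
    · rw [h0, mul_zero]; exact norm_nonneg _
    have h1 := hcoer (hLF hv)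
    have h2 : (inner ℂ v g).re ≤ ‖v‖ * ‖g‖ :=
      (Complex.re_le_norm _).trans (norm_inner_le_norm v g)
    have h3 : ‖v‖ * (c * ‖v‖) ≤ ‖v‖ * ‖g‖ := by nlinarith
    exact le_of_mul_le_mul_left h3 h0
  set R : Submodule ℂ H := L.graph.map (LinearMap.snd ℂ H H) with hR
  have hperp : ∀ k ∈ Rᗮ, (k, (0 : H)) ∈ L.adjoint.graph := fun k hk =>
    (mem_graph_adjoint_iff h.dense').2 fun {x x'} hx => by
      rw [inner_zero_right]
      exact (Submodule.mem_orthogonal _ _).1 hk x' ⟨(x, x'), hx, rfl⟩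
  -- An element k of ker L* is Σ bᵢσᵢ plus an element of Dom F. The latter contributes nothing by
  -- symmetry of F, the former nothing by the choice of `a`.
  have hf₁R : f₁ ∈ Rᗮᗮ := by
    rw [Submodule.mem_orthogonal]
    intro k hk
    have hk' := hperp k hk
    obtain ⟨b, hb'⟩ := hker k hk'
    have hyL : (k - ∑ i, b i • σ i, (0 : H) - ∑ i, b i • σ' i) ∈ L.adjoint.graph := by
      have := L.adjoint.graph.sub_mem hk'
        (L.adjoint.graph.sum_mem (t := Finset.univ) fun i _ =>
          L.adjoint.graph.smul_mem (b i) (hσ i))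
      convert this using 1
      ext <;> simp [Prod.fst_sum, Prod.snd_sum]
    have h1 := h.symmetric_prod (h.mem_graph_prod_iff.2 ⟨hb', hyL⟩) hu₁F
    have h2 : ∑ i, starRingEnd ℂ (b i) * (inner ℂ (σ' i) u₁ - inner ℂ (σ i) f₁) = 0 :=
      Finset.sum_eq_zero fun i _ => by rw [hσu i, mul_zero]
    simp only [inner_sub_left, inner_zero_left, sum_inner, inner_smul_left] at h1
    simp only [mul_sub, Finset.sum_sub_distrib] at h2
    linear_combination -h1 - h2
  rw [Submodule.orthogonal_orthogonal_eq_closure, ← SetLike.mem_coe,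
    Submodule.topologicalClosure_coe, mem_closure_iff_seq_limit] at hf₁R
  obtain ⟨y, hy, hyf⟩ := hf₁R
  choose x hx using fun n => hy n
  have hx1 : ∀ n, ((x n).1, y n) ∈ L.closure.graph := fun n => by
    have := (hx n).2; simp only [LinearMap.snd_apply] at this; rw [← this]
    exact LinearPMap.le_graph_iff.2 L.le_closure (hx n).1
  have hcau : CauchySeq fun n => (x n).1 := by
    refine Metric.cauchySeq_iff'.2 fun ε hε => ?_
    obtain ⟨N, hN⟩ := Metric.cauchySeq_iff'.1 hyf.cauchySeq (c * ε) (by positivity)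
    refine ⟨N, fun n hn => ?_⟩
    have h1 := hN n hn
    have h2 := hb (L.closure.graph.sub_mem (hx1 n) (hx1 N))
    rw [dist_eq_norm] at h1 ⊢
    exact lt_of_mul_lt_mul_left (h2.trans_lt h1) hc.le
  obtain ⟨v, hv⟩ := cauchySeq_tendsto_of_complete hcau
  have hvL : (v, f₁) ∈ L.closure.graph :=
    hcl.closure_isClosed.mem_of_tendsto (hv.prodMk_nhds hyf) (Eventually.of_forall hx1)
  have h5 := hcoer (F.graph.sub_mem hu₁F (hLF hvL))
  simp only [sub_self, inner_zero_right, Complex.zero_re] at h5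
  have h6 : ‖u₁ - v‖ = 0 := by
    have : ‖u₁ - v‖ ^ 2 ≤ 0 := by nlinarith [sq_nonneg ‖u₁ - v‖]
    exact pow_eq_zero_iff (two_ne_zero) |>.1 (le_antisymm this (sq_nonneg _))
  rw [norm_eq_zero, sub_eq_zero] at h6
  rw [h6]
  exact LinearPMap.mem_domain_iff.2 ⟨_, hvL⟩

end IsCoerciveFactor

end UnboundedOp

end

noncomputable section

/-! ### Calculus of the Wirtinger derivatives -/

section Wirtinger

open Complex

local notation "conj" => starRingEnd ℂ

variable {f g : ℂ → ℂ} {z : ℂ}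

theorem fderiv_eq_wirt (f : ℂ → ℂ) (z v : ℂ) :
    fderiv ℝ f z v = wirtD f z * v + wirtDbar f z * conj v := by
  have h : v = v.re • (1 : ℂ) + v.im • I := by simp [Complex.re_add_im]
  have h1 : fderiv ℝ f z v = v.re * fderiv ℝ f z 1 + v.im * fderiv ℝ f z I := by
    conv_lhs => rw [h, map_add, map_smul, map_smul, real_smul, real_smul]
  rw [h1, wirtD, wirtDbar]
  conv_rhs => rw [← Complex.re_add_im v]
  simp only [map_add, map_mul, conj_ofReal, conj_I]
  linear_combination (v.im * fderiv ℝ f z I) * I_sq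

/-- The decomposition of a real-linear map as a v + b v̄ is unique. The product, conjugation and
chain rules below follow by exhibiting the real differential in this shape. -/
theorem wirtD_of_fderiv {a b : ℂ} (h : ∀ v, fderiv ℝ f z v = a * v + b * conj v) :
    wirtD f z = a := by
  rw [wirtD, h, h, map_one, conj_I]
  linear_combination (-(1 / 2) * a + (1 / 2) * b) * I_sq

theorem wirtDbar_of_fderiv {a b : ℂ} (h : ∀ v, fderiv ℝ f z v = a * v + b * conj v) :
    wirtDbar f z = b := by
  rw [wirtDbar, h, h, map_one, conj_I]
  linear_combination ((1 / 2) * a - (1 / 2) * b) * I_sq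

theorem Filter.EventuallyEq.wirtD_eq (h : f =ᶠ[𝓝 z] g) : wirtD f z = wirtD g z := by
  rw [wirtD, wirtD, h.fderiv_eq]

theorem Filter.EventuallyEq.wirtDbar_eq (h : f =ᶠ[𝓝 z] g) : wirtDbar f z = wirtDbar g z := by
  rw [wirtDbar, wirtDbar, h.fderiv_eq]

theorem wirtD_mul (hf : DifferentiableAt ℝ f z) (hg : DifferentiableAt ℝ g z) :
    wirtD (fun y => f y * g y) z = wirtD f z * g z + f z * wirtD g z := by
  refine wirtD_of_fderiv (b := wirtDbar f z * g z + f z * wirtDbar g z) fun v => ?_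
  rw [fderiv_fun_mul hf hg]
  simp only [add_apply, smul_apply, smul_eq_mul, fderiv_eq_wirt]
  ring

theorem wirtDbar_mul (hf : DifferentiableAt ℝ f z) (hg : DifferentiableAt ℝ g z) :
    wirtDbar (fun y => f y * g y) z = wirtDbar f z * g z + f z * wirtDbar g z := by
  refine wirtDbar_of_fderiv (a := wirtD f z * g z + f z * wirtD g z) fun v => ?_
  rw [fderiv_fun_mul hf hg]
  simp only [add_apply, smul_apply, smul_eq_mul, fderiv_eq_wirt]
  ring

theorem wirtD_add (hf : DifferentiableAt ℝ f z) (hg : DifferentiableAt ℝ g z) :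
    wirtD (fun y => f y + g y) z = wirtD f z + wirtD g z := by
  simp only [wirtD, fderiv_fun_add hf hg, add_apply]; ring

theorem wirtDbar_add (hf : DifferentiableAt ℝ f z) (hg : DifferentiableAt ℝ g z) :
    wirtDbar (fun y => f y + g y) z = wirtDbar f z + wirtDbar g z := by
  simp only [wirtDbar, fderiv_fun_add hf hg, add_apply]; ring

theorem wirtDbar_sub (hf : DifferentiableAt ℝ f z) (hg : DifferentiableAt ℝ g z) :
    wirtDbar (fun y => f y - g y) z = wirtDbar f z - wirtDbar g z := by
  simp only [wirtDbar, fderiv_fun_sub hf hg, sub_apply]; ring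

theorem wirtD_const_mul (c : ℂ) (hf : DifferentiableAt ℝ f z) :
    wirtD (fun y => c * f y) z = c * wirtD f z := by
  simp only [wirtD, fderiv_const_mul hf, smul_apply, smul_eq_mul]; ring

theorem wirtDbar_const_mul (c : ℂ) (hf : DifferentiableAt ℝ f z) :
    wirtDbar (fun y => c * f y) z = c * wirtDbar f z := by
  simp only [wirtDbar, fderiv_const_mul hf, smul_apply, smul_eq_mul]; ring

@[simp] theorem wirtD_const (c : ℂ) : wirtD (fun _ => c) z = 0 := by simp [wirtD]

@[simp] theorem wirtDbar_const (c : ℂ) : wirtDbar (fun _ => c) z = 0 := by simp [wirtDbar]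

theorem fderiv_real_of_differentiableAt (hf : DifferentiableAt ℂ f z) (v : ℂ) :
    fderiv ℝ f z v = deriv f z * v + 0 * conj v := by
  rw [hf.fderiv_restrictScalars ℝ, ContinuousLinearMap.coe_restrictScalars',
    ← toSpanSingleton_deriv]
  simp [mul_comm]

theorem DifferentiableAt.wirtD_eq (hf : DifferentiableAt ℂ f z) : wirtD f z = deriv f z :=
  wirtD_of_fderiv (fderiv_real_of_differentiableAt hf)

theorem DifferentiableAt.wirtDbar_eq (hf : DifferentiableAt ℂ f z) : wirtDbar f z = 0 :=
  wirtDbar_of_fderiv (fderiv_real_of_differentiableAt hf)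

theorem differentiableAt_of_wirtDbar_eq_zero (hf : DifferentiableAt ℝ f z)
    (h : wirtDbar f z = 0) : DifferentiableAt ℂ f z := by
  rw [differentiableAt_complex_iff_differentiableAt_real]
  refine ⟨hf, ?_⟩
  rw [fderiv_eq_wirt, fderiv_eq_wirt, h, smul_eq_mul, map_one]
  ring

theorem fderiv_conj_comp (hf : DifferentiableAt ℝ f z) (v : ℂ) :
    fderiv ℝ (fun y => conj (f y)) z v = conj (wirtDbar f z) * v + conj (wirtD f z) * conj v := by
  have h : HasFDerivAt (fun y => conj (f y)) ((conjCLE : ℂ →L[ℝ] ℂ) ∘L fderiv ℝ f z) z :=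
    (conjCLE : ℂ →L[ℝ] ℂ).hasFDerivAt.comp z hf.hasFDerivAt
  rw [h.fderiv]
  change conj (fderiv ℝ f z v) = _
  rw [fderiv_eq_wirt]
  simp only [map_add, map_mul, conj_conj]
  ring

theorem wirtD_conj (hf : DifferentiableAt ℝ f z) :
    wirtD (fun y => conj (f y)) z = conj (wirtDbar f z) := wirtD_of_fderiv (fderiv_conj_comp hf)

theorem wirtDbar_conj (hf : DifferentiableAt ℝ f z) :
    wirtDbar (fun y => conj (f y)) z = conj (wirtD f z) := wirtDbar_of_fderiv (fderiv_conj_comp hf)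

theorem fderiv_comp_holo {ψ : ℂ → ℂ} (hg : DifferentiableAt ℝ g (ψ z))
    (hψ : DifferentiableAt ℂ ψ z) (v : ℂ) : fderiv ℝ (fun y => g (ψ y)) z v =
      deriv ψ z * wirtD g (ψ z) * v + conj (deriv ψ z) * wirtDbar g (ψ z) * conj v := by
  have := fderiv_comp z hg (hψ.restrictScalars ℝ)
  change fderiv ℝ (g ∘ ψ) z v = _
  rw [this, ContinuousLinearMap.comp_apply, fderiv_eq_wirt, fderiv_real_of_differentiableAt hψ]
  simp only [map_mul, zero_mul, add_zero]
  ring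

theorem wirtD_comp_holo {ψ : ℂ → ℂ} (hg : DifferentiableAt ℝ g (ψ z))
    (hψ : DifferentiableAt ℂ ψ z) :
    wirtD (fun y => g (ψ y)) z = deriv ψ z * wirtD g (ψ z) :=
  wirtD_of_fderiv (fderiv_comp_holo hg hψ)

theorem wirtDbar_comp_holo {ψ : ℂ → ℂ} (hg : DifferentiableAt ℝ g (ψ z))
    (hψ : DifferentiableAt ℂ ψ z) :
    wirtDbar (fun y => g (ψ y)) z = conj (deriv ψ z) * wirtDbar g (ψ z) :=
  wirtDbar_of_fderiv (fderiv_comp_holo hg hψ)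

/-- Composition of a function of a real variable with a real-valued function. -/
theorem fderiv_real_comp {p : ℝ → ℂ} {p' : ℂ} {ρ : ℂ → ℝ} (hρ : DifferentiableAt ℝ ρ z)
    (hp : HasDerivAt p p' (ρ z)) (v : ℂ) :
    fderiv ℝ (fun y => p (ρ y)) z v = fderiv ℝ ρ z v * p' := by
  have h := hp.hasFDerivAt.comp z hρ.hasFDerivAt
  rw [show (fun y => p (ρ y)) = p ∘ ρ from rfl, h.fderiv]
  simp

/-- The chain rule for d|z|² = z̄ dz + z dz̄. Radial functions are written in terms of |z|²
throughout, which keeps them smooth at the origin. -/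
theorem fderiv_normSq_comp {p : ℝ → ℂ} {p' : ℂ} (hp : HasDerivAt p p' (normSq z)) (v : ℂ) :
    fderiv ℝ (fun y => p (normSq y)) z v = p' * conj z * v + p' * z * conj v := by
  have h1 : HasFDerivAt (fun y : ℂ => normSq y)
      (2 • z.re • reCLM + 2 • z.im • imCLM) z := by
    have : (fun y : ℂ => normSq y) = fun y => y.re ^ 2 + y.im ^ 2 := by
      ext y; rw [normSq_apply]; ring
    rw [this]
    have h2 := (reCLM.hasFDerivAt (x := z)).pow 2
    have h3 := (imCLM.hasFDerivAt (x := z)).pow 2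
    refine (h2.add h3).congr_fderiv ?_
    ext
    simp
    ring
  rw [fderiv_real_comp h1.differentiableAt hp, h1.fderiv]
  have h4 : (((2 • z.re • reCLM + 2 • z.im • imCLM) v : ℝ) : ℂ) = conj z * v + z * conj v := by
    apply Complex.ext <;> simp <;> ring
  rw [h4]; ring

theorem wirtD_normSq_comp {p : ℝ → ℂ} {p' : ℂ} (hp : HasDerivAt p p' (normSq z)) :
    wirtD (fun y => p (normSq y)) z = p' * conj z := wirtD_of_fderiv (fderiv_normSq_comp hp)

theorem wirtDbar_normSq_comp {p : ℝ → ℂ} {p' : ℂ} (hp : HasDerivAt p p' (normSq z)) :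
    wirtDbar (fun y => p (normSq y)) z = p' * z := wirtDbar_of_fderiv (fderiv_normSq_comp hp)

theorem ContDiffAt.fderiv_apply_const {n : WithTop ℕ∞}
    (hf : ContDiffAt ℝ (n + 1) f z) (v : ℂ) : ContDiffAt ℝ n (fun y => fderiv ℝ f y v) z :=
  (hf.fderiv_right (m := n) le_rfl).clm_apply contDiffAt_const

theorem ContDiffAt.wirtD {n : WithTop ℕ∞} (hf : ContDiffAt ℝ (n + 1) f z) :
    ContDiffAt ℝ n (wirtD f) z :=
  contDiffAt_const.mul ((hf.fderiv_apply_const 1).sub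
    (contDiffAt_const.mul (hf.fderiv_apply_const I)))

theorem ContDiffAt.wirtDbar {n : WithTop ℕ∞} (hf : ContDiffAt ℝ (n + 1) f z) :
    ContDiffAt ℝ n (wirtDbar f) z :=
  contDiffAt_const.mul ((hf.fderiv_apply_const 1).add
    (contDiffAt_const.mul (hf.fderiv_apply_const I)))

local notation "infty" => ((⊤ : ℕ∞) : WithTop ℕ∞)

theorem ContDiffAt.wirtD_infty (hf : ContDiffAt ℝ infty f z) : ContDiffAt ℝ infty (_root_.wirtD f) z :=
  ContDiffAt.wirtD (by simpa using hf)

theorem ContDiffAt.wirtDbar_infty (hf : ContDiffAt ℝ infty f z) :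
    ContDiffAt ℝ infty (_root_.wirtDbar f) z :=
  ContDiffAt.wirtDbar (by simpa using hf)

theorem fderiv_fderiv_apply (hf : ContDiffAt ℝ 2 f z) (v w : ℂ) :
    fderiv ℝ (fun y => fderiv ℝ f y v) z w = fderiv ℝ (fderiv ℝ f) z w v := by
  have h1 : DifferentiableAt ℝ (fderiv ℝ f) z :=
    (hf.fderiv_right (m := 1) (by norm_num)).differentiableAt (by norm_num)
  rw [fderiv_clm_apply h1 (differentiableAt_const v)]
  simp

theorem fderiv_wirtDbar_apply (hf : ContDiffAt ℝ 2 f z) (w : ℂ) :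
    fderiv ℝ (wirtDbar f) z w =
      1 / 2 * (fderiv ℝ (fderiv ℝ f) z w 1 + I * fderiv ℝ (fderiv ℝ f) z w I) := by
  have h1 : ∀ v, DifferentiableAt ℝ (fun y => fderiv ℝ f y v) z := fun v =>
    ((ContDiffAt.fderiv_apply_const (n := 1) (hf.of_le (by norm_num)) v).differentiableAt
      (by norm_num))
  rw [show wirtDbar f = fun y => 1 / 2 * (fderiv ℝ f y 1 + I * fderiv ℝ f y I) from rfl,
    fderiv_const_mul (DifferentiableAt.fun_add (h1 1) ((h1 I).const_mul _)), smul_apply,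
    fderiv_fun_add (h1 1) ((h1 I).const_mul _), add_apply, fderiv_const_mul (h1 I), smul_apply,
    fderiv_fderiv_apply hf, fderiv_fderiv_apply hf, smul_eq_mul, smul_eq_mul]

theorem fderiv_wirtD_apply (hf : ContDiffAt ℝ 2 f z) (w : ℂ) :
    fderiv ℝ (wirtD f) z w =
      1 / 2 * (fderiv ℝ (fderiv ℝ f) z w 1 - I * fderiv ℝ (fderiv ℝ f) z w I) := by
  have h1 : ∀ v, DifferentiableAt ℝ (fun y => fderiv ℝ f y v) z := fun v =>
    ((ContDiffAt.fderiv_apply_const (n := 1) (hf.of_le (by norm_num)) v).differentiableAt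
      (by norm_num))
  rw [show wirtD f = fun y => 1 / 2 * (fderiv ℝ f y 1 - I * fderiv ℝ f y I) from rfl,
    fderiv_const_mul (DifferentiableAt.fun_sub (h1 1) ((h1 I).const_mul _)), smul_apply,
    fderiv_fun_sub (h1 1) ((h1 I).const_mul _), sub_apply, fderiv_const_mul (h1 I), smul_apply,
    fderiv_fderiv_apply hf, fderiv_fderiv_apply hf, smul_eq_mul, smul_eq_mul]

theorem fderiv_fderiv_comm (hf : ContDiffAt ℝ 2 f z) (v w : ℂ) :
    fderiv ℝ (fderiv ℝ f) z v w = fderiv ℝ (fderiv ℝ f) z w v :=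
  (hf.isSymmSndFDerivAt (by simp)) v w

theorem wirtD_wirtDbar_eq (hf : ContDiffAt ℝ 2 f z) : wirtD (wirtDbar f) z =
    1 / 4 * (fderiv ℝ (fderiv ℝ f) z 1 1 + fderiv ℝ (fderiv ℝ f) z I I) := by
  rw [wirtD, fderiv_wirtDbar_apply hf, fderiv_wirtDbar_apply hf, fderiv_fderiv_comm hf I 1]
  linear_combination (-1 / 4 * fderiv ℝ (fderiv ℝ f) z I I) * I_sq

/-- Symmetry of the second derivative: both orders give a quarter of the real Laplacian. This is
what makes the ∂- and ∂̄-energies of a test section equal. -/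
theorem wirtDbar_wirtD_comm (hf : ContDiffAt ℝ 2 f z) :
    wirtDbar (wirtD f) z = wirtD (wirtDbar f) z := by
  rw [wirtD_wirtDbar_eq hf, wirtDbar, fderiv_wirtD_apply hf, fderiv_wirtD_apply hf,
    fderiv_fderiv_comm hf I 1]
  linear_combination (-1 / 4 * fderiv ℝ (fderiv ℝ f) z I I) * I_sq

theorem integral_mul_wirtDbar (hf : ContDiff ℝ infty f) (hg : ContDiff ℝ infty g)
    (hfc : HasCompactSupport f) :
    ∫ z, f z * wirtDbar g z = -∫ z, wirtDbar f z * g z := by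
  have key : ∀ v, ∫ z, f z * fderiv ℝ g z v = -∫ z, fderiv ℝ f z v * g z := fun v => by
    refine integral_mul_fderiv_eq_neg_fderiv_mul_of_integrable ?_ ?_ ?_
      (fun x _ => hf.differentiable (by simp) x) (fun x _ => hg.differentiable (by simp) x)
    · exact ((((hf.continuous_fderiv (by simp)).clm_apply continuous_const).mul
        hg.continuous).integrable_of_hasCompactSupport
        (HasCompactSupport.mul_right (hfc.fderiv_apply ℝ v)))
    · exact ((hf.continuous.mul ((hg.continuous_fderiv (by simp)).clm_apply
        continuous_const)).integrable_of_hasCompactSupport hfc.mul_right)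
    · exact (hf.continuous.mul hg.continuous).integrable_of_hasCompactSupport hfc.mul_right
  have i1 : ∀ v, Integrable fun z => f z * fderiv ℝ g z v := fun v =>
    ((hf.continuous.mul ((hg.continuous_fderiv (by simp)).clm_apply
        continuous_const)).integrable_of_hasCompactSupport hfc.mul_right)
  have i2 : ∀ v, Integrable fun z => fderiv ℝ f z v * g z := fun v =>
    ((((hf.continuous_fderiv (by simp)).clm_apply continuous_const).mul
        hg.continuous).integrable_of_hasCompactSupport
        (HasCompactSupport.mul_right (hfc.fderiv_apply ℝ v)))
  have e1 : ∀ z, f z * wirtDbar g z =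
      1 / 2 * (f z * fderiv ℝ g z 1) + I / 2 * (f z * fderiv ℝ g z I) := fun z => by
    rw [wirtDbar]; ring
  have e2 : ∀ z, wirtDbar f z * g z =
      1 / 2 * (fderiv ℝ f z 1 * g z) + I / 2 * (fderiv ℝ f z I * g z) := fun z => by
    rw [wirtDbar]; ring
  simp only [e1, e2]
  rw [integral_add ((i1 1).const_mul _) ((i1 I).const_mul _),
    integral_add ((i2 1).const_mul _) ((i2 I).const_mul _), integral_const_mul, integral_const_mul,
    integral_const_mul, integral_const_mul, key, key]
  ring

end Wirtinger

end

noncomputable section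

set_option linter.unusedSectionVars false

/-! ### Holomorphic coordinates -/

namespace RiemannSurface

local notation "conj" => starRingEnd ℂ
local notation "infty" => ((⊤ : ℕ∞) : WithTop ℕ∞)

section Coordinates

variable {X : Type*} [TopologicalSpace X] [ChartedSpace ℂ X] [IsManifold 𝓘(ℂ) 1 X]
  {ξ ξ' : OpenPartialHomeomorph X ℂ}

theorem mdifferentiableAt_coord (hξ : ξ ∈ IsManifold.maximalAtlas 𝓘(ℂ) 1 X) {p : X}
    (hp : p ∈ ξ.source) : MDifferentiableAt 𝓘(ℂ) 𝓘(ℂ) ξ p :=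
  (contMDiffAt_of_mem_maximalAtlas hξ hp).mdifferentiableAt (by simp)

theorem mdifferentiableAt_coord_symm (hξ : ξ ∈ IsManifold.maximalAtlas 𝓘(ℂ) 1 X) {z : ℂ}
    (hz : z ∈ ξ.target) : MDifferentiableAt 𝓘(ℂ) 𝓘(ℂ) ξ.symm z :=
  (contMDiffAt_symm_of_mem_maximalAtlas hξ hz).mdifferentiableAt (by simp)

theorem differentiableAt_transition (hξ : ξ ∈ IsManifold.maximalAtlas 𝓘(ℂ) 1 X)
    (hξ' : ξ' ∈ IsManifold.maximalAtlas 𝓘(ℂ) 1 X) {z : ℂ} (hz : z ∈ ξ'.target)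
    (hz' : ξ'.symm z ∈ ξ.source) : DifferentiableAt ℂ (fun y => ξ (ξ'.symm y)) z :=
  mdifferentiableAt_iff_differentiableAt.1
    ((mdifferentiableAt_coord hξ hz').comp z (mdifferentiableAt_coord_symm hξ' hz))

theorem eventually_mem_target {z : ℂ} (hz : z ∈ ξ'.target)
    (hz' : ξ'.symm z ∈ ξ.source) : ∀ᶠ y in 𝓝 z, y ∈ ξ'.target ∧ ξ'.symm y ∈ ξ.source :=
  (ξ'.open_target.eventually_mem hz).and
    ((ξ'.continuousAt_symm hz).eventually (ξ.open_source.eventually_mem hz'))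

theorem deriv_transition_mul (hξ : ξ ∈ IsManifold.maximalAtlas 𝓘(ℂ) 1 X)
    (hξ' : ξ' ∈ IsManifold.maximalAtlas 𝓘(ℂ) 1 X) {χ : OpenPartialHomeomorph X ℂ}
    (hχ : χ ∈ IsManifold.maximalAtlas 𝓘(ℂ) 1 X) {p : X} (h : p ∈ ξ.source) (h' : p ∈ ξ'.source)
    (h'' : p ∈ χ.source) : deriv (fun y => χ (ξ'.symm y)) (ξ' p) =
      deriv (fun y => χ (ξ.symm y)) (ξ p) * deriv (fun y => ξ (ξ'.symm y)) (ξ' p) := by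
  have hz : ξ' p ∈ ξ'.target := ξ'.map_source h'
  have hz1 : ξ'.symm (ξ' p) = p := ξ'.left_inv h'
  have e1 : (fun y => χ (ξ'.symm y)) =ᶠ[𝓝 (ξ' p)]
      (fun y => χ (ξ.symm y)) ∘ (fun y => ξ (ξ'.symm y)) := by
    filter_upwards [eventually_mem_target (ξ := ξ) hz (by rwa [hz1])] with y hy
    simp only [Function.comp_apply, ξ.left_inv hy.2]
  have e2 := differentiableAt_transition hχ hξ (z := ξ p) (ξ.map_source h)
    (by rwa [ξ.left_inv h])
  rw [e1.deriv_eq, deriv_comp]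
  · rw [hz1]
  · rw [hz1]; exact e2
  · exact differentiableAt_transition hξ hξ' hz (by rwa [hz1])

theorem deriv_transition_ne_zero (hξ : ξ ∈ IsManifold.maximalAtlas 𝓘(ℂ) 1 X)
    (hξ' : ξ' ∈ IsManifold.maximalAtlas 𝓘(ℂ) 1 X) {p : X} (h : p ∈ ξ.source)
    (h' : p ∈ ξ'.source) : deriv (fun y => ξ (ξ'.symm y)) (ξ' p) ≠ 0 := by
  have h1 := deriv_transition_mul hξ hξ' hξ' h h' h'
  have h2 : deriv (fun y => ξ' (ξ'.symm y)) (ξ' p) = 1 := by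
    have : (fun y => ξ' (ξ'.symm y)) =ᶠ[𝓝 (ξ' p)] id := by
      filter_upwards [ξ'.open_target.mem_nhds (ξ'.map_source h')] with y hy
      exact ξ'.right_inv hy
    rw [this.deriv_eq, deriv_id]
  intro h0
  rw [h2, h0, mul_zero] at h1
  exact one_ne_zero h1

variable {ω : ∀ p : X, TangentSpace 𝓘(ℂ) p →L[ℂ] ℂ}

theorem coeff_transition (hξ : ξ ∈ IsManifold.maximalAtlas 𝓘(ℂ) 1 X)
    (hξ' : ξ' ∈ IsManifold.maximalAtlas 𝓘(ℂ) 1 X) {z : ℂ} (hz : z ∈ ξ'.target)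
    (hz' : ξ'.symm z ∈ ξ.source) : coeff ω ξ' z =
      coeff ω ξ (ξ (ξ'.symm z)) * deriv (fun y => ξ (ξ'.symm y)) z := by
  have e1 : (ξ'.symm : ℂ → X) =ᶠ[𝓝 z] ξ.symm ∘ (fun y => ξ (ξ'.symm y)) := by
    filter_upwards [eventually_mem_target (ξ := ξ) hz hz'] with y hy
    simp only [Function.comp_apply, ξ.left_inv hy.2]
  have hd := differentiableAt_transition hξ hξ' hz hz'
  have e2 : mfderiv 𝓘(ℂ) 𝓘(ℂ) ξ'.symm z =
      (mfderiv 𝓘(ℂ) 𝓘(ℂ) ξ.symm (ξ (ξ'.symm z))).comp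
        (mfderiv 𝓘(ℂ) 𝓘(ℂ) (fun y => ξ (ξ'.symm y)) z) := by
    rw [e1.mfderiv_eq]
    exact mfderiv_comp z (mdifferentiableAt_coord_symm hξ (ξ.map_source hz'))
      hd.mdifferentiableAt
  have e3 : (mfderiv 𝓘(ℂ) 𝓘(ℂ) (fun y => ξ (ξ'.symm y)) z : ℂ →L[ℂ] ℂ) (1 : ℂ) =
      deriv (fun y => ξ (ξ'.symm y)) z := by
    exact (congrArg (fun A : ℂ →L[ℂ] ℂ => A 1) mfderiv_eq_fderiv).trans fderiv_apply_one_eq_deriv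
  -- All tangent spaces are copies of ℂ, so evaluating ω at two equal base points only requires
  -- substituting one for the other.
  have e4 : ∀ (q : X) (a : ℂ), q = ξ'.symm z → ω (ξ'.symm z) a = ω q a := by
    rintro q a rfl; rfl
  have key : ∀ (A B : ℂ →L[ℂ] ℂ) (c : ℂ), A (B c) = A (B 1) * c := fun A B c => by
    rw [mul_comm, ← smul_eq_mul, ← map_smul, ← map_smul, smul_eq_mul, mul_one]
  rw [coeff, e2, coeff]
  refine Eq.trans (b := (ω (ξ'.symm z) : ℂ →L[ℂ] ℂ)
    ((mfderiv 𝓘(ℂ) 𝓘(ℂ) ξ.symm (ξ (ξ'.symm z)) : ℂ →L[ℂ] ℂ)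
      (deriv (fun y => ξ (ξ'.symm y)) z))) (congrArg (fun c : ℂ => (ω (ξ'.symm z) : ℂ →L[ℂ] ℂ)
    ((mfderiv 𝓘(ℂ) 𝓘(ℂ) ξ.symm (ξ (ξ'.symm z)) : ℂ →L[ℂ] ℂ) c)) e3) ?_
  exact (e4 _ _ (ξ.left_inv hz')).trans (key _ _ _)

theorem coeff_eq_zero_iff (hξ : ξ ∈ IsManifold.maximalAtlas 𝓘(ℂ) 1 X) {p : X}
    (hp : p ∈ ξ.source) : coeff ω ξ (ξ p) = 0 ↔ p ∈ zeros ω := by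
  have e4 : ∀ (q : X), q = p → ∀ a : ℂ, ω q a = ω p a := by
    rintro q rfl a; rfl
  have hc : coeff ω ξ (ξ p) = ω p (mfderiv 𝓘(ℂ) 𝓘(ℂ) ξ.symm (ξ p) (1 : ℂ)) :=
    e4 _ (ξ.left_inv hp) _
  rw [hc]
  constructor
  · intro h
    change ω p = 0
    ext
    have e1 : ξ.symm ∘ ξ =ᶠ[𝓝 p] id := by
      filter_upwards [ξ.open_source.mem_nhds hp] with q hq using ξ.left_inv hq
    have e2 : mfderiv 𝓘(ℂ) 𝓘(ℂ) (ξ.symm ∘ ξ) p = ContinuousLinearMap.id ℂ _ := by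
      rw [e1.mfderiv_eq]; exact mfderiv_id
    rw [mfderiv_comp p (mdifferentiableAt_coord_symm hξ (ξ.map_source hp))
      (mdifferentiableAt_coord hξ hp)] at e2
    have e3 : mfderiv 𝓘(ℂ) 𝓘(ℂ) ξ.symm (ξ p) (mfderiv 𝓘(ℂ) 𝓘(ℂ) ξ p (1 : ℂ)) = (1 : ℂ) :=
      congrArg (fun A : ℂ →L[ℂ] ℂ => A 1) e2
    have key : ∀ (A B : ℂ →L[ℂ] ℂ) (c : ℂ), A (B c) = c * A (B 1) := fun A B c => by
      rw [← smul_eq_mul, ← map_smul, ← map_smul, smul_eq_mul, mul_one]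
    refine (congrArg (fun a : ℂ => (ω p : ℂ →L[ℂ] ℂ) a) e3).symm.trans ?_
    refine (key (ω p) (mfderiv 𝓘(ℂ) 𝓘(ℂ) ξ.symm (ξ p)) _).trans ?_
    exact (congrArg _ h).trans (mul_zero _)
  · intro h
    have : ω p = 0 := h
    rw [this]; rfl

end Coordinates

/-! ### Spin frames -/

namespace SpinBundle

variable {X : Type*} [TopologicalSpace X] [ChartedSpace ℂ X] {C : SpinBundle X}
  {ω : ∀ p : X, TangentSpace 𝓘(ℂ) p →L[ℂ] ℂ}

open scoped Classical in
theorem mem_source_idx (p : X) : p ∈ (C.chart (C.idx p)).source := by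
  have := Finset.min'_mem (Finset.univ.filter fun i => p ∈ (C.chart i).source) (by
    obtain ⟨i, hi⟩ := C.cover p
    exact ⟨i, by simp [hi]⟩)
  exact (Finset.mem_filter.1 this).2

variable (C) in
/-- A holomorphic coordinate with a compatible trivialization of `C`. -/
structure Frame where
  ξ : OpenPartialHomeomorph X ℂ
  s : Fin C.n → X → ℂ
  mem : ξ ∈ IsManifold.maximalAtlas 𝓘(ℂ) 1 X
  spin : C.IsSpinFrame ξ s

variable (C) in
/-- The frame given by a chart of the defining cover of `C`. -/
def chartFrame (j : Fin C.n) : C.Frame where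
  ξ := C.chart j
  s := fun i => C.trans i j
  mem := C.chart_mem j
  spin := ⟨fun i => C.trans_holo i j, fun i p hp => C.trans_sq i j p hp,
    fun i k p hp => C.cocycle i k j p hp⟩

namespace Frame

variable (F F' : C.Frame)

/-- The representative of a section in a frame. -/
def rep (u : X → ℂ) (z : ℂ) : ℂ := C.frameRep F.s u (F.ξ.symm z)

/-- The section of `C` with representative `g` in a frame, extended by zero. -/
def ofFun (g : ℂ → ℂ) (p : X) : ℂ :=
  open scoped Classical in if p ∈ F.ξ.source then (F.s (C.idx p) p)⁻¹ * g (F.ξ p) else 0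

variable [IsManifold 𝓘(ℂ) 1 X]

theorem s_ne_zero {i : Fin C.n} {p : X} (hi : p ∈ (C.chart i).source) (hp : p ∈ F.ξ.source) :
    F.s i p ≠ 0 := by
  intro h0
  have h1 := F.spin.2.1 i p ⟨hi, hp⟩
  rw [h0, zero_pow two_ne_zero] at h1
  exact deriv_transition_ne_zero (C.chart_mem i) F.mem hi hp h1.symm

theorem s_idx_ne_zero {p : X} (hp : p ∈ F.ξ.source) : F.s (C.idx p) p ≠ 0 :=
  F.s_ne_zero (mem_source_idx p) hp

theorem differentiableAt_s {i : Fin C.n} {z : ℂ} (hz : z ∈ F.ξ.target)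
    (hi : F.ξ.symm z ∈ (C.chart i).source) :
    DifferentiableAt ℂ (fun y => F.s i (F.ξ.symm y)) z := by
  have h1 : MDifferentiableAt 𝓘(ℂ) 𝓘(ℂ) (F.s i) (F.ξ.symm z) :=
    (F.spin.1 i).mdifferentiableAt
      (((C.chart i).open_source.inter F.ξ.open_source).mem_nhds ⟨hi, F.ξ.map_target hz⟩)
  exact mdifferentiableAt_iff_differentiableAt.1
    (h1.comp z (mdifferentiableAt_coord_symm F.mem hz))

/-- The ratio of two trivializations of `C`. -/
def ratio (p : X) : ℂ := F'.s (C.idx p) p / F.s (C.idx p) p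

variable {F F'}

/-- The index `idx p` jumps from point to point; the cocycle condition allows it to be replaced by
any fixed i, which is how the ratio is seen to be holomorphic. -/
theorem ratio_eq {p : X} (h : p ∈ F.ξ.source) (h' : p ∈ F'.ξ.source) {i : Fin C.n}
    (hi : p ∈ (C.chart i).source) : F.ratio F' p = F'.s i p / F.s i p := by
  have h1 := F.spin.2.2 i (C.idx p) p ⟨⟨hi, mem_source_idx p⟩, h⟩
  have h2 := F'.spin.2.2 i (C.idx p) p ⟨⟨hi, mem_source_idx p⟩, h'⟩
  have h3 := F.s_ne_zero hi h
  have h4 : C.trans i (C.idx p) p ≠ 0 := fun h0 => h3 (by rw [← h1, h0, mul_zero])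
  rw [ratio, ← h1, ← h2, mul_div_mul_right _ _ h4]

theorem ratio_ne_zero {p : X} (h : p ∈ F.ξ.source) (h' : p ∈ F'.ξ.source) : F.ratio F' p ≠ 0 :=
  div_ne_zero (F'.s_idx_ne_zero h') (F.s_idx_ne_zero h)

theorem ratio_sq {z : ℂ} (hz : z ∈ F'.ξ.target) (hz' : F'.ξ.symm z ∈ F.ξ.source) :
    F.ratio F' (F'.ξ.symm z) ^ 2 = deriv (fun y => F.ξ (F'.ξ.symm y)) z := by
  set p := F'.ξ.symm z with hp
  have hp' : p ∈ F'.ξ.source := F'.ξ.map_target hz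
  have h1 : F'.ξ p = z := F'.ξ.right_inv hz
  have e1 := F.spin.2.1 _ p ⟨mem_source_idx p, hz'⟩
  have e2 := F'.spin.2.1 _ p ⟨mem_source_idx p, hp'⟩
  have e3 := deriv_transition_mul F.mem F'.mem (C.chart_mem (C.idx p)) hz' hp' (mem_source_idx p)
  have e4 : deriv (C.chart (C.idx p) ∘ F.ξ.symm) (F.ξ p) ≠ 0 :=
    deriv_transition_ne_zero (C.chart_mem _) F.mem (mem_source_idx p) hz'
  rw [ratio, div_pow, e1, e2, div_eq_iff e4, mul_comm, ← h1]
  exact e3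

theorem differentiableAt_ratio {z : ℂ} (hz : z ∈ F'.ξ.target)
    (hz' : F'.ξ.symm z ∈ F.ξ.source) :
    DifferentiableAt ℂ (fun y => F.ratio F' (F'.ξ.symm y)) z := by
  set p := F'.ξ.symm z with hp
  set i := C.idx p with hi
  have hpi : p ∈ (C.chart i).source := mem_source_idx p
  have e1 : (fun y => F.ratio F' (F'.ξ.symm y)) =ᶠ[𝓝 z]
      fun y => F'.s i (F'.ξ.symm y) / F.s i (F.ξ.symm (F.ξ (F'.ξ.symm y))) := by
    filter_upwards [eventually_mem_target (ξ := F.ξ) hz hz',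
      eventually_mem_target (ξ := C.chart i) hz hpi] with y hy hy'
    rw [ratio_eq hy.2 (F'.ξ.map_target hy.1) hy'.2, F.ξ.left_inv hy.2]
  refine DifferentiableAt.congr_of_eventuallyEq ?_ e1
  refine (F'.differentiableAt_s hz hpi).div ?_ ?_
  · have h1 := F.differentiableAt_s (z := F.ξ p) (i := i) (F.ξ.map_source hz')
      (by rwa [F.ξ.left_inv hz'])
    exact DifferentiableAt.comp z (g := fun y => F.s i (F.ξ.symm y))
      (f := fun y => F.ξ (F'.ξ.symm y)) h1 (differentiableAt_transition F.mem F'.mem hz hz')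
  · rw [F.ξ.left_inv hz']
    exact F.s_ne_zero hpi hz'

theorem rep_eq (u : X → ℂ) {z : ℂ} (hz' : F'.ξ.symm z ∈ F.ξ.source) :
    F'.rep u z = F.ratio F' (F'.ξ.symm z) * F.rep u (F.ξ (F'.ξ.symm z)) := by
  rw [rep, rep, F.ξ.left_inv hz', frameRep, frameRep, ratio, ← mul_assoc,
    div_mul_cancel₀ _ (F.s_idx_ne_zero hz')]

theorem rep_ofFun (g : ℂ → ℂ) {z : ℂ} (hz : z ∈ F.ξ.target) : F.rep (F.ofFun g) z = g z := by
  have h := F.ξ.map_target hz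
  rw [rep, frameRep, ofFun, if_pos h, F.ξ.right_inv hz, ← mul_assoc,
    mul_inv_cancel₀ (F.s_idx_ne_zero h), one_mul]

theorem rep_ne_zero_iff {u : X → ℂ} {p : X} (h : p ∈ F.ξ.source) :
    F.rep u (F.ξ p) = 0 ↔ u p = 0 := by
  rw [rep, F.ξ.left_inv h, frameRep, mul_eq_zero, or_iff_right (F.s_idx_ne_zero h)]

variable (F) in
/-- The coefficient of `ω` in the coordinate of a frame. -/
abbrev f (ω : ∀ p : X, TangentSpace 𝓘(ℂ) p →L[ℂ] ℂ) : ℂ → ℂ := coeff ω F.ξ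

end Frame

/-! ### The invariant differential operators -/

/-- `f̄⁻¹ ∂̄u`. -/
def localDbar (f u : ℂ → ℂ) (z : ℂ) : ℂ := (conj (f z))⁻¹ * wirtDbar u z

/-- `f⁻¹ |f| ∂(|f|⁻¹ u)`. -/
def localD (f u : ℂ → ℂ) (z : ℂ) : ℂ :=
  (f z)⁻¹ * ((‖f z‖ : ℝ) : ℂ) * wirtD (fun y => ((‖f y‖⁻¹ : ℝ) : ℂ) * u y) z

/-- `-|f|⁻¹ ∂(|f|⁻¹ ∂̄u)`. -/
def localLaplacian (f u : ℂ → ℂ) (z : ℂ) : ℂ :=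
  (((‖f z‖ ^ 2 : ℝ) : ℂ))⁻¹ * (((‖f z‖⁻¹ : ℝ) : ℂ))⁻¹ *
    (-wirtD (fun y => ((‖f y‖⁻¹ : ℝ) : ℂ) * wirtDbar u y) z)

section Covariance

variable {f f' u u' ρ ψ : ℂ → ℂ} {z : ℂ}

/-- For a transition function ρ with ρ² = ψ', the factor |ψ'| splits as ρ ρ̄, holomorphic times
antiholomorphic. Covariance of all operators on half-forms rests on this splitting. -/
theorem norm_deriv_of_sq {a b : ℂ} (h : a ^ 2 = b) : ((‖b‖ : ℝ) : ℂ) = a * conj a := by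
  rw [← h, norm_pow, Complex.mul_conj, Complex.normSq_eq_norm_sq]

theorem localDbar_covariant (hψ : DifferentiableAt ℂ ψ z) (hρ : DifferentiableAt ℂ ρ z)
    (hψ' : deriv ψ z ≠ 0)
    (hf : f' z = f (ψ z) * deriv ψ z) (hu : u' =ᶠ[𝓝 z] fun y => ρ y * u (ψ y))
    (hud : DifferentiableAt ℝ u (ψ z)) : localDbar f' u' z = ρ z * localDbar f u (ψ z) := by
  have h1 : DifferentiableAt ℝ (fun y => u (ψ y)) z := hud.comp z (hψ.restrictScalars ℝ)
  rw [localDbar, localDbar, hu.wirtDbar_eq, wirtDbar_mul (hρ.restrictScalars ℝ) h1, hρ.wirtDbar_eq,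
    wirtDbar_comp_holo hud hψ, hf, map_mul, mul_inv]
  have : conj (deriv ψ z) ≠ 0 := by simpa using hψ'
  field_simp
  ring

theorem differentiableAt_norm_inv (hf : DifferentiableAt ℂ f z) (h0 : f z ≠ 0) :
    DifferentiableAt ℝ (fun y => ((‖f y‖⁻¹ : ℝ) : ℂ)) z := by
  have h1 : DifferentiableAt ℝ (fun y => ‖f y‖⁻¹) z :=
    ((hf.restrictScalars ℝ).norm ℂ h0).inv (norm_ne_zero_iff.2 h0)
  exact Complex.ofRealCLM.differentiableAt.comp z h1

/-- The weight transforms so that |f'|⁻¹u' = ρ̄⁻¹ (|f|⁻¹u)∘ψ, and the antiholomorphic factor ρ̄⁻¹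
passes through ∂. -/
theorem localD_covariant (hψ : DifferentiableAt ℂ ψ z) (hρ : ∀ᶠ y in 𝓝 z, DifferentiableAt ℂ ρ y)
    (hρ0 : ρ z ≠ 0) (hρψ : ∀ᶠ y in 𝓝 z, ρ y ^ 2 = deriv ψ y)
    (hf : ∀ᶠ y in 𝓝 z, f' y = f (ψ y) * deriv ψ y)
    (hfd : DifferentiableAt ℂ f (ψ z)) (hf0 : f (ψ z) ≠ 0)
    (hu : u' =ᶠ[𝓝 z] fun y => ρ y * u (ψ y))
    (hud : DifferentiableAt ℝ u (ψ z)) : localD f' u' z = ρ z * localD f u (ψ z) := by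
  have hρz := hρ.self_of_nhds
  have e0 : ∀ᶠ y in 𝓝 z, ρ y ≠ 0 := hρz.continuousAt.eventually_ne hρ0
  have e1 : (fun y => ((‖f' y‖⁻¹ : ℝ) : ℂ) * u' y) =ᶠ[𝓝 z]
      fun y => (conj (ρ y)) ⁻¹ * ((((‖f (ψ y)‖⁻¹ : ℝ) : ℂ) * u (ψ y))) := by
    filter_upwards [hf, hu, hρψ, e0] with y h1 h2 h3 h4
    have h5 : conj (ρ y) ≠ 0 := by simpa using h4
    rw [h1, h2, norm_mul, mul_inv, Complex.ofReal_mul, Complex.ofReal_inv ‖deriv ψ y‖,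
      norm_deriv_of_sq h3]
    field_simp
  have d1 : DifferentiableAt ℝ (fun y => ((‖f y‖⁻¹ : ℝ) : ℂ) * u y) (ψ z) :=
    (differentiableAt_norm_inv hfd hf0).mul hud
  have d2 : DifferentiableAt ℂ (fun y => (ρ y)⁻¹) z := hρz.inv hρ0
  have d3 : DifferentiableAt ℝ (fun y => conj ((ρ y)⁻¹)) z :=
    (Complex.conjCLE.differentiableAt).comp z (d2.restrictScalars ℝ)
  have e2 : (fun y => (conj (ρ y)) ⁻¹) = fun y => conj ((ρ y)⁻¹) := by
    ext y; rw [map_inv₀]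
  have d4 : wirtD (fun y => conj ((ρ y)⁻¹)) z = 0 := by
    rw [wirtD_conj (d2.restrictScalars ℝ), d2.wirtDbar_eq, map_zero]
  have d5 := wirtD_comp_holo d1 hψ
  rw [localD, localD, e1.wirtD_eq]
  simp only [← map_inv₀]
  rw [wirtD_mul d3 (d1.fun_comp' z (hψ.restrictScalars ℝ)), d4, d5, hf.self_of_nhds, norm_mul,
    Complex.ofReal_mul, norm_deriv_of_sq hρψ.self_of_nhds, ← hρψ.self_of_nhds, map_inv₀]
  have h5 : conj (ρ z) ≠ 0 := by simpa using hρ0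
  field_simp
  ring

/-- Here |f'|⁻¹∂̄u' = ρ̄ (|f|⁻¹∂̄u)∘ψ, because ∂̄u' carries the factor ρ ρ̄² and |f'|⁻¹ the factor
(ρρ̄)⁻¹; the antiholomorphic ρ̄ then passes through ∂. -/
theorem localLaplacian_covariant (hψ : ∀ᶠ y in 𝓝 z, DifferentiableAt ℂ ψ y)
    (hρ : ∀ᶠ y in 𝓝 z, DifferentiableAt ℂ ρ y)
    (hρ0 : ρ z ≠ 0) (hρψ : ∀ᶠ y in 𝓝 z, ρ y ^ 2 = deriv ψ y)
    (hf : ∀ᶠ y in 𝓝 z, f' y = f (ψ y) * deriv ψ y)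
    (hfd : DifferentiableAt ℂ f (ψ z)) (hf0 : f (ψ z) ≠ 0)
    (hu : u' =ᶠ[𝓝 z] fun y => ρ y * u (ψ y))
    (hud : ContDiffAt ℝ 2 u (ψ z)) :
    localLaplacian f' u' z = ρ z * localLaplacian f u (ψ z) := by
  have hρz := hρ.self_of_nhds
  have hψz := hψ.self_of_nhds
  have e0 : ∀ᶠ y in 𝓝 z, ρ y ≠ 0 := hρz.continuousAt.eventually_ne hρ0
  have e3 : ∀ᶠ y in 𝓝 z, ContDiffAt ℝ 2 u (ψ y) :=
    hψz.continuousAt.eventually (hud.eventually (by simp))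
  have e1 : (fun y => ((‖f' y‖⁻¹ : ℝ) : ℂ) * wirtDbar u' y) =ᶠ[𝓝 z]
      fun y => conj (ρ y) * ((((‖f (ψ y)‖⁻¹ : ℝ) : ℂ) * wirtDbar u (ψ y))) := by
    filter_upwards [hf, hu.eventuallyEq_nhds, hρψ, e0, hρ, hψ, e3] with y h1 h2 h3 h4 h5 h6 h7
    have h7' : DifferentiableAt ℝ u (ψ y) := h7.differentiableAt (by norm_num)
    have h8 : DifferentiableAt ℝ (fun y => u (ψ y)) y := h7'.comp y (h6.restrictScalars ℝ)
    rw [h2.wirtDbar_eq, wirtDbar_mul (h5.restrictScalars ℝ) h8, h5.wirtDbar_eq,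
      wirtDbar_comp_holo h7' h6, h1, norm_mul, mul_inv, Complex.ofReal_mul,
      Complex.ofReal_inv ‖deriv ψ y‖, norm_deriv_of_sq h3, ← h3, map_pow]
    have h9 : conj (ρ y) ≠ 0 := by simpa using h4
    field_simp
    ring
  have d1 : DifferentiableAt ℝ (fun y => ((‖f y‖⁻¹ : ℝ) : ℂ) * wirtDbar u y) (ψ z) :=
    (differentiableAt_norm_inv hfd hf0).mul
      ((ContDiffAt.wirtDbar (n := 1) (hud.of_le (by norm_num))).differentiableAt (by norm_num))
  have d3 : DifferentiableAt ℝ (fun y => conj (ρ y)) z :=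
    (Complex.conjCLE.differentiableAt).comp z (hρz.restrictScalars ℝ)
  have d4 : wirtD (fun y => conj (ρ y)) z = 0 := by
    rw [wirtD_conj (hρz.restrictScalars ℝ), hρz.wirtDbar_eq, map_zero]
  have d5 := wirtD_comp_holo d1 hψz
  rw [localLaplacian, localLaplacian, e1.wirtD_eq, 
    wirtD_mul d3 (d1.fun_comp' z (hψz.restrictScalars ℝ)), d4, d5, hf.self_of_nhds, norm_mul,
    mul_pow, mul_inv, Complex.ofReal_mul, Complex.ofReal_mul, Complex.ofReal_inv ‖deriv ψ z‖,
    Complex.ofReal_pow ‖deriv ψ z‖,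
    norm_deriv_of_sq hρψ.self_of_nhds, ← hρψ.self_of_nhds]
  have h5 : conj (ρ z) ≠ 0 := by simpa using hρ0
  field_simp
  ring

end Covariance

variable (C ω) in
/-- The section of `C` given by a covariant local operator. -/
def sectionOp (A : (ℂ → ℂ) → (ℂ → ℂ) → ℂ → ℂ) (u : X → ℂ) (p : X) : ℂ :=
  A (coeff ω (C.chart (C.idx p))) (C.rep u (C.idx p)) (C.chart (C.idx p) p)

theorem dbarOmega_eq : C.dbarOmega ω = C.sectionOp ω localDbar := rfl

variable (C) in
/-- The representatives of the section `u` are smooth at `p`. -/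
def SmoothAt (u : X → ℂ) (p : X) : Prop :=
  ∀ F : C.Frame, p ∈ F.ξ.source → ContDiffAt ℝ infty (F.rep u) (F.ξ p)

section Sections

variable [IsManifold 𝓘(ℂ) 1 X] {u v : X → ℂ} {p : X}

theorem Frame.rep_eventuallyEq (F F' : C.Frame) (u : X → ℂ) (h : p ∈ F.ξ.source)
    (h' : p ∈ F'.ξ.source) : F'.rep u =ᶠ[𝓝 (F'.ξ p)]
      fun z => F.ratio F' (F'.ξ.symm z) * F.rep u (F.ξ (F'.ξ.symm z)) := by
  filter_upwards [eventually_mem_target (ξ := F.ξ) (F'.ξ.map_source h')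
    (by rwa [F'.ξ.left_inv h'])] with z hz
  exact Frame.rep_eq u hz.2

theorem contDiffAt_of_eventually_differentiableAt {g : ℂ → ℂ} {z : ℂ} {n : WithTop ℕ∞}
    (h : ∀ᶠ y in 𝓝 z, DifferentiableAt ℂ g y) : ContDiffAt ℝ n g z :=
  ((Complex.analyticAt_iff_eventually_differentiableAt.2 h).contDiffAt).restrict_scalars ℝ

theorem Frame.eventually_transition (F F' : C.Frame) (h : p ∈ F.ξ.source) (h' : p ∈ F'.ξ.source) :
    ∀ᶠ z in 𝓝 (F'.ξ p), z ∈ F'.ξ.target ∧ F'.ξ.symm z ∈ F.ξ.source :=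
  eventually_mem_target (F'.ξ.map_source h') (by rwa [F'.ξ.left_inv h'])

theorem smoothAt_of_frame (F : C.Frame) (hp : p ∈ F.ξ.source)
    (h : ContDiffAt ℝ infty (F.rep u) (F.ξ p)) : C.SmoothAt u p := by
  intro F' hp'
  have e := F.eventually_transition F' hp hp'
  refine ContDiffAt.congr_of_eventuallyEq ?_ (F.rep_eventuallyEq F' u hp hp')
  refine ContDiffAt.mul (contDiffAt_of_eventually_differentiableAt ?_) ?_
  · filter_upwards [e] with z hz using Frame.differentiableAt_ratio hz.1 hz.2
  · have h1 : ContDiffAt ℝ infty (fun z => F.ξ (F'.ξ.symm z)) (F'.ξ p) := by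
      refine contDiffAt_of_eventually_differentiableAt ?_
      filter_upwards [e] with z hz using differentiableAt_transition F.mem F'.mem hz.1 hz.2
    refine ContDiffAt.comp (F'.ξ p) (g := F.rep u) ?_ h1
    rwa [F'.ξ.left_inv hp']

theorem Frame.smoothAt_ofFun (F : C.Frame) (hp : p ∈ F.ξ.source) {g : ℂ → ℂ}
    (hg : ContDiffAt ℝ infty g (F.ξ p)) : C.SmoothAt (F.ofFun g) p := by
  refine smoothAt_of_frame F hp (hg.congr_of_eventuallyEq ?_)
  filter_upwards [F.ξ.open_target.mem_nhds (F.ξ.map_source hp)] with z hz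
  exact Frame.rep_ofFun g hz

theorem rep_congr_of_eventuallyEq (F : C.Frame) (hp : p ∈ F.ξ.source) (huv : u =ᶠ[𝓝 p] v) :
    F.rep u =ᶠ[𝓝 (F.ξ p)] F.rep v := by
  have h1 := F.ξ.continuousAt_symm (F.ξ.map_source hp)
  rw [ContinuousAt, F.ξ.left_inv hp] at h1
  filter_upwards [h1.eventually huv] with z hz
  rw [Frame.rep, Frame.rep, frameRep, frameRep, hz]

theorem SmoothAt.congr (hu : C.SmoothAt u p) (huv : v =ᶠ[𝓝 p] u) : C.SmoothAt v p :=
  fun F hp => (hu F hp).congr_of_eventuallyEq (rep_congr_of_eventuallyEq F hp huv)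

theorem smoothAt_zero : C.SmoothAt (fun _ => 0) p := fun F _ => by
  have : F.rep (fun _ => 0) = fun _ => 0 := by ext z; simp [Frame.rep, frameRep]
  rw [this]; exact contDiffAt_const

theorem isTestSection_iff : C.IsTestSection ω u ↔
    (∀ p, C.SmoothAt u p) ∧ Disjoint (tsupport u) (zeros ω) := by
  refine and_congr_left fun _ => ⟨fun h p => ?_, fun h j z hz => ?_⟩
  · refine smoothAt_of_frame (C.chartFrame (C.idx p)) (mem_source_idx p) ?_
    exact (h (C.idx p)).contDiffAt
      ((C.chart (C.idx p)).open_target.mem_nhds ((C.chart (C.idx p)).map_source (mem_source_idx p)))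
  · have h1 := h ((C.chart j).symm z) (C.chartFrame j) ((C.chart j).map_target hz)
    change ContDiffAt ℝ _ (C.rep u j) (C.chart j ((C.chart j).symm z)) at h1
    rw [(C.chart j).right_inv hz] at h1
    exact h1.contDiffWithinAt

/-- The operators on sections are defined in the chart of least index only; a covariance formula
between that chart and F suffices to compute them in F. -/
theorem rep_sectionOp_aux (F : C.Frame) (A : (ℂ → ℂ) → (ℂ → ℂ) → ℂ → ℂ) (hp : p ∈ F.ξ.source)
    (h : A (coeff ω (C.chart (C.idx p))) (C.rep u (C.idx p)) (C.chart (C.idx p) p) =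
      F.ratio (C.chartFrame (C.idx p)) p * A (F.f ω) (F.rep u) (F.ξ p)) :
    F.rep (C.sectionOp ω A u) (F.ξ p) = A (F.f ω) (F.rep u) (F.ξ p) := by
  have h2 : F.s (C.idx p) p ≠ 0 := F.s_idx_ne_zero hp
  -- The cocycle condition with three equal indices says that a nonzero number equals its square.
  have h3 : (C.chartFrame (C.idx p)).s (C.idx p) p = 1 := by
    have h4 := C.cocycle (C.idx p) (C.idx p) (C.idx p) p
      ⟨⟨mem_source_idx p, mem_source_idx p⟩, mem_source_idx p⟩
    have h5 : (C.chartFrame (C.idx p)).s (C.idx p) p ≠ 0 :=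
      (C.chartFrame (C.idx p)).s_ne_zero (mem_source_idx p) (mem_source_idx p)
    exact mul_left_cancel₀ h5 (h4.trans (mul_one _).symm)
  rw [Frame.rep, F.ξ.left_inv hp, frameRep, sectionOp, h, Frame.ratio, h3]
  field_simp

theorem frame_hyps (F F' : C.Frame) (h : p ∈ F.ξ.source) (h' : p ∈ F'.ξ.source) :
    (∀ᶠ y in 𝓝 (F'.ξ p), DifferentiableAt ℂ (fun y => F.ξ (F'.ξ.symm y)) y) ∧
    (∀ᶠ y in 𝓝 (F'.ξ p), DifferentiableAt ℂ (fun y => F.ratio F' (F'.ξ.symm y)) y) ∧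
    (F.ratio F' (F'.ξ.symm (F'.ξ p)) ≠ 0) ∧
    (∀ᶠ y in 𝓝 (F'.ξ p), F.ratio F' (F'.ξ.symm y) ^ 2 =
      deriv (fun y => F.ξ (F'.ξ.symm y)) y) ∧
    (∀ᶠ y in 𝓝 (F'.ξ p), F'.f ω y = F.f ω (F.ξ (F'.ξ.symm y)) *
      deriv (fun y => F.ξ (F'.ξ.symm y)) y) := by
  have e := F.eventually_transition F' h h'
  refine ⟨?_, ?_, ?_, ?_, ?_⟩
  · filter_upwards [e] with z hz using differentiableAt_transition F.mem F'.mem hz.1 hz.2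
  · filter_upwards [e] with z hz using Frame.differentiableAt_ratio hz.1 hz.2
  · rw [F'.ξ.left_inv h']; exact Frame.ratio_ne_zero h h'
  · filter_upwards [e] with z hz using Frame.ratio_sq hz.1 hz.2
  · filter_upwards [e] with z hz using coeff_transition F.mem F'.mem hz.1 hz.2

theorem rep_dbarOmega (F : C.Frame) (hp : p ∈ F.ξ.source) (hu : C.SmoothAt u p) :
    F.rep (C.dbarOmega ω u) (F.ξ p) = localDbar (F.f ω) (F.rep u) (F.ξ p) := by
  refine rep_sectionOp_aux F localDbar hp ?_
  obtain ⟨h1, h2, h3, h4, h5⟩ := frame_hyps (ω := ω) F (C.chartFrame (C.idx p)) hp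
    (mem_source_idx p)
  have h6 := (C.chartFrame (C.idx p)).ξ.left_inv (mem_source_idx p)
  have := localDbar_covariant h1.self_of_nhds h2.self_of_nhds
    (by rw [← h4.self_of_nhds]; exact pow_ne_zero _ h3) h5.self_of_nhds
    (F.rep_eventuallyEq (C.chartFrame (C.idx p)) u hp (mem_source_idx p))
    (by rw [h6]; exact (hu F hp).differentiableAt (by simp))
  rw [h6] at this
  exact this

theorem holo_coeff (hω : ω ∈ holomorphicOneForms X) (F : C.Frame) (hp : p ∈ F.ξ.source) :
    DifferentiableAt ℂ (F.f ω) (F.ξ p) :=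
  (hω F.ξ F.mem).differentiableAt (F.ξ.open_target.mem_nhds (F.ξ.map_source hp))

theorem rep_laplacian (hω : ω ∈ holomorphicOneForms X) (F : C.Frame) (hp : p ∈ F.ξ.source)
    (hp0 : p ∉ zeros ω) (hu : C.SmoothAt u p) :
    F.rep (C.laplacian ω u) (F.ξ p) = localLaplacian (F.f ω) (F.rep u) (F.ξ p) := by
  refine rep_sectionOp_aux F localLaplacian hp ?_
  obtain ⟨h1, h2, h3, h4, h5⟩ := frame_hyps (ω := ω) F (C.chartFrame (C.idx p)) hp
    (mem_source_idx p)
  have h6 := (C.chartFrame (C.idx p)).ξ.left_inv (mem_source_idx p)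
  have := localLaplacian_covariant h1 h2 h3 h4 h5 (by rw [h6]; exact holo_coeff hω F hp)
    (by rw [h6]; exact fun h0 => hp0 ((coeff_eq_zero_iff F.mem hp).1 h0))
    (F.rep_eventuallyEq (C.chartFrame (C.idx p)) u hp (mem_source_idx p))
    (by rw [h6]; exact (hu F hp).of_le (WithTop.coe_le_coe.2 (le_top : (2 : ℕ∞) ≤ ⊤)))
  rw [h6] at this
  exact this

variable (C ω) in
/-- The section `ω⁻¹ h⁻¹ ∂(h u)` of `C`. -/
def dOmega : (X → ℂ) → X → ℂ := C.sectionOp ω localD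

theorem rep_dOmega (hω : ω ∈ holomorphicOneForms X) (F : C.Frame) (hp : p ∈ F.ξ.source)
    (hp0 : p ∉ zeros ω) (hu : C.SmoothAt u p) :
    F.rep (C.dOmega ω u) (F.ξ p) = localD (F.f ω) (F.rep u) (F.ξ p) := by
  refine rep_sectionOp_aux F localD hp ?_
  obtain ⟨h1, h2, h3, h4, h5⟩ := frame_hyps (ω := ω) F (C.chartFrame (C.idx p)) hp
    (mem_source_idx p)
  have h6 := (C.chartFrame (C.idx p)).ξ.left_inv (mem_source_idx p)
  have := localD_covariant h1.self_of_nhds h2 h3 h4 h5 (by rw [h6]; exact holo_coeff hω F hp)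
    (by rw [h6]; exact fun h0 => hp0 ((coeff_eq_zero_iff F.mem hp).1 h0))
    (F.rep_eventuallyEq (C.chartFrame (C.idx p)) u hp (mem_source_idx p))
    (by rw [h6]; exact (hu F hp).differentiableAt (by simp))
  rw [h6] at this
  exact this

end Sections

end SpinBundle

end RiemannSurface

end

noncomputable section

set_option linter.unusedSectionVars false

/-! ### Existence of flat and distinguished frames -/

namespace RiemannSurface

local notation "conj" => starRingEnd ℂ
local notation "infty" => ((⊤ : ℕ∞) : WithTop ℕ∞)

open Metric

/-- The inverse function theorem, shrunk until the image is a disc and until Φ'(x₀)/Φ' stays in the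
slit plane. There the principal root is holomorphic and provides a square root of the derivative of
the inverse, as required for changing the frame of C along with the coordinate. -/
theorem exists_local_coordinate {Φ : ℂ → ℂ} {x₀ : ℂ} (hΦ : ∀ᶠ y in 𝓝 x₀, DifferentiableAt ℂ Φ y)
    (h0 : deriv Φ x₀ ≠ 0) {U : Set ℂ} (hU : U ∈ 𝓝 x₀) :
    ∃ (g : OpenPartialHomeomorph ℂ ℂ) (R : ℝ) (r : ℂ → ℂ), 0 < R ∧ (∀ x, g x = Φ x) ∧
      x₀ ∈ g.source ∧ g.source ⊆ U ∧ g.target = ball (Φ x₀) R ∧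
      (∀ x ∈ g.source, DifferentiableAt ℂ Φ x) ∧
      ∀ z ∈ g.target, HasDerivAt g.symm (r z ^ 2) z ∧ DifferentiableAt ℂ r z ∧
        deriv Φ (g.symm z) * r z ^ 2 = 1 := by
  have hc : ContDiffAt ℂ 1 Φ x₀ :=
    (Complex.analyticAt_iff_eventually_differentiableAt.2 hΦ).contDiffAt
  have hd : HasFDerivAt Φ ((ContinuousLinearEquiv.unitsEquivAut ℂ (Units.mk0 _ h0) :
      ℂ ≃L[ℂ] ℂ) : ℂ →L[ℂ] ℂ) x₀ := hΦ.self_of_nhds.hasDerivAt.hasFDerivAt_equiv h0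
  set e := hc.toOpenPartialHomeomorph Φ hd one_ne_zero with he
  have hex : x₀ ∈ e.source := hc.mem_toOpenPartialHomeomorph_source hd one_ne_zero
  have hΦa : AnalyticAt ℂ Φ x₀ := Complex.analyticAt_iff_eventually_differentiableAt.2 hΦ
  have hdc : ContinuousAt (fun y => deriv Φ x₀ / deriv Φ y) x₀ :=
    continuousAt_const.div hΦa.deriv.continuousAt h0
  have hV : ∀ᶠ y in 𝓝 x₀, y ∈ U ∧ AnalyticAt ℂ Φ y ∧ deriv Φ y ≠ 0 ∧
      deriv Φ x₀ / deriv Φ y ∈ Complex.slitPlane := by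
    refine (eventually_mem_set.2 hU).and (hΦa.eventually_analyticAt.and
      ((hΦa.deriv.continuousAt.eventually_ne h0).and ?_))
    refine hdc.eventually (Complex.isOpen_slitPlane.eventually_mem ?_)
    simpa [div_self h0] using Complex.one_mem_slitPlane
  have hsymm : Tendsto e.symm (𝓝 (Φ x₀)) (𝓝 x₀) := by
    have h1 := e.continuousAt_symm (e.map_source hex)
    rwa [ContinuousAt, e.left_inv hex] at h1
  obtain ⟨R, hR, hball⟩ := Metric.eventually_nhds_iff_ball.1
    ((e.open_target.eventually_mem (e.map_source hex)).and (hsymm.eventually hV))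
  set g := (e.symm.restrOpen (ball (Φ x₀) R) isOpen_ball).symm with hg
  have hgt : g.target = ball (Φ x₀) R := by
    change e.target ∩ ball (Φ x₀) R = _
    exact Set.inter_eq_right.2 fun z hz => (hball z hz).1
  have hgs : ∀ z, g.symm z = e.symm z := fun z => rfl
  have hgc : ∀ x, g x = Φ x := fun x => rfl
  have hsrc : ∀ x ∈ g.source, x ∈ U ∧ AnalyticAt ℂ Φ x ∧ deriv Φ x ≠ 0 ∧
      deriv Φ x₀ / deriv Φ x ∈ Complex.slitPlane := fun x hx => by
    have h1 := (hball (g x) (hgt ▸ g.map_source hx)).2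
    rwa [← hgs, g.left_inv hx] at h1
  -- The constant c corrects the normalisation of the root: c² Φ'(x₀)/Φ' = 1/Φ'.
  obtain ⟨c, hc2⟩ := IsAlgClosed.exists_pow_nat_eq ((deriv Φ x₀)⁻¹) two_pos
  refine ⟨g, R, fun z => c * (deriv Φ x₀ / deriv Φ (g.symm z)) ^ (1 / 2 : ℂ), hR, hgc, ?_,
    fun x hx => (hsrc x hx).1, hgt, fun x hx => (hsrc x hx).2.1.differentiableAt, ?_⟩
  · have h1 : Φ x₀ ∈ g.target := hgt ▸ mem_ball_self hR
    have h2 := g.map_target h1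
    rwa [hgs, show Φ x₀ = e x₀ from rfl, e.left_inv hex] at h2
  · intro z hz
    have hz' := hsrc _ (g.map_target hz)
    have hsq : (c * (deriv Φ x₀ / deriv Φ (g.symm z)) ^ (1 / 2 : ℂ)) ^ 2 =
        (deriv Φ (g.symm z))⁻¹ := by
      rw [mul_pow, hc2, ← Complex.cpow_nat_mul]
      norm_num
      field_simp
    have hds : HasDerivAt g.symm ((deriv Φ (g.symm z))⁻¹) z :=
      g.hasDerivAt_symm hz hz'.2.2.1 hz'.2.1.differentiableAt.hasDerivAt
    refine ⟨by rw [hsq]; exact hds, ?_, ?_⟩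
    · have h3 : DifferentiableAt ℂ (fun z => deriv Φ (g.symm z)) z :=
        DifferentiableAt.comp z (g := deriv Φ) hz'.2.1.deriv.differentiableAt hds.differentiableAt
      have h4 : DifferentiableAt ℂ (fun z => deriv Φ x₀ / deriv Φ (g.symm z)) z :=
        (differentiableAt_const _).div h3 hz'.2.2.1
      exact (h4.cpow_const hz'.2.2.2).const_mul c
    · rw [hsq, mul_inv_cancel₀ hz'.2.2.1]

namespace SpinBundle

variable {X : Type*} [TopologicalSpace X] [ChartedSpace ℂ X] {C : SpinBundle X}
  {ω : ∀ p : X, TangentSpace 𝓘(ℂ) p →L[ℂ] ℂ} [IsManifold 𝓘(ℂ) 1 X]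

theorem contMDiffOn_of_differentiableOn {f : ℂ → ℂ} {s : Set ℂ} (hs : IsOpen s)
    (hf : DifferentiableOn ℂ f s) : ContMDiffOn 𝓘(ℂ) 𝓘(ℂ) 1 f s :=
  contMDiffOn_iff_contDiffOn.2 (hf.contDiffOn hs)

/-- The frame obtained by a holomorphic change of coordinate `g`, where `r` is a square root of the
derivative of `g⁻¹`. -/
def Frame.pull (F : C.Frame) (g : OpenPartialHomeomorph ℂ ℂ)
    (hg : DifferentiableOn ℂ g g.source) (_hsrc : g.source ⊆ F.ξ.target) (r : ℂ → ℂ)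
    (hr : ∀ z ∈ g.target, HasDerivAt g.symm (r z ^ 2) z ∧ DifferentiableAt ℂ r z) : C.Frame where
  ξ := F.ξ.trans g
  s := fun i p => F.s i p * r (g (F.ξ p))
  mem := by
    refine OpenPartialHomeomorph.mem_maximalAtlas_of_contMDiffOn _ ?_ ?_
    · rw [OpenPartialHomeomorph.trans_source]
      exact (contMDiffOn_of_differentiableOn g.open_source hg).comp
        ((contMDiffOn_of_mem_maximalAtlas F.mem).mono Set.inter_subset_left) fun p hp => hp.2
    · rw [OpenPartialHomeomorph.trans_target]
      have h1 : DifferentiableOn ℂ g.symm g.target := fun z hz =>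
        (hr z hz).1.differentiableAt.differentiableWithinAt
      exact (contMDiffOn_symm_of_mem_maximalAtlas F.mem).comp
        ((contMDiffOn_of_differentiableOn g.open_target h1).mono Set.inter_subset_left)
        fun p hp => hp.2
  spin := by
    refine ⟨fun i p hp => ?_, fun i p hp => ?_, fun i j p hp => ?_⟩
    · rw [OpenPartialHomeomorph.trans_source] at hp
      obtain ⟨hp1, hp2, hp3⟩ := hp
      have hp3' : F.ξ p ∈ g.source := hp3
      refine MDifferentiableAt.mdifferentiableWithinAt ?_
      have h1 : MDifferentiableAt 𝓘(ℂ) 𝓘(ℂ) (F.s i) p := (F.spin.1 i).mdifferentiableAt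
        (((C.chart i).open_source.inter F.ξ.open_source).mem_nhds ⟨hp1, hp2⟩)
      have h2 : DifferentiableAt ℂ (fun z => r (g z)) (F.ξ p) :=
        DifferentiableAt.comp _ (g := r) (hr _ (g.map_source hp3')).2
          (hg.differentiableAt (g.open_source.mem_nhds hp3'))
      exact h1.mul (h2.mdifferentiableAt.comp p (mdifferentiableAt_coord F.mem hp2))
    · rw [OpenPartialHomeomorph.trans_source] at hp
      obtain ⟨hp1, hp2, hp3⟩ := hp
      have hp3' : F.ξ p ∈ g.source := hp3
      rw [mul_pow, F.spin.2.1 i p ⟨hp1, hp2⟩]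
      have h1 : HasDerivAt g.symm (r (g (F.ξ p)) ^ 2) (g (F.ξ p)) :=
        (hr _ (g.map_source hp3')).1
      have h2 := differentiableAt_transition (C.chart_mem i) F.mem (F.ξ.map_source hp2)
        (by rwa [F.ξ.left_inv hp2])
      have h3 : HasDerivAt (fun y => (C.chart i) (F.ξ.symm y))
          (deriv (C.chart i ∘ F.ξ.symm) (F.ξ p)) (g.symm (g (F.ξ p))) := by
        rw [g.left_inv hp3']; exact h2.hasDerivAt
      exact (h3.comp _ h1).deriv.symm
    · rw [OpenPartialHomeomorph.trans_source] at hp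
      obtain ⟨hp1, hp2, hp3⟩ := hp
      rw [mul_right_comm, F.spin.2.2 i j p ⟨hp1, hp2⟩]

section Pull

variable {F : C.Frame} {g : OpenPartialHomeomorph ℂ ℂ}
    {hg : DifferentiableOn ℂ g g.source} {hsrc : g.source ⊆ F.ξ.target} {r : ℂ → ℂ}
    {hr : ∀ z ∈ g.target, HasDerivAt g.symm (r z ^ 2) z ∧ DifferentiableAt ℂ r z}

theorem Frame.pull_source : (F.pull g hg hsrc r hr).ξ.source = F.ξ.source ∩ F.ξ ⁻¹' g.source :=
  OpenPartialHomeomorph.trans_source _ _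

theorem Frame.pull_target : (F.pull g hg hsrc r hr).ξ.target = g.target := by
  have : (F.pull g hg hsrc r hr).ξ.target = g.target ∩ g.symm ⁻¹' F.ξ.target :=
    OpenPartialHomeomorph.trans_target _ _
  rw [this]
  exact Set.inter_eq_left.2 fun z hz => hsrc (g.map_target hz)

theorem Frame.pull_f {z : ℂ} (hz : z ∈ g.target) : (F.pull g hg hsrc r hr).f ω z =
    F.f ω (g.symm z) * r z ^ 2 := by
  have h1 : g.symm z ∈ F.ξ.target := hsrc (g.map_target hz)
  have h2 : (F.pull g hg hsrc r hr).ξ.symm z = F.ξ.symm (g.symm z) := rfl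
  have h3 := coeff_transition (ω := ω) F.mem (F.pull g hg hsrc r hr).mem
    (Frame.pull_target (hg := hg) (hsrc := hsrc) (hr := hr) ▸ hz)
    (by rw [h2]; exact F.ξ.map_target h1)
  have h4 : (fun y => F.ξ ((F.pull g hg hsrc r hr).ξ.symm y)) =ᶠ[𝓝 z] g.symm := by
    filter_upwards [g.open_target.mem_nhds hz] with y hy
    exact F.ξ.right_inv (hsrc (g.map_target hy))
  rw [h4.deriv_eq, (hr z hz).1.deriv, h2, F.ξ.right_inv h1] at h3
  exact h3

end Pull

/-- A frame whose coordinate `z` satisfies `ω = dz`. -/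
def Frame.IsFlat (F : C.Frame) (ω : ∀ p : X, TangentSpace 𝓘(ℂ) p →L[ℂ] ℂ) : Prop :=
  ∀ z ∈ F.ξ.target, F.f ω z = 1

/-- A local primitive of the coefficient of ω is a coordinate wherever that coefficient does not
vanish. -/
theorem exists_flat_frame (hω : ω ∈ holomorphicOneForms X) {p : X} (hp : p ∉ zeros ω) :
    ∃ F : C.Frame, p ∈ F.ξ.source ∧ F.IsFlat ω ∧ ∃ R > 0, F.ξ.target = ball (F.ξ p) R := by
  set F := C.chartFrame (C.idx p) with hF
  have hpF : p ∈ F.ξ.source := mem_source_idx p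
  obtain ⟨ε, hε, hball⟩ := Metric.isOpen_iff.1 F.ξ.open_target _ (F.ξ.map_source hpF)
  have hd : DifferentiableOn ℂ (F.f ω) (ball (F.ξ p) ε) := (hω F.ξ F.mem).mono hball
  obtain ⟨Φ, hΦ⟩ := hd.isExactOn_ball
  have h0 : deriv Φ (F.ξ p) ≠ 0 := by
    rw [(hΦ _ (mem_ball_self hε)).deriv]
    exact fun h => hp ((coeff_eq_zero_iff F.mem hpF).1 h)
  obtain ⟨g, R, r, hR, hgΦ, hx, hU, ht, hd, hr⟩ := exists_local_coordinate (x₀ := F.ξ p)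
    (by filter_upwards [isOpen_ball.mem_nhds (mem_ball_self hε)] with y hy
        exact (hΦ y hy).differentiableAt) h0 (isOpen_ball.mem_nhds (mem_ball_self hε))
  have hg : DifferentiableOn ℂ g g.source := fun x hx => by
    rw [show (g : ℂ → ℂ) = Φ from funext hgΦ]; exact (hd x hx).differentiableWithinAt
  refine ⟨F.pull g hg (hU.trans hball) r (fun z hz => ⟨(hr z hz).1, (hr z hz).2.1⟩), ?_, ?_, R, hR,
    ?_⟩
  · rw [Frame.pull_source]; exact ⟨hpF, hx⟩
  · intro z hz
    rw [Frame.pull_target] at hz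
    rw [Frame.pull_f hz, ← (hΦ _ (hU (g.map_target hz))).deriv]
    exact (hr z hz).2.2
  · refine Frame.pull_target.trans (ht.trans ?_)
    congr 1
    exact (hgΦ _).symm

/-- The primitive Φ of ω with Φ(x₀) = 0 has a double zero, Φ = (x - x₀)² q with q(x₀) ≠ 0 as the
zero of ω is simple. The coordinate η = (x - x₀)(2q)^{1/2} satisfies η² = 2Φ, so ω = η dη. -/
theorem exists_distinguished_frame (hω : ω ∈ holomorphicOneForms X) (hs : HasSimpleZeros ω) {p : X}
    (hp : p ∈ zeros ω) : ∃ F : C.Frame, IsDistinguished ω p F.ξ := by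
  set F := C.chartFrame (C.idx p) with hF
  have hpF : p ∈ F.ξ.source := mem_source_idx p
  obtain ⟨ε, hε, hball⟩ := Metric.isOpen_iff.1 F.ξ.open_target _ (F.ξ.map_source hpF)
  set x₀ := F.ξ p with hx₀
  have hnb : ball x₀ ε ∈ 𝓝 x₀ := isOpen_ball.mem_nhds (mem_ball_self hε)
  have hd : DifferentiableOn ℂ (F.f ω) (ball x₀ ε) := (hω F.ξ F.mem).mono hball
  obtain ⟨Φ, hΦ0, hΦ⟩ := hd.isExactOn_ball.with_val_at x₀ 0
  have hf0 : F.f ω x₀ = 0 := (coeff_eq_zero_iff F.mem hpF).2 hp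
  have hf1 : deriv (F.f ω) x₀ ≠ 0 := hs p hp F.ξ F.mem hpF
  -- `Φ = (x - x₀)² q`
  set q₁ := dslope Φ x₀ with hq₁
  set q := dslope q₁ x₀ with hq
  have dΦ : DifferentiableOn ℂ Φ (ball x₀ ε) := fun x hx =>
    (hΦ x hx).differentiableAt.differentiableWithinAt
  have dq₁ : DifferentiableOn ℂ q₁ (ball x₀ ε) := (Complex.differentiableOn_dslope hnb).2 dΦ
  have dq : DifferentiableOn ℂ q (ball x₀ ε) := (Complex.differentiableOn_dslope hnb).2 dq₁
  have e1 : ∀ x, Φ x = (x - x₀) * q₁ x := fun x => by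
    have := sub_smul_dslope Φ x₀ x
    rw [hΦ0, sub_zero, smul_eq_mul] at this; exact this.symm
  have hq10 : q₁ x₀ = 0 := by
    rw [hq₁, dslope_same, (hΦ x₀ (mem_ball_self hε)).deriv, hf0]
  have e2 : ∀ x, q₁ x = (x - x₀) * q x := fun x => by
    have := sub_smul_dslope q₁ x₀ x
    rw [hq10, sub_zero, smul_eq_mul] at this; exact this.symm
  have hΦq : ∀ x, Φ x = (x - x₀) ^ 2 * q x := fun x => by rw [e1, e2]; ring
  have hfq : ∀ x ∈ ball x₀ ε, F.f ω x = (x - x₀) * (2 * q x + (x - x₀) * deriv q x) := by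
    intro x hx
    have h1 : HasDerivAt q (deriv q x) x :=
      (dq.differentiableAt (isOpen_ball.mem_nhds hx)).hasDerivAt
    have h2 := (((hasDerivAt_id x).sub_const x₀).pow 2).mul h1
    have h3 : HasDerivAt Φ _ x := h2.congr_of_eventuallyEq (Eventually.of_forall hΦq)
    rw [(hΦ x hx).unique h3]
    simp; ring
  have hq0 : q x₀ ≠ 0 := by
    intro h0
    apply hf1
    have h1 : F.f ω =ᶠ[𝓝 x₀] fun x => (x - x₀) * (2 * q x + (x - x₀) * deriv q x) := by
      filter_upwards [hnb] with x hx using hfq x hx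
    have h2 : DifferentiableAt ℂ (fun x => 2 * q x + (x - x₀) * deriv q x) x₀ :=
      ((dq.differentiableAt hnb).const_mul 2).add
        (((differentiableAt_id).sub_const x₀).mul ((dq.deriv isOpen_ball).differentiableAt hnb))
    have h3 := ((hasDerivAt_id x₀).sub_const x₀).mul h2.hasDerivAt
    rw [h1.deriv_eq]
    exact (HasDerivAt.deriv h3).trans (by simp [h0])
  -- the distinguished coordinate `(x - x₀) (2 q)^{1/2}`
  obtain ⟨c, hc2⟩ := IsAlgClosed.exists_pow_nat_eq (2 * q x₀) two_pos
  have hc0 : c ≠ 0 := by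
    rintro rfl
    rw [zero_pow two_ne_zero] at hc2
    exact hq0 (by simpa using hc2.symm)
  set κ : ℂ → ℂ := fun x => c * (q x / q x₀) ^ (1 / 2 : ℂ) with hκ
  have hsl : ∀ᶠ x in 𝓝 x₀, x ∈ ball x₀ ε ∧ q x / q x₀ ∈ Complex.slitPlane := by
    refine (eventually_mem_set.2 hnb).and ?_
    have h1 : ContinuousAt (fun x => q x / q x₀) x₀ :=
      (dq.differentiableAt hnb).continuousAt.div_const _
    refine h1.eventually (Complex.isOpen_slitPlane.eventually_mem ?_)
    simpa [div_self hq0] using Complex.one_mem_slitPlane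
  have dκ : ∀ x, x ∈ ball x₀ ε ∧ q x / q x₀ ∈ Complex.slitPlane → DifferentiableAt ℂ κ x :=
    fun x hx => (((dq.differentiableAt (isOpen_ball.mem_nhds hx.1)).div_const _).cpow_const
      hx.2).const_mul c
  have hκ2 : ∀ x, κ x ^ 2 = 2 * q x := fun x => by
    rw [hκ]; simp only
    rw [mul_pow, hc2, ← Complex.cpow_nat_mul]
    norm_num
    field_simp
  set η : ℂ → ℂ := fun x => (x - x₀) * κ x with hη
  have dη : ∀ x, x ∈ ball x₀ ε ∧ q x / q x₀ ∈ Complex.slitPlane → DifferentiableAt ℂ η x :=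
    fun x hx => (differentiableAt_id.sub_const x₀).mul (dκ x hx)
  have hη2 : ∀ x, η x ^ 2 = 2 * Φ x := fun x => by rw [hη, hΦq]; simp only; rw [mul_pow, hκ2]; ring
  have hη0 : η x₀ = 0 := by simp [hη]
  have hηd : deriv η x₀ ≠ 0 := by
    have h3 := ((hasDerivAt_id x₀).sub_const x₀).mul (dκ x₀ hsl.self_of_nhds).hasDerivAt
    have h4 : deriv η x₀ = 1 * κ x₀ + (id x₀ - x₀) * deriv κ x₀ := HasDerivAt.deriv h3
    rw [h4]
    have h5 := hκ2 x₀
    intro h6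
    simp only [id_eq, sub_self, zero_mul, one_mul, add_zero] at h6
    rw [h6, zero_pow two_ne_zero] at h5
    exact hq0 (by simpa using h5.symm)
  obtain ⟨g, R, r, hR, hgη, hx, hU, ht, hdg, hr⟩ := exists_local_coordinate (x₀ := x₀)
    (hsl.mono dη) hηd hsl
  have hg : DifferentiableOn ℂ g g.source := fun x hx => by
    rw [show (g : ℂ → ℂ) = η from funext hgη]; exact (hdg x hx).differentiableWithinAt
  have hsub : g.source ⊆ F.ξ.target := fun x hx => hball (hU hx).1
  set F' := F.pull g hg hsub r
    (fun z hz => ⟨(hr z hz).1, (hr z hz).2.1⟩) with hF'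
  have htF : F'.ξ.target = ball 0 R := by rw [hF', Frame.pull_target, ht, hη0]
  have h0F : F'.ξ p = 0 := by
    change g (F.ξ p) = 0
    rw [hgη]; exact hη0
  refine ⟨F', F'.mem, ?_, h0F, ⟨R, hR, htF⟩, fun z hz => ?_⟩
  · rw [hF', Frame.pull_source]; exact ⟨hpF, hx⟩
  · rw [hF', Frame.pull_target] at hz
    have h1 : F'.f ω z = F.f ω (g.symm z) * r z ^ 2 := Frame.pull_f hz
    change F'.f ω z = z
    set x := g.symm z with hxz
    have h2 := hU (g.map_target hz)
    have h3 : HasDerivAt η (deriv η x) x := (dη x h2).hasDerivAt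
    have h4 := h3.pow 2
    have h5 : HasDerivAt (fun x => η x ^ 2) (2 * F.f ω x) x := by
      simp only [hη2]; exact (hΦ x h2.1).const_mul 2
    have h6 := h4.unique h5
    simp only [Nat.cast_ofNat, Nat.add_one_sub_one, pow_one] at h6
    have h7 : η x = z := by rw [← hgη]; exact g.right_inv hz
    have h8 := (hr z hz).2.2
    rw [h1]
    rw [h7] at h6
    -- Differentiating η² = 2Φ gives η η' = f, and η' r² = 1, so that f r² = η = z.
    linear_combination (-1 / 2 * r z ^ 2) * h6 + z * h8

/-- Near a distinguished frame, `x²/2` is a flat coordinate. -/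
theorem exists_flat_frame_of_distinguished {P : X} {F : C.Frame} (hF : IsDistinguished ω P F.ξ)
    {δ : ℝ} (hδ : F.ξ.target = ball 0 δ) {x₀ : ℂ} (h0 : x₀ ≠ 0) (hx₀ : ‖x₀‖ < δ / 2) :
    ∃ F' : C.Frame, F'.IsFlat ω ∧ F'.ξ.target = ball (x₀ ^ 2 / 2) (‖x₀ ^ 2 / 2‖ / 2) ∧
      F'.ξ.source ⊆ F.ξ.source ∧ F.ξ.symm x₀ ∈ F'.ξ.source ∧
      (∀ p ∈ F'.ξ.source, F'.ξ p = F.ξ p ^ 2 / 2) ∧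
      ∀ p ∈ F'.ξ.source, F.ratio F' p ^ 2 = (F.ξ p)⁻¹ := by
  set z₀ := x₀ ^ 2 / 2 with hz₀
  have hz0 : z₀ ≠ 0 := by rw [hz₀]; simpa using h0
  have hzn : 0 < ‖z₀‖ := norm_pos_iff.2 hz0
  set B := ball z₀ (‖z₀‖ / 2) with hB
  have hquot : ∀ z ∈ B, ‖z / z₀ - 1‖ < 1 / 2 := fun z hz => by
    rw [hB, mem_ball, dist_eq_norm] at hz
    rw [div_sub_one hz0, norm_div, div_lt_iff₀ hzn]
    linarith
  have hslit : ∀ w : ℂ, ‖w - 1‖ < 1 / 2 → 0 < w.re := fun w hw => by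
    have := (Complex.abs_re_le_norm (w - 1)).trans_lt hw
    rw [abs_lt, Complex.sub_re, Complex.one_re] at this
    linarith [this.1]
  have hsl : ∀ z ∈ B, z / z₀ ∈ Complex.slitPlane := fun z hz => Or.inl (hslit _ (hquot z hz))
  -- The branch of (2z)^{1/2} which takes the value x₀ at z₀; on the disc B the quotient z/z₀ avoids
  -- the cut.
  set ψ : ℂ → ℂ := fun z => x₀ * (z / z₀) ^ (1 / 2 : ℂ) with hψ
  have hψ2 : ∀ z, ψ z ^ 2 = 2 * z := fun z => by
    rw [hψ]; simp only
    rw [mul_pow, ← Complex.cpow_nat_mul]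
    norm_num
    rw [hz₀]; field_simp
  have hψne : ∀ z ∈ B, ψ z ≠ 0 := fun z hz h => by
    have := hψ2 z
    rw [h, zero_pow two_ne_zero] at this
    have h1 : z = 0 := by simpa using this.symm
    rw [hB, mem_ball, h1, dist_eq_norm, zero_sub, norm_neg] at hz
    linarith
  have hψre : ∀ z ∈ B, 0 < (ψ z / x₀).re := fun z hz => by
    rw [hψ]; simp only
    rw [mul_div_assoc, mul_div_cancel₀ _ h0]
    have hs := hsl z hz
    have hne : z / z₀ ≠ 0 := Complex.slitPlane_ne_zero hs
    rw [Complex.cpow_def_of_ne_zero hne, Complex.exp_re]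
    refine mul_pos (Real.exp_pos _) (Real.cos_pos_of_mem_Ioo ?_)
    have h1 := Complex.neg_pi_lt_log_im (z / z₀)
    have h2 := Complex.log_im_le_pi (z / z₀)
    have h3 : (Complex.log (z / z₀) * (1 / 2 : ℂ)).im = (Complex.log (z / z₀)).im / 2 := by
      simp [Complex.mul_im]; ring
    have h4 : (Complex.log (z / z₀)).im ≠ Real.pi := by
      rw [Complex.log_im]; exact (Complex.mem_slitPlane_iff_arg.1 hs).1
    rw [h3]
    constructor
    · linarith
    · have := lt_of_le_of_ne h2 h4; linarith
  -- the coordinate change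
  set S : Set ℂ := {x | x ^ 2 / 2 ∈ B ∧ 0 < (x / x₀).re} with hS
  have hSo : IsOpen S := by
    refine IsOpen.inter (isOpen_ball.preimage (f := fun x : ℂ => x ^ 2 / 2) (by fun_prop)) ?_
    exact isOpen_lt continuous_const (Complex.continuous_re.comp (continuous_id.div_const x₀))
  have hroot : ∀ x ∈ S, ψ (x ^ 2 / 2) = x := fun x hx => by
    have h1 : (ψ (x ^ 2 / 2) - x) * (ψ (x ^ 2 / 2) + x) = 0 := by
      linear_combination hψ2 (x ^ 2 / 2)
    rcases mul_eq_zero.1 h1 with h | h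
    · exact sub_eq_zero.1 h
    · exfalso
      have h2 := hψre _ hx.1
      have h3 : ψ (x ^ 2 / 2) = -x := eq_neg_of_add_eq_zero_left h
      rw [h3, neg_div, Complex.neg_re] at h2
      linarith [hx.2]
  have hψz : ∀ z, ψ z ^ 2 / 2 = z := fun z => by rw [hψ2]; ring
  have dψ : ∀ z ∈ B, HasDerivAt ψ (ψ z)⁻¹ z := fun z hz => by
    have h1 : DifferentiableAt ℂ ψ z :=
      ((differentiableAt_id.div_const z₀).cpow_const (hsl z hz)).const_mul x₀
    have h2 := h1.hasDerivAt.pow 2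
    have h3 : HasDerivAt (fun z => ψ z ^ 2) 2 z := by
      simp only [hψ2]; simpa using (hasDerivAt_id z).const_mul 2
    have h4 := h2.unique h3
    simp only [Nat.cast_ofNat, Nat.add_one_sub_one, pow_one] at h4
    have h5 : deriv ψ z = (ψ z)⁻¹ := by
      refine eq_inv_of_mul_eq_one_left ?_
      linear_combination (1 / 2) * h4
    rw [← h5]; exact h1.hasDerivAt
  let g : OpenPartialHomeomorph ℂ ℂ :=
    { toFun := fun x => x ^ 2 / 2
      invFun := ψ
      source := S
      target := B
      map_source' := fun x hx => hx.1
      map_target' := fun z hz => ⟨by rw [hψz]; exact hz, hψre z hz⟩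
      left_inv' := hroot
      right_inv' := fun z _ => hψz z
      open_source := hSo
      open_target := isOpen_ball
      continuousOn_toFun := by fun_prop
      continuousOn_invFun := fun z hz => (dψ z hz).continuousAt.continuousWithinAt }
  have hg : DifferentiableOn ℂ g g.source := by
    change DifferentiableOn ℂ (fun x : ℂ => x ^ 2 / 2) S
    fun_prop
  have hsrc : g.source ⊆ F.ξ.target := fun x hx => by
    have h1 : x ^ 2 / 2 ∈ B := hx.1
    rw [hB, mem_ball, dist_eq_norm] at h1
    have h2 : ‖x ^ 2 / 2‖ ≤ ‖x ^ 2 / 2 - z₀‖ + ‖z₀‖ := norm_le_norm_sub_add _ _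
    have h3 : ‖x ^ 2 / 2‖ = ‖x‖ ^ 2 / 2 := by simp
    have h4 : ‖z₀‖ = ‖x₀‖ ^ 2 / 2 := by rw [hz₀]; simp
    rw [hδ, mem_ball, dist_zero_right]
    -- In fact ‖x‖² < (3/2)‖x₀‖²; the cruder bound already puts S in the disc of radius δ, since
    -- ‖x₀‖ < δ/2.
    have h5 : ‖x‖ ^ 2 < (2 * ‖x₀‖) ^ 2 := by nlinarith [norm_nonneg x₀]
    have h6 := lt_of_pow_lt_pow_left₀ 2 (by positivity) h5
    linarith
  -- The frame factor must satisfy r² = ψ' = ψ⁻¹, hence the exponent -1/4 and c² = x₀⁻¹.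
  obtain ⟨c, hc2⟩ := IsAlgClosed.exists_pow_nat_eq (x₀⁻¹) two_pos
  set r : ℂ → ℂ := fun z => c * (z / z₀) ^ (-(1 / 4) : ℂ) with hr
  have hr2 : ∀ z, r z ^ 2 = (ψ z)⁻¹ := fun z => by
    rw [hr, hψ]; simp only
    rw [mul_pow, hc2, ← Complex.cpow_nat_mul, mul_inv, ← Complex.cpow_neg]
    norm_num
  have hgr : ∀ z ∈ g.target, HasDerivAt g.symm (r z ^ 2) z ∧ DifferentiableAt ℂ r z :=
    fun z hz => ⟨by rw [hr2]; exact dψ z hz,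
      ((differentiableAt_id.div_const z₀).cpow_const (hsl z hz)).const_mul c⟩
  set F' := F.pull g hg hsrc r hgr with hF'
  have hsub : F'.ξ.source ⊆ F.ξ.source := by
    rw [hF', Frame.pull_source]; exact Set.inter_subset_left
  have hx₀t : x₀ ∈ F.ξ.target := by
    rw [hδ, mem_ball, dist_zero_right]; linarith [norm_nonneg x₀]
  refine ⟨F', ?_, ?_, hsub, ?_, fun p _ => rfl, fun p hp => ?_⟩
  · intro z hz
    rw [hF', Frame.pull_target] at hz
    rw [hF', Frame.pull_f hz, hr2]
    have h1 : F.f ω (g.symm z) = g.symm z := hF.2.2.2.2 _ (hsrc (g.map_target hz))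
    rw [h1]
    exact mul_inv_cancel₀ (hψne z hz)
  · rw [hF', Frame.pull_target]
  · rw [hF', Frame.pull_source]
    refine ⟨F.ξ.map_target hx₀t, ?_⟩
    change F.ξ (F.ξ.symm x₀) ∈ S
    rw [F.ξ.right_inv hx₀t]
    refine ⟨mem_ball_self (by positivity), ?_⟩
    rw [div_self h0]; simp
  · have h1 : F.ratio F' p = r (g (F.ξ p)) := by
      change F.s _ p * r (g (F.ξ p)) / F.s _ p = _
      exact mul_div_cancel_left₀ _ (F.s_idx_ne_zero (hsub hp))
    rw [h1, hr2]
    congr 1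
    rw [hF', Frame.pull_source] at hp
    exact hroot _ hp.2

end SpinBundle

end RiemannSurface

end

noncomputable section

set_option linter.unusedSectionVars false

/-! ### The area measure in frames -/

theorem det_toSpanSingleton_restrictScalars (a : ℂ) :
    ((ContinuousLinearMap.toSpanSingleton ℂ a).restrictScalars ℝ : ℂ →L[ℝ] ℂ).det =
      ‖a‖ ^ 2 := by
  have h : LinearMap.det ((ContinuousLinearMap.toSpanSingleton ℂ a : ℂ →L[ℂ] ℂ) : ℂ →ₗ[ℂ] ℂ) = a := by
    rw [← LinearMap.det_toMatrix (Module.Basis.singleton Unit ℂ)]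
    simp [Matrix.det_unique, LinearMap.toMatrix_apply]
  have h2 := LinearMap.det_restrictScalars (R := ℝ) (S := ℂ)
    (f := ((ContinuousLinearMap.toSpanSingleton ℂ a : ℂ →L[ℂ] ℂ) : ℂ →ₗ[ℂ] ℂ))
  rw [h, Algebra.norm_complex_apply, Complex.normSq_eq_norm_sq] at h2
  exact h2

/-- Multiplication by a complex number a has real determinant |a|², so the Jacobian is |ψ'|². -/
theorem lintegral_image_holomorphic {ψ : ℂ → ℂ} {B : Set ℂ} (hB : MeasurableSet B)
    (hψ : ∀ z ∈ B, DifferentiableAt ℂ ψ z) (hinj : Set.InjOn ψ B) (g : ℂ → ℝ≥0∞) :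
    ∫⁻ y in ψ '' B, g y = ∫⁻ z in B, ‖deriv ψ z‖ₑ ^ 2 * g (ψ z) := by
  have h1 : ∀ z ∈ B, HasFDerivWithinAt ψ
      ((ContinuousLinearMap.toSpanSingleton ℂ (deriv ψ z)).restrictScalars ℝ) B z := fun z hz =>
    ((hψ z hz).hasDerivAt.hasFDerivAt.restrictScalars ℝ).hasFDerivWithinAt
  rw [lintegral_image_eq_lintegral_abs_det_fderiv_mul volume hB h1 hinj]
  refine lintegral_congr fun z => ?_
  rw [det_toSpanSingleton_restrictScalars, abs_of_nonneg (by positivity),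
    ENNReal.ofReal_pow (norm_nonneg _), ofReal_norm]

namespace RiemannSurface

namespace SpinBundle

local notation "conj" => starRingEnd ℂ
local notation "infty" => ((⊤ : ℕ∞) : WithTop ℕ∞)

variable {X : Type*} [TopologicalSpace X] [ChartedSpace ℂ X] {C : SpinBundle X}
  {ω : ∀ p : X, TangentSpace 𝓘(ℂ) p →L[ℂ] ℂ}

open scoped Classical in
theorem idx_eq_iff {p : X} {i : Fin C.n} : C.idx p = i ↔
    p ∈ (C.chart i).source ∧ ∀ j < i, p ∉ (C.chart j).source := by
  have hle : ∀ j, p ∈ (C.chart j).source → C.idx p ≤ j := fun j hj =>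
    Finset.min'_le _ _ (by simp [hj])
  constructor
  · rintro rfl
    exact ⟨mem_source_idx p, fun j hj hp => absurd (hle j hp) (not_le.2 hj)⟩
  · rintro ⟨h1, h2⟩
    refine le_antisymm (hle i h1) (not_lt.1 fun h => h2 _ h (mem_source_idx p))

variable [MeasurableSpace X] [BorelSpace X]

theorem measurable_idx : Measurable C.idx := by
  refine measurable_to_countable' fun i => ?_
  have : C.idx ⁻¹' {i} = (C.chart i).source ∩ ⋂ j, ⋂ (_ : j < i), ((C.chart j).source)ᶜ := by
    ext p
    simp [idx_eq_iff]
  rw [this]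
  exact (C.chart i).open_source.measurableSet.inter (MeasurableSet.iInter fun j =>
    MeasurableSet.iInter fun _ => (C.chart j).open_source.measurableSet.compl)

theorem measurable_of_idx {β : Type*} [MeasurableSpace β] {g : X → β} {g' : Fin C.n → X → β}
    (h : ∀ i, Measurable ((C.idx ⁻¹' {i}).domRestrict (g' i))) (he : ∀ p, g p = g' (C.idx p) p) :
    Measurable g := by
  intro S hS
  have : g ⁻¹' S = ⋃ i, (Subtype.val '' (((C.idx ⁻¹' {i}).domRestrict (g' i)) ⁻¹' S)) := by
    ext p
    simp only [Set.mem_preimage, he p, Set.mem_iUnion, Set.mem_image, Subtype.exists,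
      Set.domRestrict_apply, Set.mem_singleton_iff, exists_and_right, exists_eq_right]
    constructor
    · intro hp; exact ⟨C.idx p, rfl, hp⟩
    · rintro ⟨i, rfl, hp⟩; exact hp
  rw [this]
  exact MeasurableSet.iUnion fun i =>
    MeasurableSet.subtype_image (measurable_idx (MeasurableSet.singleton i)) (h i hS)

theorem measurable_domRestrict_of_subset {α β : Type*} [TopologicalSpace α] [MeasurableSpace α]
    [BorelSpace α] [TopologicalSpace β] [MeasurableSpace β] [BorelSpace β] {g : α → β} {S T : Set α}
    (hg : ContinuousOn g T) (hST : S ⊆ T) : Measurable (S.domRestrict g) :=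
  (continuousOn_iff_continuous_domRestrict.1 (hg.mono hST)).measurable

variable [IsManifold 𝓘(ℂ) 1 X]

theorem Frame.continuousOn_f (F : C.Frame) (hω : ω ∈ holomorphicOneForms X) :
    ContinuousOn (F.f ω) F.ξ.target := (hω F.ξ F.mem).continuousOn

theorem Frame.continuousOn_s (F : C.Frame) (i : Fin C.n) :
    ContinuousOn (F.s i) ((C.chart i).source ∩ F.ξ.source) := (F.spin.1 i).continuousOn

theorem measurable_hWeight (hω : ω ∈ holomorphicOneForms X) :
    Measurable fun p : X => (‖coeff ω (C.chart (C.idx p)) (C.chart (C.idx p) p)‖ₑ)⁻¹ := by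
  refine measurable_of_idx (g' := fun i p => (‖coeff ω (C.chart i) (C.chart i p)‖ₑ)⁻¹)
    (fun i => ?_) fun p => rfl
  refine measurable_domRestrict_of_subset (T := (C.chart i).source) ?_ ?_
  · have h1 : ContinuousOn (fun p => coeff ω (C.chart i) (C.chart i p)) (C.chart i).source :=
      ((C.chartFrame i).continuousOn_f hω).comp (C.chart i).continuousOn
        fun p hp => (C.chart i).map_source hp
    exact (continuous_inv.comp continuous_enorm).comp_continuousOn h1
  · rintro p rfl
    exact mem_source_idx p

variable (ω) in
/-- The density of `h dS` in a frame. -/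
def Frame.dens (F : C.Frame) (z : ℂ) : ℝ≥0∞ :=
  ‖F.s (C.idx (F.ξ.symm z)) (F.ξ.symm z)‖ₑ ^ 2 * ‖F.f ω z‖ₑ

theorem Frame.measurableSet_piece (F : C.Frame) {S : Set X} (hS : MeasurableSet S) :
    MeasurableSet (F.ξ.target ∩ F.ξ.symm ⁻¹' S) := by
  have h1 := (continuousOn_iff_continuous_domRestrict.1 F.ξ.continuousOn_symm).measurable hS
  have h2 := MeasurableSet.subtype_image F.ξ.open_target.measurableSet h1
  convert h2 using 1
  ext z
  simp [Set.domRestrict_apply, and_comm]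

/-- The measure is defined piece by piece on the sets where `idx` is constant. On each piece it is
transported to the coordinate of F by the holomorphic change of variables, and the pieces are
summed. -/
theorem Frame.setLIntegral_source (F : C.Frame) (hω : ω ∈ holomorphicOneForms X) {h : X → ℝ≥0∞}
    (hh : Measurable h) : ∫⁻ p in F.ξ.source, h p ∂(C.hArea ω) =
      ∫⁻ z in F.ξ.target, F.dens ω z * h (F.ξ.symm z) := by
  set w : X → ℝ≥0∞ := fun p => (‖coeff ω (C.chart (C.idx p)) (C.chart (C.idx p) p)‖ₑ)⁻¹ with hw
  have hwm : Measurable w := measurable_hWeight hω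
  have hE : ∀ i, MeasurableSet (C.idx ⁻¹' {i}) := fun i => measurable_idx (MeasurableSet.singleton i)
  set k : X → ℝ≥0∞ := F.ξ.source.indicator h with hk
  have hkm : Measurable k := hh.indicator F.ξ.open_source.measurableSet
  set B : Fin C.n → Set ℂ := fun i => F.ξ.target ∩ F.ξ.symm ⁻¹' (C.idx ⁻¹' {i}) with hB
  have hBm : ∀ i, MeasurableSet (B i) := fun i => F.measurableSet_piece (hE i)
  have hpiece : ∀ i, ∫⁻ p in C.idx ⁻¹' {i}, w p * k p
      ∂((((volume : Measure ℂ).restrict (C.chart i).target).withDensity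
        fun z => ‖coeff ω (C.chart i) z‖ₑ ^ 2).map (C.chart i).symm) =
      ∫⁻ z in B i, F.dens ω z * h (F.ξ.symm z) := by
    intro i
    have hfc := (C.chartFrame i).continuousOn_f hω
    have hfm : AEMeasurable (fun z => ‖coeff ω (C.chart i) z‖ₑ ^ 2)
        ((volume : Measure ℂ).restrict (C.chart i).target) :=
      ((ENNReal.continuous_pow 2).comp continuous_enorm).comp_continuousOn hfc |>.aemeasurable
        (C.chart i).open_target.measurableSet
    have hsm : AEMeasurable (C.chart i).symm
        (((volume : Measure ℂ).restrict (C.chart i).target).withDensity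
        fun z => ‖coeff ω (C.chart i) z‖ₑ ^ 2) :=
      ((C.chart i).continuousOn_symm.aemeasurable (C.chart i).open_target.measurableSet).mono_ac
        (withDensity_absolutelyContinuous _ _)
    have hgm : Measurable ((C.idx ⁻¹' {i}).indicator fun p => w p * k p) :=
      (hwm.mul hkm).indicator (hE i)
    rw [← lintegral_indicator (hE i), lintegral_map' hgm.aemeasurable hsm,
      lintegral_withDensity_eq_lintegral_mul₀ hfm]
    swap
    · exact (hgm.comp_aemeasurable ((C.chart i).continuousOn_symm.aemeasurable
        (C.chart i).open_target.measurableSet))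
    set A : Set ℂ := (C.chart i).target ∩ (C.chart i).symm ⁻¹' (C.idx ⁻¹' {i} ∩ F.ξ.source) with hA
    have hAm : MeasurableSet A := (C.chartFrame i).measurableSet_piece
      ((hE i).inter F.ξ.open_source.measurableSet)
    -- The area form contributes |f|² and the metric h contributes |f|⁻¹, leaving |f|; at a zero of
    -- f both sides vanish.
    have e1 : ∫⁻ y in (C.chart i).target, ((fun z => ‖coeff ω (C.chart i) z‖ₑ ^ 2) *
        fun y => (C.idx ⁻¹' {i}).indicator (fun p => w p * k p) ((C.chart i).symm y)) y =
        ∫⁻ y in A, ‖coeff ω (C.chart i) y‖ₑ * h ((C.chart i).symm y) := by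
      rw [← lintegral_indicator (C.chart i).open_target.measurableSet, ← lintegral_indicator hAm]
      refine lintegral_congr fun y => ?_
      by_cases hy : y ∈ A
      · have hy2 : C.idx ((C.chart i).symm y) = i := hy.2.1
        rw [Set.indicator_of_mem hy, Set.indicator_of_mem hy.1, Pi.mul_apply,
          Set.indicator_of_mem hy.2.1, hk, Set.indicator_of_mem hy.2.2, hw]
        simp only [hy2, (C.chart i).right_inv hy.1]
        rw [← mul_assoc]
        congr 1
        by_cases h0 : coeff ω (C.chart i) y = 0
        · simp [h0]
        · rw [sq, mul_assoc, ENNReal.mul_inv_cancel (by simpa using h0) enorm_ne_top, mul_one]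
      · rw [Set.indicator_of_notMem hy]
        by_cases hy1 : y ∈ (C.chart i).target
        · rw [Set.indicator_of_mem hy1, Pi.mul_apply]
          by_cases hy2 : (C.chart i).symm y ∈ C.idx ⁻¹' {i}
          · have hy3 : (C.chart i).symm y ∉ F.ξ.source := fun h3 => hy ⟨hy1, hy2, h3⟩
            rw [Set.indicator_of_mem hy2, hk, Set.indicator_of_notMem hy3]
            simp
          · rw [Set.indicator_of_notMem hy2]; simp
        · rw [Set.indicator_of_notMem hy1]
    rw [e1]
    set ψ : ℂ → ℂ := fun z => C.chart i (F.ξ.symm z) with hψ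
    have hmem : ∀ z ∈ B i, F.ξ.symm z ∈ (C.chart i).source := fun z hz => by
      have : C.idx (F.ξ.symm z) = i := hz.2
      exact this ▸ mem_source_idx (F.ξ.symm z)
    have e2 : A = ψ '' B i := by
      ext y
      constructor
      · rintro ⟨h1, h2, h3⟩
        refine ⟨F.ξ ((C.chart i).symm y), ⟨F.ξ.map_source h3, ?_⟩, ?_⟩
        · rw [Set.mem_preimage, F.ξ.left_inv h3]; exact h2
        · rw [hψ]; simp only [F.ξ.left_inv h3, (C.chart i).right_inv h1]
      · rintro ⟨z, hz, rfl⟩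
        have h1 := hmem z hz
        refine ⟨(C.chart i).map_source h1, ?_⟩
        rw [Set.mem_preimage, (C.chart i).left_inv h1]
        exact ⟨hz.2, F.ξ.map_target hz.1⟩
    -- With ψ' = s² and f_F = f_i ψ', the Jacobian weight |ψ'|²|f_i| equals |s|²|f_F|, which is the
    -- density of the frame F.
    rw [e2, lintegral_image_holomorphic (hBm i)
      (fun z hz => differentiableAt_transition (C.chart_mem i) F.mem hz.1 (hmem z hz))]
    · refine setLIntegral_congr_fun (hBm i) fun z hz => ?_
      have h1 := hmem z hz
      have h2 : C.idx (F.ξ.symm z) = i := hz.2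
      have h3 := F.spin.2.1 i (F.ξ.symm z) ⟨h1, F.ξ.map_target hz.1⟩
      rw [F.ξ.right_inv hz.1] at h3
      have h4 := coeff_transition (ω := ω) (C.chart_mem i) F.mem hz.1 h1
      have h5 : deriv ψ z = F.s i (F.ξ.symm z) ^ 2 := h3.symm
      have h6 : F.f ω z = coeff ω (C.chart i) (ψ z) * deriv ψ z := h4
      simp only [Frame.dens, h2]
      rw [h6, h5, hψ]
      simp only [(C.chart i).left_inv h1, enorm_mul, enorm_pow]
      ring
    · intro z hz z' hz' hzz
      have := (C.chart i).injOn (hmem z hz) (hmem z' hz') hzz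
      exact F.ξ.symm.injOn hz.1 hz'.1 this
  rw [← lintegral_indicator F.ξ.open_source.measurableSet]
  change ∫⁻ p, k p ∂(C.hArea ω) = _
  rw [hArea, lintegral_withDensity_eq_lintegral_mul _ hwm hkm, area,
    lintegral_finsetSum_measure]
  change ∑ i, ∫⁻ p in C.idx ⁻¹' {i}, w p * k p ∂_ = _
  rw [Finset.sum_congr rfl fun i _ => hpiece i, ← lintegral_biUnion_finset]
  · congr 2
    ext z
    simp only [Finset.mem_univ, Set.iUnion_true, Set.mem_iUnion, hB, Set.mem_inter_iff,
      Set.mem_preimage, Set.mem_singleton_iff, exists_and_left, exists_eq', and_true]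
  · intro i _ j _ hij
    refine Set.disjoint_left.2 fun z hz hz' => hij ?_
    exact (show C.idx (F.ξ.symm z) = i from hz.2).symm.trans hz'.2
  · exact fun i _ => hBm i

open scoped Classical in
theorem Frame.measurable_coord (F : C.Frame) : Measurable (F.ξ.source.piecewise F.ξ 0) :=
  F.ξ.continuousOn.measurable_piecewise continuousOn_const F.ξ.open_source.measurableSet

variable (F : C.Frame)

namespace Frame

/-- The trivialization of a frame, extended by zero. -/
def triv (p : X) : ℂ := F.ξ.source.indicator (fun p => F.s (C.idx p) p) p

open scoped Classical in
theorem measurable_triv : Measurable F.triv := by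
  have h : F.triv = fun p => ∑ i, (C.idx ⁻¹' {i} ∩ F.ξ.source).indicator (F.s i) p := by
    ext p
    rw [Finset.sum_eq_single (C.idx p)]
    · by_cases hp : p ∈ F.ξ.source
      · rw [triv, Set.indicator_of_mem hp,
          Set.indicator_of_mem (show p ∈ C.idx ⁻¹' {C.idx p} ∩ F.ξ.source from ⟨rfl, hp⟩)]
      · rw [triv, Set.indicator_of_notMem hp, Set.indicator_of_notMem fun h => hp h.2]
    · intro i _ hi
      exact Set.indicator_of_notMem (fun h => hi (Set.mem_singleton_iff.1 h.1).symm) _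
    · simp
  rw [h]
  refine Finset.measurable_fun_sum _ fun i _ => ?_
  rw [← Set.piecewise_eq_indicator]
  refine ContinuousOn.measurable_piecewise ((F.continuousOn_s i).mono ?_) continuousOn_const
    ((measurable_idx (MeasurableSet.singleton i)).inter F.ξ.open_source.measurableSet)
  rintro p ⟨hp, hp'⟩
  exact ⟨(Set.mem_singleton_iff.1 hp) ▸ mem_source_idx p, hp'⟩

theorem triv_of_mem {p : X} (hp : p ∈ F.ξ.source) : F.triv p = F.s (C.idx p) p :=
  Set.indicator_of_mem hp _

open scoped Classical in
theorem measurable_ofFun {g : ℂ → ℂ} (hg : Measurable g) : Measurable (F.ofFun g) := by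
  have h : F.ofFun g = fun p => (F.triv p)⁻¹ * g (F.ξ.source.piecewise F.ξ 0 p) := by
    ext p
    by_cases hp : p ∈ F.ξ.source
    · rw [ofFun, if_pos hp, F.triv_of_mem hp, Set.piecewise_eq_of_mem _ _ _ hp]
    · rw [ofFun, if_neg hp, triv, Set.indicator_of_notMem hp, inv_zero, zero_mul]
  rw [h]
  exact F.measurable_triv.inv.mul (hg.comp F.measurable_coord)

theorem aemeasurable_symm : AEMeasurable F.ξ.symm ((volume : Measure ℂ).restrict F.ξ.target) :=
  F.ξ.continuousOn_symm.aemeasurable F.ξ.open_target.measurableSet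

theorem aemeasurable_f (hω : ω ∈ holomorphicOneForms X) :
    AEMeasurable (F.f ω) ((volume : Measure ℂ).restrict F.ξ.target) :=
  (F.continuousOn_f hω).aemeasurable F.ξ.open_target.measurableSet

theorem aemeasurable_dens (hω : ω ∈ holomorphicOneForms X) :
    AEMeasurable (F.dens ω) ((volume : Measure ℂ).restrict F.ξ.target) := by
  have h1 : AEMeasurable (fun z => ‖F.triv (F.ξ.symm z)‖ₑ ^ 2 * ‖F.f ω z‖ₑ)
      ((volume : Measure ℂ).restrict F.ξ.target) :=
    ((F.measurable_triv.comp_aemeasurable F.aemeasurable_symm).enorm.pow_const 2).mul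
      (F.aemeasurable_f hω).enorm
  refine h1.congr ?_
  filter_upwards [ae_restrict_mem F.ξ.open_target.measurableSet] with z hz
  rw [F.triv_of_mem (F.ξ.map_target hz), dens]

theorem restrict_hArea (hω : ω ∈ holomorphicOneForms X) : (C.hArea ω).restrict F.ξ.source =
    (((volume : Measure ℂ).restrict F.ξ.target).withDensity (F.dens ω)).map F.ξ.symm := by
  refine Measure.ext_of_lintegral _ fun h hh => ?_
  have hsm := F.aemeasurable_symm.mono_ac (withDensity_absolutelyContinuous _ (F.dens ω))
  rw [F.setLIntegral_source hω hh, lintegral_map' hh.aemeasurable hsm]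
  exact (lintegral_withDensity_eq_lintegral_mul₀ (F.aemeasurable_dens hω)
      (hh.comp_aemeasurable F.aemeasurable_symm)).symm

theorem ae_f_ne_zero (hz : (zeros ω).Finite) :
    ∀ᵐ z ∂((volume : Measure ℂ).restrict F.ξ.target), F.f ω z ≠ 0 := by
  rw [ae_restrict_iff' F.ξ.open_target.measurableSet]
  have hfin : (F.ξ '' (zeros ω)).Finite := hz.image _
  filter_upwards [hfin.countable.ae_notMem volume] with z hz1 hz2 h0
  refine hz1 ⟨F.ξ.symm z, ?_, F.ξ.right_inv hz2⟩
  rw [← coeff_eq_zero_iff F.mem (F.ξ.map_target hz2), F.ξ.right_inv hz2]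
  exact h0

theorem dens_ne_zero {z : ℂ} (hz : z ∈ F.ξ.target) (h : F.f ω z ≠ 0) : F.dens ω z ≠ 0 :=
  mul_ne_zero (pow_ne_zero _ (by simpa using F.s_idx_ne_zero (F.ξ.map_target hz)))
    (by simpa using h)

theorem dens_lt_top (z : ℂ) : F.dens ω z < ∞ :=
  ENNReal.mul_lt_top (ENNReal.pow_lt_top enorm_lt_top) enorm_lt_top

/-- The density of h dS vanishes only at the finitely many zeros, so sets null for h dS are Lebesgue
null in the coordinate. This direction transports almost everywhere statements from X to the plane.
-/
theorem volume_ac (hω : ω ∈ holomorphicOneForms X) (hz : (zeros ω).Finite) :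
    (volume : Measure ℂ).restrict F.ξ.target ≪
      ((volume : Measure ℂ).restrict F.ξ.target).withDensity (F.dens ω) := by
  refine withDensity_absolutelyContinuous' (F.aemeasurable_dens hω) ?_
  filter_upwards [F.ae_f_ne_zero hz, ae_restrict_mem F.ξ.open_target.measurableSet] with z h1 h2
  exact F.dens_ne_zero h2 h1

theorem ae_target_of_ae (hω : ω ∈ holomorphicOneForms X) (hz : (zeros ω).Finite) {P : X → Prop}
    (h : ∀ᵐ p ∂(C.hArea ω), p ∈ F.ξ.source → P p) : ∀ᵐ z, z ∈ F.ξ.target → P (F.ξ.symm z) := by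
  rw [← ae_restrict_iff' F.ξ.open_target.measurableSet]
  have h1 : ∀ᵐ p ∂((C.hArea ω).restrict F.ξ.source), P p :=
    (ae_restrict_iff' F.ξ.open_source.measurableSet).2 h
  rw [F.restrict_hArea hω] at h1
  exact (F.volume_ac hω hz).ae_le (ae_of_ae_map
    (F.aemeasurable_symm.mono_ac (withDensity_absolutelyContinuous _ _)) h1)

open scoped Classical in
theorem ae_of_ae_target (hω : ω ∈ holomorphicOneForms X) {P : X → Prop}
    (h : ∀ᵐ z, z ∈ F.ξ.target → P (F.ξ.symm z)) : ∀ᵐ p ∂(C.hArea ω), p ∈ F.ξ.source → P p := by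
  -- The exceptional set need not be measurable, while the statement about the image measure
  -- requires a measurable set; hence the measurable hull.
  set M := toMeasurable volume {z : ℂ | ¬ (z ∈ F.ξ.target → P (F.ξ.symm z))} with hM
  have hM0 : volume M = 0 := by rw [hM, measure_toMeasurable]; exact h
  have hN : MeasurableSet {p | F.ξ.source.piecewise F.ξ 0 p ∉ M ∨ p ∉ F.ξ.source} :=
    (F.measurable_coord (measurableSet_toMeasurable _ _)).compl.union
      F.ξ.open_source.measurableSet.compl
  have h1 : ∀ᵐ p ∂((C.hArea ω).restrict F.ξ.source),
      F.ξ.source.piecewise F.ξ 0 p ∉ M ∨ p ∉ F.ξ.source := by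
    rw [F.restrict_hArea hω, ae_map_iff
      (F.aemeasurable_symm.mono_ac (withDensity_absolutelyContinuous _ _)) hN]
    refine (withDensity_absolutelyContinuous _ _).ae_le ?_
    filter_upwards [ae_restrict_mem F.ξ.open_target.measurableSet,
      ae_restrict_of_ae (measure_eq_zero_iff_ae_notMem.1 hM0)] with z hz1 hz2
    rw [Set.piecewise_eq_of_mem _ _ _ (F.ξ.map_target hz1), F.ξ.right_inv hz1]
    exact Or.inl hz2
  filter_upwards [(ae_restrict_iff' F.ξ.open_source.measurableSet).1 h1] with p hp hp'
  have h2 := (hp hp').resolve_right (not_not.2 hp')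
  rw [Set.piecewise_eq_of_mem _ _ _ hp'] at h2
  by_contra h3
  exact h2 (subset_toMeasurable _ _ (by
    simp only [Set.mem_ofPred_eq]
    intro h4
    have h5 := h4 (F.ξ.map_source hp')
    rw [F.ξ.left_inv hp'] at h5
    exact h3 h5))

variable {u v : X → ℂ}

theorem aestronglyMeasurable_rep (hω : ω ∈ holomorphicOneForms X) (hz : (zeros ω).Finite)
    (hu : AEStronglyMeasurable u (C.hArea ω)) :
    AEStronglyMeasurable (F.rep u) ((volume : Measure ℂ).restrict F.ξ.target) := by
  have h1 : AEMeasurable u ((((volume : Measure ℂ).restrict F.ξ.target).withDensity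
      (F.dens ω)).map F.ξ.symm) := by
    rw [← F.restrict_hArea hω]; exact hu.aemeasurable.restrict
  have h2 : AEMeasurable (fun z => u (F.ξ.symm z)) ((volume : Measure ℂ).restrict F.ξ.target) :=
    (h1.comp_aemeasurable (F.aemeasurable_symm.mono_ac
      (withDensity_absolutelyContinuous _ _))).mono_ac (F.volume_ac hω hz)
  have h3 := ((F.measurable_triv.comp_aemeasurable F.aemeasurable_symm).mul h2).aestronglyMeasurable
  refine h3.congr ?_
  filter_upwards [ae_restrict_mem F.ξ.open_target.measurableSet] with z hz
  simp only [Pi.mul_apply, Function.comp_apply]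
  rw [F.triv_of_mem (F.ξ.map_target hz)]; rfl

theorem lintegral_source (hω : ω ∈ holomorphicOneForms X)
    (hu : AEStronglyMeasurable u (C.hArea ω)) : ∫⁻ p in F.ξ.source, ‖u p‖ₑ ^ 2 ∂(C.hArea ω) =
      ∫⁻ z in F.ξ.target, ‖F.rep u z‖ₑ ^ 2 * ‖F.f ω z‖ₑ := by
  have h1 : AEMeasurable (fun p => ‖u p‖ₑ ^ 2) ((((volume : Measure ℂ).restrict
      F.ξ.target).withDensity (F.dens ω)).map F.ξ.symm) := by
    rw [← F.restrict_hArea hω]; exact (hu.enorm.pow_const 2).restrict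
  have hsm := F.aemeasurable_symm.mono_ac (withDensity_absolutelyContinuous
    ((volume : Measure ℂ).restrict F.ξ.target) (F.dens ω))
  rw [F.restrict_hArea hω, lintegral_map' h1 hsm]
  refine (lintegral_withDensity_eq_lintegral_mul₀' (F.aemeasurable_dens hω)
    (h1.comp_aemeasurable hsm)).trans (lintegral_congr fun z => ?_)
  simp only [Pi.mul_apply, Function.comp_apply, dens, rep, frameRep, enorm_mul, mul_pow]
  ring

theorem integral_source (hω : ω ∈ holomorphicOneForms X)
    (hu : AEStronglyMeasurable u (C.hArea ω)) (hv : AEStronglyMeasurable v (C.hArea ω)) :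
    ∫ p in F.ξ.source, conj (u p) * v p ∂(C.hArea ω) =
      ∫ z in F.ξ.target, conj (F.rep u z) * F.rep v z * ((‖F.f ω z‖ : ℝ) : ℂ) := by
  have h1 : AEStronglyMeasurable (fun p => conj (u p) * v p) ((((volume : Measure ℂ).restrict
      F.ξ.target).withDensity (F.dens ω)).map F.ξ.symm) := by
    rw [← F.restrict_hArea hω]
    exact ((Complex.continuous_conj.comp_aestronglyMeasurable hu).mul hv).restrict
  have hsm := F.aemeasurable_symm.mono_ac (withDensity_absolutelyContinuous
    ((volume : Measure ℂ).restrict F.ξ.target) (F.dens ω))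
  rw [F.restrict_hArea hω, integral_map hsm h1, integral_withDensity_eq_integral_toReal_smul₀
    (F.aemeasurable_dens hω) (ae_of_all _ F.dens_lt_top)]
  refine integral_congr_ae (ae_of_all _ fun z => ?_)
  have h2 : (F.dens ω z).toReal = ‖F.s (C.idx (F.ξ.symm z)) (F.ξ.symm z)‖ ^ 2 * ‖F.f ω z‖ := by
    simp [dens]
  simp only [h2, rep, frameRep, map_mul, Complex.real_smul, Complex.ofReal_mul, Complex.ofReal_pow]
  rw [← Complex.conj_mul']
  ring

end Frame

end SpinBundle

end RiemannSurface

end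

noncomputable section

set_option linter.unusedSectionVars false

/-! ### Cutoff functions -/

theorem exists_smooth_cutoff {K V : Set ℂ} (hK : IsCompact K) (hV : IsOpen V) (hKV : K ⊆ V) :
    ∃ χ : ℂ → ℝ, ContDiff ℝ ((⊤ : ℕ∞) : WithTop ℕ∞) χ ∧ HasCompactSupport χ ∧ tsupport χ ⊆ V ∧
      (∀ᶠ x in 𝓝ˢ K, χ x = 1) ∧ ∀ x, χ x ∈ Set.Icc (0 : ℝ) 1 := by
  obtain ⟨L, hL, hKL, hLV⟩ := exists_compact_between hK hV hKV
  obtain ⟨f, h1, h2, h3⟩ := exists_contMDiffMap_one_nhds_of_subset_interior (n := ⊤)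
    𝓘(ℝ, ℂ) hK.isClosed hKL
  have h4 : tsupport f ⊆ L := closure_minimal (fun x hx => by
    by_contra h; exact hx (h2 x h)) hL.isClosed
  exact ⟨f, f.contMDiff.contDiff, HasCompactSupport.of_support_subset_isCompact hL
    ((subset_tsupport _).trans h4), h4.trans hLV, h1, h3⟩

theorem contDiffOn_extend {g : ℂ → ℂ} {χ : ℂ → ℝ} {V : Set ℂ} (hV : IsOpen V)
    (hg : ContDiffOn ℝ ((⊤ : ℕ∞) : WithTop ℕ∞) g V)
    (hχ : ContDiff ℝ ((⊤ : ℕ∞) : WithTop ℕ∞) χ) (hs : tsupport χ ⊆ V) :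
    ContDiff ℝ ((⊤ : ℕ∞) : WithTop ℕ∞) fun z => (χ z : ℂ) * g z := by
  refine contDiff_iff_contDiffAt.2 fun z => ?_
  by_cases hz : z ∈ V
  · exact (Complex.ofRealCLM.contDiff.comp hχ).contDiffAt.mul (hg.contDiffAt (hV.mem_nhds hz))
  · have : (fun z => (χ z : ℂ) * g z) =ᶠ[𝓝 z] fun _ => 0 := by
      filter_upwards [notMem_tsupport_iff_eventuallyEq.1 fun h => hz (hs h)] with y hy
      simp [hy]
    exact contDiffAt_const.congr_of_eventuallyEq this

/-- Since g is smooth only on V, it is multiplied by a cutoff equal to 1 near supp f, which changes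
neither integrand. -/
theorem integral_mul_wirtDbar_of_contDiffOn {f g : ℂ → ℂ} {V : Set ℂ} (hV : IsOpen V)
    (hf : ContDiff ℝ ((⊤ : ℕ∞) : WithTop ℕ∞) f) (hfc : HasCompactSupport f) (hfV : tsupport f ⊆ V)
    (hg : ContDiffOn ℝ ((⊤ : ℕ∞) : WithTop ℕ∞) g V) :
    ∫ z, f z * wirtDbar g z = -∫ z, wirtDbar f z * g z := by
  obtain ⟨χ, h1, -, h3, h4, -⟩ := exists_smooth_cutoff hfc hV hfV
  have h5 := integral_mul_wirtDbar hf (contDiffOn_extend hV hg h1 h3) hfc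
  have key : ∀ z ∈ tsupport f, (fun z => (χ z : ℂ) * g z) =ᶠ[𝓝 z] g := fun z hz => by
    filter_upwards [h4.filter_mono (nhds_le_nhdsSet hz)] with y hy
    rw [hy, Complex.ofReal_one, one_mul]
  have e1 : ∀ z, f z * wirtDbar (fun z => (χ z : ℂ) * g z) z = f z * wirtDbar g z := fun z => by
    by_cases hz : z ∈ tsupport f
    · rw [(key z hz).wirtDbar_eq]
    · rw [image_eq_zero_of_notMem_tsupport hz, zero_mul, zero_mul]
  have e2 : ∀ z, wirtDbar f z * ((χ z : ℂ) * g z) = wirtDbar f z * g z := fun z => by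
    by_cases hz : z ∈ tsupport f
    · exact congrArg _ (key z hz).self_of_nhds
    · have : f =ᶠ[𝓝 z] fun _ => 0 := notMem_tsupport_iff_eventuallyEq.1 hz
      rw [this.wirtDbar_eq, wirtDbar_const, zero_mul, zero_mul]
  simpa only [e1, e2] using h5

namespace RiemannSurface

namespace SpinBundle

local notation "conj" => starRingEnd ℂ
local notation "infty" => ((⊤ : ℕ∞) : WithTop ℕ∞)

variable {X : Type*} [TopologicalSpace X] [ChartedSpace ℂ X] {C : SpinBundle X}
  {ω : ∀ p : X, TangentSpace 𝓘(ℂ) p →L[ℂ] ℂ}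

variable (C) in
/-- The function `β` is smooth at `p`. -/
def SmoothFunAt (β : X → ℂ) (p : X) : Prop :=
  ∀ F : C.Frame, p ∈ F.ξ.source → ContDiffAt ℝ infty (fun z => β (F.ξ.symm z)) (F.ξ p)

section Smooth

variable {u v β : X → ℂ} {p : X}

theorem SmoothFunAt.mul (hβ : C.SmoothFunAt β p) (hu : C.SmoothAt u p) :
    C.SmoothAt (fun q => β q * u q) p := fun F hp => by
  have : F.rep (fun q => β q * u q) = fun z => β (F.ξ.symm z) * F.rep u z := by
    ext z; simp only [Frame.rep, frameRep]; ring
  rw [this]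
  exact (hβ F hp).mul (hu F hp)

theorem SmoothFunAt.one_sub (hβ : C.SmoothFunAt β p) : C.SmoothFunAt (fun q => 1 - β q) p :=
  fun F hp => contDiffAt_const.sub (hβ F hp)

theorem smoothFunAt_const (c : ℂ) : C.SmoothFunAt (fun _ => c) p := fun _ _ => contDiffAt_const

theorem SmoothAt.add (hu : C.SmoothAt u p) (hv : C.SmoothAt v p) :
    C.SmoothAt (fun q => u q + v q) p := fun F hp => by
  have : F.rep (fun q => u q + v q) = fun z => F.rep u z + F.rep v z := by
    ext z; simp only [Frame.rep, frameRep]; ring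
  rw [this]
  exact (hu F hp).add (hv F hp)

theorem SmoothAt.const_mul (c : ℂ) (hu : C.SmoothAt u p) : C.SmoothAt (fun q => c * u q) p :=
  (smoothFunAt_const c).mul hu

theorem smoothFunAt_congr {β' : X → ℂ} (hβ : C.SmoothFunAt β p) (h : β' =ᶠ[𝓝 p] β) :
    C.SmoothFunAt β' p := fun F hp => by
  refine (hβ F hp).congr_of_eventuallyEq ?_
  have h1 := F.ξ.continuousAt_symm (F.ξ.map_source hp)
  rw [ContinuousAt, F.ξ.left_inv hp] at h1
  exact h1.eventually h

variable [IsManifold 𝓘(ℂ) 1 X]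

theorem smoothFunAt_of_frame (F : C.Frame) (hp : p ∈ F.ξ.source)
    (h : ContDiffAt ℝ infty (fun z => β (F.ξ.symm z)) (F.ξ p)) : C.SmoothFunAt β p := by
  intro F' hp'
  have e := F.eventually_transition F' hp hp'
  have h1 : ContDiffAt ℝ infty (fun z => F.ξ (F'.ξ.symm z)) (F'.ξ p) := by
    refine contDiffAt_of_eventually_differentiableAt ?_
    filter_upwards [e] with z hz using differentiableAt_transition F.mem F'.mem hz.1 hz.2
  refine ContDiffAt.congr_of_eventuallyEq (f := fun z => β (F.ξ.symm (F.ξ (F'.ξ.symm z)))) ?_ ?_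
  · refine ContDiffAt.comp (F'.ξ p) (g := fun z => β (F.ξ.symm z)) ?_ h1
    rwa [F'.ξ.left_inv hp']
  · filter_upwards [e] with z hz
    rw [F.ξ.left_inv hz.2]

theorem Frame.eventually_notMem_image [T2Space X] (F : C.Frame) {K : Set ℂ} (hK : IsCompact K)
    (hKt : K ⊆ F.ξ.target) (hp : p ∉ F.ξ.symm '' K) :
    ∀ᶠ q in 𝓝 p, q ∈ F.ξ.source → F.ξ q ∉ K := by
  have h1 : IsClosed (F.ξ.symm '' K) :=
    (hK.image_of_continuousOn (F.ξ.continuousOn_symm.mono hKt)).isClosed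
  filter_upwards [h1.isOpen_compl.mem_nhds hp] with q hq hq1 hq2
  exact hq ⟨F.ξ q, hq2, F.ξ.left_inv hq1⟩

theorem Frame.ofFun_eventuallyEq_zero [T2Space X] (F : C.Frame) {g : ℂ → ℂ}
    (hg : HasCompactSupport g) (hgt : tsupport g ⊆ F.ξ.target) (hp : p ∉ F.ξ.symm '' tsupport g) :
    F.ofFun g =ᶠ[𝓝 p] fun _ => 0 := by
  filter_upwards [F.eventually_notMem_image hg hgt hp] with q hq
  by_cases hq1 : q ∈ F.ξ.source
  · rw [Frame.ofFun, if_pos hq1, image_eq_zero_of_notMem_tsupport (hq hq1), mul_zero]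
  · rw [Frame.ofFun, if_neg hq1]

theorem Frame.tsupport_ofFun_subset [T2Space X] (F : C.Frame) {g : ℂ → ℂ}
    (hg : HasCompactSupport g) (hgt : tsupport g ⊆ F.ξ.target) :
    tsupport (F.ofFun g) ⊆ F.ξ.symm '' tsupport g := fun p hp => by
  by_contra h
  exact notMem_tsupport_iff_eventuallyEq.2 (F.ofFun_eventuallyEq_zero hg hgt h) hp

theorem Frame.image_symm_subset (F : C.Frame) {K : Set ℂ} (hK : K ⊆ F.ξ.target) :
    F.ξ.symm '' K ⊆ F.ξ.source := by
  rintro _ ⟨z, hz, rfl⟩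
  exact F.ξ.map_target (hK hz)

theorem Frame.smoothAt_ofFun' [T2Space X] (F : C.Frame) {g : ℂ → ℂ}
    (hg : HasCompactSupport g) (hgt : tsupport g ⊆ F.ξ.target)
    (hgd : p ∈ F.ξ.source → ContDiffAt ℝ infty g (F.ξ p)) : C.SmoothAt (F.ofFun g) p := by
  by_cases hp : p ∈ F.ξ.source
  · exact F.smoothAt_ofFun hp (hgd hp)
  · exact smoothAt_zero.congr (F.ofFun_eventuallyEq_zero hg hgt fun h =>
      hp (F.image_symm_subset hgt h))

theorem Frame.isTestSection_ofFun [T2Space X] (F : C.Frame) {g : ℂ → ℂ}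
    (hgd : ContDiff ℝ infty g) (hg : HasCompactSupport g) (hgt : tsupport g ⊆ F.ξ.target)
    (hf : ∀ z ∈ tsupport g, F.f ω z ≠ 0) : C.IsTestSection ω (F.ofFun g) := by
  refine isTestSection_iff.2 ⟨fun p => F.smoothAt_ofFun' hg hgt fun _ => hgd.contDiffAt,
    Set.disjoint_left.2 fun p hp hp0 => ?_⟩
  obtain ⟨z, hz, rfl⟩ := F.tsupport_ofFun_subset hg hgt hp
  have h1 := (coeff_eq_zero_iff F.mem (F.ξ.map_target (hgt hz))).2 hp0
  rw [F.ξ.right_inv (hgt hz)] at h1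
  exact hf z hz h1

theorem Frame.contDiffOn_rep (F : C.Frame) (hu : ∀ p ∈ F.ξ.source, C.SmoothAt u p) :
    ContDiffOn ℝ infty (F.rep u) F.ξ.target := fun z hz => by
  have h1 := hu _ (F.ξ.map_target hz) F (F.ξ.map_target hz)
  rw [F.ξ.right_inv hz] at h1
  exact h1.contDiffWithinAt

theorem Frame.exists_eq_ofFun [T2Space X] [CompactSpace X] (F : C.Frame)
    (hu : ∀ p, C.SmoothAt u p) (hs : tsupport u ⊆ F.ξ.source) :
    ∃ g : ℂ → ℂ, ContDiff ℝ infty g ∧ HasCompactSupport g ∧ tsupport g ⊆ F.ξ '' tsupport u ∧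
      u = F.ofFun g ∧ ∀ z ∈ F.ξ.target, F.rep u z = g z := by
  set K := F.ξ '' tsupport u with hK
  have hKc : IsCompact K := (isClosed_tsupport u).isCompact.image_of_continuousOn
    (F.ξ.continuousOn.mono hs)
  have hKt : K ⊆ F.ξ.target := by
    rintro _ ⟨p, hp, rfl⟩; exact F.ξ.map_source (hs hp)
  obtain ⟨χ, h1, h2, h3, h4, -⟩ := exists_smooth_cutoff hKc F.ξ.open_target hKt
  have h5 := contDiffOn_extend F.ξ.open_target (F.contDiffOn_rep fun p _ => hu p) h1 h3
  have hrep0 : ∀ z ∈ F.ξ.target, z ∉ K → F.rep u z = 0 := fun z hz hzK => by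
    have : u (F.ξ.symm z) = 0 := image_eq_zero_of_notMem_tsupport fun h =>
      hzK ⟨_, h, F.ξ.right_inv hz⟩
    rw [Frame.rep, frameRep, this, mul_zero]
  have h6 : ∀ z ∉ K, (χ z : ℂ) * F.rep u z = 0 := fun z hzK => by
    by_cases hz : z ∈ F.ξ.target
    · rw [hrep0 z hz hzK, mul_zero]
    · rw [image_eq_zero_of_notMem_tsupport fun h => hz (h3 h), Complex.ofReal_zero, zero_mul]
  have h7 : tsupport (fun z => (χ z : ℂ) * F.rep u z) ⊆ K :=
    closure_minimal (fun z hz => by by_contra h; exact hz (h6 z h)) hKc.isClosed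
  have h8 : ∀ z ∈ F.ξ.target, F.rep u z = (χ z : ℂ) * F.rep u z := fun z hz => by
    by_cases hzK : z ∈ K
    · rw [h4.self_of_nhdsSet z hzK, Complex.ofReal_one, one_mul]
    · rw [hrep0 z hz hzK, mul_zero]
  refine ⟨_, h5, HasCompactSupport.of_support_subset_isCompact hKc ((subset_tsupport _).trans h7),
    h7, ?_, h8⟩
  ext p
  by_cases hp : p ∈ F.ξ.source
  · rw [Frame.ofFun, if_pos hp, ← h8 _ (F.ξ.map_source hp), Frame.rep, F.ξ.left_inv hp, frameRep,
      inv_mul_cancel_left₀ (F.s_idx_ne_zero hp)]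
  · rw [Frame.ofFun, if_neg hp]
    exact image_eq_zero_of_notMem_tsupport fun h => hp (hs h)

theorem exists_smoothFun_bump [T2Space X] (C : SpinBundle X) {U : Set X} (hU : U ∈ 𝓝 p) :
    ∃ β : X → ℂ, (∀ q, C.SmoothFunAt β q) ∧ (∀ᶠ q in 𝓝 p, β q = 1) ∧ tsupport β ⊆ U := by
  classical
  set F := C.chartFrame (C.idx p) with hF
  have hp : p ∈ F.ξ.source := mem_source_idx p
  have h1 : F.ξ.symm ⁻¹' (interior U) ∩ F.ξ.target ∈ 𝓝 (F.ξ p) := by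
    refine inter_mem ?_ (F.ξ.open_target.mem_nhds (F.ξ.map_source hp))
    have h1 := F.ξ.continuousAt_symm (F.ξ.map_source hp)
    rw [ContinuousAt, F.ξ.left_inv hp] at h1
    exact h1 (isOpen_interior.mem_nhds (mem_interior_iff_mem_nhds.2 hU))
  obtain ⟨V, hV, hVo, hVp⟩ := mem_nhds_iff.1 h1
  obtain ⟨χ, k1, k2, k3, k4, -⟩ := exists_smooth_cutoff (isCompact_singleton (x := F.ξ p)) hVo
    (Set.singleton_subset_iff.2 hVp)
  have k5 : tsupport χ ⊆ F.ξ.target := fun z hz => (hV (k3 hz)).2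
  set β : X → ℂ := fun q => if q ∈ F.ξ.source then ((χ (F.ξ q) : ℝ) : ℂ) else 0 with hβ
  have h0 : ∀ q, q ∉ F.ξ.symm '' tsupport χ → β =ᶠ[𝓝 q] fun _ => 0 := fun q hq => by
    filter_upwards [F.eventually_notMem_image k2 k5 hq] with q' hq'
    by_cases hq1 : q' ∈ F.ξ.source
    · simp only [hβ, if_pos hq1, image_eq_zero_of_notMem_tsupport (hq' hq1), Complex.ofReal_zero]
    · simp only [hβ, if_neg hq1]
  refine ⟨β, fun q => ?_, ?_, fun q hq => ?_⟩
  · by_cases hq : q ∈ F.ξ.source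
    · refine smoothFunAt_of_frame F hq ?_
      refine ContDiffAt.congr_of_eventuallyEq (f := fun z => (χ z : ℂ))
        (Complex.ofRealCLM.contDiff.comp k1).contDiffAt ?_
      filter_upwards [F.ξ.open_target.mem_nhds (F.ξ.map_source hq)] with z hz
      simp only [hβ, if_pos (F.ξ.map_target hz), F.ξ.right_inv hz]
    · exact smoothFunAt_congr (smoothFunAt_const 0)
        (h0 q fun h => hq (F.image_symm_subset k5 h))
  · have k6 : ∀ᶠ z in 𝓝 (F.ξ p), χ z = 1 := by rwa [nhdsSet_singleton] at k4
    filter_upwards [(F.ξ.continuousAt hp).eventually k6, F.ξ.open_source.mem_nhds hp] with q hq hq'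
    simp only [hβ, if_pos hq', hq, Complex.ofReal_one]
  · by_contra hqU
    refine notMem_tsupport_iff_eventuallyEq.2 (h0 q ?_) hq
    rintro ⟨z, hz, rfl⟩
    exact hqU (interior_subset (hV (k3 hz)).1)

end Smooth

section Test

variable {u v β : X → ℂ} {p : X} [IsManifold 𝓘(ℂ) 1 X]

theorem IsTestSection.smul_fun (hu : C.IsTestSection ω u) (hβ : ∀ q, C.SmoothFunAt β q) :
    C.IsTestSection ω fun q => β q * u q := by
  rw [isTestSection_iff] at hu ⊢
  exact ⟨fun q => (hβ q).mul (hu.1 q), hu.2.mono_left (tsupport_mul_subset_right)⟩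

theorem IsTestSection.add (hu : C.IsTestSection ω u) (hv : C.IsTestSection ω v) :
    C.IsTestSection ω fun q => u q + v q := by
  rw [isTestSection_iff] at hu hv ⊢
  exact ⟨fun q => (hu.1 q).add (hv.1 q),
    (hu.2.union_left hv.2).mono_left (tsupport_add u v)⟩

theorem IsTestSection.const_mul (c : ℂ) (hu : C.IsTestSection ω u) :
    C.IsTestSection ω fun q => c * u q := hu.smul_fun fun _ => smoothFunAt_const c

theorem isTestSection_zero : C.IsTestSection ω fun _ => 0 :=
  isTestSection_iff.2 ⟨fun _ => smoothAt_zero, by simp [tsupport]⟩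

/-- Localization of additive statements about test sections. -/
theorem IsTestSection.induction [T2Space X] [CompactSpace X] {P : (X → ℂ) → Prop}
    (h0 : P fun _ => 0)
    (hadd : ∀ u v, C.IsTestSection ω u → C.IsTestSection ω v → P u → P v → P fun q => u q + v q)
    (hloc : ∀ p ∉ zeros ω, ∃ U ∈ 𝓝 p, ∀ u, C.IsTestSection ω u → tsupport u ⊆ U → P u)
    (hu : C.IsTestSection ω u) : P u := by
  classical
  choose! U hU hP using hloc
  choose β hβ hβ1 hβU using fun p : X => exists_smoothFun_bump C (p := p)
    (U := if p ∈ zeros ω then Set.univ else U p) (by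
      split_ifs with h
      · exact univ_mem
      · exact hU p h)
  have hcomp : IsCompact (tsupport u) := (isClosed_tsupport u).isCompact
  obtain ⟨t, ht, htu⟩ := hcomp.elim_nhds_subcover (fun p => {q | β p q = 1}) fun p _ => hβ1 p
  -- Splitting v = β v + (1 - β) v removes one factor of the product at a time: β v is localised,
  -- and (1 - β) v is annihilated by the remaining factors. For u itself the product vanishes on the
  -- support, as the sets β = 1 cover it.
  have key : ∀ (s : Finset X), (∀ p ∈ s, p ∉ zeros ω) → ∀ v, C.IsTestSection ω v →
      (∀ q, v q * ∏ p ∈ s, (1 - β p q) = 0) → P v := by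
    intro s
    induction s using Finset.induction_on with
    | empty =>
      intro _ v _ hv0
      have : v = fun _ => 0 := by ext q; simpa using hv0 q
      rwa [this]
    | insert p s hps ih =>
      intro hs v hv hv0
      have h1 : P fun q => β p q * v q := by
        refine hP p (hs p (Finset.mem_insert_self _ _)) _ (hv.smul_fun (hβ p)) ?_
        have h2 := hβU p
        rw [if_neg (hs p (Finset.mem_insert_self _ _))] at h2
        exact (tsupport_mul_subset_left).trans h2
      have hv' := hv.smul_fun fun q => (hβ p q).one_sub
      have h2 : P fun q => (1 - β p q) * v q := by
        refine ih (fun q hq => hs q (Finset.mem_insert_of_mem hq)) _ hv' fun q => ?_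
        have := hv0 q
        rw [Finset.prod_insert hps] at this
        rw [← this]; ring
      have h3 := hadd _ _ (hv.smul_fun (hβ p)) hv' h1 h2
      have : v = fun q => β p q * v q + (1 - β p q) * v q := by ext q; ring
      rwa [this]
  refine key t (fun p hp h => (isTestSection_iff.1 hu).2.le_bot ⟨ht p hp, h⟩) u hu fun q => ?_
  by_cases hq : q ∈ tsupport u
  · obtain ⟨p, hp, hpq⟩ := Set.mem_iUnion₂.1 (htu hq)
    have : (1 : ℂ) - β p q = 0 := by rw [show β p q = 1 from hpq, sub_self]
    rw [Finset.prod_eq_zero hp this, mul_zero]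
  · rw [image_eq_zero_of_notMem_tsupport hq, zero_mul]

end Test

end SpinBundle

end RiemannSurface

end

noncomputable section

set_option linter.unusedSectionVars false

namespace RiemannSurface

namespace SpinBundle

local notation "conj" => starRingEnd ℂ
local notation "infty" => ((⊤ : ℕ∞) : WithTop ℕ∞)

variable {X : Type*} [TopologicalSpace X] [ChartedSpace ℂ X] {C : SpinBundle X}
  {ω : ∀ p : X, TangentSpace 𝓘(ℂ) p →L[ℂ] ℂ}

/-! ### Operators with constant coefficients in flat frames -/

variable (C ω) in
/-- `A` acts on sections as the local linear operator `B` in every flat frame. -/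
structure FlatOp (A : (X → ℂ) → X → ℂ) (B : (ℂ → ℂ) → ℂ → ℂ) : Prop where
  rep_eq : ∀ {F : C.Frame} {u : X → ℂ} {p : X}, F.IsFlat ω → p ∈ F.ξ.source → C.SmoothAt u p →
    F.rep (A u) (F.ξ p) = B (F.rep u) (F.ξ p)
  zero : ∀ {u : X → ℂ} {p : X}, (u =ᶠ[𝓝 p] fun _ => 0) → A u p = 0
  congr : ∀ {f g : ℂ → ℂ} {z : ℂ}, f =ᶠ[𝓝 z] g → B f z = B g z
  add : ∀ {f g : ℂ → ℂ} {z : ℂ}, ContDiffAt ℝ infty f z → ContDiffAt ℝ infty g z →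
    B (fun y => f y + g y) z = B f z + B g z
  const_mul : ∀ (c : ℂ) {f : ℂ → ℂ} {z : ℂ}, ContDiffAt ℝ infty f z →
    B (fun y => c * f y) z = c * B f z
  smooth : ∀ {f : ℂ → ℂ} {z : ℂ}, ContDiffAt ℝ infty f z → ContDiffAt ℝ infty (B f) z

variable [IsManifold 𝓘(ℂ) 1 X]

theorem sectionOp_eq_zero {A : (ℂ → ℂ) → (ℂ → ℂ) → ℂ → ℂ}
    (hA : ∀ f u z, (u =ᶠ[𝓝 z] fun _ => 0) → A f u z = 0) {u : X → ℂ} {p : X}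
    (hu : u =ᶠ[𝓝 p] fun _ => 0) : C.sectionOp ω A u p = 0 := by
  refine hA _ _ _ ?_
  have h1 := rep_congr_of_eventuallyEq (C.chartFrame (C.idx p)) (mem_source_idx p) hu
  refine h1.trans (Eventually.of_forall fun z => ?_)
  simp [Frame.rep, frameRep]

theorem differentiableAt_of_contDiffAt_infty {f : ℂ → ℂ} {z : ℂ} (hf : ContDiffAt ℝ infty f z) :
    DifferentiableAt ℝ f z := hf.differentiableAt (by simp)

theorem Frame.IsFlat.eventually_f {F : C.Frame} (hF : F.IsFlat ω) {p : X} (hp : p ∈ F.ξ.source) :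
    ∀ᶠ z in 𝓝 (F.ξ p), F.f ω z = 1 := by
  filter_upwards [F.ξ.open_target.mem_nhds (F.ξ.map_source hp)] with z hz using hF z hz

theorem Frame.IsFlat.notMem_zeros {F : C.Frame} (hF : F.IsFlat ω) {p : X} (hp : p ∈ F.ξ.source) :
    p ∉ zeros ω := fun h => by
  have h1 := (coeff_eq_zero_iff F.mem hp).2 h
  rw [show coeff ω F.ξ (F.ξ p) = 1 from hF _ (F.ξ.map_source hp)] at h1
  exact one_ne_zero h1

theorem flatOp_dbarOmega : C.FlatOp ω (C.dbarOmega ω) wirtDbar where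
  rep_eq {F u p} hF hp hu := by
    rw [rep_dbarOmega F hp hu, localDbar, hF _ (F.ξ.map_source hp), map_one, inv_one, one_mul]
  zero hu := sectionOp_eq_zero (A := localDbar)
    (fun f u z h => by rw [localDbar, h.wirtDbar_eq, wirtDbar_const, mul_zero]) hu
  congr h := h.wirtDbar_eq
  add hf hg := wirtDbar_add (differentiableAt_of_contDiffAt_infty hf)
    (differentiableAt_of_contDiffAt_infty hg)
  const_mul c _ _ hf := wirtDbar_const_mul c (differentiableAt_of_contDiffAt_infty hf)
  smooth hf := hf.wirtDbar_infty

theorem flatOp_dOmega (hω : ω ∈ holomorphicOneForms X) : C.FlatOp ω (C.dOmega ω) wirtD where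
  rep_eq {F u p} hF hp hu := by
    have h1 : (fun y => ((‖F.f ω y‖⁻¹ : ℝ) : ℂ) * F.rep u y) =ᶠ[𝓝 (F.ξ p)] F.rep u := by
      filter_upwards [hF.eventually_f hp] with z hz
      simp [hz]
    rw [rep_dOmega hω F hp (hF.notMem_zeros hp) hu, localD, h1.wirtD_eq,
      hF _ (F.ξ.map_source hp)]
    simp
  zero hu := sectionOp_eq_zero (A := localD)
    (fun f u z h => by
      have : (fun y => ((‖f y‖⁻¹ : ℝ) : ℂ) * u y) =ᶠ[𝓝 z] fun _ => 0 := by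
        filter_upwards [h] with y hy
        rw [hy, mul_zero]
      rw [localD, this.wirtD_eq, wirtD_const, mul_zero]) hu
  congr h := h.wirtD_eq
  add hf hg := wirtD_add (differentiableAt_of_contDiffAt_infty hf)
    (differentiableAt_of_contDiffAt_infty hg)
  const_mul c _ _ hf := wirtD_const_mul c (differentiableAt_of_contDiffAt_infty hf)
  smooth hf := hf.wirtD_infty

theorem eventually_contDiffAt_infty {f : ℂ → ℂ} {z : ℂ} (hf : ContDiffAt ℝ infty f z) :
    ∀ᶠ y in 𝓝 z, ContDiffAt ℝ 2 f y :=
  (hf.of_le (WithTop.coe_le_coe.2 (le_top : (2 : ℕ∞) ≤ ⊤))).eventually (by simp)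

theorem flatOp_laplacian (hω : ω ∈ holomorphicOneForms X) :
    C.FlatOp ω (C.laplacian ω) fun f z => -wirtD (wirtDbar f) z where
  rep_eq {F u p} hF hp hu := by
    have h1 : (fun y => ((‖F.f ω y‖⁻¹ : ℝ) : ℂ) * wirtDbar (F.rep u) y) =ᶠ[𝓝 (F.ξ p)]
        wirtDbar (F.rep u) := by
      filter_upwards [hF.eventually_f hp] with z hz
      simp [hz]
    rw [rep_laplacian hω F hp (hF.notMem_zeros hp) hu, localLaplacian, h1.wirtD_eq,
      hF _ (F.ξ.map_source hp)]
    simp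
  zero hu := sectionOp_eq_zero (A := localLaplacian)
    (fun f u z h => by
      have : (fun y => ((‖f y‖⁻¹ : ℝ) : ℂ) * wirtDbar u y) =ᶠ[𝓝 z] fun _ => 0 := by
        filter_upwards [h.eventuallyEq_nhds] with y hy
        rw [hy.wirtDbar_eq, wirtDbar_const, mul_zero]
      rw [localLaplacian, this.wirtD_eq, wirtD_const, neg_zero, mul_zero]) hu
  congr {f g z} h := by
    have : wirtDbar f =ᶠ[𝓝 z] wirtDbar g := by
      filter_upwards [h.eventuallyEq_nhds] with y hy using hy.wirtDbar_eq
    rw [this.wirtD_eq]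
  add {f g z} hf hg := by
    have : wirtDbar (fun y => f y + g y) =ᶠ[𝓝 z] fun y => wirtDbar f y + wirtDbar g y := by
      filter_upwards [eventually_contDiffAt_infty hf, eventually_contDiffAt_infty hg] with y h1 h2
      exact wirtDbar_add (h1.differentiableAt (by simp)) (h2.differentiableAt (by simp))
    rw [this.wirtD_eq, wirtD_add (differentiableAt_of_contDiffAt_infty hf.wirtDbar_infty)
      (differentiableAt_of_contDiffAt_infty hg.wirtDbar_infty), neg_add]
  const_mul c f z hf := by
    have : wirtDbar (fun y => c * f y) =ᶠ[𝓝 z] fun y => c * wirtDbar f y := by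
      filter_upwards [eventually_contDiffAt_infty hf] with y h1
      exact wirtDbar_const_mul c (h1.differentiableAt (by simp))
    rw [this.wirtD_eq, wirtD_const_mul c (differentiableAt_of_contDiffAt_infty hf.wirtDbar_infty),
      mul_neg]
  smooth hf := hf.wirtDbar_infty.wirtD_infty.neg

theorem Frame.eq_of_rep_eq (F : C.Frame) {u v : X → ℂ} {p : X} (hp : p ∈ F.ξ.source)
    (h : F.rep u (F.ξ p) = F.rep v (F.ξ p)) : u p = v p := by
  rw [Frame.rep, Frame.rep, F.ξ.left_inv hp, frameRep, frameRep] at h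
  exact mul_left_cancel₀ (F.s_idx_ne_zero hp) h

theorem IsTestSection.eventually_zero {u : X → ℂ} (hu : C.IsTestSection ω u) {p : X}
    (hp : p ∈ zeros ω) : u =ᶠ[𝓝 p] fun _ => 0 :=
  notMem_tsupport_iff_eventuallyEq.1 fun h => (isTestSection_iff.1 hu).2.le_bot ⟨h, hp⟩

theorem IsTestSection.smoothAt {u : X → ℂ} (hu : C.IsTestSection ω u) (p : X) : C.SmoothAt u p :=
  (isTestSection_iff.1 hu).1 p

namespace FlatOp

variable {A : (X → ℂ) → X → ℂ} {B : (ℂ → ℂ) → ℂ → ℂ} (hA : C.FlatOp ω A B)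
  (hω : ω ∈ holomorphicOneForms X) {u v : X → ℂ}
include hA

theorem tsupport_subset : tsupport (A u) ⊆ tsupport u := by
  refine closure_minimal (fun p hp => ?_) (isClosed_tsupport u)
  by_contra h
  exact hp (hA.zero (notMem_tsupport_iff_eventuallyEq.1 h))

theorem rep_eventuallyEq {F : C.Frame} (hF : F.IsFlat ω) {p : X} (hp : p ∈ F.ξ.source)
    (hu : ∀ p ∈ F.ξ.source, C.SmoothAt u p) : F.rep (A u) =ᶠ[𝓝 (F.ξ p)] B (F.rep u) := by
  filter_upwards [F.ξ.open_target.mem_nhds (F.ξ.map_source hp)] with z hz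
  have := hA.rep_eq hF (F.ξ.map_target hz) (hu _ (F.ξ.map_target hz))
  rwa [F.ξ.right_inv hz] at this

include hω

theorem isTestSection (hu : C.IsTestSection ω u) : C.IsTestSection ω (A u) := by
  refine isTestSection_iff.2 ⟨fun p => ?_, (isTestSection_iff.1 hu).2.mono_left hA.tsupport_subset⟩
  by_cases hp : p ∈ zeros ω
  · refine smoothAt_zero.congr ?_
    filter_upwards [(hu.eventually_zero hp).eventuallyEq_nhds] with q hq using hA.zero hq
  · obtain ⟨F, hpF, hF, -⟩ := exists_flat_frame (C := C) hω hp
    exact smoothAt_of_frame F hpF ((hA.smooth (hu.smoothAt p F hpF)).congr_of_eventuallyEq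
      (hA.rep_eventuallyEq hF hpF fun p _ => hu.smoothAt p))

theorem add_test (hu : C.IsTestSection ω u) (hv : C.IsTestSection ω v) :
    A (fun q => u q + v q) = fun q => A u q + A v q := by
  ext p
  by_cases hp : p ∈ zeros ω
  · rw [hA.zero (hu.eventually_zero hp), hA.zero (hv.eventually_zero hp),
      hA.zero ((hu.add hv).eventually_zero hp), add_zero]
  · obtain ⟨F, hpF, hF, -⟩ := exists_flat_frame (C := C) hω hp
    refine F.eq_of_rep_eq (v := fun q => A u q + A v q) hpF ?_
    have h1 : ∀ u v : X → ℂ, F.rep (fun q => u q + v q) = fun z => F.rep u z + F.rep v z :=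
      fun u v => by ext z; simp only [Frame.rep, frameRep]; ring
    rw [hA.rep_eq hF hpF ((hu.add hv).smoothAt p), h1, h1, hA.add (hu.smoothAt p F hpF)
      (hv.smoothAt p F hpF)]
    beta_reduce
    rw [hA.rep_eq hF hpF (hu.smoothAt p), hA.rep_eq hF hpF (hv.smoothAt p)]

theorem const_mul_test (c : ℂ) (hu : C.IsTestSection ω u) :
    A (fun q => c * u q) = fun q => c * A u q := by
  ext p
  by_cases hp : p ∈ zeros ω
  · rw [hA.zero (hu.eventually_zero hp), hA.zero ((hu.const_mul c).eventually_zero hp), mul_zero]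
  · obtain ⟨F, hpF, hF, -⟩ := exists_flat_frame (C := C) hω hp
    refine F.eq_of_rep_eq (v := fun q => c * A u q) hpF ?_
    have h1 : ∀ u : X → ℂ, F.rep (fun q => c * u q) = fun z => c * F.rep u z :=
      fun u => by ext z; simp only [Frame.rep, frameRep]; ring
    rw [hA.rep_eq hF hpF ((hu.const_mul c).smoothAt p), h1, h1, hA.const_mul c (hu.smoothAt p F hpF)]
    beta_reduce
    rw [hA.rep_eq hF hpF (hu.smoothAt p)]

end FlatOp

theorem rep_neg (F : C.Frame) (u : X → ℂ) : F.rep (fun q => -u q) = fun z => -F.rep u z := by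
  ext z; simp only [Frame.rep, frameRep]; ring

theorem laplacian_eq_dOmega_dbarOmega (hω : ω ∈ holomorphicOneForms X) {u : X → ℂ}
    (hu : C.IsTestSection ω u) : C.laplacian ω u = fun q => -C.dOmega ω (C.dbarOmega ω u) q := by
  ext p
  have hv := flatOp_dbarOmega.isTestSection hω hu
  by_cases hp : p ∈ zeros ω
  · rw [(flatOp_laplacian hω).zero (hu.eventually_zero hp),
      (flatOp_dOmega hω).zero (hv.eventually_zero hp), neg_zero]
  · obtain ⟨F, hpF, hF, -⟩ := exists_flat_frame (C := C) hω hp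
    refine F.eq_of_rep_eq (v := fun q => -C.dOmega ω (C.dbarOmega ω u) q) hpF ?_
    rw [rep_neg]
    beta_reduce
    rw [(flatOp_laplacian hω).rep_eq hF hpF (hu.smoothAt p),
      (flatOp_dOmega hω).rep_eq hF hpF (hv.smoothAt p),
      (flatOp_dbarOmega.rep_eventuallyEq hF hpF fun p _ => hu.smoothAt p).wirtD_eq]

/-- The second factorisation of Δ, with the order of ∂ and ∂̄ exchanged; it holds because the metric
is flat, so that the two derivatives commute in flat frames. -/
theorem laplacian_eq_dbarOmega_dOmega (hω : ω ∈ holomorphicOneForms X) {u : X → ℂ}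
    (hu : C.IsTestSection ω u) : C.laplacian ω u = fun q => -C.dbarOmega ω (C.dOmega ω u) q := by
  ext p
  have hv := (flatOp_dOmega hω).isTestSection hω hu
  by_cases hp : p ∈ zeros ω
  · rw [(flatOp_laplacian hω).zero (hu.eventually_zero hp),
      flatOp_dbarOmega.zero (hv.eventually_zero hp), neg_zero]
  · obtain ⟨F, hpF, hF, -⟩ := exists_flat_frame (C := C) hω hp
    refine F.eq_of_rep_eq (v := fun q => -C.dbarOmega ω (C.dOmega ω u) q) hpF ?_
    have h2 := (hu.smoothAt p F hpF).of_le (WithTop.coe_le_coe.2 (le_top : (2 : ℕ∞) ≤ ⊤))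
    rw [rep_neg]
    beta_reduce
    rw [(flatOp_laplacian hω).rep_eq hF hpF (hu.smoothAt p),
      flatOp_dbarOmega.rep_eq hF hpF (hv.smoothAt p),
      ((flatOp_dOmega hω).rep_eventuallyEq hF hpF fun p _ => hu.smoothAt p).wirtDbar_eq,
      wirtDbar_wirtD_comm h2]

/-! ### Test sections in `L²` -/

variable [MeasurableSpace X] [BorelSpace X] {u v : X → ℂ}

open scoped Classical in
theorem measurable_of_smoothAt (hu : ∀ p, C.SmoothAt u p) : Measurable u := by
  have h : u = fun p => ∑ i, (C.idx ⁻¹' {i}).indicator (fun p => C.rep u i (C.chart i p)) p := by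
    ext p
    rw [Finset.sum_eq_single (C.idx p)]
    · rw [Set.indicator_of_mem (show p ∈ C.idx ⁻¹' {C.idx p} from rfl)]
      have hp : p ∈ (C.chart (C.idx p)).source := mem_source_idx p
      have h4 := C.cocycle (C.idx p) (C.idx p) (C.idx p) p ⟨⟨hp, hp⟩, hp⟩
      have h5 : (C.chartFrame (C.idx p)).s (C.idx p) p ≠ 0 :=
        (C.chartFrame (C.idx p)).s_ne_zero hp hp
      rw [rep, (C.chart _).left_inv hp, mul_left_cancel₀ h5 (h4.trans (mul_one _).symm), one_mul]
    · intro i _ hi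
      exact Set.indicator_of_notMem (show p ∉ C.idx ⁻¹' {i} from
        fun h => hi (Set.mem_singleton_iff.1 h).symm) _
    · simp
  rw [h]
  refine Finset.measurable_fun_sum _ fun i _ => ?_
  rw [← Set.piecewise_eq_indicator]
  have h1 : ContinuousOn (fun p => C.rep u i (C.chart i p)) (C.chart i).source :=
    (((C.chartFrame i).contDiffOn_rep fun p _ => hu p).continuousOn).comp (C.chart i).continuousOn
      fun p hp => (C.chart i).map_source hp
  refine ContinuousOn.measurable_piecewise (h1.mono ?_) continuousOn_const
    (measurable_idx (MeasurableSet.singleton i))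
  rintro p rfl
  exact mem_source_idx p

theorem exists_nhds_lintegral_lt_top (hω : ω ∈ holomorphicOneForms X)
    (hu : ∀ p, C.SmoothAt u p) (p : X) :
    ∃ W ∈ 𝓝 p, ∫⁻ q in W, ‖u q‖ₑ ^ 2 ∂(C.hArea ω) < ∞ := by
  set F := C.chartFrame (C.idx p) with hF
  have hp : p ∈ F.ξ.source := mem_source_idx p
  have hpt := F.ξ.map_source hp
  have hc : ContinuousOn (fun z => ‖F.rep u z‖ ^ 2 * ‖F.f ω z‖) F.ξ.target :=
    (((F.contDiffOn_rep fun p _ => hu p).continuousOn).norm.pow 2).mul (F.continuousOn_f hω).norm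
  obtain ⟨K, hK, hpK, hKt⟩ := exists_compact_subset F.ξ.open_target hpt
  obtain ⟨M, hM⟩ := hK.exists_bound_of_continuousOn (hc.mono hKt)
  have hWo : IsOpen (F.ξ.source ∩ F.ξ ⁻¹' interior K) := F.ξ.isOpen_inter_preimage isOpen_interior
  refine ⟨_, hWo.mem_nhds ⟨hp, hpK⟩, ?_⟩
  set W := F.ξ.source ∩ F.ξ ⁻¹' interior K with hW
  have hum := measurable_of_smoothAt hu
  have h1 := F.lintegral_source hω
    ((hum.indicator hWo.measurableSet).aestronglyMeasurable (μ := C.hArea ω))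
  have h2 : ∫⁻ q in W, ‖u q‖ₑ ^ 2 ∂(C.hArea ω) =
      ∫⁻ q in F.ξ.source, ‖W.indicator u q‖ₑ ^ 2 ∂(C.hArea ω) := by
    rw [← lintegral_indicator hWo.measurableSet, ← lintegral_indicator F.ξ.open_source.measurableSet]
    refine lintegral_congr fun q => ?_
    by_cases hq : q ∈ W
    · rw [Set.indicator_of_mem hq, Set.indicator_of_mem hq.1, Set.indicator_of_mem hq]
    · by_cases hq' : q ∈ F.ξ.source
      · rw [Set.indicator_of_notMem hq, Set.indicator_of_mem hq', Set.indicator_of_notMem hq]; simp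
      · rw [Set.indicator_of_notMem hq, Set.indicator_of_notMem hq']
  rw [h2, h1]
  calc ∫⁻ z in F.ξ.target, ‖F.rep (W.indicator u) z‖ₑ ^ 2 * ‖F.f ω z‖ₑ
      ≤ ∫⁻ z, K.indicator (fun _ => ENNReal.ofReal M) z := by
        rw [← lintegral_indicator F.ξ.open_target.measurableSet]
        refine lintegral_mono fun z => ?_
        by_cases hz : z ∈ F.ξ.target
        · rw [Set.indicator_of_mem hz]
          by_cases hzW : F.ξ.symm z ∈ W
          · have hzK : z ∈ K := by
              have := hzW.2
              rw [Set.mem_preimage, F.ξ.right_inv hz] at this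
              exact interior_subset this
            rw [Set.indicator_of_mem hzK, Frame.rep, frameRep, Set.indicator_of_mem hzW]
            have h3 := hM z hzK
            rw [Real.norm_of_nonneg (by positivity)] at h3
            refine le_trans (le_of_eq ?_) (ENNReal.ofReal_le_ofReal h3)
            rw [ENNReal.ofReal_mul (by positivity), ENNReal.ofReal_pow (norm_nonneg _), ofReal_norm,
              ofReal_norm]
            rfl
          · rw [Frame.rep, frameRep, Set.indicator_of_notMem hzW]; simp
        · rw [Set.indicator_of_notMem hz]; exact zero_le
    _ < ∞ := by
        rw [lintegral_indicator hK.measurableSet, setLIntegral_const]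
        exact ENNReal.mul_lt_top ENNReal.ofReal_lt_top hK.measure_lt_top

theorem memLp_of_smoothAt [CompactSpace X] (hω : ω ∈ holomorphicOneForms X)
    (hu : ∀ p, C.SmoothAt u p) : MemLp u 2 (C.hArea ω) := by
  refine ⟨(measurable_of_smoothAt hu).aestronglyMeasurable, ?_⟩
  rw [eLpNorm_lt_top_iff_lintegral_rpow_enorm_lt_top (by norm_num) (by norm_num)]
  have h1 : ∫⁻ q in Set.univ, ‖u q‖ₑ ^ 2 ∂(C.hArea ω) < ∞ := by
    refine isCompact_univ.induction_on (p := fun s => ∫⁻ q in s, ‖u q‖ₑ ^ 2 ∂(C.hArea ω) < ∞)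
      (by simp) (fun s t hst ht => (lintegral_mono_set hst).trans_lt ht)
      (fun s t hs ht => (lintegral_union_le _ _ _).trans_lt (ENNReal.add_lt_top.2 ⟨hs, ht⟩))
      fun p _ => ?_
    obtain ⟨W, hW, h⟩ := exists_nhds_lintegral_lt_top hω hu p
    exact ⟨W, mem_nhdsWithin_of_mem_nhds hW, h⟩
  simpa using h1

variable (C ω) in
/-- The scalar product `∫ ū v h dS`. -/
def ip (u v : X → ℂ) : ℂ := ∫ p, conj (u p) * v p ∂(C.hArea ω)

theorem inner_eq_ip {x y : C.L2 ω} (hx : x =ᵐ[C.hArea ω] u) (hy : y =ᵐ[C.hArea ω] v) :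
    inner ℂ x y = C.ip ω u v := by
  rw [L2.inner_def]
  refine integral_congr_ae ?_
  filter_upwards [hx, hy] with p h1 h2
  rw [h1, h2, RCLike.inner_apply, mul_comm]

theorem integrable_conj_mul {u v : X → ℂ} (hu : MemLp u 2 (C.hArea ω)) (hv : MemLp v 2 (C.hArea ω)) :
    Integrable (fun p => conj (u p) * v p) (C.hArea ω) := by
  have h1 : MemLp (fun p => conj (u p)) 2 (C.hArea ω) := hu.star
  exact h1.integrable_mul hv

theorem ip_add_right {v' : X → ℂ} (hu : MemLp u 2 (C.hArea ω)) (hv : MemLp v 2 (C.hArea ω))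
    (hv' : MemLp v' 2 (C.hArea ω)) :
    C.ip ω u (fun q => v q + v' q) = C.ip ω u v + C.ip ω u v' := by
  rw [ip, ip, ip, ← integral_add (integrable_conj_mul hu hv) (integrable_conj_mul hu hv')]
  simp only [mul_add]

theorem ip_neg_right : C.ip ω u (fun q => -v q) = -C.ip ω u v := by
  rw [ip, ip, ← integral_neg]
  congr 1; ext p; ring

theorem conj_ip : conj (C.ip ω u v) = C.ip ω v u := by
  rw [ip, ip, ← integral_conj]
  congr 1; ext p; simp [mul_comm]

theorem Frame.ip_eq (F : C.Frame) (hω : ω ∈ holomorphicOneForms X)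
    (hu : AEStronglyMeasurable u (C.hArea ω)) (hv : AEStronglyMeasurable v (C.hArea ω))
    (hs : ∀ p ∉ F.ξ.source, v p = 0) : C.ip ω u v =
      ∫ z in F.ξ.target, conj (F.rep u z) * F.rep v z * ((‖F.f ω z‖ : ℝ) : ℂ) := by
  rw [← F.integral_source hω hu hv, ip]
  refine (setIntegral_eq_integral_of_forall_compl_eq_zero fun p hp => ?_).symm
  rw [hs p hp, mul_zero]

theorem Frame.IsFlat.ip_eq {F : C.Frame} (hF : F.IsFlat ω) (hω : ω ∈ holomorphicOneForms X)
    (hu : AEStronglyMeasurable u (C.hArea ω)) (hv : AEStronglyMeasurable v (C.hArea ω))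
    (hs : ∀ p ∉ F.ξ.source, v p = 0) : C.ip ω u v =
      ∫ z in F.ξ.target, conj (F.rep u z) * F.rep v z := by
  rw [F.ip_eq hω hu hv hs]
  refine setIntegral_congr_fun F.ξ.open_target.measurableSet fun z hz => ?_
  simp only [hF z hz, norm_one, Complex.ofReal_one, mul_one]

theorem Frame.IsFlat.ip_ofFun {F : C.Frame} (hF : F.IsFlat ω) (hω : ω ∈ holomorphicOneForms X)
    (hu : AEStronglyMeasurable u (C.hArea ω)) {g : ℂ → ℂ} (hg : Measurable g)
    (hgs : tsupport g ⊆ F.ξ.target) : C.ip ω u (F.ofFun g) = ∫ z, conj (F.rep u z) * g z := by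
  rw [hF.ip_eq hω hu (F.measurable_ofFun hg).aestronglyMeasurable
    (fun p hp => by rw [Frame.ofFun, if_neg hp])]
  refine Eq.trans (b := ∫ z in F.ξ.target, conj (F.rep u z) * g z) ?_ ?_
  · refine setIntegral_congr_fun F.ξ.open_target.measurableSet fun z hz => ?_
    simp only [F.rep_ofFun g hz]
  · refine setIntegral_eq_integral_of_forall_compl_eq_zero fun z hz => ?_
    rw [image_eq_zero_of_notMem_tsupport fun h => hz (hgs h), mul_zero]

variable [T2Space X] [CompactSpace X]

theorem IsTestSection.memLp (hω : ω ∈ holomorphicOneForms X) (hu : C.IsTestSection ω u) :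
    MemLp u 2 (C.hArea ω) := memLp_of_smoothAt hω hu.smoothAt

theorem FlatOp.ofFun_eq {A : (X → ℂ) → X → ℂ} {B : (ℂ → ℂ) → ℂ → ℂ} (hA : C.FlatOp ω A B)
    {F : C.Frame} (hF : F.IsFlat ω) {g : ℂ → ℂ}
    (hg : ContDiff ℝ infty g) (hgc : HasCompactSupport g) (hgs : tsupport g ⊆ F.ξ.target) :
    A (F.ofFun g) = F.ofFun (B g) := by
  ext p
  by_cases hp : p ∈ F.ξ.source
  · refine F.eq_of_rep_eq hp ?_
    rw [hA.rep_eq hF hp (F.smoothAt_ofFun' hgc hgs fun _ => hg.contDiffAt),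
      F.rep_ofFun _ (F.ξ.map_source hp)]
    refine hA.congr ?_
    filter_upwards [F.ξ.open_target.mem_nhds (F.ξ.map_source hp)] with z hz
    exact F.rep_ofFun g hz
  · rw [Frame.ofFun, if_neg hp]
    exact hA.zero (F.ofFun_eventuallyEq_zero hgc hgs fun h => hp (F.image_symm_subset hgs h))

/-- Integration by parts. Both sides are additive in v, so v may be supported in one flat disc,
where no boundary term arises; u need only be smooth there. -/
theorem ip_dbarOmega (hω : ω ∈ holomorphicOneForms X) (hu : C.IsTestSection ω u)
    (hv : C.IsTestSection ω v) :
    C.ip ω (C.dbarOmega ω u) v = -C.ip ω u (C.dOmega ω v) := by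
  have hDu := flatOp_dbarOmega.isTestSection hω hu
  refine hv.induction (P := fun v => C.ip ω (C.dbarOmega ω u) v = -C.ip ω u (C.dOmega ω v)) ?_ ?_ ?_
  · have : C.dOmega ω (fun _ => 0) = fun _ => 0 := by
      ext p; exact (flatOp_dOmega hω).zero EventuallyEq.rfl
    rw [this]; simp [ip]
  · intro v w hv hw h1 h2
    rw [ip_add_right (hDu.memLp hω) (hv.memLp hω) (hw.memLp hω), h1, h2,
      (flatOp_dOmega hω).add_test hω hv hw,
      ip_add_right (hu.memLp hω) (((flatOp_dOmega hω).isTestSection hω hv).memLp hω)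
      (((flatOp_dOmega hω).isTestSection hω hw).memLp hω), neg_add]
  · intro p hp
    obtain ⟨F, hpF, hF, -⟩ := exists_flat_frame (C := C) hω hp
    refine ⟨F.ξ.source, F.ξ.open_source.mem_nhds hpF, fun v hv hvs => ?_⟩
    obtain ⟨g, hg, hgc, hgs, rfl, -⟩ := F.exists_eq_ofFun hv.smoothAt hvs
    have hgs' : tsupport g ⊆ F.ξ.target := hgs.trans (by
      rintro _ ⟨q, hq, rfl⟩; exact F.ξ.map_source (hvs hq))
    have hdg : ContDiff ℝ infty (wirtD g) :=
      contDiff_iff_contDiffAt.2 fun z => hg.contDiffAt.wirtD_infty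
    have hdgs : tsupport (wirtD g) ⊆ tsupport g := by
      refine closure_minimal (fun z hz => ?_) (isClosed_tsupport g)
      by_contra h
      have h1 : g =ᶠ[𝓝 z] fun _ => 0 := notMem_tsupport_iff_eventuallyEq.1 h
      exact hz (by rw [h1.wirtD_eq, wirtD_const])
    rw [(flatOp_dOmega hω).ofFun_eq hF hg hgc hgs',
      hF.ip_ofFun hω (hDu.memLp hω).1 hg.continuous.measurable hgs',
      hF.ip_ofFun hω (hu.memLp hω).1 hdg.continuous.measurable (hdgs.trans hgs')]
    have hgcj : ContDiff ℝ infty fun z => conj (g z) := Complex.conjCLE.contDiff.comp hg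
    have hsupp : tsupport (fun z => conj (g z)) = tsupport g := by
      rw [tsupport, tsupport]; congr 1; ext z; simp
    have h2 := integral_mul_wirtDbar_of_contDiffOn F.ξ.open_target hgcj
      (by rw [HasCompactSupport, hsupp]; exact hgc) (hsupp ▸ hgs')
      (F.contDiffOn_rep fun p _ => hu.smoothAt p)
    have h3 := congrArg conj h2
    rw [map_neg, ← integral_conj, ← integral_conj] at h3
    refine Eq.trans (integral_congr_ae (ae_of_all _ fun z => ?_)) (h3.trans (congrArg Neg.neg
      (integral_congr_ae (ae_of_all _ fun z => ?_))))
    · by_cases hz : z ∈ F.ξ.target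
      · have h4 := flatOp_dbarOmega.rep_eq hF (F.ξ.map_target hz) (hu.smoothAt _)
        rw [F.ξ.right_inv hz] at h4
        simp only [h4, map_mul, Complex.conj_conj, mul_comm]
      · simp only [image_eq_zero_of_notMem_tsupport fun h => hz (hgs' h)]; simp
    · simp only [wirtDbar_conj (differentiableAt_of_contDiffAt_infty hg.contDiffAt), map_mul,
        Complex.conj_conj, mul_comm]

end SpinBundle

end RiemannSurface

end

noncomputable section

set_option linter.unusedSectionVars false

namespace RiemannSurface

namespace SpinBundle

local notation "conj" => starRingEnd ℂ
local notation "infty" => ((⊤ : ℕ∞) : WithTop ℕ∞)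

variable {X : Type*} [TopologicalSpace X] [ChartedSpace ℂ X] {C : SpinBundle X}
  {ω : ∀ p : X, TangentSpace 𝓘(ℂ) p →L[ℂ] ℂ} [IsManifold 𝓘(ℂ) 1 X]
  [MeasurableSpace X] [BorelSpace X] {u v : X → ℂ}
  (hω : ω ∈ holomorphicOneForms X) (hz : (zeros ω).Finite)

/-! ### Almost everywhere statements on the surface -/

include hω in
theorem hArea_singleton (p : X) : C.hArea ω {p} = 0 := by
  set F := C.chartFrame (C.idx p) with hF
  have hp : p ∈ F.ξ.source := mem_source_idx p
  have h1 : ∀ᵐ z, z ∈ F.ξ.target → F.ξ.symm z ≠ p := by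
    filter_upwards [(Set.countable_singleton (F.ξ p)).ae_notMem volume] with z hz1 hz2 h3
    exact hz1 (by rw [← h3, F.ξ.right_inv hz2]; rfl)
  refine measure_mono_null ?_ (F.ae_of_ae_target (P := fun q => q ≠ p) hω h1)
  intro q hq
  rw [Set.mem_singleton_iff.1 hq]
  simp [hp]

include hω hz in
theorem ae_notMem_zeros [T2Space X] : ∀ᵐ p ∂(C.hArea ω), p ∉ zeros ω := by
  rw [← Set.biUnion_of_singleton (zeros ω)]
  exact measure_eq_zero_iff_ae_notMem.1 ((measure_biUnion_null_iff hz.countable).2 fun p _ => hArea_singleton hω p)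

include hω hz in
theorem ae_of_locally [T2Space X] [CompactSpace X] {P : X → Prop}
    (h : ∀ p ∉ zeros ω, ∃ U ∈ 𝓝 p, ∀ᵐ q ∂(C.hArea ω), q ∈ U → P q) :
    ∀ᵐ q ∂(C.hArea ω), P q := by
  have : SecondCountableTopology X := ChartedSpace.secondCountable_of_sigmaCompact ℂ X
  have h1 : C.hArea ω {q | ¬ (q ∉ zeros ω → P q)} = 0 := by
    refine measure_null_of_locally_null _ fun p hp => ?_
    have hp0 : p ∉ zeros ω := fun h0 => hp fun h1 => absurd h0 h1
    obtain ⟨U, hU, hUP⟩ := h p hp0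
    refine ⟨_, inter_mem_nhdsWithin _ hU, measure_mono_null ?_ hUP⟩
    rintro q ⟨hq1, hq2⟩ h3
    exact hq1 fun _ => h3 hq2
  filter_upwards [ae_notMem_zeros hω hz, show ∀ᵐ q ∂(C.hArea ω), q ∉ zeros ω → P q from h1] with q h2 h3
  exact h3 h2

include hω hz in
theorem Frame.IsFlat.memLp_rep {F : C.Frame} (hF : F.IsFlat ω) (hu : MemLp u 2 (C.hArea ω)) :
    MemLp (F.rep u) 2 ((volume : Measure ℂ).restrict F.ξ.target) := by
  refine ⟨F.aestronglyMeasurable_rep hω hz hu.1, ?_⟩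
  rw [eLpNorm_lt_top_iff_lintegral_rpow_enorm_lt_top (by norm_num) (by norm_num)]
  have h1 := hu.2
  rw [eLpNorm_lt_top_iff_lintegral_rpow_enorm_lt_top (by norm_num) (by norm_num)] at h1
  simp only [ENNReal.toReal_ofNat, ENNReal.rpow_ofNat] at h1 ⊢
  have h2 := F.lintegral_source hω hu.1
  have h3 : ∫⁻ z in F.ξ.target, ‖F.rep u z‖ₑ ^ 2 * ‖F.f ω z‖ₑ =
      ∫⁻ z in F.ξ.target, ‖F.rep u z‖ₑ ^ 2 := by
    refine setLIntegral_congr_fun F.ξ.open_target.measurableSet fun z hz => ?_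
    simp only [hF z hz, enorm_one, mul_one]
  rw [← h3, ← h2]
  exact (setLIntegral_le_lintegral _ _).trans_lt h1

variable [T2Space X] [CompactSpace X]

include hω hz in
-- The fundamental lemma of the calculus of variations, applied in flat discs; these cover
-- everything but the finitely many zeros, a null set.
theorem eq_zero_of_ip_eq_zero (hu : MemLp u 2 (C.hArea ω))
    (h : ∀ v, C.IsTestSection ω v → C.ip ω u v = 0) : u =ᵐ[C.hArea ω] 0 := by
  refine ae_of_locally hω hz fun p hp => ?_
  obtain ⟨F, hpF, hF, -⟩ := exists_flat_frame (C := C) hω hp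
  refine ⟨F.ξ.source, F.ξ.open_source.mem_nhds hpF, ?_⟩
  have hfz : ∀ z ∈ F.ξ.target, F.f ω z ≠ 0 := fun z hz => by rw [hF z hz]; exact one_ne_zero
  have h1 : ∀ᵐ z, z ∈ F.ξ.target → conj (F.rep u z) = 0 := by
    have hm : MemLp (fun z => conj (F.rep u z)) 2 (volume.restrict F.ξ.target) :=
      (hF.memLp_rep hω hz hu).star
    refine F.ξ.open_target.ae_eq_zero_of_integral_contDiff_smul_eq_zero
      (locallyIntegrableOn_of_locallyIntegrable_restrict (hm.locallyIntegrable (by norm_num))) ?_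
    intro g hg hgc hgs
    have hgd : ContDiff ℝ infty fun z => (g z : ℂ) := Complex.ofRealCLM.contDiff.comp hg
    have hts : tsupport (fun z => (g z : ℂ)) = tsupport g := by
      rw [tsupport, tsupport]; congr 1; ext z; simp
    have h2 := h _ (F.isTestSection_ofFun (ω := ω) hgd (by rw [HasCompactSupport, hts]; exact hgc)
      (hts ▸ hgs) fun z hz => hfz z (hgs (hts ▸ hz)))
    rw [hF.ip_ofFun hω hu.1 hgd.continuous.measurable (hts ▸ hgs)] at h2
    rw [← h2]
    refine integral_congr_ae (ae_of_all _ fun z => ?_)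
    simp only [Complex.real_smul, mul_comm]
  refine F.ae_of_ae_target hω ?_
  filter_upwards [h1] with z h2 h3
  have h4 : F.rep u z = 0 := by simpa using h2 h3
  have h5 := F.rep_ne_zero_iff (u := u) (F.ξ.map_target h3)
  rw [F.ξ.right_inv h3] at h5
  exact h5.1 h4

include hω hz in
theorem IsTestSection.eq_zero_of_ae (hu : C.IsTestSection ω u) (h : u =ᵐ[C.hArea ω] 0) :
    u = fun _ => 0 := by
  ext p
  by_cases hp : p ∈ zeros ω
  · exact (hu.eventually_zero hp).self_of_nhds
  obtain ⟨F, hpF, hF, -⟩ := exists_flat_frame (C := C) hω hp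
  have h1 := F.ae_target_of_ae hω hz (h.mono fun q hq _ => hq)
  have h2 : F.rep u =ᵐ[volume.restrict F.ξ.target] fun _ => 0 := by
    rw [EventuallyEq, ae_restrict_iff' F.ξ.open_target.measurableSet]
    filter_upwards [h1] with z hz1 hz2
    have h3 : u (F.ξ.symm z) = 0 := hz1 hz2
    rw [Frame.rep, frameRep, h3, mul_zero]
  have h3 := Measure.eqOn_open_of_ae_eq h2 F.ξ.open_target
    (F.contDiffOn_rep fun p _ => hu.smoothAt p).continuousOn continuousOn_const
  exact (F.rep_ne_zero_iff hpF).1 (h3 (F.ξ.map_source hpF))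

/-! ### The minimal operators -/

section Graph

variable {A : (X → ℂ) → X → ℂ} {B : (ℂ → ℂ) → ℂ → ℂ} (hA : C.FlatOp ω A B)

include hω in
/-- The class of a test section in `L²`. -/
theorem IsTestSection.exists_toLp (hu : C.IsTestSection ω u) : ∃ x : C.L2 ω, x =ᵐ[C.hArea ω] u :=
  ⟨(hu.memLp hω).toLp u, (hu.memLp hω).coeFn_toLp⟩

include hω hz hA in
-- The pairs already form a subspace, so no span is needed. They form a graph because a smooth
-- section which vanishes almost everywhere vanishes identically, and A maps it to 0.
theorem mem_graph_testOperator {x y : C.L2 ω} : (x, y) ∈ (C.testOperator ω A).graph ↔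
    ∃ u, C.IsTestSection ω u ∧ x =ᵐ[C.hArea ω] u ∧ y =ᵐ[C.hArea ω] A u := by
  set S : Submodule ℂ (C.L2 ω × C.L2 ω) :=
    { carrier := {q | ∃ u : X → ℂ, C.IsTestSection ω u ∧
        q.1 =ᵐ[C.hArea ω] u ∧ q.2 =ᵐ[C.hArea ω] A u}
      zero_mem' := by
        refine ⟨fun _ => 0, isTestSection_zero, Lp.coeFn_zero _ _ _, ?_⟩
        have : A (fun _ => 0) = 0 := by ext p; exact hA.zero EventuallyEq.rfl
        rw [this]; exact Lp.coeFn_zero _ _ _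
      add_mem' := by
        rintro a b ⟨u, hu, h1, h2⟩ ⟨v, hv, h3, h4⟩
        refine ⟨_, hu.add hv, (Lp.coeFn_add _ _).trans (h1.add h3), ?_⟩
        rw [hA.add_test hω hu hv]
        exact (Lp.coeFn_add _ _).trans (h2.add h4)
      smul_mem' := by
        rintro c a ⟨u, hu, h1, h2⟩
        refine ⟨_, hu.const_mul c, (Lp.coeFn_smul _ _).trans (h1.const_smul c), ?_⟩
        rw [hA.const_mul_test hω c hu]
        exact (Lp.coeFn_smul _ _).trans (h2.const_smul c) } with hS
  have h1 : Submodule.span ℂ {q : C.L2 ω × C.L2 ω | ∃ u : X → ℂ, C.IsTestSection ω u ∧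
      q.1 =ᵐ[C.hArea ω] u ∧ q.2 =ᵐ[C.hArea ω] A u} = S := Submodule.span_eq S
  rw [testOperator, h1, Submodule.toLinearPMap_graph_eq]
  · rfl
  · rintro ⟨a, b⟩ ⟨u, hu, h2, h3⟩ h4
    simp only at h4 h2 h3 ⊢
    rw [h4] at h2
    have h5 := hu.eq_zero_of_ae hω hz (h2.symm.trans (Lp.coeFn_zero _ _ _))
    have h6 : A u = 0 := by ext p; rw [h5]; exact hA.zero EventuallyEq.rfl
    rw [h6] at h3
    exact Lp.ext (h3.trans (Lp.coeFn_zero _ _ _).symm)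

include hω hz hA in
theorem mem_domain_testOperator {x : C.L2 ω} : x ∈ (C.testOperator ω A).domain ↔
    ∃ u, C.IsTestSection ω u ∧ x =ᵐ[C.hArea ω] u := by
  rw [UnboundedOp.mem_domain_iff_graph]
  simp only [mem_graph_testOperator hω hz hA]
  constructor
  · rintro ⟨t, u, hu, h1, -⟩; exact ⟨u, hu, h1⟩
  · rintro ⟨u, hu, h1⟩
    obtain ⟨t, ht⟩ := (hA.isTestSection hω hu).exists_toLp hω
    exact ⟨t, u, hu, h1, ht⟩

include hω hz hA in
theorem dense_testOperator : Dense ((C.testOperator ω A).domain : Set (C.L2 ω)) := by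
  rw [Submodule.dense_iff_topologicalClosure_eq_top, Submodule.topologicalClosure_eq_top_iff,
    Submodule.eq_bot_iff]
  intro x hx
  have h1 : x =ᵐ[C.hArea ω] 0 := by
    refine eq_zero_of_ip_eq_zero hω hz (Lp.memLp x) fun v hv => ?_
    obtain ⟨y, hy⟩ := hv.exists_toLp hω
    rw [← inner_eq_ip EventuallyEq.rfl hy]
    exact inner_eq_zero_symm.1 ((Submodule.mem_orthogonal _ _).1 hx y
      ((mem_domain_testOperator hω hz hA).2 ⟨v, hv, hy⟩))
  exact Lp.ext (h1.trans (Lp.coeFn_zero _ _ _).symm)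

include hω hz hA in
theorem mem_graph_adjoint_testOperator {x y : C.L2 ω} :
    (x, y) ∈ (C.testOperator ω A).adjoint.graph ↔
      ∀ u, C.IsTestSection ω u → C.ip ω (A u) x = C.ip ω u y := by
  rw [UnboundedOp.mem_graph_adjoint_iff (dense_testOperator hω hz hA)]
  constructor
  · intro h u hu
    obtain ⟨a, ha⟩ := hu.exists_toLp hω
    obtain ⟨b, hb⟩ := (hA.isTestSection hω hu).exists_toLp hω
    have h1 := h ((mem_graph_testOperator hω hz hA).2 ⟨u, hu, ha, hb⟩)
    rwa [inner_eq_ip hb EventuallyEq.rfl, inner_eq_ip ha EventuallyEq.rfl] at h1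
  · intro h a b hab
    obtain ⟨u, hu, ha, hb⟩ := (mem_graph_testOperator hω hz hA).1 hab
    rw [inner_eq_ip hb EventuallyEq.rfl, inner_eq_ip ha EventuallyEq.rfl]
    exact h u hu

end Graph

include hω in
theorem ip_laplacian (hu : C.IsTestSection ω u) (hv : C.IsTestSection ω v) :
    C.ip ω u (C.laplacian ω v) = C.ip ω (C.dbarOmega ω u) (C.dbarOmega ω v) := by
  rw [laplacian_eq_dOmega_dbarOmega hω hv, ip_neg_right,
    ip_dbarOmega hω hu (flatOp_dbarOmega.isTestSection hω hv)]

include hω in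
theorem ip_laplacian' (hu : C.IsTestSection ω u) (hv : C.IsTestSection ω v) :
    C.ip ω u (C.laplacian ω v) = C.ip ω (C.dOmega ω u) (C.dOmega ω v) := by
  have h1 := ip_dbarOmega hω ((flatOp_dOmega hω).isTestSection hω hv) hu
  rw [laplacian_eq_dbarOmega_dOmega hω hv, ip_neg_right, ← conj_ip, h1, map_neg, neg_neg, conj_ip]

include hω hz in
-- By parts, D is contained in the adjoint of minus the ∂-operator, and an adjoint is closed.
theorem closable_dbarOmega : (C.testOperator ω (C.dbarOmega ω)).IsClosable := by
  set D := C.testOperator ω (C.dOmega ω) with hD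
  have hd : Dense (D.domain : Set (C.L2 ω)) := dense_testOperator hω hz (flatOp_dOmega hω)
  have hd' : Dense ((-D).domain : Set (C.L2 ω)) := hd
  refine (LinearPMap.adjoint_isClosed hd').isClosable.leIsClosable ?_
  refine LinearPMap.IsFormalAdjoint.le_adjoint hd' fun y x => ?_
  obtain ⟨u, hu, h1, h2⟩ := (mem_graph_testOperator hω hz flatOp_dbarOmega).1
    (LinearPMap.mem_graph _ x)
  obtain ⟨v, hv, h3, h4⟩ := (mem_graph_testOperator hω hz (flatOp_dOmega hω)).1
    (LinearPMap.mem_graph D y)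
  have h5 : (-D) y = -(D y) := rfl
  rw [h5, inner_neg_left, inner_eq_ip h4 h1, inner_eq_ip h3 h2, ← conj_ip (u := u),
    ← conj_ip (u := C.dbarOmega ω u), ip_dbarOmega hω hu hv, map_neg]

end SpinBundle

end RiemannSurface

end

noncomputable section

set_option linter.unusedSectionVars false

/-! ### Integral inequalities along flows -/

theorem sq_lintegral_le {α : Type*} [MeasurableSpace α] (μ : Measure α) {g : α → ℝ≥0∞}
    (hg : AEMeasurable g μ) : (∫⁻ a, g a ∂μ) ^ 2 ≤ μ Set.univ * ∫⁻ a, g a ^ 2 ∂μ := by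
  have h := ENNReal.lintegral_mul_le_Lp_mul_Lq μ (p := 2) (q := 2)
    (Real.holderConjugate_iff.2 ⟨by norm_num, by norm_num⟩) (f := fun _ => 1) aemeasurable_const hg
  have h2 := pow_le_pow_left₀ zero_le h 2
  rw [mul_pow, ← ENNReal.rpow_mul_natCast, ← ENNReal.rpow_mul_natCast] at h2
  simpa using h2

/-- Cauchy–Schwarz in the time variable followed by Fubini: a function dominated by an integral of w
along orbits of length T has L² norm at most T times that of w, provided the flow does not increase
the integral of w². -/
theorem lintegral_sq_le_of_flow {ν : Measure ℂ} [SFinite ν] {φ : ℝ → ℂ → ℂ}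
    (hφ : Measurable (Function.uncurry φ)) {T : ℝ} {w G : ℂ → ℝ≥0∞}
    (hw : Measurable w) {A B : Set ℂ} (hA : MeasurableSet A)
    (hG : ∀ x ∈ A, G x ≤ ∫⁻ s in Set.Icc (0 : ℝ) T, w (φ s x))
    (hAB : ∀ s : ℝ, s ∈ Set.Icc 0 T → ∫⁻ x in A, w (φ s x) ^ 2 ∂ν ≤ ∫⁻ x in B, w x ^ 2 ∂ν) :
    ∫⁻ x in A, G x ^ 2 ∂ν ≤ ENNReal.ofReal T ^ 2 * ∫⁻ x in B, w x ^ 2 ∂ν := by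
  have hm : Measurable (Function.uncurry fun (x : ℂ) (s : ℝ) => w (φ s x) ^ 2) :=
    ((hw.comp (hφ.comp measurable_swap)).pow_const 2)
  have hvol : (volume.restrict (Set.Icc 0 T)) Set.univ = ENNReal.ofReal T := by simp
  calc ∫⁻ x in A, G x ^ 2 ∂ν
      ≤ ∫⁻ x in A, (ENNReal.ofReal T * ∫⁻ s in Set.Icc (0 : ℝ) T, w (φ s x) ^ 2) ∂ν := by
        refine setLIntegral_mono' hA fun x hx => ?_
        have h1 := sq_lintegral_le (volume.restrict (Set.Icc 0 T)) (g := fun s => w (φ s x))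
          (hw.comp (hφ.comp measurable_prodMk_right)).aemeasurable
        rw [hvol] at h1
        exact (pow_le_pow_left₀ zero_le (hG x hx) 2).trans h1
    _ = ENNReal.ofReal T * ∫⁻ s in Set.Icc (0 : ℝ) T, ∫⁻ x in A, w (φ s x) ^ 2 ∂ν := by
        have h1 : Measurable fun x => ∫⁻ s in Set.Icc (0 : ℝ) T, w (φ s x) ^ 2 :=
          hm.lintegral_prod_right'
        rw [lintegral_const_mul _ h1, lintegral_lintegral_swap hm.aemeasurable]
    _ ≤ ENNReal.ofReal T * ∫⁻ s in Set.Icc (0 : ℝ) T, ∫⁻ x in B, w x ^ 2 ∂ν := by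
        refine mul_le_mul_right ?_ _
        exact setLIntegral_mono' measurableSet_Icc hAB
    _ = ENNReal.ofReal T ^ 2 * ∫⁻ x in B, w x ^ 2 ∂ν := by
        rw [lintegral_const, hvol]; ring

theorem enorm_sub_le_lintegral {γ γ' : ℝ → ℂ} {a b : ℝ} (hab : a ≤ b)
    (h : ∀ s, HasDerivAt γ (γ' s) s) (hc : Continuous γ') :
    ‖γ b - γ a‖ₑ ≤ ∫⁻ s in Set.Icc a b, ‖γ' s‖ₑ := by
  rw [← intervalIntegral.integral_eq_sub_of_hasDerivAt (fun s _ => h s) (hc.intervalIntegrable _ _),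
    intervalIntegral.integral_of_le hab]
  exact (enorm_integral_le_lintegral_enorm _).trans (lintegral_mono_set Set.Ioc_subset_Icc_self)

section Planar

variable {U : ℂ → ℂ} (hU : ContDiff ℝ ((⊤ : ℕ∞) : WithTop ℕ∞) U)
include hU

theorem continuous_wirtD : Continuous (wirtD U) :=
  continuous_iff_continuousAt.2 fun _ => hU.contDiffAt.wirtD_infty.continuousAt

theorem continuous_wirtDbar : Continuous (wirtDbar U) :=
  continuous_iff_continuousAt.2 fun _ => hU.contDiffAt.wirtDbar_infty.continuousAt

theorem hasFDerivAt_of_smooth (z : ℂ) : HasFDerivAt U (fderiv ℝ U z) z :=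
  (hU.contDiffAt.differentiableAt (by simp)).hasFDerivAt

theorem hasDerivAt_comp_curve {γ : ℝ → ℂ} {v : ℂ} {s : ℝ} (hγ : HasDerivAt γ v s) :
    HasDerivAt (fun s => U (γ s)) (wirtD U (γ s) * v + wirtDbar U (γ s) * starRingEnd ℂ v) s := by
  rw [← fderiv_eq_wirt]
  exact (hasFDerivAt_of_smooth hU (γ s)).comp_hasDerivAt s hγ

theorem lintegral_translate_le {h : ℂ} {A B : Set ℂ} (hA : MeasurableSet A) (hB : MeasurableSet B)
    (hAB : ∀ z ∈ A, ∀ s ∈ Set.Icc (0 : ℝ) 1, z + s * h ∈ B) :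
    ∫⁻ z in A, ‖U (z + h) - U z‖ₑ ^ 2 ≤
      ∫⁻ z in B, (‖wirtD U z‖ₑ * ‖h‖ₑ + ‖wirtDbar U z‖ₑ * ‖h‖ₑ) ^ 2 := by
  have hw : Measurable fun z => ‖wirtD U z‖ₑ * ‖h‖ₑ + ‖wirtDbar U z‖ₑ * ‖h‖ₑ :=
    ((continuous_wirtD hU).measurable.enorm.mul_const _).add
      ((continuous_wirtDbar hU).measurable.enorm.mul_const _)
  have := lintegral_sq_le_of_flow (ν := volume) (φ := fun s z => z + s * h) (T := 1)
    (by fun_prop) hw (G := fun z => ‖U (z + h) - U z‖ₑ) (A := A) (B := B) hA ?_ ?_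
  · simpa using this
  · intro z _
    have hγ : ∀ s : ℝ, HasDerivAt (fun s : ℝ => z + s * h) h s := fun s => by
      simpa using ((Complex.ofRealCLM.hasDerivAt (x := s)).mul_const h).const_add z
    have h1 := enorm_sub_le_lintegral zero_le_one (fun s => hasDerivAt_comp_curve hU (hγ s))
      (by
        have h2 := continuous_wirtD hU
        have h3 := continuous_wirtDbar hU
        fun_prop)
    simp only [Complex.ofReal_one, one_mul, Complex.ofReal_zero, zero_mul, add_zero] at h1
    refine h1.trans (lintegral_mono fun s => ?_)
    refine (enorm_add_le _ _).trans ?_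
    rw [enorm_mul, enorm_mul, RCLike.enorm_conj]
  · intro s hs
    have h1 : ∀ z, A.indicator (fun z => (‖wirtD U (z + s * h)‖ₑ * ‖h‖ₑ +
        ‖wirtDbar U (z + s * h)‖ₑ * ‖h‖ₑ) ^ 2) z ≤
        (fun z => B.indicator (fun z => (‖wirtD U z‖ₑ * ‖h‖ₑ + ‖wirtDbar U z‖ₑ * ‖h‖ₑ) ^ 2) z)
          (z + s * h) := fun z => by
      by_cases hz : z ∈ A
      · simp only [Set.indicator_of_mem hz, Set.indicator_of_mem (hAB z hz s hs), le_refl]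
      · rw [Set.indicator_of_notMem hz]; exact zero_le
    rw [← lintegral_indicator hA, ← lintegral_indicator hB]
    exact (lintegral_mono h1).trans (le_of_eq (lintegral_add_right_eq_self _ _))

/-- The generator of the rotations of half-forms. -/
def rotGen (U : ℂ → ℂ) (x : ℂ) : ℂ :=
  x * wirtD U x - starRingEnd ℂ x * wirtDbar U x - U x / 2

/-- Along the circle through x, the function e^{-is/2} U(e^{is}x) has derivative of modulus |rotGen
U| and changes sign after a full turn. The total variation is thus at least 2|U(x)|: antiperiodicity
excludes a constant mode. -/
theorem enorm_le_lintegral_rotGen (x : ℂ) :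
    ‖U x‖ₑ ≤ ∫⁻ s in Set.Icc (0 : ℝ) (2 * Real.pi), ‖rotGen U (Complex.exp (s * Complex.I) * x)‖ₑ := by
  set γ : ℝ → ℂ := fun s => Complex.exp (s * Complex.I) * x with hγd
  have hlin : ∀ s : ℝ, HasDerivAt (fun s : ℝ => (s : ℂ) * Complex.I) Complex.I s := fun s => by
    simpa using (Complex.ofRealCLM.hasDerivAt (x := s)).mul_const Complex.I
  have hγ : ∀ s, HasDerivAt γ (Complex.I * γ s) s := fun s => by
    refine ((hlin s).cexp.mul_const x).congr_deriv ?_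
    simp only [hγd]; ring
  have he : ∀ s : ℝ, HasDerivAt (fun s : ℝ => Complex.exp (-(s * Complex.I) / 2))
      (-(Complex.I / 2) * Complex.exp (-(s * Complex.I) / 2)) s := fun s => by
    have h1 : HasDerivAt (fun s : ℝ => -((s : ℂ) * Complex.I) / 2) (-Complex.I / 2) s :=
      (hlin s).neg.div_const 2
    refine h1.cexp.congr_deriv ?_
    ring
  have hd : ∀ s : ℝ, HasDerivAt (fun s : ℝ => Complex.exp (-(s * Complex.I) / 2) * U (γ s))
      (Complex.I * Complex.exp (-(s * Complex.I) / 2) * rotGen U (γ s)) s := fun s => by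
    refine ((he s).mul (hasDerivAt_comp_curve hU (hγ s))).congr_deriv ?_
    rw [rotGen, map_mul, Complex.conj_I]
    ring
  have h2 := continuous_wirtD hU
  have h3 := continuous_wirtDbar hU
  have hcγ : Continuous γ := by simp only [hγd]; fun_prop
  have hc : Continuous fun s : ℝ => Complex.I * Complex.exp (-(s * Complex.I) / 2) *
      rotGen U (γ s) := by
    have h4 := hU.continuous
    unfold rotGen
    fun_prop
  have h1 := enorm_sub_le_lintegral (b := 2 * Real.pi) (by positivity) hd hc
  -- The half-form factor after one turn is e^{-iπ} = -1.
  have e1 : Complex.exp (-(((2 * Real.pi : ℝ) : ℂ) * Complex.I) / 2) = -1 := by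
    rw [show -(((2 * Real.pi : ℝ) : ℂ) * Complex.I) / 2 = -(Real.pi * Complex.I) by push_cast; ring,
      Complex.exp_neg, Complex.exp_pi_mul_I]; norm_num
  have e2 : γ (2 * Real.pi) = x := by
    simp only [hγd]; push_cast; rw [Complex.exp_two_pi_mul_I, one_mul]
  have e3 : γ 0 = x := by simp [hγd]
  rw [e1, e2, e3] at h1
  have e4 : (-1 : ℂ) * U x - Complex.exp (-(((0 : ℝ) : ℂ) * Complex.I) / 2) * U x = (-2) * U x := by
    simp; ring
  rw [e4] at h1
  refine le_trans ?_ (h1.trans (lintegral_mono fun s => le_of_eq ?_))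
  · rw [enorm_mul]
    refine le_mul_of_one_le_left zero_le ?_
    rw [← ofReal_norm]; simp
  · have : ‖Complex.exp (-((s : ℂ) * Complex.I) / 2)‖ = 1 := by
      rw [show -((s : ℂ) * Complex.I) / 2 = ((-s / 2 : ℝ) : ℂ) * Complex.I by push_cast; ring,
        Complex.norm_exp_ofReal_mul_I]
    rw [enorm_mul, enorm_mul, ← ofReal_norm Complex.I, ← ofReal_norm (Complex.exp _), this,
      Complex.norm_I, ENNReal.ofReal_one, one_mul, one_mul]

/-- The measure |x| dA and the disc are invariant under rotation, so the flow inequality applies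
with T = 2π. -/
theorem lintegral_ball_le_rotGen (ρ : ℝ) :
    ∫⁻ x in Metric.ball (0 : ℂ) ρ, ‖U x‖ₑ ^ 2 * ‖x‖ₑ ≤ ENNReal.ofReal (2 * Real.pi) ^ 2 *
      ∫⁻ x in Metric.ball (0 : ℂ) ρ, ‖rotGen U x‖ₑ ^ 2 * ‖x‖ₑ := by
  have h2 := continuous_wirtD hU
  have h3 := continuous_wirtDbar hU
  have h4 := hU.continuous
  have hwc : Continuous (rotGen U) := by unfold rotGen; fun_prop
  have hb : MeasurableSet (Metric.ball (0 : ℂ) ρ) := Metric.isOpen_ball.measurableSet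
  have hn : Measurable fun x : ℂ => ‖x‖ₑ := measurable_enorm
  have key : ∀ k : ℂ → ℝ≥0∞, Measurable k →
      ∫⁻ x in Metric.ball (0 : ℂ) ρ, k x ∂(volume.withDensity fun x : ℂ => ‖x‖ₑ) =
        ∫⁻ x in Metric.ball (0 : ℂ) ρ, k x * ‖x‖ₑ := fun k hk => by
    rw [restrict_withDensity hb, lintegral_withDensity_eq_lintegral_mul _ hn hk]
    simp only [Pi.mul_apply, mul_comm]
  have := lintegral_sq_le_of_flow (ν := volume.withDensity fun x : ℂ => ‖x‖ₑ)
    (φ := fun s z => Complex.exp (s * Complex.I) * z) (T := 2 * Real.pi)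
    (by fun_prop) hwc.measurable.enorm (G := fun z => ‖U z‖ₑ) (A := Metric.ball (0 : ℂ) ρ)
    (B := Metric.ball (0 : ℂ) ρ) hb (fun x _ => enorm_le_lintegral_rotGen hU x) ?_
  · rwa [key _ (h4.measurable.enorm.pow_const 2), key _ (hwc.measurable.enorm.pow_const 2)] at this
  · intro s _
    set c : Circle := Circle.exp s with hc
    have hcv : (c : ℂ) = Complex.exp (s * Complex.I) := by simp [hc, Circle.coe_exp]
    have hm : Measurable fun x : ℂ => ‖rotGen U (Complex.exp (s * Complex.I) * x)‖ₑ ^ 2 :=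
      (hwc.comp (by fun_prop)).measurable.enorm.pow_const 2
    rw [key _ hm,
      key _ (hwc.measurable.enorm.pow_const 2), ← lintegral_indicator hb, ← lintegral_indicator hb]
    refine le_of_le_of_eq ?_ ((LinearIsometryEquiv.measurePreserving (rotation c)).lintegral_comp_emb
        (rotation c).toHomeomorph.measurableEmbedding _)
    refine le_of_eq (lintegral_congr fun x => ?_)
    have hr : rotation c x = Complex.exp (s * Complex.I) * x := by rw [rotation_apply, hcv]
    have hrn : ‖rotation c x‖ = ‖x‖ := (rotation c).norm_map x
    by_cases hx : x ∈ Metric.ball (0 : ℂ) ρ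
    · have hx' : rotation c x ∈ Metric.ball (0 : ℂ) ρ := by
        rw [mem_ball_zero_iff] at hx ⊢; rwa [hrn]
      rw [Set.indicator_of_mem hx, Set.indicator_of_mem hx', ← hr, ← ofReal_norm (rotation c x), hrn,
        ofReal_norm]
    · have hx' : rotation c x ∉ Metric.ball (0 : ℂ) ρ := by
        rw [mem_ball_zero_iff] at hx ⊢; rwa [hrn]
      rw [Set.indicator_of_notMem hx, Set.indicator_of_notMem hx']

end Planar

end

noncomputable section

set_option linter.unusedSectionVars false

namespace RiemannSurface

namespace SpinBundle

local notation "conj" => starRingEnd ℂ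
local notation "infty" => ((⊤ : ℕ∞) : WithTop ℕ∞)

variable {X : Type*} [TopologicalSpace X] [ChartedSpace ℂ X] {C : SpinBundle X}
  {ω : ∀ p : X, TangentSpace 𝓘(ℂ) p →L[ℂ] ℂ} [IsManifold 𝓘(ℂ) 1 X]
  [MeasurableSpace X] [BorelSpace X] {u v : X → ℂ}
  (hω : ω ∈ holomorphicOneForms X) (hz : (zeros ω).Finite)

/-! ### The Poincaré inequality -/

variable (C ω) in
/-- The square of the norm in `L²`, with values in `[0, ∞]`. -/
def nsq (u : X → ℂ) : ℝ≥0∞ := ∫⁻ p, ‖u p‖ₑ ^ 2 ∂(C.hArea ω)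

variable (C ω) in
/-- The Dirichlet energy. -/
def energy (u : X → ℂ) : ℝ≥0∞ := C.nsq ω (C.dbarOmega ω u) + C.nsq ω (C.dOmega ω u)

include hω in
theorem Frame.lintegral_rep_le (F : C.Frame) (hu : AEStronglyMeasurable u (C.hArea ω)) {B : Set ℂ}
    (hB : B ⊆ F.ξ.target) : ∫⁻ z in B, ‖F.rep u z‖ₑ ^ 2 * ‖F.f ω z‖ₑ ≤ C.nsq ω u :=
  (lintegral_mono_set hB).trans ((F.lintegral_source hω hu).symm.le.trans
    (setLIntegral_le_lintegral _ _))

include hω in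
theorem Frame.setLIntegral_preimage (F : C.Frame) (hu : Measurable u) {B : Set ℂ}
    (hB : MeasurableSet B) (hBt : B ⊆ F.ξ.target) :
    ∫⁻ q in F.ξ.source ∩ F.ξ ⁻¹' B, ‖u q‖ₑ ^ 2 ∂(C.hArea ω) =
      ∫⁻ z in B, ‖F.rep u z‖ₑ ^ 2 * ‖F.f ω z‖ₑ := by
  have hW : MeasurableSet (F.ξ.source ∩ F.ξ ⁻¹' B) := by
    classical
    have h1 := F.measurable_coord hB
    have h2 := F.ξ.open_source.measurableSet.inter h1
    convert h2 using 1
    ext q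
    simp only [Set.mem_inter_iff, Set.mem_preimage, and_congr_right_iff]
    intro hq
    rw [Set.piecewise_eq_of_mem _ _ _ hq]
  set W := F.ξ.source ∩ F.ξ ⁻¹' B with hWd
  have h1 := F.lintegral_source hω ((hu.indicator hW).aestronglyMeasurable (μ := C.hArea ω))
  have h2 : ∫⁻ q in W, ‖u q‖ₑ ^ 2 ∂(C.hArea ω) =
      ∫⁻ q in F.ξ.source, ‖W.indicator u q‖ₑ ^ 2 ∂(C.hArea ω) := by
    rw [← lintegral_indicator hW, ← lintegral_indicator F.ξ.open_source.measurableSet]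
    refine lintegral_congr fun q => ?_
    by_cases hq : q ∈ W
    · rw [Set.indicator_of_mem hq, Set.indicator_of_mem hq.1, Set.indicator_of_mem hq]
    · by_cases hq' : q ∈ F.ξ.source
      · rw [Set.indicator_of_notMem hq, Set.indicator_of_mem hq', Set.indicator_of_notMem hq]; simp
      · rw [Set.indicator_of_notMem hq, Set.indicator_of_notMem hq']
  rw [h2, h1, ← lintegral_indicator hB, ← lintegral_indicator F.ξ.open_target.measurableSet]
  refine lintegral_congr fun z => ?_
  by_cases hz : z ∈ F.ξ.target
  · rw [Set.indicator_of_mem hz, Frame.rep, frameRep]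
    by_cases hzB : z ∈ B
    · have : F.ξ.symm z ∈ W := ⟨F.ξ.map_target hz, by rwa [Set.mem_preimage, F.ξ.right_inv hz]⟩
      rw [Set.indicator_of_mem hzB, Set.indicator_of_mem this]; rfl
    · have : F.ξ.symm z ∉ W := fun h => hzB (by
        have := h.2; rwa [Set.mem_preimage, F.ξ.right_inv hz] at this)
      rw [Set.indicator_of_notMem hzB, Set.indicator_of_notMem this]; simp
  · rw [Set.indicator_of_notMem hz, Set.indicator_of_notMem fun h => hz (hBt h)]

variable (C ω) in
/-- The Poincaré inequality holds for test sections near `p`. -/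
def PoincareAt (p : X) : Prop :=
  ∃ V ∈ 𝓝 p, ∃ K : ℝ≥0∞, K ≠ ∞ ∧ ∀ u, C.IsTestSection ω u →
    ∫⁻ q in V, ‖u q‖ₑ ^ 2 ∂(C.hArea ω) ≤ K * C.energy ω u

theorem isOpen_poincareAt : IsOpen {p | C.PoincareAt ω p} := by
  refine isOpen_iff_mem_nhds.2 fun p hp => ?_
  obtain ⟨V, hV, K, hK, h⟩ := hp
  filter_upwards [eventually_mem_nhds_iff.2 hV] with q hq using ⟨V, hq, K, hK, h⟩

theorem sq_add_le (a b : ℝ≥0∞) : (a + b) ^ 2 ≤ 2 * (a ^ 2 + b ^ 2) := by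
  have := ENNReal.rpow_add_le_mul_rpow_add_rpow a b (p := 2) (by norm_num)
  norm_num at this
  exact this

variable [T2Space X] [CompactSpace X]

include hω in
-- With ω = x dx the rotation generator equals x² times the ∂-derivative minus x̄² times the
-- ∂̄-derivative of u in the invariant sense, so its weighted square is at most 2ρ⁴ times the energy
-- density.
theorem lintegral_rotGen_le {P : X} {F : C.Frame} (hF : IsDistinguished ω P F.ξ) {ρ : ℝ}
    (hρ : Metric.ball 0 ρ ⊆ F.ξ.target) (hρ0 : 0 < ρ) (hu : C.IsTestSection ω u) :
    ∫⁻ x in Metric.ball (0 : ℂ) ρ, ‖rotGen (F.rep u) x‖ₑ ^ 2 * ‖x‖ₑ ≤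
      2 * ENNReal.ofReal ρ ^ 4 * C.energy ω u := by
  obtain ⟨-, hP, hP0, -, hf⟩ := hF
  have hDb := (flatOp_dbarOmega.isTestSection hω hu)
  have hD := ((flatOp_dOmega hω).isTestSection hω hu)
  have hpt : ∀ x ∈ Metric.ball (0 : ℂ) ρ, ‖rotGen (F.rep u) x‖ₑ ^ 2 * ‖x‖ₑ ≤
      2 * ENNReal.ofReal ρ ^ 4 * (‖F.rep (C.dbarOmega ω u) x‖ₑ ^ 2 * ‖F.f ω x‖ₑ +
        ‖F.rep (C.dOmega ω u) x‖ₑ ^ 2 * ‖F.f ω x‖ₑ) := by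
    intro x hx
    have hxt := hρ hx
    have hfx : F.f ω x = x := hf x hxt
    by_cases hx0 : x = 0
    · simp [hx0]
    have hq := F.ξ.map_target hxt
    have hq0 : F.ξ.symm x ∉ zeros ω := fun h => by
      have h1 := (coeff_eq_zero_iff F.mem hq).2 h
      rw [F.ξ.right_inv hxt] at h1
      exact hx0 (hfx.symm.trans h1)
    have e1 := rep_dbarOmega (ω := ω) F hq (hu.smoothAt _)
    have e2 := rep_dOmega hω F hq hq0 (hu.smoothAt _)
    have hsm := (hu.smoothAt _) F hq
    rw [F.ξ.right_inv hxt] at e1 e2 hsm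
    have hn0 : ‖x‖ ≠ 0 := norm_ne_zero_iff.2 hx0
    have hnn : Complex.normSq x ≠ 0 := by simpa using hx0
    have e3 : (fun y => ((‖F.f ω y‖⁻¹ : ℝ) : ℂ) * F.rep u y) =ᶠ[𝓝 x]
        fun y => (((Real.sqrt (Complex.normSq y))⁻¹ : ℝ) : ℂ) * F.rep u y := by
      filter_upwards [F.ξ.open_target.mem_nhds hxt] with y hy
      rw [show F.f ω y = y from hf y hy]; rfl
    have h0 : HasDerivAt (fun t : ℝ => (((Real.sqrt t)⁻¹ : ℝ) : ℂ))
        ((-(1 / (2 * Real.sqrt (Complex.normSq x))) / Real.sqrt (Complex.normSq x) ^ 2 : ℝ) : ℂ)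
        (Complex.normSq x) :=
      ((Real.hasDerivAt_sqrt hnn).inv (Real.sqrt_ne_zero'.2
        (lt_of_le_of_ne (Complex.normSq_nonneg x) hnn.symm))).ofReal_comp
    have h0d : DifferentiableAt ℝ (fun y => (((Real.sqrt (Complex.normSq y))⁻¹ : ℝ) : ℂ)) x := by
      have h1 : DifferentiableAt ℝ (fun y : ℂ => Complex.normSq y) x := by
        have : (fun y : ℂ => Complex.normSq y) = fun y => y.re * y.re + y.im * y.im := by
          ext y; exact Complex.normSq_apply y
        rw [this]
        have hr := Complex.reCLM.differentiableAt (x := x)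
        have hi := Complex.imCLM.differentiableAt (x := x)
        exact (hr.mul hr).add (hi.mul hi)
      exact (h0.differentiableAt).comp x h1
    -- The term -U/2 in the generator comes from differentiating the weight |x|⁻¹ in the definition
    -- of the ∂-derivative.
    have e4 : rotGen (F.rep u) x = x ^ 2 * F.rep (C.dOmega ω u) x -
        conj x ^ 2 * F.rep (C.dbarOmega ω u) x := by
      rw [e1, e2, localD, localDbar, e3.wirtD_eq,
        wirtD_mul h0d (differentiableAt_of_contDiffAt_infty hsm), wirtD_normSq_comp h0, rotGen]
      have hs : Real.sqrt (Complex.normSq x) = ‖x‖ := rfl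
      rw [hs, hfx]
      have hcx : conj x ≠ 0 := by simpa using hx0
      have hnc : ((‖x‖ : ℝ) : ℂ) ≠ 0 := by exact_mod_cast hn0
      have hxx : conj x * x = ((‖x‖ : ℝ) : ℂ) ^ 2 := Complex.conj_mul' x
      push_cast
      field_simp
      linear_combination (F.rep u x) * hxx
    have hxρ : ‖x‖ₑ ≤ ENNReal.ofReal ρ := by
      rw [← ofReal_norm]
      exact ENNReal.ofReal_le_ofReal (mem_ball_zero_iff.1 hx).le
    rw [e4, hfx, ← add_mul, ← mul_assoc]
    gcongr ?_ * _
    refine (pow_le_pow_left₀ zero_le (enorm_sub_le (a := x ^ 2 * _)) 2).trans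
      ((sq_add_le _ _).trans ?_)
    rw [enorm_mul, enorm_mul, enorm_pow, enorm_pow, RCLike.enorm_conj, mul_pow, mul_pow, ← mul_add,
      ← mul_assoc, ← pow_mul, add_comm]
    gcongr
  refine (setLIntegral_mono' Metric.isOpen_ball.measurableSet hpt).trans ?_
  have hfin : (2 * ENNReal.ofReal ρ ^ 4 : ℝ≥0∞) ≠ ∞ := by finiteness
  rw [lintegral_const_mul' _ _ hfin]
  gcongr
  have hfm : AEMeasurable (F.f ω) ((volume : Measure ℂ).restrict (Metric.ball 0 ρ)) :=
    (F.aemeasurable_f hω).mono_measure (Measure.restrict_mono hρ le_rfl)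
  have hm1 : AEMeasurable (F.rep (C.dbarOmega ω u)) ((volume : Measure ℂ).restrict (Metric.ball 0 ρ)) :=
    (((F.contDiffOn_rep fun p _ => hDb.smoothAt p).continuousOn).mono hρ).aemeasurable
      Metric.isOpen_ball.measurableSet
  have hm2 : AEMeasurable (fun z => ‖F.rep (C.dbarOmega ω u) z‖ₑ ^ 2 * ‖F.f ω z‖ₑ)
      _ := (hm1.enorm.pow_const 2).mul hfm.enorm
  rw [lintegral_add_left' hm2]
  exact add_le_add (F.lintegral_rep_le hω (hDb.memLp hω).1 hρ)
    (F.lintegral_rep_le hω (hD.memLp hω).1 hρ)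

theorem exists_smooth_eq_on_closedBall {g : ℂ → ℂ} {V : Set ℂ} (hV : IsOpen V)
    (hg : ContDiffOn ℝ infty g V) {c : ℂ} {ρ : ℝ} (hρ : Metric.closedBall c ρ ⊆ V) :
    ∃ U : ℂ → ℂ, ContDiff ℝ infty U ∧ ∀ z ∈ Metric.closedBall c ρ, U =ᶠ[𝓝 z] g := by
  obtain ⟨χ, h1, -, h3, h4, -⟩ := exists_smooth_cutoff (isCompact_closedBall c ρ) hV hρ
  refine ⟨_, contDiffOn_extend hV hg h1 h3, fun z hz => ?_⟩
  filter_upwards [h4.filter_mono (nhds_le_nhdsSet hz)] with y hy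
  rw [hy, Complex.ofReal_one, one_mul]

include hω in
theorem poincareAt_zero (hs : HasSimpleZeros ω) {P : X} (hP : P ∈ zeros ω) : C.PoincareAt ω P := by
  obtain ⟨F, hF⟩ := exists_distinguished_frame (C := C) hω hs hP
  obtain ⟨-, hPs, hP0, ⟨r, hr, hrt⟩, hf⟩ := id hF
  have hcb : Metric.closedBall (0 : ℂ) (r / 2) ⊆ F.ξ.target := by
    rw [hrt]; exact Metric.closedBall_subset_ball (by linarith)
  have hb : Metric.ball (0 : ℂ) (r / 2) ⊆ F.ξ.target := Metric.ball_subset_closedBall.trans hcb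
  refine ⟨F.ξ.source ∩ F.ξ ⁻¹' Metric.ball 0 (r / 2), ?_, ENNReal.ofReal (2 * Real.pi) ^ 2 *
    (2 * ENNReal.ofReal (r / 2) ^ 4), by finiteness, fun u hu => ?_⟩
  · exact (F.ξ.isOpen_inter_preimage Metric.isOpen_ball).mem_nhds
      ⟨hPs, by rw [Set.mem_preimage, hP0]; exact Metric.mem_ball_self (by linarith)⟩
  · rw [F.setLIntegral_preimage hω (measurable_of_smoothAt hu.smoothAt)
      Metric.isOpen_ball.measurableSet hb]
    obtain ⟨U, hU, hUe⟩ := exists_smooth_eq_on_closedBall F.ξ.open_target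
      (F.contDiffOn_rep fun p _ => hu.smoothAt p) hcb
    have e1 : ∫⁻ z in Metric.ball 0 (r / 2), ‖F.rep u z‖ₑ ^ 2 * ‖F.f ω z‖ₑ =
        ∫⁻ z in Metric.ball 0 (r / 2), ‖U z‖ₑ ^ 2 * ‖z‖ₑ := by
      refine setLIntegral_congr_fun Metric.isOpen_ball.measurableSet fun z hz => ?_
      simp only [show F.f ω z = z from hf z (hb hz),
        (hUe z (Metric.ball_subset_closedBall hz)).self_of_nhds]
    have e2 : ∫⁻ z in Metric.ball 0 (r / 2), ‖rotGen U z‖ₑ ^ 2 * ‖z‖ₑ =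
        ∫⁻ z in Metric.ball 0 (r / 2), ‖rotGen (F.rep u) z‖ₑ ^ 2 * ‖z‖ₑ := by
      refine setLIntegral_congr_fun Metric.isOpen_ball.measurableSet fun z hz => ?_
      have h1 := hUe z (Metric.ball_subset_closedBall hz)
      simp only [rotGen, h1.wirtD_eq, h1.wirtDbar_eq, h1.self_of_nhds]
    rw [e1]
    refine (lintegral_ball_le_rotGen hU _).trans ?_
    rw [e2, mul_assoc]
    gcongr
    exact lintegral_rotGen_le hω hF hb (by linarith) hu

include hω in
-- Near p there is a point q where the inequality holds. In the flat coordinate a small disc at p is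
-- the translate of a disc at q, and U(z + h) - U(z) is bounded in L² by |h| times the gradient,
-- that is, by the energy.
theorem poincareAt_of_closure {p : X} (hp : p ∉ zeros ω) (hpc : p ∈ closure {q | C.PoincareAt ω q}) :
    C.PoincareAt ω p := by
  obtain ⟨F, hpF, hF, R, hR, hRt⟩ := exists_flat_frame (C := C) hω hp
  have hO : IsOpen (F.ξ.source ∩ F.ξ ⁻¹' Metric.ball (F.ξ p) (R / 4)) :=
    F.ξ.isOpen_inter_preimage Metric.isOpen_ball
  obtain ⟨q, ⟨hqs, hqb⟩, V, hV, K, hK, hKV⟩ := mem_closure_iff.1 hpc _ hO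
    ⟨hpF, Metric.mem_ball_self (by linarith)⟩
  -- a small ball around `q`
  have h1 : F.ξ.symm ⁻¹' V ∈ 𝓝 (F.ξ q) := by
    have h1 := F.ξ.continuousAt_symm (F.ξ.map_source hqs)
    rw [ContinuousAt, F.ξ.left_inv hqs] at h1
    exact h1 hV
  obtain ⟨ρ', hρ', hρV⟩ := Metric.mem_nhds_iff.1 h1
  set ρ := min ρ' (R / 4) with hρd
  have hρ : 0 < ρ := lt_min hρ' (by linarith)
  have hρ4 : ρ ≤ R / 4 := min_le_right _ _
  have hρV' : Metric.ball (F.ξ q) ρ ⊆ F.ξ.symm ⁻¹' V :=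
    (Metric.ball_subset_ball (min_le_left _ _)).trans hρV
  set h : ℂ := F.ξ p - F.ξ q with hh
  have hhn : ‖h‖ < R / 4 := by
    rw [hh, ← dist_eq_norm, dist_comm]; exact hqb
  have hcb : Metric.closedBall (F.ξ p) (R / 2) ⊆ F.ξ.target := by
    rw [hRt]; exact Metric.closedBall_subset_ball (by linarith)
  have hqB : Metric.ball (F.ξ q) ρ ⊆ Metric.closedBall (F.ξ p) (R / 2) := fun z hz => by
    have h2 := dist_triangle z (F.ξ q) (F.ξ p)
    have h3 : dist z (F.ξ q) < ρ := hz
    have h4 : dist (F.ξ q) (F.ξ p) < R / 4 := hqb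
    exact Metric.mem_closedBall.2 (by linarith)
  have hpB : Metric.ball (F.ξ p) ρ ⊆ Metric.closedBall (F.ξ p) (R / 2) :=
    Metric.ball_subset_closedBall.trans (Metric.closedBall_subset_closedBall (by linarith))
  -- Both ρ and |h| are at most R/4, so the segments of translation stay in the disc of radius R/2
  -- about p, inside the chart.
  have hseg : ∀ z ∈ Metric.ball (F.ξ q) ρ, ∀ s ∈ Set.Icc (0 : ℝ) 1,
      z + s * h ∈ Metric.ball (F.ξ p) (R / 2) := fun z hz s hs => by
    rw [Metric.mem_ball, dist_eq_norm]
    have e : z + s * h - F.ξ p = (z - F.ξ q) - ((1 - s : ℝ) : ℂ) * h := by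
      rw [hh]; push_cast; ring
    have h3 : ‖z - F.ξ q‖ < ρ := by rw [← dist_eq_norm]; exact hz
    have h4 : ‖((1 - s : ℝ) : ℂ) * h‖ ≤ ‖h‖ := by
      rw [norm_mul, Complex.norm_real, Real.norm_of_nonneg (by linarith [hs.2])]
      exact mul_le_of_le_one_left (norm_nonneg _) (by linarith [hs.1])
    rw [e]
    linarith [norm_sub_le (z - F.ξ q) (((1 - s : ℝ) : ℂ) * h)]
  refine ⟨F.ξ.source ∩ F.ξ ⁻¹' Metric.ball (F.ξ p) ρ,
    (F.ξ.isOpen_inter_preimage Metric.isOpen_ball).mem_nhds ⟨hpF, Metric.mem_ball_self hρ⟩,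
    2 * (2 * ‖h‖ₑ ^ 2 + K), by finiteness, fun u hu => ?_⟩
  have hum := measurable_of_smoothAt hu.smoothAt
  have hDb := (flatOp_dbarOmega.isTestSection hω hu)
  have hD := ((flatOp_dOmega hω).isTestSection hω hu)
  rw [F.setLIntegral_preimage hω hum Metric.isOpen_ball.measurableSet (hpB.trans hcb)]
  obtain ⟨U, hU, hUe⟩ := exists_smooth_eq_on_closedBall F.ξ.open_target
    (F.contDiffOn_rep fun p _ => hu.smoothAt p) hcb
  have e1 : ∫⁻ z in Metric.ball (F.ξ p) ρ, ‖F.rep u z‖ₑ ^ 2 * ‖F.f ω z‖ₑ =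
      ∫⁻ z in Metric.ball (F.ξ q) ρ, ‖U (z + h)‖ₑ ^ 2 := by
    rw [← lintegral_indicator Metric.isOpen_ball.measurableSet,
      ← lintegral_indicator Metric.isOpen_ball.measurableSet, ← lintegral_add_right_eq_self _ h]
    refine lintegral_congr fun z => ?_
    have hiff : z + h ∈ Metric.ball (F.ξ p) ρ ↔ z ∈ Metric.ball (F.ξ q) ρ := by
      rw [Metric.mem_ball, Metric.mem_ball, dist_eq_norm, dist_eq_norm, hh]
      rw [show z + (F.ξ p - F.ξ q) - F.ξ p = z - F.ξ q by ring]
    by_cases hzb : z ∈ Metric.ball (F.ξ q) ρ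
    · rw [Set.indicator_of_mem hzb, Set.indicator_of_mem (hiff.2 hzb)]
      have h5 := hpB (hiff.2 hzb)
      rw [(hUe _ h5).self_of_nhds, hF _ (hcb h5), enorm_one, mul_one]
    · rw [Set.indicator_of_notMem hzb, Set.indicator_of_notMem fun h => hzb (hiff.1 h)]
  have e2 : ∫⁻ z in Metric.ball (F.ξ q) ρ, ‖U z‖ₑ ^ 2 ≤ K * C.energy ω u := by
    refine le_trans (le_of_eq ?_) (le_trans (lintegral_mono_set (μ := C.hArea ω)
      (s := F.ξ.source ∩ F.ξ ⁻¹' Metric.ball (F.ξ q) ρ) (t := V) ?_) (hKV u hu))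
    · rw [F.setLIntegral_preimage hω hum Metric.isOpen_ball.measurableSet (hqB.trans hcb)]
      refine setLIntegral_congr_fun Metric.isOpen_ball.measurableSet fun z hz => ?_
      simp only [(hUe _ (hqB hz)).self_of_nhds, hF _ (hcb (hqB hz)), enorm_one, mul_one]
    · rintro y ⟨hy1, hy2⟩
      have := hρV' hy2
      rwa [Set.mem_preimage, F.ξ.left_inv hy1] at this
  have e3 : ∫⁻ z in Metric.ball (F.ξ q) ρ, ‖U (z + h) - U z‖ₑ ^ 2 ≤
      2 * ‖h‖ₑ ^ 2 * C.energy ω u := by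
    refine (lintegral_translate_le hU Metric.isOpen_ball.measurableSet
      Metric.isOpen_ball.measurableSet hseg).trans ?_
    have hB := Metric.ball_subset_closedBall.trans hcb
    have hpt : ∀ z ∈ Metric.ball (F.ξ p) (R / 2), (‖wirtD U z‖ₑ * ‖h‖ₑ + ‖wirtDbar U z‖ₑ * ‖h‖ₑ) ^ 2 ≤
        2 * ‖h‖ₑ ^ 2 * (‖F.rep (C.dbarOmega ω u) z‖ₑ ^ 2 * ‖F.f ω z‖ₑ +
          ‖F.rep (C.dOmega ω u) z‖ₑ ^ 2 * ‖F.f ω z‖ₑ) := fun z hz => by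
      have hzt := hB hz
      have h1 := hUe z (Metric.ball_subset_closedBall hz)
      have h2 := flatOp_dbarOmega.rep_eq hF (F.ξ.map_target hzt) (hu.smoothAt _)
      have h3 := (flatOp_dOmega hω).rep_eq hF (F.ξ.map_target hzt) (hu.smoothAt _)
      rw [F.ξ.right_inv hzt] at h2 h3
      rw [h2, h3, hF z hzt, h1.wirtD_eq, h1.wirtDbar_eq, enorm_one, mul_one, mul_one]
      refine (sq_add_le _ _).trans (le_of_eq ?_)
      ring
    refine (setLIntegral_mono' Metric.isOpen_ball.measurableSet hpt).trans ?_
    rw [lintegral_const_mul' _ _ (by finiteness)]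
    gcongr
    have hfm : AEMeasurable (F.f ω) ((volume : Measure ℂ).restrict (Metric.ball (F.ξ p) (R / 2))) :=
      (F.aemeasurable_f hω).mono_measure (Measure.restrict_mono hB le_rfl)
    have hm1 : AEMeasurable (F.rep (C.dbarOmega ω u))
        ((volume : Measure ℂ).restrict (Metric.ball (F.ξ p) (R / 2))) :=
      (((F.contDiffOn_rep fun p _ => hDb.smoothAt p).continuousOn).mono hB).aemeasurable
        Metric.isOpen_ball.measurableSet
    have hm2 : AEMeasurable (fun z => ‖F.rep (C.dbarOmega ω u) z‖ₑ ^ 2 * ‖F.f ω z‖ₑ)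
        _ := (hm1.enorm.pow_const 2).mul hfm.enorm
    rw [lintegral_add_left' hm2]
    exact add_le_add (F.lintegral_rep_le hω (hDb.memLp hω).1 hB)
      (F.lintegral_rep_le hω (hD.memLp hω).1 hB)
  rw [e1]
  calc ∫⁻ z in Metric.ball (F.ξ q) ρ, ‖U (z + h)‖ₑ ^ 2
      ≤ ∫⁻ z in Metric.ball (F.ξ q) ρ, 2 * (‖U (z + h) - U z‖ₑ ^ 2 + ‖U z‖ₑ ^ 2) := by
        refine lintegral_mono fun z => ?_
        refine le_trans ?_ (sq_add_le _ _)
        gcongr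
        calc ‖U (z + h)‖ₑ = ‖(U (z + h) - U z) + U z‖ₑ := by rw [sub_add_cancel]
          _ ≤ _ := enorm_add_le _ _
    _ = 2 * ((∫⁻ z in Metric.ball (F.ξ q) ρ, ‖U (z + h) - U z‖ₑ ^ 2) +
          ∫⁻ z in Metric.ball (F.ξ q) ρ, ‖U z‖ₑ ^ 2) := by
        rw [lintegral_const_mul' _ _ (by finiteness),
          lintegral_add_right _ (hU.continuous.measurable.enorm.pow_const 2)]
    _ ≤ 2 * (2 * ‖h‖ₑ ^ 2 * C.energy ω u + K * C.energy ω u) := by gcongr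
    _ = _ := by ring

include hω in
-- The points at which the inequality holds form an open and closed set containing the zeros, hence
-- all of X; finitely many such neighbourhoods cover X.
theorem exists_poincare [ConnectedSpace X] (hs : HasSimpleZeros ω) (hne : (zeros ω).Nonempty) :
    ∃ K : ℝ≥0∞, K ≠ ∞ ∧ ∀ u, C.IsTestSection ω u → C.nsq ω u ≤ K * C.energy ω u := by
  have hcl : IsClosed {p | C.PoincareAt ω p} := isClosed_of_closure_subset fun p hp => by
    by_cases h : p ∈ zeros ω
    · exact poincareAt_zero hω hs h
    · exact poincareAt_of_closure hω h hp
  have huniv : {p | C.PoincareAt ω p} = Set.univ :=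
    IsClopen.eq_univ ⟨hcl, isOpen_poincareAt⟩ (hne.mono fun P hP => poincareAt_zero hω hs hP)
  have h1 := isCompact_univ.induction_on (X := X) (p := fun s => ∃ K : ℝ≥0∞, K ≠ ∞ ∧ ∀ u,
    C.IsTestSection ω u → ∫⁻ q in s, ‖u q‖ₑ ^ 2 ∂(C.hArea ω) ≤ K * C.energy ω u)
    ⟨0, by simp, fun u _ => by simp⟩
    (fun s t hst ⟨K, hK, h⟩ => ⟨K, hK, fun u hu => (lintegral_mono_set hst).trans (h u hu)⟩)
    (fun s t ⟨K, hK, h⟩ ⟨K', hK', h'⟩ => ⟨K + K', by finiteness, fun u hu =>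
      (lintegral_union_le _ _ _).trans (by rw [add_mul]; exact add_le_add (h u hu) (h' u hu))⟩)
    fun p _ => by
      obtain ⟨V, hV, K, hK, h⟩ := huniv.symm ▸ Set.mem_univ p
      exact ⟨V, mem_nhdsWithin_of_mem_nhds hV, K, hK, h⟩
  simpa [nsq] using h1

theorem enorm_sq_eq_nsq {x : C.L2 ω} (hx : x =ᵐ[C.hArea ω] u) : ‖x‖ₑ ^ 2 = C.nsq ω u := by
  rw [Lp.enorm_def, eLpNorm_eq_lintegral_rpow_enorm_toReal (by norm_num) (by norm_num),
    ← ENNReal.rpow_mul_natCast]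
  simp only [ENNReal.toReal_ofNat, ENNReal.rpow_ofNat, nsq]
  norm_num
  refine lintegral_congr_ae ?_
  filter_upwards [hx] with p hp
  rw [hp]

include hω in
-- Both energies equal (u, Δu), by the two factorisations of Δ. The energy in the Poincaré
-- inequality is therefore twice the ∂̄-energy.
theorem nsq_dOmega (hu : C.IsTestSection ω u) :
    C.nsq ω (C.dOmega ω u) = C.nsq ω (C.dbarOmega ω u) := by
  obtain ⟨x, hx⟩ := (flatOp_dbarOmega.isTestSection hω hu).exists_toLp hω
  obtain ⟨y, hy⟩ := ((flatOp_dOmega hω).isTestSection hω hu).exists_toLp hω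
  have h1 := (ip_laplacian hω hu hu).symm.trans (ip_laplacian' hω hu hu)
  rw [← inner_eq_ip hx hx, ← inner_eq_ip hy hy, inner_self_eq_norm_sq_to_K,
    inner_self_eq_norm_sq_to_K] at h1
  have h2 : ‖x‖ = ‖y‖ := by
    have h3 : ‖x‖ ^ 2 = ‖y‖ ^ 2 := by exact_mod_cast h1
    exact (sq_eq_sq₀ (norm_nonneg _) (norm_nonneg _)).1 h3
  rw [← enorm_sq_eq_nsq hx, ← enorm_sq_eq_nsq hy, ← ofReal_norm, ← ofReal_norm, h2]

include hω hz in
theorem isCoerciveFactor [ConnectedSpace X] (hs : HasSimpleZeros ω) (hne : (zeros ω).Nonempty) :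
    UnboundedOp.IsCoerciveFactor (C.testOperator ω (C.dbarOmega ω))
      (C.testOperator ω (C.laplacian ω)) where
  dense := dense_testOperator hω hz flatOp_dbarOmega
  domain_eq := by
    ext x
    rw [mem_domain_testOperator hω hz (flatOp_laplacian hω),
      mem_domain_testOperator hω hz flatOp_dbarOmega]
  form {x x' y y' y''} hx hy hy' := by
    obtain ⟨u, hu, h1, h2⟩ := (mem_graph_testOperator hω hz flatOp_dbarOmega).1 hx
    obtain ⟨v, hv, h3, h4⟩ := (mem_graph_testOperator hω hz flatOp_dbarOmega).1 hy
    obtain ⟨w, hw, h5, h6⟩ := (mem_graph_testOperator hω hz (flatOp_laplacian hω)).1 hy'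
    have hvw : v = w := by
      have h7 := ((hv.add (hw.const_mul (-1))).eq_zero_of_ae hω hz (by
        filter_upwards [h3, h5] with p h8 h9
        rw [← h8, ← h9]; simp))
      ext p
      have := congrFun h7 p
      linear_combination this
    subst hvw
    rw [inner_eq_ip h1 h6, inner_eq_ip h2 h4, ip_laplacian hω hu hv]
  closable := closable_dbarOmega hω hz
  coercive := by
    obtain ⟨K, hK, h⟩ := exists_poincare (C := C) hω hs hne
    -- The factor 2 counts the two equal energies; the summand 1 keeps the root positive when K = 0.
    refine ⟨(Real.sqrt (2 * K.toReal + 1))⁻¹, by positivity, fun {x x'} hx => ?_⟩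
    obtain ⟨u, hu, h1, h2⟩ := (mem_graph_testOperator hω hz flatOp_dbarOmega).1 hx
    have h3 := h u hu
    rw [energy, nsq_dOmega hω hu, ← enorm_sq_eq_nsq h1, ← enorm_sq_eq_nsq h2, ← two_mul] at h3
    have h4 := ENNReal.toReal_mono (by finiteness) h3
    simp only [ENNReal.toReal_pow, ENNReal.toReal_mul, toReal_enorm, ENNReal.toReal_ofNat] at h4
    have h5 : ‖x‖ ^ 2 ≤ (2 * K.toReal + 1) * ‖x'‖ ^ 2 := by nlinarith [sq_nonneg ‖x'‖]
    have h6 := Real.sqrt_le_sqrt h5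
    rw [Real.sqrt_sq (norm_nonneg _), Real.sqrt_mul (by positivity), Real.sqrt_sq (norm_nonneg _)] at h6
    rwa [inv_mul_le_iff₀ (by positivity)]

end SpinBundle

end RiemannSurface

end

noncomputable section

set_option linter.unusedSectionVars false

/-! ### A radial cutoff function -/

/-- A smooth function on the line, equal to `1` on `(-∞, 1]` and to `0` on `[2, ∞)`. -/
def cutR (t : ℝ) : ℝ := Real.smoothTransition (2 - t)

theorem contDiff_cutR : ContDiff ℝ ((⊤ : ℕ∞) : WithTop ℕ∞) cutR :=
  Real.smoothTransition.contDiff.comp (contDiff_const.sub contDiff_id)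

theorem cutR_of_le {t : ℝ} (ht : t ≤ 1) : cutR t = 1 :=
  Real.smoothTransition.one_of_one_le (by linarith)

theorem cutR_of_ge {t : ℝ} (ht : 2 ≤ t) : cutR t = 0 :=
  Real.smoothTransition.zero_of_nonpos (by linarith)

theorem abs_cutR_le (t : ℝ) : |cutR t| ≤ 1 := by
  rw [cutR, abs_of_nonneg (Real.smoothTransition.nonneg _)]
  exact Real.smoothTransition.le_one _

theorem deriv_cutR_of_ge {t : ℝ} (ht : 2 < t) : deriv cutR t = 0 := by
  have : cutR =ᶠ[𝓝 t] fun _ => 0 := by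
    filter_upwards [lt_mem_nhds ht] with s hs using cutR_of_ge hs.le
  rw [this.deriv_eq, deriv_const]

theorem hasDerivAt_cutR (t : ℝ) : HasDerivAt cutR (deriv cutR t) t :=
  (contDiff_cutR.differentiable (by simp) t).hasDerivAt

/-- The bound is invariant under scaling: it gives |z| |∂̄χ(a|z|²)| ≤ M with M independent of a,
which makes the cutoff argument at a zero uniform. -/
theorem exists_bound_mul_deriv_cutR : ∃ M : ℝ, 0 ≤ M ∧ ∀ t, 0 ≤ t → |t * deriv cutR t| ≤ M := by
  have hc : Continuous fun t => t * deriv cutR t :=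
    continuous_id.mul (contDiff_cutR.continuous_deriv (by simp))
  obtain ⟨M, hM⟩ := (isCompact_Icc (a := (0 : ℝ)) (b := 2)).exists_bound_of_continuousOn hc.continuousOn
  refine ⟨M, (norm_nonneg _).trans (hM 0 (by simp)), fun t ht => ?_⟩
  by_cases h2 : t ≤ 2
  · exact hM t ⟨ht, h2⟩
  · rw [deriv_cutR_of_ge (not_le.1 h2), mul_zero, abs_zero]
    exact (norm_nonneg _).trans (hM 0 (by simp))

theorem contDiff_normSq : ContDiff ℝ ((⊤ : ℕ∞) : WithTop ℕ∞) fun z : ℂ => Complex.normSq z := by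
  have : (fun z : ℂ => Complex.normSq z) = fun z => z.re * z.re + z.im * z.im := by
    ext z; exact Complex.normSq_apply z
  rw [this]
  have hr := Complex.reCLM.contDiff (n := ((⊤ : ℕ∞) : WithTop ℕ∞))
  have hi := Complex.imCLM.contDiff (n := ((⊤ : ℕ∞) : WithTop ℕ∞))
  exact (hr.mul hr).add (hi.mul hi)

/-- The cutoff function of `a |z|²`. -/
def cutC (a : ℝ) (z : ℂ) : ℂ := ((cutR (a * Complex.normSq z) : ℝ) : ℂ)

theorem contDiff_cutC (a : ℝ) : ContDiff ℝ ((⊤ : ℕ∞) : WithTop ℕ∞) (cutC a) :=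
  Complex.ofRealCLM.contDiff.comp (contDiff_cutR.comp (contDiff_const.mul contDiff_normSq))

theorem norm_cutC_le (a : ℝ) (z : ℂ) : ‖cutC a z‖ ≤ 1 := by
  rw [cutC, Complex.norm_real]; exact abs_cutR_le _

theorem wirtDbar_cutC (a : ℝ) (z : ℂ) :
    wirtDbar (cutC a) z = ((deriv cutR (a * Complex.normSq z) * a : ℝ) : ℂ) * z := by
  have h : HasDerivAt (fun t : ℝ => ((cutR (a * t) : ℝ) : ℂ))
      ((deriv cutR (a * Complex.normSq z) * a : ℝ) : ℂ) (Complex.normSq z) := by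
    refine HasDerivAt.ofReal_comp ?_
    have h1 : HasDerivAt (fun t : ℝ => a * t) a (Complex.normSq z) := by
      simpa using (hasDerivAt_id (Complex.normSq z)).const_mul a
    exact (hasDerivAt_cutR _).comp _ h1
  exact wirtDbar_normSq_comp h

theorem cutC_eventually_one (a : ℝ) : ∀ᶠ z in 𝓝 (0 : ℂ), cutC a z = 1 := by
  have h : Tendsto (fun z : ℂ => a * Complex.normSq z) (𝓝 0) (𝓝 (a * Complex.normSq 0)) :=
    (continuous_const.mul Complex.continuous_normSq).tendsto 0
  rw [map_zero, mul_zero] at h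
  filter_upwards [h.eventually (gt_mem_nhds zero_lt_one)] with z hz
  rw [cutC, cutR_of_le hz.le, Complex.ofReal_one]

theorem cutC_eventually_zero {z : ℂ} (hz : z ≠ 0) :
    ∀ᶠ k : ℕ in atTop, ∀ᶠ y in 𝓝 z, cutC k y = 0 := by
  have hn : 0 < Complex.normSq z := Complex.normSq_pos.2 hz
  obtain ⟨K, hK⟩ := exists_nat_gt (2 / Complex.normSq z)
  filter_upwards [eventually_ge_atTop K] with k hk
  have h1 : 2 < (k : ℝ) * Complex.normSq z := by
    rw [div_lt_iff₀ hn] at hK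
    have : (K : ℝ) ≤ k := by exact_mod_cast hk
    nlinarith
  have h2 : ContinuousAt (fun y : ℂ => (k : ℝ) * Complex.normSq y) z :=
    (continuous_const.mul Complex.continuous_normSq).continuousAt
  filter_upwards [h2.eventually (lt_mem_nhds h1)] with y hy
  rw [cutC, cutR_of_ge hy.le, Complex.ofReal_zero]

theorem lintegral_norm_inv_lt_top (ρ : ℝ) :
    ∫⁻ x in Metric.ball (0 : ℂ) ρ, ENNReal.ofReal (‖x‖⁻¹) < ∞ := by
  have h1 : IntegrableOn (fun x : ℂ => ‖x‖⁻¹) (Metric.ball 0 ρ) := by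
    rw [integrableOn_fun_norm_addHaar volume (f := fun r => r⁻¹)]
    refine Integrable.congr (f := fun _ => (1 : ℝ)) (integrable_const _) ?_
    filter_upwards [ae_restrict_mem measurableSet_Ioo] with y hy
    have : y ≠ 0 := hy.1.ne'
    simp [this]
  have h2 := h1.2
  rw [hasFiniteIntegral_iff_enorm] at h2
  refine lt_of_le_of_lt (lintegral_mono fun x => ?_) h2
  rw [← ofReal_norm, norm_inv, norm_norm]

namespace RiemannSurface

namespace SpinBundle

local notation "conj" => starRingEnd ℂ
local notation "infty" => ((⊤ : ℕ∞) : WithTop ℕ∞)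

variable {X : Type*} [TopologicalSpace X] [ChartedSpace ℂ X] {C : SpinBundle X}
  {ω : ∀ p : X, TangentSpace 𝓘(ℂ) p →L[ℂ] ℂ} [IsManifold 𝓘(ℂ) 1 X]
  [MeasurableSpace X] [BorelSpace X] {u v : X → ℂ}
  (hω : ω ∈ holomorphicOneForms X) (hz : (zeros ω).Finite)

/-! ### Sections which are smooth off the zeros -/

include hω in
theorem Frame.nsq_ofFun (F : C.Frame) {g : ℂ → ℂ} (hg : Measurable g) :
    C.nsq ω (F.ofFun g) = ∫⁻ z in F.ξ.target, ‖g z‖ₑ ^ 2 * ‖F.f ω z‖ₑ := by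
  have h1 := F.lintegral_source hω ((F.measurable_ofFun hg).aestronglyMeasurable (μ := C.hArea ω))
  have h2 : C.nsq ω (F.ofFun g) = ∫⁻ p in F.ξ.source, ‖F.ofFun g p‖ₑ ^ 2 ∂(C.hArea ω) := by
    rw [nsq, ← lintegral_indicator F.ξ.open_source.measurableSet]
    refine lintegral_congr fun p => ?_
    by_cases hp : p ∈ F.ξ.source
    · rw [Set.indicator_of_mem hp]
    · rw [Set.indicator_of_notMem hp, Frame.ofFun, if_neg hp]; simp
  rw [h2, h1]
  refine setLIntegral_congr_fun F.ξ.open_target.measurableSet fun z hz => ?_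
  simp only [F.rep_ofFun g hz]

theorem memLp_iff_nsq (hu : AEStronglyMeasurable u (C.hArea ω)) :
    MemLp u 2 (C.hArea ω) ↔ C.nsq ω u < ∞ := by
  rw [MemLp, eLpNorm_lt_top_iff_lintegral_rpow_enorm_lt_top (by norm_num) (by norm_num),
    and_iff_right hu]
  simp [nsq]

variable [T2Space X] [CompactSpace X]

theorem tendsto_of_nsq {x : ℕ → C.L2 ω} {y : C.L2 ω} {u : ℕ → X → ℂ}
    (hx : ∀ n, x n =ᵐ[C.hArea ω] u n) (hy : y =ᵐ[C.hArea ω] v)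
    (h : Tendsto (fun n => C.nsq ω fun p => u n p - v p) atTop (𝓝 0)) :
    Tendsto x atTop (𝓝 y) := by
  have h1 : ∀ n, ‖x n - y‖ₑ ^ 2 = C.nsq ω fun p => u n p - v p := fun n =>
    enorm_sq_eq_nsq ((Lp.coeFn_sub _ _).trans ((hx n).sub hy))
  simp only [← h1] at h
  have h2 : Tendsto (fun n => ‖x n - y‖ ^ 2) atTop (𝓝 0) := by
    have h3 := (ENNReal.tendsto_toReal ENNReal.zero_ne_top).comp h
    simpa [Function.comp_def, ENNReal.toReal_pow, toReal_enorm] using h3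
  rw [tendsto_iff_norm_sub_tendsto_zero]
  have h3 := h2.sqrt
  simpa using h3

include hω hz in
-- Tested against φ, the section u may be replaced by βu with β = 1 near supp φ and β = 0 near the
-- zeros. Then βu is a test section and the claim is the symmetry of Δ on test sections.
theorem mem_adjoint_of_smooth (hu : ∀ p ∉ zeros ω, C.SmoothAt u p) {x y : C.L2 ω}
    (hx : x =ᵐ[C.hArea ω] u) (hy : y =ᵐ[C.hArea ω] C.laplacian ω u) :
    (x, y) ∈ (C.testOperator ω (C.laplacian ω)).adjoint.graph := by
  have hxm : MemLp u 2 (C.hArea ω) := (memLp_congr_ae hx).1 (Lp.memLp x)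
  have hym : MemLp (C.laplacian ω u) 2 (C.hArea ω) := (memLp_congr_ae hy).1 (Lp.memLp y)
  have hL := flatOp_laplacian (C := C) hω
  rw [mem_graph_adjoint_testOperator hω hz hL]
  intro φ hφ
  have e1 : ∀ v w : X → ℂ, v =ᵐ[C.hArea ω] w → ∀ φ, C.ip ω φ v = C.ip ω φ w := fun v w h φ =>
    integral_congr_ae (by filter_upwards [h] with p hp; rw [hp])
  rw [e1 _ _ hx, e1 _ _ hy]
  refine hφ.induction (P := fun φ => C.ip ω (C.laplacian ω φ) u = C.ip ω φ (C.laplacian ω u)) ?_ ?_ ?_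
  · have : C.laplacian ω (fun _ => 0) = fun _ => 0 := by
      ext p; exact hL.zero EventuallyEq.rfl
    rw [this]; simp [ip]
  · intro φ ψ hφ hψ h1 h2
    rw [hL.add_test hω hφ hψ, ← conj_ip, ip_add_right hxm ((hL.isTestSection hω hφ).memLp hω)
      ((hL.isTestSection hω hψ).memLp hω), map_add, conj_ip, conj_ip, h1, h2,
      ← conj_ip (v := fun q => φ q + ψ q), ip_add_right hym (hφ.memLp hω) (hψ.memLp hω), map_add,
      conj_ip, conj_ip]
  · intro p hp
    obtain ⟨β, hβ, hβ1, hβs⟩ := exists_smoothFun_bump C (p := p) (U := (zeros ω)ᶜ)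
      (hz.isClosed.isOpen_compl.mem_nhds hp)
    refine ⟨{q | ∀ᶠ q' in 𝓝 q, β q' = 1}, hβ1.eventually_nhds, fun φ hφ hφs => ?_⟩
    have hts : C.IsTestSection ω fun q => β q * u q := by
      refine isTestSection_iff.2 ⟨fun q => ?_, ?_⟩
      · by_cases hq : q ∈ zeros ω
        · refine smoothAt_zero.congr ?_
          have : q ∉ tsupport β := fun h => hβs h hq
          filter_upwards [notMem_tsupport_iff_eventuallyEq.1 this] with q' hq'
          rw [hq']; simp
        · exact (hβ q).mul (hu q hq)
      · exact (Set.subset_compl_iff_disjoint_right.1 (tsupport_mul_subset_left.trans hβs))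
    have key : ∀ q ∈ tsupport φ, (fun q => β q * u q) =ᶠ[𝓝 q] u := fun q hq => by
      filter_upwards [hφs hq] with q' hq'
      rw [hq', one_mul]
    have h1 : C.ip ω (C.laplacian ω φ) u = C.ip ω (C.laplacian ω φ) fun q => β q * u q := by
      refine integral_congr_ae (ae_of_all _ fun q => ?_)
      by_cases hq : q ∈ tsupport φ
      · have := (key q hq).self_of_nhds
        simp only at this ⊢
        rw [this]
      · simp only [hL.zero (notMem_tsupport_iff_eventuallyEq.1 hq), map_zero, zero_mul]
    have h2 : C.ip ω φ (C.laplacian ω fun q => β q * u q) = C.ip ω φ (C.laplacian ω u) := by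
      refine integral_congr_ae (ae_of_all _ fun q => ?_)
      by_cases hq : q ∈ tsupport φ
      · have : C.laplacian ω (fun q => β q * u q) q = C.laplacian ω u q := by
          have h3 := rep_congr_of_eventuallyEq (C.chartFrame (C.idx q)) (mem_source_idx q) (key q hq)
          have h4 : ∀ f a b : ℂ → ℂ, ∀ z, a =ᶠ[𝓝 z] b → localLaplacian f a z = localLaplacian f b z := by
            intro f a b z h
            have : (fun y => ((‖f y‖⁻¹ : ℝ) : ℂ) * wirtDbar a y) =ᶠ[𝓝 z]
                fun y => ((‖f y‖⁻¹ : ℝ) : ℂ) * wirtDbar b y := by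
              filter_upwards [h.eventuallyEq_nhds] with y hy
              rw [hy.wirtDbar_eq]
            rw [localLaplacian, this.wirtD_eq, localLaplacian]
          exact h4 _ _ _ _ h3
        simp only [this]
      · simp only [image_eq_zero_of_notMem_tsupport hq, map_zero, zero_mul]
    rw [h1, ← h2, ip_laplacian hω hφ hts, ← conj_ip (v := C.laplacian ω φ), ip_laplacian hω hts hφ,
      conj_ip]

section Punctured

variable {P : X} {F : C.Frame} (hF : IsDistinguished ω P F.ξ) {g : ℂ → ℂ}

include hF in
theorem IsDistinguished.symm_zero : F.ξ.symm 0 = P := by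
  rw [← hF.2.2.1, F.ξ.left_inv hF.2.1]

include hF in
theorem IsDistinguished.zero_mem : (0 : ℂ) ∈ F.ξ.target := by
  rw [← hF.2.2.1]; exact F.ξ.map_source hF.2.1

include hF in
theorem IsDistinguished.notMem_zeros {z : ℂ} (hz : z ∈ F.ξ.target) (hz0 : z ≠ 0) :
    F.ξ.symm z ∉ zeros ω := fun h => by
  have h1 := (coeff_eq_zero_iff F.mem (F.ξ.map_target hz)).2 h
  rw [F.ξ.right_inv hz, hF.2.2.2.2 z hz] at h1
  exact hz0 h1

include hF in
theorem IsDistinguished.coord_ne_zero {p : X} (hp : p ∈ F.ξ.source) (hpP : p ≠ P) : F.ξ p ≠ 0 :=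
  fun h => hpP (by rw [← F.ξ.left_inv hp, h, IsDistinguished.symm_zero hF])

include hF in
theorem IsDistinguished.mem_zeros : P ∈ zeros ω :=
  (coeff_eq_zero_iff F.mem hF.2.1).1 (by
    rw [hF.2.2.2.2 _ (F.ξ.map_source hF.2.1), hF.2.2.1])

include hF in
theorem dbarOmega_ofFun (hg : ContDiffOn ℝ infty g {0}ᶜ) (hgc : HasCompactSupport g)
    (hgs : tsupport g ⊆ F.ξ.target) : C.dbarOmega ω (F.ofFun g) = F.ofFun (localDbar id g) := by
  ext p
  by_cases hp : p ∈ F.ξ.source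
  · by_cases hpP : p = P
    · subst hpP
      rw [Frame.ofFun, if_pos hp, hF.2.2.1, localDbar, id, map_zero, inv_zero, zero_mul, mul_zero,
        dbarOmega_eq, sectionOp, localDbar]
      have h1 : coeff ω (C.chart (C.idx p)) (C.chart (C.idx p) p) = 0 :=
        (coeff_eq_zero_iff (C.chart_mem _) (mem_source_idx p)).2 (IsDistinguished.mem_zeros hF)
      rw [h1, map_zero, inv_zero, zero_mul]
    · have h0 := IsDistinguished.coord_ne_zero hF hp hpP
      refine F.eq_of_rep_eq hp ?_
      rw [rep_dbarOmega F hp (F.smoothAt_ofFun' hgc hgs fun _ => hg.contDiffAt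
        (isOpen_compl_singleton.mem_nhds h0)), F.rep_ofFun _ (F.ξ.map_source hp), localDbar, localDbar,
        show F.f ω _ = _ from hF.2.2.2.2 _ (F.ξ.map_source hp), id]
      congr 1
      refine EventuallyEq.wirtDbar_eq ?_
      filter_upwards [F.ξ.open_target.mem_nhds (F.ξ.map_source hp)] with z hz
      exact F.rep_ofFun g hz
  · rw [Frame.ofFun, if_neg hp]
    exact flatOp_dbarOmega.zero (F.ofFun_eventuallyEq_zero hgc hgs fun h =>
      hp (F.image_symm_subset hgs h))

theorem measurable_of_continuousOn_punctured (hg : ContinuousOn g {0}ᶜ) : Measurable g := by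
  classical
  have h1 : ({0}ᶜ : Set ℂ).piecewise g (fun _ => g 0) = g := by
    ext z
    by_cases hz : z ∈ ({0}ᶜ : Set ℂ)
    · rw [Set.piecewise_eq_of_mem _ _ _ hz]
    · rw [Set.piecewise_eq_of_notMem _ _ _ hz, not_not.1 hz]
  rw [← h1]
  exact hg.measurable_piecewise continuousOn_const (measurableSet_singleton 0).compl

theorem continuousOn_wirtDbar_punctured (hg : ContDiffOn ℝ infty g {0}ᶜ) :
    ContinuousOn (wirtDbar g) {0}ᶜ := fun _ hz =>
  ((hg.contDiffAt (isOpen_compl_singleton.mem_nhds hz)).wirtDbar_infty.continuousAt).continuousWithinAt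

include hω hF in
/-- Dominated convergence in a distinguished frame. -/
theorem tendsto_nsq_ofFun {G : ℕ → ℂ → ℂ} (hG : ∀ n, Measurable (G n)) {K : ℝ}
    (hb : ∀ n z, z ∈ F.ξ.target → z ≠ 0 → ‖G n z‖ ≤ K * ‖z‖⁻¹)
    (hlim : ∀ z ∈ F.ξ.target, z ≠ 0 → ∀ᶠ n in atTop, G n z = 0) :
    Tendsto (fun n => C.nsq ω (F.ofFun (G n))) atTop (𝓝 0) := by
  obtain ⟨-, -, -, ⟨r, -, hr⟩, hf⟩ := id hF
  have h0 : ∀ᵐ z ∂((volume : Measure ℂ).restrict F.ξ.target), z ≠ 0 :=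
    ae_restrict_of_ae (by simpa using (Set.countable_singleton (0 : ℂ)).ae_notMem volume)
  have hmt := ae_restrict_mem (μ := (volume : Measure ℂ)) F.ξ.open_target.measurableSet
  -- In the distinguished coordinate the weight of h dS is |z|, so a bound K|z|⁻¹ on the functions
  -- gives the dominating function K²|z|⁻¹, integrable in the plane.
  have hlt : ∫⁻ z in F.ξ.target, ENNReal.ofReal (K ^ 2) * ENNReal.ofReal (‖z‖⁻¹) ≠ ∞ := by
    rw [lintegral_const_mul' _ _ ENNReal.ofReal_ne_top, hr]
    exact (ENNReal.mul_lt_top ENNReal.ofReal_lt_top (lintegral_norm_inv_lt_top r)).ne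
  have h1 := tendsto_lintegral_of_dominated_convergence' (μ := volume.restrict F.ξ.target)
    (F := fun n z => ‖G n z‖ₑ ^ 2 * ‖F.f ω z‖ₑ) (f := fun _ => 0) _
    (fun n => ((hG n).enorm.pow_const 2).aemeasurable.mul (F.aemeasurable_f hω).enorm) ?_ hlt ?_
  · simpa [F.nsq_ofFun hω (hG _)] using h1
  · intro n
    filter_upwards [h0, hmt] with z hz0 hzt
    have h2 := hb n z hzt hz0
    have hzn : 0 < ‖z‖ := norm_pos_iff.2 hz0
    rw [show F.f ω z = z from hf z hzt, ← ofReal_norm, ← ofReal_norm, ← ENNReal.ofReal_pow (norm_nonneg _),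
      ← ENNReal.ofReal_mul (by positivity), ← ENNReal.ofReal_mul (by positivity)]
    refine ENNReal.ofReal_le_ofReal ?_
    calc ‖G n z‖ ^ 2 * ‖z‖ ≤ (K * ‖z‖⁻¹) ^ 2 * ‖z‖ := by gcongr
      _ = K ^ 2 * ‖z‖⁻¹ := by field_simp
  · filter_upwards [h0, hmt] with z hz0 hzt
    refine tendsto_const_nhds.congr' ?_
    filter_upwards [hlim z hzt hz0] with n hn
    rw [hn]; simp

include hω hF in
theorem memLp_ofFun_of_bound (hg : Measurable g) {K : ℝ}
    (hb : ∀ z ∈ F.ξ.target, z ≠ 0 → ‖g z‖ ≤ K * ‖z‖⁻¹) : MemLp (F.ofFun g) 2 (C.hArea ω) := by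
  rw [memLp_iff_nsq (F.measurable_ofFun hg).aestronglyMeasurable, F.nsq_ofFun hω hg]
  obtain ⟨-, -, -, ⟨r, -, hr⟩, hf⟩ := id hF
  have h0 : ∀ᵐ z ∂((volume : Measure ℂ).restrict F.ξ.target), z ≠ 0 :=
    ae_restrict_of_ae (by simpa using (Set.countable_singleton (0 : ℂ)).ae_notMem volume)
  have hmt := ae_restrict_mem (μ := (volume : Measure ℂ)) F.ξ.open_target.measurableSet
  refine lt_of_le_of_lt (lintegral_mono_ae (g := fun z => ENNReal.ofReal (K ^ 2) * ENNReal.ofReal (‖z‖⁻¹)) ?_) ?_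
  · filter_upwards [h0, hmt] with z hz0 hzt
    have h2 := hb z hzt hz0
    have hzn : 0 < ‖z‖ := norm_pos_iff.2 hz0
    rw [show F.f ω z = z from hf z hzt, ← ofReal_norm, ← ofReal_norm, ← ENNReal.ofReal_pow (norm_nonneg _),
      ← ENNReal.ofReal_mul (by positivity), ← ENNReal.ofReal_mul (by positivity)]
    refine ENNReal.ofReal_le_ofReal ?_
    calc ‖g z‖ ^ 2 * ‖z‖ ≤ (K * ‖z‖⁻¹) ^ 2 * ‖z‖ := by gcongr
      _ = K ^ 2 * ‖z‖⁻¹ := by field_simp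
  · rw [lintegral_const_mul' _ _ ENNReal.ofReal_ne_top, hr]
    exact ENNReal.mul_lt_top ENNReal.ofReal_lt_top (lintegral_norm_inv_lt_top r)

theorem ofFun_sub (F : C.Frame) (a b : ℂ → ℂ) :
    (fun p => F.ofFun a p - F.ofFun b p) = F.ofFun fun z => a z - b z := by
  ext p
  by_cases hp : p ∈ F.ξ.source
  · rw [Frame.ofFun, Frame.ofFun, Frame.ofFun, if_pos hp, if_pos hp, if_pos hp, mul_sub]
  · rw [Frame.ofFun, Frame.ofFun, Frame.ofFun, if_neg hp, if_neg hp, if_neg hp, sub_zero]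

include hω hz hF in
-- The functions (1 - χ(k|z|²)) g vanish near the zero. The error in the derivative is z̄⁻¹(χ ∂̄g +
-- g ∂̄χ) up to sign: as |g| ≤ K|z| and |z||∂̄χ| ≤ M, it is bounded by a multiple of |z|⁻¹ uniformly
-- in k, and it is eventually zero at every z ≠ 0. Dominated convergence applies.
theorem mem_closure_of_bound (hg : ContDiffOn ℝ infty g {0}ᶜ) (hgc : HasCompactSupport g)
    (hgs : tsupport g ⊆ F.ξ.target) {K : ℝ} (hK : ∀ z ≠ 0, ‖g z‖ ≤ K * ‖z‖)
    (hK' : ∀ z ≠ 0, ‖wirtDbar g z‖ ≤ K) : ∃ x y : C.L2 ω,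
      x =ᵐ[C.hArea ω] F.ofFun g ∧ y =ᵐ[C.hArea ω] C.dbarOmega ω (F.ofFun g) ∧
      (x, y) ∈ (C.dbarOp ω).graph := by
  obtain ⟨-, -, -, ⟨r, hr0, hr⟩, hf⟩ := id hF
  have hgm : Measurable g := measurable_of_continuousOn_punctured hg.continuousOn
  have hK0 : 0 ≤ K := (norm_nonneg _).trans (hK' 1 one_ne_zero)
  have hDm : Measurable (localDbar id g) :=
    (Complex.continuous_conj.measurable.inv).mul
      (measurable_of_continuousOn_punctured (continuousOn_wirtDbar_punctured hg))
  have hDb : ∀ z ≠ 0, ‖localDbar id g z‖ ≤ K * ‖z‖⁻¹ := fun z hz => by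
    rw [localDbar, norm_mul, norm_inv, id, RCLike.norm_conj, mul_comm]
    gcongr; exact hK' z hz
  -- A crude bound, from |z| < r, that brings g itself under the same dominating function.
  have hgb : ∀ z ∈ F.ξ.target, z ≠ 0 → ‖g z‖ ≤ K * r ^ 2 * ‖z‖⁻¹ := fun z hzt hz => by
    refine (hK z hz).trans ?_
    have hzn : 0 < ‖z‖ := norm_pos_iff.2 hz
    have hzr : ‖z‖ < r := by rw [hr] at hzt; exact mem_ball_zero_iff.1 hzt
    rw [mul_assoc]
    gcongr
    rw [← div_eq_mul_inv, le_div_iff₀ hzn]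
    nlinarith
  have hD : C.dbarOmega ω (F.ofFun g) = F.ofFun (localDbar id g) := dbarOmega_ofFun hF hg hgc hgs
  have hx := memLp_ofFun_of_bound hω hF hgm hgb
  have hy := memLp_ofFun_of_bound hω hF hDm fun z _ hz => hDb z hz
  refine ⟨hx.toLp _, hy.toLp _, hx.coeFn_toLp, by rw [hD]; exact hy.coeFn_toLp, ?_⟩
  -- approximation by test sections
  set gk : ℕ → ℂ → ℂ := fun k z => (1 - cutC k z) * g z with hgk
  have hgk0 : ∀ k, gk k =ᶠ[𝓝 0] fun _ => 0 := fun k => by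
    filter_upwards [cutC_eventually_one k] with z hz
    simp [hgk, hz]
  have hgks : ∀ k, ContDiff ℝ infty (gk k) := fun k => contDiff_iff_contDiffAt.2 fun z => by
    by_cases hz : z = 0
    · subst hz; exact contDiffAt_const.congr_of_eventuallyEq (hgk0 k)
    · exact (contDiffAt_const.sub (contDiff_cutC k).contDiffAt).mul
        (hg.contDiffAt (isOpen_compl_singleton.mem_nhds hz))
  have hgkt : ∀ k, tsupport (gk k) ⊆ tsupport g := fun k => tsupport_mul_subset_right
  have hgkc : ∀ k, HasCompactSupport (gk k) := fun k => hgc.mul_left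
  have htest : ∀ k, C.IsTestSection ω (F.ofFun (gk k)) := fun k =>
    F.isTestSection_ofFun (hgks k) (hgkc k) ((hgkt k).trans hgs) fun z hz => by
      rw [show F.f ω _ = _ from hf z (hgs (hgkt k hz))]
      rintro rfl
      exact notMem_tsupport_iff_eventuallyEq.2 (hgk0 k) hz
  have hDk : ∀ k, C.dbarOmega ω (F.ofFun (gk k)) = F.ofFun (localDbar id (gk k)) := fun k =>
    dbarOmega_ofFun hF (hgks k).contDiffOn (hgkc k) ((hgkt k).trans hgs)
  choose xk hxk using fun k => (htest k).exists_toLp hω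
  choose yk hyk using fun k => (flatOp_dbarOmega.isTestSection hω (htest k)).exists_toLp hω
  refine (UnboundedOp.mem_graph_closure_iff_seq (closable_dbarOmega hω hz)).2 ⟨xk, yk, fun k =>
    (mem_graph_testOperator hω hz flatOp_dbarOmega).2 ⟨_, htest k, hxk k, hyk k⟩, ?_, ?_⟩
  · refine tendsto_of_nsq hxk hx.coeFn_toLp ?_
    simp only [ofFun_sub]
    refine tendsto_nsq_ofFun hω hF (fun k => (hgks k).continuous.measurable.sub hgm) (K := K * r ^ 2) ?_ ?_
    · intro k z hzt hz
      have : gk k z - g z = -(cutC k z * g z) := by simp only [hgk]; ring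
      rw [this, norm_neg, norm_mul]
      exact (mul_le_of_le_one_left (norm_nonneg _) (norm_cutC_le _ _)).trans (hgb z hzt hz)
    · intro z _ hz
      filter_upwards [cutC_eventually_zero hz] with k hk
      simp only [hgk, hk.self_of_nhds]; ring
  · obtain ⟨M, hM0, hM⟩ := exists_bound_mul_deriv_cutR
    refine tendsto_of_nsq hyk hy.coeFn_toLp ?_
    simp only [hDk, ofFun_sub]
    have hDkm : ∀ k, Measurable (localDbar id (gk k)) := fun k =>
      (Complex.continuous_conj.measurable.inv).mul (continuous_wirtDbar (hgks k)).measurable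
    refine tendsto_nsq_ofFun hω hF (fun k => (hDkm k).sub hDm) (K := K + M * K) ?_ ?_
    · intro k z hzt hz
      have hzn : 0 < ‖z‖ := norm_pos_iff.2 hz
      have hgd := differentiableAt_of_contDiffAt_infty (hg.contDiffAt (isOpen_compl_singleton.mem_nhds hz))
      have hcd : DifferentiableAt ℝ (cutC k) z := (contDiff_cutC k).differentiable (by simp) z
      have h1 : wirtDbar (gk k) z = (1 - cutC k z) * wirtDbar g z - wirtDbar (cutC k) z * g z := by
        have h2 : wirtDbar (fun z => 1 - cutC k z) z = -wirtDbar (cutC k) z := by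
          rw [wirtDbar_sub (differentiableAt_const _) hcd, wirtDbar_const, zero_sub]
        have h3 := wirtDbar_mul (f := fun z => 1 - cutC k z) (g := g) (z := z)
          ((differentiableAt_const _).sub hcd) hgd
        rw [h2] at h3
        rw [hgk, h3]; ring
      have h2 : localDbar id (gk k) z - localDbar id g z =
          -((conj z)⁻¹ * (cutC k z * wirtDbar g z + wirtDbar (cutC k) z * g z)) := by
        rw [localDbar, localDbar, h1, id]; ring
      have h3 : ‖wirtDbar (cutC k) z * g z‖ ≤ M * K := by
        rw [wirtDbar_cutC, norm_mul, norm_mul, Complex.norm_real, Real.norm_eq_abs]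
        have h4 := hM (k * Complex.normSq z) (mul_nonneg (Nat.cast_nonneg _) (Complex.normSq_nonneg _))
        rw [Complex.normSq_eq_norm_sq] at h4 ⊢
        calc _ ≤ |deriv cutR (k * ‖z‖ ^ 2) * k| * ‖z‖ * (K * ‖z‖) := by gcongr; exact hK z hz
          _ = |(k * ‖z‖ ^ 2) * deriv cutR (k * ‖z‖ ^ 2)| * K := by
            rw [abs_mul, abs_mul, abs_mul, abs_of_nonneg (sq_nonneg ‖z‖)]; ring
          _ ≤ M * K := by gcongr
      have h5 : ‖cutC k z * wirtDbar g z‖ ≤ K := by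
        rw [norm_mul]
        exact (mul_le_of_le_one_left (norm_nonneg _) (norm_cutC_le _ _)).trans (hK' z hz)
      rw [h2, norm_neg, norm_mul, norm_inv, RCLike.norm_conj, mul_comm]
      gcongr
      exact (norm_add_le _ _).trans (add_le_add h5 h3)
    · intro z _ hz
      filter_upwards [cutC_eventually_zero hz] with k hk
      have : gk k =ᶠ[𝓝 z] g := by
        filter_upwards [hk] with y hy
        simp [hgk, hy]
      rw [localDbar, localDbar, this.wirtDbar_eq, sub_self]

end Punctured

end SpinBundle

end RiemannSurface

end

noncomputable section

set_option linter.unusedSectionVars false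

/-! ### Model functions `xⁿ |x|²ᵉ` near a zero -/

section Model

open Complex RiemannSurface RiemannSurface.SpinBundle

local notation "infty" => ((⊤ : ℕ∞) : WithTop ℕ∞)

/-- The rescaled cutoff function. -/
def cutA (a t : ℝ) : ℝ := cutR (a * t)

/-- The function `zⁿ |z|²ᵉ`, cut off outside `a |z|² ≤ 2`. -/
def radialModel (a : ℝ) (n : ℤ) (e : ℝ) (z : ℂ) : ℂ :=
  z ^ n * ((cutA a (normSq z) * normSq z ^ e : ℝ) : ℂ)

/-- Every term contains a derivative of the cutoff. The term with the cutoff itself has the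
coefficient e(n + e - 1/2), which is zero for the exponents in use. -/
def lapProfile (a : ℝ) (n : ℤ) (e t : ℝ) : ℝ :=
  deriv (deriv (cutA a)) t * t ^ (e + 1 / 2) +
    (n + 1 / 2 + 2 * e) * deriv (cutA a) t * t ^ (e - 1 / 2)

/-- The Laplacian of `radialModel`. -/
def radialModelLap (a : ℝ) (n : ℤ) (e : ℝ) (z : ℂ) : ℂ :=
  -(((‖z‖⁻¹ : ℝ) : ℂ) * (z ^ n * ((lapProfile a n e (normSq z) : ℝ) : ℂ)))

variable {a : ℝ} {n m : ℤ} {e e' : ℝ} {z : ℂ}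

theorem contDiff_cutA : ContDiff ℝ infty (cutA a) := contDiff_cutR.comp (contDiff_const.mul contDiff_id)

theorem contDiff_deriv_cutA : ContDiff ℝ infty (deriv (cutA a)) :=
  (contDiff_infty_iff_deriv.1 contDiff_cutA).2

theorem contDiff_deriv2_cutA : ContDiff ℝ infty (deriv (deriv (cutA a))) :=
  (contDiff_infty_iff_deriv.1 contDiff_deriv_cutA).2

theorem hasDerivAt_cutA (t : ℝ) : HasDerivAt (cutA a) (deriv (cutA a) t) t :=
  (contDiff_cutA.differentiable (by simp) t).hasDerivAt

theorem hasDerivAt_deriv_cutA (t : ℝ) : HasDerivAt (deriv (cutA a)) (deriv (deriv (cutA a)) t) t :=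
  (contDiff_deriv_cutA.differentiable (by simp) t).hasDerivAt

theorem cutA_of_le {t : ℝ} (h : a * t ≤ 1) : cutA a t = 1 := cutR_of_le h

theorem cutA_of_ge {t : ℝ} (h : 2 ≤ a * t) : cutA a t = 0 := cutR_of_ge h

theorem deriv_cutA_eventuallyEq_of_lt {t : ℝ} (h : a * t < 1) : deriv (cutA a) =ᶠ[𝓝 t] fun _ => 0 := by
  have h1 : ∀ᶠ s in 𝓝 t, a * s < 1 :=
    (continuous_const.mul continuous_id).continuousAt.eventually (gt_mem_nhds h)
  have h2 : cutA a =ᶠ[𝓝 t] fun _ => 1 := h1.mono fun s hs => cutA_of_le hs.le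
  filter_upwards [h2.eventuallyEq_nhds] with s hs
  rw [hs.deriv_eq, deriv_const]

theorem deriv_cutA_eventuallyEq_of_gt {t : ℝ} (h : 2 < a * t) : deriv (cutA a) =ᶠ[𝓝 t] fun _ => 0 := by
  have h1 : ∀ᶠ s in 𝓝 t, 2 < a * s :=
    (continuous_const.mul continuous_id).continuousAt.eventually (lt_mem_nhds h)
  have h2 : cutA a =ᶠ[𝓝 t] fun _ => 0 := h1.mono fun s hs => cutA_of_ge hs.le
  filter_upwards [h2.eventuallyEq_nhds] with s hs
  rw [hs.deriv_eq, deriv_const]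

theorem lapProfile_of_lt {t : ℝ} (h : a * t < 1) : lapProfile a n e t = 0 := by
  have h1 := deriv_cutA_eventuallyEq_of_lt h
  rw [lapProfile, h1.self_of_nhds, h1.deriv_eq]; simp

theorem lapProfile_of_gt {t : ℝ} (h : 2 < a * t) : lapProfile a n e t = 0 := by
  have h1 := deriv_cutA_eventuallyEq_of_gt h
  rw [lapProfile, h1.self_of_nhds, h1.deriv_eq]; simp

theorem radialModel_of_le (h : a * normSq z ≤ 1) :
    radialModel a n e z = z ^ n * ((normSq z ^ e : ℝ) : ℂ) := by
  rw [radialModel, cutA_of_le h, one_mul]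

theorem radialModel_of_ge (h : 2 ≤ a * normSq z) : radialModel a n e z = 0 := by
  rw [radialModel, cutA_of_ge h, zero_mul, ofReal_zero, mul_zero]

theorem radialModelLap_of_lt (h : a * normSq z < 1) : radialModelLap a n e z = 0 := by
  rw [radialModelLap, lapProfile_of_lt h]; simp

theorem radialModelLap_of_gt (h : 2 < a * normSq z) : radialModelLap a n e z = 0 := by
  rw [radialModelLap, lapProfile_of_gt h]; simp

theorem isClosed_normSq_le : IsClosed {z : ℂ | a * normSq z ≤ 2} :=
  isClosed_le (continuous_const.mul continuous_normSq) continuous_const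

theorem isCompact_normSq_le (ha : 0 < a) : IsCompact {z : ℂ | a * normSq z ≤ 2} := by
  refine Metric.isCompact_of_isClosed_isBounded isClosed_normSq_le ?_
  refine (Metric.isBounded_closedBall (x := (0 : ℂ)) (r := 2 / a + 1)).subset fun z hz => ?_
  rw [mem_closedBall_zero_iff]
  have hz' : a * normSq z ≤ 2 := hz
  rw [normSq_eq_norm_sq, mul_comm, ← le_div_iff₀ ha] at hz'
  nlinarith [sq_nonneg (‖z‖ - 1)]

theorem tsupport_radialModel_subset : tsupport (radialModel a n e) ⊆ {z | a * normSq z ≤ 2} :=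
  closure_minimal (fun _ hz => not_lt.1 fun h => hz (radialModel_of_ge h.le)) isClosed_normSq_le

theorem tsupport_radialModelLap_subset : tsupport (radialModelLap a n e) ⊆ {z | a * normSq z ≤ 2} :=
  closure_minimal (fun _ hz => not_lt.1 fun h => hz (radialModelLap_of_gt h)) isClosed_normSq_le

theorem hasCompactSupport_radialModel (ha : 0 < a) : HasCompactSupport (radialModel a n e) :=
  (isCompact_normSq_le ha).of_isClosed_subset (isClosed_tsupport _) tsupport_radialModel_subset

theorem hasCompactSupport_radialModelLap (ha : 0 < a) : HasCompactSupport (radialModelLap a n e) :=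
  (isCompact_normSq_le ha).of_isClosed_subset (isClosed_tsupport _) tsupport_radialModelLap_subset

theorem contDiffAt_zpow_real (hz : z ≠ 0) : ContDiffAt ℝ infty (fun y : ℂ => y ^ n) z := by
  have h : ContDiffAt ℂ infty (fun y : ℂ => y ^ n) z :=
    (DifferentiableOn.analyticAt (s := {0}ᶜ) (fun y hy =>
      (differentiableAt_zpow.2 (Or.inl hy)).differentiableWithinAt)
      (isOpen_compl_singleton.mem_nhds hz)).contDiffAt
  exact h.restrict_scalars ℝ

theorem contDiffAt_normSq_rpow (hz : z ≠ 0) (e : ℝ) : ContDiffAt ℝ infty (fun y : ℂ => normSq y ^ e) z :=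
  contDiff_normSq.contDiffAt.rpow_const_of_ne (normSq_pos.2 hz).ne'

theorem contDiffOn_radialModel : ContDiffOn ℝ infty (radialModel a n e) {0}ᶜ := fun z hz =>
  ((contDiffAt_zpow_real hz).mul (ofRealCLM.contDiff.contDiffAt.comp z
    ((contDiff_cutA.comp contDiff_normSq).contDiffAt.mul (contDiffAt_normSq_rpow hz e)))).contDiffWithinAt

theorem radialModelLap_eventuallyEq_zero : radialModelLap a n e =ᶠ[𝓝 0] fun _ => 0 := by
  have h1 : Tendsto (fun z : ℂ => a * normSq z) (𝓝 0) (𝓝 (a * normSq 0)) :=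
    (continuous_const.mul continuous_normSq).tendsto 0
  rw [map_zero, mul_zero] at h1
  filter_upwards [h1.eventually (gt_mem_nhds zero_lt_one)] with z hz using radialModelLap_of_lt hz

theorem contDiff_radialModelLap : ContDiff ℝ infty (radialModelLap a n e) := by
  refine contDiff_iff_contDiffAt.2 fun z => ?_
  by_cases hz : z = 0
  · subst hz
    exact contDiffAt_const.congr_of_eventuallyEq radialModelLap_eventuallyEq_zero
  · have h1 : ContDiffAt ℝ infty (fun y : ℂ => lapProfile a n e (normSq y)) z :=
      ((contDiff_deriv2_cutA.comp contDiff_normSq).contDiffAt.mul (contDiffAt_normSq_rpow hz _)).add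
        ((contDiffAt_const.mul (contDiff_deriv_cutA.comp contDiff_normSq).contDiffAt).mul
          (contDiffAt_normSq_rpow hz _))
    have h2 : ContDiffAt ℝ infty (fun y : ℂ => ‖y‖⁻¹) z :=
      (contDiffAt_norm ℝ hz).inv (norm_ne_zero_iff.2 hz)
    exact ((ofRealCLM.contDiff.contDiffAt.comp z h2).mul
      ((contDiffAt_zpow_real hz).mul (ofRealCLM.contDiff.contDiffAt.comp z h1))).neg

theorem wirtDbar_zpow_mul_radial {q : ℝ → ℝ} {q' : ℝ} (hz : z ≠ 0) (hq : HasDerivAt q q' (normSq z)) :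
    wirtDbar (fun y => y ^ n * ((q (normSq y) : ℝ) : ℂ)) z = z ^ n * ((q' : ℂ) * z) := by
  have h1 : DifferentiableAt ℂ (fun y : ℂ => y ^ n) z := differentiableAt_zpow.2 (Or.inl hz)
  have h2 : DifferentiableAt ℝ (fun y : ℂ => ((q (normSq y) : ℝ) : ℂ)) z :=
    ofRealCLM.differentiableAt.comp z (hq.differentiableAt.comp z
      (contDiff_normSq.differentiable (by simp) z))
  rw [wirtDbar_mul (h1.restrictScalars ℝ) h2, h1.wirtDbar_eq, zero_mul, zero_add,
    wirtDbar_normSq_comp (p := fun t => ((q t : ℝ) : ℂ)) hq.ofReal_comp]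

theorem wirtD_zpow_mul_radial {q : ℝ → ℝ} {q' : ℝ} (hz : z ≠ 0) (hq : HasDerivAt q q' (normSq z)) :
    wirtD (fun y => y ^ n * ((q (normSq y) : ℝ) : ℂ)) z =
      n * z ^ (n - 1) * q (normSq z) + z ^ n * ((q' : ℂ) * starRingEnd ℂ z) := by
  have h1 : DifferentiableAt ℂ (fun y : ℂ => y ^ n) z := differentiableAt_zpow.2 (Or.inl hz)
  have h2 : DifferentiableAt ℝ (fun y : ℂ => ((q (normSq y) : ℝ) : ℂ)) z :=
    ofRealCLM.differentiableAt.comp z (hq.differentiableAt.comp z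
      (contDiff_normSq.differentiable (by simp) z))
  rw [wirtD_mul (h1.restrictScalars ℝ) h2, h1.wirtD_eq,
    wirtD_normSq_comp (p := fun t => ((q t : ℝ) : ℂ)) hq.ofReal_comp, (hasDerivAt_zpow n z (Or.inl hz)).deriv]

theorem hasDerivAt_mul_rpow {f : ℝ → ℝ} {f' t : ℝ} (ht : 0 < t) (hf : HasDerivAt f f' t) (e : ℝ) :
    HasDerivAt (fun t => f t * t ^ e) (f' * t ^ e + f t * (e * t ^ (e - 1))) t :=
  hf.mul (Real.hasDerivAt_rpow_const (Or.inl ht.ne'))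

theorem wirtDbar_radialModel (hz : z ≠ 0) : wirtDbar (radialModel a n e) z =
    z ^ n * (((deriv (cutA a) (normSq z) * normSq z ^ e +
      cutA a (normSq z) * (e * normSq z ^ (e - 1)) : ℝ) : ℂ) * z) :=
  wirtDbar_zpow_mul_radial hz (hasDerivAt_mul_rpow (normSq_pos.2 hz) (hasDerivAt_cutA _) e)

theorem normSq_rpow_half (z : ℂ) : normSq z ^ (1 / 2 : ℝ) = ‖z‖ := by
  rw [← Real.sqrt_eq_rpow]; rfl

/-- The condition on e is the indicial equation: xⁿ|x|^{2e} is harmonic for e = 0 (holomorphic) and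
for e = 1/2 - n (where |x|⁻¹∂̄u is antiholomorphic). Only derivatives of the cutoff survive. -/
theorem localLaplacian_radialModel (he : e * (n + e - 1 / 2) = 0) (hz : z ≠ 0) :
    localLaplacian id (radialModel a n e) z = radialModelLap a n e z := by
  -- The radial profile of |z|⁻¹∂̄u, which is z^{n+1} q(|z|²); applying ∂ to this product gives
  -- zⁿ((n+1)q + |z|²q').
  set q : ℝ → ℝ := fun t => deriv (cutA a) t * t ^ (e - 1 / 2) + e * (cutA a t * t ^ (e - 3 / 2)) with hq
  have key : (fun y => ((‖id y‖⁻¹ : ℝ) : ℂ) * wirtDbar (radialModel a n e) y) =ᶠ[𝓝 z]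
      fun y => y ^ (n + 1) * ((q (normSq y) : ℝ) : ℂ) := by
    filter_upwards [isOpen_compl_singleton.mem_nhds hz] with y hy
    have hy0 : y ≠ 0 := hy
    have ht : 0 < normSq y := normSq_pos.2 hy0
    have hn : 0 < ‖y‖ := norm_pos_iff.2 hy0
    have h1 : normSq y ^ (e - 1 / 2) = ‖y‖⁻¹ * normSq y ^ e := by
      rw [Real.rpow_sub ht, normSq_rpow_half]; field_simp
    have h2 : normSq y ^ (e - 3 / 2) = ‖y‖⁻¹ * normSq y ^ (e - 1) := by
      rw [show e - 3 / 2 = (e - 1) - 1 / 2 by ring, Real.rpow_sub ht, normSq_rpow_half]; field_simp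
    rw [wirtDbar_radialModel hy0, hq, zpow_add_one₀ hy0, id]
    simp only [h1, h2]
    push_cast
    ring
  have ht : 0 < normSq z := normSq_pos.2 hz
  have hn : 0 < ‖z‖ := norm_pos_iff.2 hz
  obtain ⟨q', hd, hm⟩ : ∃ q', HasDerivAt q q' (normSq z) ∧
      ((n : ℝ) + 1) * q (normSq z) + ‖z‖ ^ 2 * q' = lapProfile a n e (normSq z) := by
    refine ⟨_, (hasDerivAt_mul_rpow ht (hasDerivAt_deriv_cutA (a := a) _) (e - 1 / 2)).add
      ((hasDerivAt_mul_rpow ht (hasDerivAt_cutA (a := a) _) (e - 3 / 2)).const_mul e), ?_⟩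
    have h1 : normSq z ^ (e - 1 / 2) = normSq z ^ e * ‖z‖⁻¹ := by
      rw [Real.rpow_sub ht, normSq_rpow_half]; field_simp
    have h2 : normSq z ^ (e - 1 / 2 - 1) = normSq z ^ e * (‖z‖ ^ 3)⁻¹ := by
      rw [Real.rpow_sub ht, h1, Real.rpow_one, normSq_eq_norm_sq]; field_simp
    have h3 : normSq z ^ (e - 3 / 2) = normSq z ^ e * (‖z‖ ^ 3)⁻¹ := by
      rw [← h2]; congr 1; ring
    have h4 : normSq z ^ (e - 3 / 2 - 1) = normSq z ^ e * (‖z‖ ^ 5)⁻¹ := by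
      rw [Real.rpow_sub ht, h3, Real.rpow_one, normSq_eq_norm_sq]; field_simp
    have h5 : normSq z ^ (e + 1 / 2) = normSq z ^ e * ‖z‖ := by
      rw [Real.rpow_add ht, normSq_rpow_half]
    simp only [hq, lapProfile]
    rw [h1, h2, h3, h4, h5]
    generalize normSq z ^ e = T
    field_simp
    linear_combination (2 * cutA a (normSq z)) * T * he
  have hconj : z * starRingEnd ℂ z = ((‖z‖ ^ 2 : ℝ) : ℂ) := by
    rw [mul_conj, normSq_eq_norm_sq]
  rw [localLaplacian, key.wirtD_eq, wirtD_zpow_mul_radial hz hd, radialModelLap, id, ← hm,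
    show n + 1 - 1 = n by ring, zpow_add_one₀ hz]
  have hnc : (‖z‖ : ℂ) ≠ 0 := by exact_mod_cast hn.ne'
  push_cast at hconj ⊢
  rw [show ∀ w : ℂ, z ^ n * z * (q' * w) = z ^ n * q' * (z * w) by intro w; ring, hconj]
  field_simp

end Model
end

/-! ### Growth of the model functions at the origin -/

noncomputable section

set_option linter.unusedSectionVars false

section Model

open Complex RiemannSurface RiemannSurface.SpinBundle

variable {a : ℝ} {n m : ℤ} {e e' : ℝ} {z : ℂ}

theorem norm_zpow_mul_rpow (hz : z ≠ 0) (n : ℤ) (e : ℝ) :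
    ‖z‖ ^ n * normSq z ^ e = ‖z‖ ^ (n + 2 * e) := by
  have hn : 0 < ‖z‖ := norm_pos_iff.2 hz
  rw [normSq_eq_norm_sq, ← Real.rpow_natCast, ← Real.rpow_mul hn.le, ← Real.rpow_intCast,
    ← Real.rpow_add hn]
  norm_num

theorem exists_bound_norm_of_normSq_le (ha : 0 < a) : ∃ R : ℝ, 0 < R ∧ ∀ z, a * normSq z ≤ 2 → ‖z‖ ≤ R := by
  obtain ⟨R, hR, h⟩ := (isCompact_normSq_le ha).isBounded.exists_pos_norm_le
  exact ⟨R, hR, fun z hz => h z hz⟩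

theorem rpow_le_mul_rpow {r R s t : ℝ} (hr : 0 < r) (hR : r ≤ R) (hst : t ≤ s) :
    r ^ s ≤ R ^ (s - t) * r ^ t := by
  have : r ^ s = r ^ (s - t) * r ^ t := by rw [← Real.rpow_add hr]; congr 1; ring
  rw [this]
  gcongr

theorem exists_bound_radialModel (ha : 0 < a) {s : ℝ} (hs : s ≤ n + 2 * e) :
    ∃ K : ℝ, 0 ≤ K ∧ ∀ z ≠ 0, ‖radialModel a n e z‖ ≤ K * ‖z‖ ^ s := by
  obtain ⟨R, hR, h⟩ := exists_bound_norm_of_normSq_le ha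
  refine ⟨R ^ (n + 2 * e - s), by positivity, fun z hz => ?_⟩
  have hn : 0 < ‖z‖ := norm_pos_iff.2 hz
  by_cases h2 : a * normSq z ≤ 2
  · refine le_trans ?_ (rpow_le_mul_rpow hn (h z h2) hs)
    rw [← norm_zpow_mul_rpow hz, radialModel, norm_mul, norm_zpow, norm_real, norm_mul,
      Real.norm_of_nonneg (Real.rpow_nonneg (normSq_nonneg z) e)]
    gcongr
    exact mul_le_of_le_one_left (Real.rpow_nonneg (normSq_nonneg z) e) (abs_cutR_le _)
  · rw [radialModel_of_ge (not_le.1 h2).le, norm_zero]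
    positivity

theorem exists_bound_deriv_cutA (ha : 0 < a) : ∃ M : ℝ, 0 ≤ M ∧ ∀ t, 0 ≤ t → |deriv (cutA a) t| ≤ M := by
  obtain ⟨M, hM⟩ := (isCompact_Icc (a := (0 : ℝ)) (b := 2 / a)).exists_bound_of_continuousOn
    (contDiff_deriv_cutA (a := a)).continuous.continuousOn
  have hM0 : 0 ≤ M := (norm_nonneg _).trans (hM 0 ⟨le_rfl, by positivity⟩)
  refine ⟨M, hM0, fun t ht => ?_⟩
  by_cases h2 : t ≤ 2 / a
  · exact hM t ⟨ht, h2⟩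
  · rw [not_le, div_lt_iff₀' ha] at h2
    rw [(deriv_cutA_eventuallyEq_of_gt h2).self_of_nhds, abs_zero]
    exact hM0

theorem exists_bound_wirtDbar_radialModel (ha : 0 < a) (hs : 1 ≤ n + 2 * e) :
    ∃ K : ℝ, 0 ≤ K ∧ ∀ z ≠ 0, ‖wirtDbar (radialModel a n e) z‖ ≤ K := by
  obtain ⟨R, hR, h⟩ := exists_bound_norm_of_normSq_le ha
  obtain ⟨M, hM0, hM⟩ := exists_bound_deriv_cutA ha
  refine ⟨M * (R ^ (n + 2 * e) * R) + |e| * R ^ (n + 2 * e - 1), by positivity, fun z hz => ?_⟩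
  have hn : 0 < ‖z‖ := norm_pos_iff.2 hz
  have ht := normSq_pos.2 hz
  rw [wirtDbar_radialModel hz]
  by_cases h2 : a * normSq z ≤ 2
  · have hzR := h z h2
    have e1 : z ^ n * (((deriv (cutA a) (normSq z) * normSq z ^ e +
        cutA a (normSq z) * (e * normSq z ^ (e - 1)) : ℝ) : ℂ) * z) =
        z ^ n * ((deriv (cutA a) (normSq z) * normSq z ^ e : ℝ) : ℂ) * z +
        z ^ n * ((cutA a (normSq z) * e * normSq z ^ (e - 1) : ℝ) : ℂ) * z := by
      push_cast; ring
    have e2 : ‖z‖ ^ n * normSq z ^ (e - 1) * ‖z‖ = ‖z‖ ^ (n + 2 * e - 1) := by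
      rw [norm_zpow_mul_rpow hz]
      nth_rewrite 2 [← Real.rpow_one ‖z‖]
      rw [← Real.rpow_add hn]; congr 1; ring
    rw [e1]
    refine (norm_add_le _ _).trans (add_le_add ?_ ?_)
    · rw [norm_mul, norm_mul, norm_zpow, norm_real, norm_mul, Real.norm_eq_abs,
        Real.norm_of_nonneg (Real.rpow_nonneg ht.le e)]
      calc ‖z‖ ^ n * (|deriv (cutA a) (normSq z)| * normSq z ^ e) * ‖z‖
          = |deriv (cutA a) (normSq z)| * (‖z‖ ^ (n + 2 * e) * ‖z‖) := by
            rw [← norm_zpow_mul_rpow hz]; ring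
        _ ≤ M * (R ^ (n + 2 * e) * R) := by
            gcongr
            exact hM _ ht.le
    · rw [norm_mul, norm_mul, norm_zpow, norm_real, norm_mul, norm_mul, Real.norm_eq_abs e,
        Real.norm_of_nonneg (Real.rpow_nonneg ht.le (e - 1))]
      calc ‖z‖ ^ n * (‖cutA a (normSq z)‖ * |e| * normSq z ^ (e - 1)) * ‖z‖
          = ‖cutA a (normSq z)‖ * (|e| * ‖z‖ ^ (n + 2 * e - 1)) := by rw [← e2]; ring
        _ ≤ 1 * (|e| * R ^ (n + 2 * e - 1)) := by
            gcongr
            exact abs_cutR_le _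
        _ = _ := one_mul _
  · rw [(deriv_cutA_eventuallyEq_of_gt (not_le.1 h2)).self_of_nhds, cutA_of_ge (not_le.1 h2).le]
    simp only [zero_mul, add_zero, ofReal_zero, mul_zero, norm_zero]
    positivity

/-! ### The boundary form on model functions -/

/-- The condition on e + e' says that the two exponents are the two roots of the indicial equation
for degree n, or have the same sum. All powers of |z| then cancel, and the integrand is a constant
multiple of the derivative of χ² evaluated at |z|². -/
theorem boundary_density (hz : z ≠ 0) (he : e + e' + n = 1 / 2) :
    starRingEnd ℂ (radialModelLap a n e z) * radialModel a n e' z * ((‖z‖ : ℝ) : ℂ) -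
      starRingEnd ℂ (radialModel a n e z) * radialModelLap a n e' z * ((‖z‖ : ℝ) : ℂ) =
      (((e' - e) * (2 * cutA a (normSq z) * deriv (cutA a) (normSq z)) : ℝ) : ℂ) := by
  have hn : 0 < ‖z‖ := norm_pos_iff.2 hz
  have ht := normSq_pos.2 hz
  have h1 : starRingEnd ℂ z ^ n * z ^ n = ((normSq z ^ (n : ℝ) : ℝ) : ℂ) := by
    rw [← mul_zpow, ← normSq_eq_conj_mul_self, Real.rpow_intCast]; norm_cast
  have h2 : normSq z ^ (n : ℝ) * (normSq z ^ e * normSq z ^ e') = ‖z‖ := by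
    rw [← Real.rpow_add ht, ← Real.rpow_add ht, ← normSq_rpow_half]
    congr 1; linarith
  have h3 : ∀ e, lapProfile a n e (normSq z) = deriv (deriv (cutA a)) (normSq z) * (normSq z ^ e * ‖z‖) +
      (n + 1 / 2 + 2 * e) * deriv (cutA a) (normSq z) * (normSq z ^ e * ‖z‖⁻¹) := fun e => by
    rw [lapProfile, Real.rpow_add ht, Real.rpow_sub ht, normSq_rpow_half]; ring
  have key : ‖z‖⁻¹ * ‖z‖ * (normSq z ^ (n : ℝ)) * (cutA a (normSq z) * normSq z ^ e *
      lapProfile a n e' (normSq z) - lapProfile a n e (normSq z) * (cutA a (normSq z) * normSq z ^ e')) =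
      (e' - e) * (2 * cutA a (normSq z) * deriv (cutA a) (normSq z)) := by
    rw [h3, h3]
    have : ‖z‖⁻¹ * ‖z‖ = 1 := inv_mul_cancel₀ hn.ne'
    linear_combination (cutA a (normSq z) * normSq z ^ (n:ℝ) * normSq z ^ e * normSq z ^ e' *
      (2 * (e' - e)) * deriv (cutA a) (normSq z) * ‖z‖⁻¹ + (e' - e) * (2 * cutA a (normSq z) * deriv (cutA a) (normSq z))) * this +
      (cutA a (normSq z) * (2 * (e' - e)) * deriv (cutA a) (normSq z) * ‖z‖⁻¹) * h2
  rw [← key]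
  simp only [radialModel, radialModelLap, map_neg, map_mul, map_zpow₀, conj_ofReal]
  push_cast
  linear_combination ((‖z‖ : ℂ)⁻¹ * ‖z‖ * (cutA a (normSq z) * (normSq z ^ e : ℝ) *
      lapProfile a n e' (normSq z) - lapProfile a n e (normSq z) * (cutA a (normSq z) * (normSq z ^ e' : ℝ)))) * h1

/-- In polar coordinates with t = |z|² this is π∫(χ²)' dt = -π; the value is independent of a, as a
boundary term must be. -/
theorem integral_cutA_mul_deriv (ha : 0 < a) :
    ∫ z : ℂ, (2 * cutA a (normSq z) * deriv (cutA a) (normSq z)) = -Real.pi := by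
  have h1 := integral_fun_norm_addHaar (volume : Measure ℂ)
    (fun r : ℝ => 2 * cutA a (r ^ 2) * deriv (cutA a) (r ^ 2))
  simp only [← normSq_eq_norm_sq] at h1
  rw [h1, Complex.finrank_real_complex]
  have hd : ∀ r : ℝ, HasDerivAt (fun r : ℝ => cutA a (r ^ 2) ^ 2 / 2)
      (r ^ (2 - 1) • (2 * cutA a (r ^ 2) * deriv (cutA a) (r ^ 2))) r := fun r => by
    have h2 : HasDerivAt (fun r : ℝ => r ^ 2) (2 * r) r := by simpa using hasDerivAt_pow 2 r
    have h3 : HasDerivAt (fun r : ℝ => cutA a (r ^ 2)) (deriv (cutA a) (r ^ 2) * (2 * r)) r :=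
      HasDerivAt.comp (h₂ := cutA a) r (hasDerivAt_cutA (a := a) (r ^ 2)) h2
    exact ((h3.pow 2).div_const 2).congr_deriv (by simp; ring)
  have hlim : ∀ r : ℝ, 2 / a + 1 ≤ r → 2 < a * r ^ 2 := fun r hr => by
    have h4 : 1 ≤ r := le_trans (by have : 0 < 2 / a := by positivity
                                    linarith) hr
    have h5 : 2 < a * r := by
      have : a * (2 / a + 1) ≤ a * r := by gcongr
      rw [mul_add, mul_div_cancel₀ _ ha.ne'] at this
      linarith
    nlinarith
  have h6 : ∫ r in Set.Ioi (0 : ℝ), r ^ (2 - 1) • (2 * cutA a (r ^ 2) * deriv (cutA a) (r ^ 2)) =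
      0 - cutA a (0 ^ 2) ^ 2 / 2 := by
    refine integral_Ioi_of_hasDerivAt_of_tendsto' (fun r _ => hd r) ?_ ?_
    · have hc : Continuous fun r : ℝ => r ^ (2 - 1) • (2 * cutA a (r ^ 2) * deriv (cutA a) (r ^ 2)) :=
        (continuous_pow _).smul ((continuous_const.mul (contDiff_cutA.continuous.comp (continuous_pow 2))).mul
          (contDiff_deriv_cutA.continuous.comp (continuous_pow 2)))
      have h7 : IntegrableOn (fun r : ℝ => r ^ (2 - 1) • (2 * cutA a (r ^ 2) * deriv (cutA a) (r ^ 2)))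
          (Set.Icc 0 (2 / a + 1)) := hc.continuousOn.integrableOn_Icc
      refine h7.of_forall_sdiff_eq_zero measurableSet_Ioi fun r hr => ?_
      have h8 : 2 / a + 1 ≤ r := by
        by_contra h9
        exact hr.2 ⟨le_of_lt hr.1, (not_le.1 h9).le⟩
      rw [cutA_of_ge (hlim r h8).le]; simp
    · refine tendsto_const_nhds.congr' ?_
      filter_upwards [eventually_ge_atTop (2 / a + 1)] with r hr
      rw [cutA_of_ge (hlim r hr).le]; simp
  rw [h6, cutA_of_le (by simp)]
  simp [Measure.real]
  ring

theorem exists_unit_zpow_eq_neg_one {k : ℤ} (hk : k ≠ 0) : ∃ c : Circle, (c : ℂ) ^ k = -1 := by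
  refine ⟨Circle.exp (Real.pi / k), ?_⟩
  rw [Circle.coe_exp, ← Complex.exp_int_mul]
  have : (k : ℂ) ≠ 0 := by exact_mod_cast hk
  push_cast
  rw [show (k : ℂ) * (Real.pi / k * I) = Real.pi * I by field_simp, exp_pi_mul_I]

/-- Orthogonality of distinct angular modes: a rotation by c with c^{m-n} = -1 preserves Lebesgue
measure and changes the sign of the integrand. -/
theorem integral_zpow_mul_radial_eq_zero (hnm : n ≠ m) (R : ℝ → ℂ) :
    ∫ z : ℂ, starRingEnd ℂ z ^ n * z ^ m * R ‖z‖ = 0 := by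
  obtain ⟨c, hc⟩ := exists_unit_zpow_eq_neg_one (sub_ne_zero.2 hnm.symm)
  have h1 := (LinearIsometryEquiv.measurePreserving (rotation c)).integral_comp
    (rotation c).toHomeomorph.measurableEmbedding fun z : ℂ => starRingEnd ℂ z ^ n * z ^ m * R ‖z‖
  have hc0 : (c : ℂ) ≠ 0 := Circle.coe_ne_zero c
  have h2 : starRingEnd ℂ (c : ℂ) = (c : ℂ)⁻¹ := by rw [← Circle.coe_inv_eq_conj, Circle.coe_inv]
  have h3 : ∀ z : ℂ, starRingEnd ℂ (rotation c z) ^ n * rotation c z ^ m * R ‖rotation c z‖ =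
      -(starRingEnd ℂ z ^ n * z ^ m * R ‖z‖) := fun z => by
    rw [LinearIsometryEquiv.norm_map, rotation_apply, map_mul, mul_zpow, mul_zpow, h2, inv_zpow]
    rw [zpow_sub₀ hc0, div_eq_mul_inv] at hc
    linear_combination (starRingEnd ℂ z ^ n * z ^ m * R ‖z‖) * hc
  simp only [h3, integral_neg] at h1
  linear_combination (-1 / 2) * h1

/-- The Laplacian of a model vanishes near the origin, so the singularity of the other factor there
is harmless. -/
theorem continuous_radialModelLap_mul {g : ℂ → ℂ} (hg : ContinuousOn g {0}ᶜ) :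
    Continuous fun z => radialModelLap a n e z * g z := by
  refine continuous_iff_continuousAt.2 fun z => ?_
  by_cases hz : z = 0
  · subst hz
    refine (continuousAt_const (y := (0 : ℂ))).congr ?_
    filter_upwards [radialModelLap_eventuallyEq_zero] with z hz
    rw [hz, zero_mul]
  · exact (contDiff_radialModelLap.continuous.continuousAt).mul
      (hg.continuousAt (isOpen_compl_singleton.mem_nhds hz))

theorem integrable_radialModelLap_mul (ha : 0 < a) {g : ℂ → ℂ} (hg : ContinuousOn g {0}ᶜ) :
    Integrable fun z => radialModelLap a n e z * g z :=
  (continuous_radialModelLap_mul hg).integrable_of_hasCompactSupport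
    ((hasCompactSupport_radialModelLap ha).mul_right)

theorem continuousOn_radialModel : ContinuousOn (radialModel a n e) {0}ᶜ :=
  contDiffOn_radialModel.continuousOn

theorem integrable_boundary_left (ha : 0 < a) : Integrable fun z =>
    starRingEnd ℂ (radialModelLap a n e z) * radialModel a m e' z * ((‖z‖ : ℝ) : ℂ) := by
  have h1 := integrable_radialModelLap_mul (n := n) (e := e) ha
    (g := fun z => starRingEnd ℂ (radialModel a m e' z) * ((‖z‖ : ℝ) : ℂ))
    ((continuous_conj.comp_continuousOn continuousOn_radialModel).mul
      (continuous_ofReal.comp continuous_norm).continuousOn)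
  have h2 := (LinearIsometryEquiv.integrable_comp_iff conjLIE).2 h1
  refine h2.congr (ae_of_all _ fun z => ?_)
  simp [mul_assoc]

theorem integrable_boundary_right (ha : 0 < a) : Integrable fun z =>
    starRingEnd ℂ (radialModel a n e z) * radialModelLap a m e' z * ((‖z‖ : ℝ) : ℂ) := by
  have h1 := integrable_radialModelLap_mul (n := m) (e := e') ha
    (g := fun z => starRingEnd ℂ (radialModel a n e z) * ((‖z‖ : ℝ) : ℂ))
    ((continuous_conj.comp_continuousOn continuousOn_radialModel).mul
      (continuous_ofReal.comp continuous_norm).continuousOn)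
  exact h1.congr (ae_of_all _ fun z => by simp; ring)

theorem boundary_integral (ha : 0 < a) (he : e + e' + n = 1 / 2) :
    (∫ z, starRingEnd ℂ (radialModelLap a n e z) * radialModel a n e' z * ((‖z‖ : ℝ) : ℂ)) -
      ∫ z, starRingEnd ℂ (radialModel a n e z) * radialModelLap a n e' z * ((‖z‖ : ℝ) : ℂ) =
      (((e - e') * Real.pi : ℝ) : ℂ) := by
  rw [← integral_sub (integrable_boundary_left ha) (integrable_boundary_right ha)]
  have h0 : ∀ᵐ z : ℂ, z ≠ 0 := by simpa using (Set.countable_singleton (0 : ℂ)).ae_notMem volume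
  rw [integral_congr_ae (h0.mono fun z hz => boundary_density hz he),
    integral_complex_ofReal, integral_const_mul, integral_cutA_mul_deriv ha]
  push_cast; ring

theorem boundary_integral_left_eq_zero (hnm : n ≠ m) :
    ∫ z, starRingEnd ℂ (radialModelLap a n e z) * radialModel a m e' z * ((‖z‖ : ℝ) : ℂ) = 0 := by
  refine Eq.trans (integral_congr_ae (ae_of_all _ fun z => ?_)) (integral_zpow_mul_radial_eq_zero hnm
    fun r => -(((r⁻¹ : ℝ) : ℂ) * lapProfile a n e (r ^ 2) * ((cutA a (r ^ 2) * (r ^ 2) ^ e' : ℝ) : ℂ) * r))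
  simp only [radialModel, radialModelLap, map_neg, map_mul, map_zpow₀, conj_ofReal, normSq_eq_norm_sq]
  push_cast; ring

theorem boundary_integral_right_eq_zero (hnm : n ≠ m) :
    ∫ z, starRingEnd ℂ (radialModel a n e z) * radialModelLap a m e' z * ((‖z‖ : ℝ) : ℂ) = 0 := by
  refine Eq.trans (integral_congr_ae (ae_of_all _ fun z => ?_)) (integral_zpow_mul_radial_eq_zero hnm
    fun r => -(((r⁻¹ : ℝ) : ℂ) * lapProfile a m e' (r ^ 2) * ((cutA a (r ^ 2) * (r ^ 2) ^ e : ℝ) : ℂ) * r))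
  simp only [radialModel, radialModelLap, map_mul, map_zpow₀, conj_ofReal, normSq_eq_norm_sq]
  push_cast; ring

end Model
end

/-! ### Disjoint discs at the zeros and a criterion for membership in Dom D̄ -/

noncomputable section

set_option linter.unusedSectionVars false

namespace RiemannSurface

namespace SpinBundle

local notation "conj" => starRingEnd ℂ
local notation "infty" => ((⊤ : ℕ∞) : WithTop ℕ∞)

variable {X : Type*} [TopologicalSpace X] [ChartedSpace ℂ X] {C : SpinBundle X}
  {ω : ∀ p : X, TangentSpace 𝓘(ℂ) p →L[ℂ] ℂ}

/-- The family `F` of frames at the zeros of `ω` is distinguished, and its discs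
`a |x|² ≤ 2` are pairwise disjoint. -/
structure IsAdapted (F : zeros ω → C.Frame) (a : ℝ) : Prop where
  dist : ∀ P, IsDistinguished ω P.1 (F P).ξ
  pos : 0 < a
  disc_subset : ∀ P, {z | a * Complex.normSq z ≤ 2} ⊆ (F P).ξ.target
  disj : ∀ P Q, P ≠ Q → Disjoint ((F P).ξ.symm '' {z | a * Complex.normSq z ≤ 2})
    ((F Q).ξ.symm '' {z | a * Complex.normSq z ≤ 2})

variable [IsManifold 𝓘(ℂ) 1 X] [T2Space X] [CompactSpace X] [MeasurableSpace X] [BorelSpace X]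
  (hω : ω ∈ holomorphicOneForms X)
  (hz : (zeros ω).Finite) {F : zeros ω → C.Frame} {u v : X → ℂ}

include hz in
-- The zeros are separated by disjoint open sets, and the discs a|x|² ≤ 2 shrink to the zeros as a
-- grows; finiteness provides one a for all of them.
theorem exists_isAdapted (hF : ∀ P, IsDistinguished ω P.1 (F P).ξ) {V : zeros ω → Set X}
    (hV : ∀ P, V P ∈ 𝓝 P.1) : ∃ a, IsAdapted F a ∧
      ∀ P, (F P).ξ.symm '' {z | a * Complex.normSq z ≤ 2} ⊆ V P := by
  have : Finite (zeros ω) := hz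
  obtain ⟨U, hU, hUd⟩ := hz.t2_separation
  have h1 : ∀ P, ∀ᶠ a in atTop, ∀ z : ℂ, a * Complex.normSq z ≤ 2 →
      z ∈ (F P).ξ.target ∧ (F P).ξ.symm z ∈ V P ∩ U P := fun P => by
    have h2 : (F P).ξ.symm ⁻¹' (V P ∩ U P) ∩ (F P).ξ.target ∈ 𝓝 (0 : ℂ) := by
      have h3 := (F P).ξ.continuousAt_symm (IsDistinguished.zero_mem (hF P))
      rw [ContinuousAt, IsDistinguished.symm_zero (hF P)] at h3
      exact inter_mem (h3 (inter_mem (hV P) ((hU P).2.mem_nhds (hU P).1)))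
        ((F P).ξ.open_target.mem_nhds (IsDistinguished.zero_mem (hF P)))
    obtain ⟨r, hr, hrs⟩ := Metric.mem_nhds_iff.1 h2
    filter_upwards [eventually_gt_atTop (2 / r ^ 2)] with a ha z hz
    have hr2 : 0 < r ^ 2 := by positivity
    have ha0 : 0 < a := lt_of_le_of_lt (by positivity) ha
    have : z ∈ Metric.ball (0 : ℂ) r := by
      rw [mem_ball_zero_iff]
      rw [div_lt_iff₀ hr2] at ha
      rw [Complex.normSq_eq_norm_sq] at hz
      exact lt_of_pow_lt_pow_left₀ 2 hr.le (lt_of_mul_lt_mul_left (hz.trans_lt ha) ha0.le)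
    exact ⟨(hrs this).2, (hrs this).1⟩
  obtain ⟨a, ha, ha0⟩ := ((eventually_all.2 h1).and (eventually_gt_atTop 0)).exists
  refine ⟨a, ⟨hF, ha0, fun P z hz => (ha P z hz).1, fun P Q hPQ => ?_⟩, ?_⟩
  · refine (hUd P.2 Q.2 fun h => hPQ (Subtype.ext h)).mono ?_ ?_
    · rintro _ ⟨z, hz, rfl⟩; exact (ha P z hz).2.2
    · rintro _ ⟨z, hz, rfl⟩; exact (ha Q z hz).2.2
  · rintro P _ ⟨z, hz, rfl⟩; exact (ha P z hz).2.1

theorem IsDistinguished.eq_of_mem_source {P Q : X} {G : C.Frame} (hG : IsDistinguished ω P G.ξ)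
    (hQ : Q ∈ zeros ω) (hs : Q ∈ G.ξ.source) : Q = P := by
  by_contra h
  have := IsDistinguished.notMem_zeros hG (G.ξ.map_source hs) (IsDistinguished.coord_ne_zero hG hs h)
  rw [G.ξ.left_inv hs] at this
  exact this hQ

theorem IsDistinguished.ofFun_eventuallyEq_zero {P Q : X} {G : C.Frame} (hG : IsDistinguished ω P G.ξ)
    {g : ℂ → ℂ} (hg : HasCompactSupport g) (hgt : tsupport g ⊆ G.ξ.target) (hQ : Q ∈ zeros ω)
    (h : Q ≠ P) : G.ofFun g =ᶠ[𝓝 Q] fun _ => 0 :=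
  G.ofFun_eventuallyEq_zero hg hgt fun hQ' =>
    h (IsDistinguished.eq_of_mem_source hG hQ (G.image_symm_subset hgt hQ'))

theorem SmoothAt.sum {ι : Type*} {s : Finset ι} {f : ι → X → ℂ} {p : X}
    (h : ∀ i ∈ s, C.SmoothAt (f i) p) : C.SmoothAt (fun q => ∑ i ∈ s, f i q) p := by
  classical
  induction s using Finset.induction_on with
  | empty => simpa using smoothAt_zero
  | insert i s hi ih =>
    simp only [Finset.sum_insert hi]
    exact (h i (Finset.mem_insert_self i s)).add (ih fun j hj => h j (Finset.mem_insert_of_mem hj))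

theorem SmoothAt.sub {p : X} (hu : C.SmoothAt u p) (hv : C.SmoothAt v p) :
    C.SmoothAt (fun q => u q - v q) p := by
  have := hu.add (hv.const_mul (-1))
  refine this.congr (Eventually.of_forall fun q => ?_)
  simp only; ring

include hω hz in
/-- A section which is smooth off the zeros and satisfies `|u| ≤ K |x|`, `|∂̄u| ≤ K` near each zero
belongs to the domain of the closure of `u ↦ ω̄⁻¹ ∂̄u`. -/
theorem mem_dbarOp_domain_of_bound (hF : ∀ P, IsDistinguished ω P.1 (F P).ξ)
    (hu : ∀ p ∉ zeros ω, C.SmoothAt u p)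
    (hb : ∀ P, ∃ K : ℝ, ∀ᶠ x in 𝓝[≠] (0 : ℂ), ‖(F P).rep u x‖ ≤ K * ‖x‖ ∧
      ‖wirtDbar ((F P).rep u) x‖ ≤ K) {x : C.L2 ω} (hx : x =ᵐ[C.hArea ω] u) :
    x ∈ (C.dbarOp ω).domain := by
  classical
  have : Fintype (zeros ω) := hz.fintype
  choose K hK using hb
  have hρ : ∀ P, ∃ ρ > 0, ∀ x ∈ Metric.ball (0 : ℂ) ρ, x ≠ 0 →
      ‖(F P).rep u x‖ ≤ K P * ‖x‖ ∧ ‖wirtDbar ((F P).rep u) x‖ ≤ K P := fun P => by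
    have := hK P
    rw [eventually_nhdsWithin_iff, Metric.eventually_nhds_iff_ball] at this
    exact this
  choose ρ hρ0 hρ using hρ
  obtain ⟨a, hA, haV⟩ := exists_isAdapted hz hF (V := fun P => (F P).ξ.source ∩ (F P).ξ ⁻¹' Metric.ball 0 (ρ P))
    fun P => by
      refine inter_mem ((F P).ξ.open_source.mem_nhds (hF P).2.1)
        (((F P).ξ.continuousAt (hF P).2.1) ?_)
      rw [(hF P).2.2.1]
      exact Metric.ball_mem_nhds _ (hρ0 P)
  have hdisc : ∀ P z, a * Complex.normSq z ≤ 2 → z ∈ Metric.ball (0 : ℂ) (ρ P) := fun P z hz => by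
    have := (haV P ⟨z, hz, rfl⟩).2
    rwa [Set.mem_preimage, (F P).ξ.right_inv (hA.disc_subset P hz)] at this
  -- The section is split into its parts near the zeros, to which the local closure criterion
  -- applies, and a remainder that vanishes near the zeros and is a test section.
  set g : zeros ω → ℂ → ℂ := fun P z => cutC a z * (F P).rep u z with hg
  have hcut0 : ∀ z, 2 < a * Complex.normSq z → cutC a =ᶠ[𝓝 z] fun _ => 0 := fun z hz => by
    have h2 : ContinuousAt (fun y : ℂ => a * Complex.normSq y) z :=
      (continuous_const.mul Complex.continuous_normSq).continuousAt
    filter_upwards [h2.eventually (lt_mem_nhds hz)] with y hy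
    rw [cutC, cutR_of_ge hy.le, Complex.ofReal_zero]
  have hgt : ∀ P, tsupport (g P) ⊆ {z | a * Complex.normSq z ≤ 2} := fun P =>
    closure_minimal (fun z hz => not_lt.1 fun h => hz (show cutC a z * _ = 0 by
      rw [(hcut0 z h).self_of_nhds, zero_mul])) isClosed_normSq_le
  have hgc : ∀ P, HasCompactSupport (g P) := fun P =>
    (isCompact_normSq_le hA.pos).of_isClosed_subset (isClosed_tsupport _) (hgt P)
  have hrep : ∀ P z, z ≠ 0 → a * Complex.normSq z ≤ 2 → ContDiffAt ℝ infty ((F P).rep u) z := fun P z hz h => by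
    have hzt := hA.disc_subset P h
    have := hu _ (IsDistinguished.notMem_zeros (hF P) hzt hz) (F P) ((F P).ξ.map_target hzt)
    rwa [(F P).ξ.right_inv hzt] at this
  have hgd : ∀ P, ContDiffOn ℝ infty (g P) {0}ᶜ := fun P z hz => by
    refine ContDiffAt.contDiffWithinAt ?_
    by_cases h : a * Complex.normSq z ≤ 2
    · exact (contDiff_cutC a).contDiffAt.mul (hrep P z hz h)
    · refine (contDiffAt_const (c := (0 : ℂ))).congr_of_eventuallyEq ?_
      filter_upwards [hcut0 z (not_le.1 h)] with y hy
      simp [hg, hy]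
  obtain ⟨M, hM0, hM⟩ := exists_bound_mul_deriv_cutR
  have hK0 : ∀ P, 0 ≤ K P := fun P => by
    have h1 : ((ρ P / 2 : ℝ) : ℂ) ∈ Metric.ball (0 : ℂ) (ρ P) := by
      rw [mem_ball_zero_iff, Complex.norm_real, Real.norm_of_nonneg (by linarith [hρ0 P])]
      linarith [hρ0 P]
    exact (norm_nonneg _).trans (hρ P _ h1 (by
      rw [Complex.ofReal_ne_zero]; linarith [hρ0 P])).2
  have hmem : ∀ P, ∃ y y' : C.L2 ω, y =ᵐ[C.hArea ω] (F P).ofFun (g P) ∧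
      y' =ᵐ[C.hArea ω] C.dbarOmega ω ((F P).ofFun (g P)) ∧ (y, y') ∈ (C.dbarOp ω).graph := fun P => by
    refine mem_closure_of_bound hω hz (hF P) (hgd P) (hgc P) ((hgt P).trans (hA.disc_subset P))
      (K := M * K P + K P) ?_ ?_
    · intro z hz
      by_cases h : a * Complex.normSq z ≤ 2
      · have h1 := (hρ P z (hdisc P z h) hz).1
        calc ‖g P z‖ ≤ 1 * (K P * ‖z‖) := by
              rw [hg, norm_mul]; gcongr; exact norm_cutC_le _ _
          _ ≤ (M * K P + K P) * ‖z‖ := by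
              have := mul_nonneg (mul_nonneg hM0 (hK0 P)) (norm_nonneg z)
              nlinarith
      · have : g P z = 0 := image_eq_zero_of_notMem_tsupport fun h' => h (hgt P h')
        rw [this, norm_zero]
        have := hK0 P
        positivity
    · intro z hz
      by_cases h : a * Complex.normSq z ≤ 2
      · have h1 := hρ P z (hdisc P z h) hz
        rw [hg, wirtDbar_mul ((contDiff_cutC a).differentiable (by simp) z)
          (differentiableAt_of_contDiffAt_infty (hrep P z hz h))]
        refine (norm_add_le _ _).trans (add_le_add ?_ ?_)
        · rw [wirtDbar_cutC, norm_mul, norm_mul, Complex.norm_real, Real.norm_eq_abs]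
          have h4 := hM (a * Complex.normSq z) (mul_nonneg hA.pos.le (Complex.normSq_nonneg _))
          rw [Complex.normSq_eq_norm_sq] at h4 ⊢
          calc _ ≤ |deriv cutR (a * ‖z‖ ^ 2) * a| * ‖z‖ * (K P * ‖z‖) := by gcongr; exact h1.1
            _ = |(a * ‖z‖ ^ 2) * deriv cutR (a * ‖z‖ ^ 2)| * K P := by
              rw [abs_mul, abs_mul, abs_mul, abs_of_nonneg (sq_nonneg ‖z‖)]; ring
            _ ≤ M * K P := by gcongr; exact hK0 P
        · rw [norm_mul]
          exact (mul_le_of_le_one_left (norm_nonneg _) (norm_cutC_le _ _)).trans h1.2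
      · have : g P =ᶠ[𝓝 z] fun _ => 0 := notMem_tsupport_iff_eventuallyEq.1 fun h' => h (hgt P h')
        rw [this.wirtDbar_eq, wirtDbar_const, norm_zero]
        have := hK0 P
        positivity
  have htest : C.IsTestSection ω fun q => u q - ∑ P, (F P).ofFun (g P) q := by
    have hzero : ∀ Q ∈ zeros ω, (fun q => u q - ∑ P, (F P).ofFun (g P) q) =ᶠ[𝓝 Q] fun _ => 0 := fun Q hQ => by
      have h1 : ∀ P : zeros ω, P ≠ ⟨Q, hQ⟩ → (F P).ofFun (g P) =ᶠ[𝓝 Q] fun _ => 0 := fun P hP =>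
        IsDistinguished.ofFun_eventuallyEq_zero (hF P) (hgc P) ((hgt P).trans (hA.disc_subset P)) hQ
          fun h => hP (Subtype.ext h.symm)
      have h2 : ∀ᶠ q in 𝓝 Q, ∀ P : zeros ω, P ≠ ⟨Q, hQ⟩ → (F P).ofFun (g P) q = 0 :=
        eventually_all.2 fun P => by
          by_cases hP : P = ⟨Q, hQ⟩
          · exact Eventually.of_forall fun _ h => absurd hP h
          · filter_upwards [h1 P hP] with q hq _ using hq
      have h3 : ∀ᶠ q in 𝓝 Q, cutC a ((F ⟨Q, hQ⟩).ξ q) = 1 := by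
        have h4 := (F ⟨Q, hQ⟩).ξ.continuousAt (hF ⟨Q, hQ⟩).2.1
        rw [ContinuousAt, (hF ⟨Q, hQ⟩).2.2.1] at h4
        exact h4.eventually (cutC_eventually_one a)
      filter_upwards [h2, h3, (F ⟨Q, hQ⟩).ξ.open_source.mem_nhds (hF ⟨Q, hQ⟩).2.1] with q hq1 hq2 hq3
      rw [Finset.sum_eq_single ⟨Q, hQ⟩ (fun P _ hP => hq1 P hP) (by simp), sub_eq_zero]
      refine (F ⟨Q, hQ⟩).eq_of_rep_eq (v := (F ⟨Q, hQ⟩).ofFun (g ⟨Q, hQ⟩)) hq3 ?_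
      rw [(F ⟨Q, hQ⟩).rep_ofFun _ ((F ⟨Q, hQ⟩).ξ.map_source hq3)]
      simp only [hg, hq2, one_mul]
    refine isTestSection_iff.2 ⟨fun q => ?_, Set.disjoint_right.2 fun Q hQ hQ' =>
      notMem_tsupport_iff_eventuallyEq.2 (hzero Q hQ) hQ'⟩
    by_cases hq : q ∈ zeros ω
    · exact smoothAt_zero.congr (hzero q hq)
    · refine (hu q hq).sub (SmoothAt.sum fun P _ => (F P).smoothAt_ofFun' (hgc P)
        ((hgt P).trans (hA.disc_subset P)) fun hqs => (hgd P).contDiffAt ?_)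
      exact isOpen_compl_singleton.mem_nhds (IsDistinguished.coord_ne_zero (hF P) hqs
        fun h => hq (h ▸ P.2))
  have hind : ∀ s : Finset (zeros ω), ∀ x : C.L2 ω, x =ᵐ[C.hArea ω]
      (fun q => (u q - ∑ P, (F P).ofFun (g P) q) + ∑ P ∈ s, (F P).ofFun (g P) q) →
      x ∈ (C.dbarOp ω).domain := by
    intro s
    induction s using Finset.induction_on with
    | empty =>
      intro x hx
      refine (LinearPMap.le_closure _).1 ((mem_domain_testOperator hω hz flatOp_dbarOmega).2 ⟨_, htest, ?_⟩)
      simpa using hx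
    | insert P s hP ih =>
      intro x hx
      obtain ⟨y, y', hy, -, hyy⟩ := hmem P
      have h1 : x - y ∈ (C.dbarOp ω).domain := ih _ (by
        filter_upwards [Lp.coeFn_sub x y, hx, hy] with q h1 h2 h3
        rw [h1, Pi.sub_apply, h2, h3, Finset.sum_insert hP]; ring)
      have h2 := (C.dbarOp ω).domain.add_mem h1 (UnboundedOp.mem_domain_iff_graph.2 ⟨_, hyy⟩)
      rwa [sub_add_cancel] at h2
  exact hind Finset.univ x (by simpa using hx)

end SpinBundle

end RiemannSurface

end

/-! ### Model sections on the surface -/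

noncomputable section

set_option linter.unusedSectionVars false

namespace RiemannSurface

namespace SpinBundle

local notation "conj" => starRingEnd ℂ
local notation "infty" => ((⊤ : ℕ∞) : WithTop ℕ∞)

variable {X : Type*} [TopologicalSpace X] [ChartedSpace ℂ X] {C : SpinBundle X}
  {ω : ∀ p : X, TangentSpace 𝓘(ℂ) p →L[ℂ] ℂ}

theorem localLaplacian_congr {f f' u u' : ℂ → ℂ} {z : ℂ} (hf : f =ᶠ[𝓝 z] f') (hu : u =ᶠ[𝓝 z] u') :
    localLaplacian f u z = localLaplacian f' u' z := by
  have : (fun y => ((‖f y‖⁻¹ : ℝ) : ℂ) * wirtDbar u y) =ᶠ[𝓝 z]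
      fun y => ((‖f' y‖⁻¹ : ℝ) : ℂ) * wirtDbar u' y := by
    filter_upwards [hf, hu.eventuallyEq_nhds] with y h1 h2
    rw [h1, h2.wirtDbar_eq]
  rw [localLaplacian, localLaplacian, this.wirtD_eq, hf.self_of_nhds]

variable [IsManifold 𝓘(ℂ) 1 X] [T2Space X] [CompactSpace X] [MeasurableSpace X] [BorelSpace X]
  (hω : ω ∈ holomorphicOneForms X)
  (hz : (zeros ω).Finite) {F : zeros ω → C.Frame} {u v : X → ℂ} {a : ℝ} (hA : IsAdapted F a)
  {P Q : zeros ω} {n m : ℤ} {e e' : ℝ}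

include hA

theorem IsAdapted.tsupport_model : tsupport (radialModel a n e) ⊆ (F P).ξ.target :=
  tsupport_radialModel_subset.trans (hA.disc_subset P)

theorem IsAdapted.tsupport_modelLap : tsupport (radialModelLap a n e) ⊆ (F P).ξ.target :=
  tsupport_radialModelLap_subset.trans (hA.disc_subset P)

theorem IsAdapted.smoothAt_model {p : X} (hp : p ∉ zeros ω) :
    C.SmoothAt ((F P).ofFun (radialModel a n e)) p :=
  (F P).smoothAt_ofFun' (hasCompactSupport_radialModel hA.pos) hA.tsupport_model fun hps =>
    contDiffOn_radialModel.contDiffAt (isOpen_compl_singleton.mem_nhds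
      (IsDistinguished.coord_ne_zero (hA.dist P) hps fun h => hp (h ▸ P.2)))

include hω in
theorem IsAdapted.laplacian_model (he : e * (n + e - 1 / 2) = 0) {p : X} (hp : p ∉ zeros ω) :
    C.laplacian ω ((F P).ofFun (radialModel a n e)) p = (F P).ofFun (radialModelLap a n e) p := by
  by_cases hps : p ∈ (F P).ξ.source
  · refine (F P).eq_of_rep_eq (v := (F P).ofFun (radialModelLap a n e)) hps ?_
    have hpt := (F P).ξ.map_source hps
    have hev := (F P).ξ.open_target.mem_nhds hpt
    rw [rep_laplacian hω (F P) hps hp (hA.smoothAt_model hp), (F P).rep_ofFun _ hpt,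
      ← localLaplacian_radialModel he (IsDistinguished.coord_ne_zero (hA.dist P) hps fun h => hp (h ▸ P.2))]
    refine localLaplacian_congr ?_ ?_
    · filter_upwards [hev] with z hz using (hA.dist P).2.2.2.2 z hz
    · filter_upwards [hev] with z hz using (F P).rep_ofFun _ hz
  · rw [Frame.ofFun, if_neg hps]
    exact (flatOp_laplacian hω).zero ((F P).ofFun_eventuallyEq_zero (hasCompactSupport_radialModel hA.pos)
      hA.tsupport_model fun h => hps ((F P).image_symm_subset hA.tsupport_model h))

theorem IsAdapted.isTestSection_modelLap : C.IsTestSection ω ((F P).ofFun (radialModelLap a n e)) :=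
  (F P).isTestSection_ofFun contDiff_radialModelLap (hasCompactSupport_radialModelLap hA.pos)
    hA.tsupport_modelLap fun z hz => by
      rw [show (F P).f ω z = z from (hA.dist P).2.2.2.2 z (hA.tsupport_modelLap hz)]
      rintro rfl
      exact notMem_tsupport_iff_eventuallyEq.2 radialModelLap_eventuallyEq_zero hz

include hω hz in
-- The size |x|^{n+2e} is square integrable for the weight |x| once n + 2e ≥ -1. When n + 2e ≥ 1 the
-- model is O(|x|) with bounded ∂̄, which is the criterion for Dom D̄.
theorem IsAdapted.exists_model (he : e * (n + e - 1 / 2) = 0) (hs : -1 ≤ n + 2 * e) (P : zeros ω) :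
    ∃ x y : C.L2 ω, x =ᵐ[C.hArea ω] (F P).ofFun (radialModel a n e) ∧
      y =ᵐ[C.hArea ω] (F P).ofFun (radialModelLap a n e) ∧
      (x, y) ∈ (C.testOperator ω (C.laplacian ω)).adjoint.graph ∧
      (1 ≤ n + 2 * e → x ∈ (C.dbarOp ω).domain) := by
  obtain ⟨K, hK0, hK⟩ := exists_bound_radialModel (n := n) (e := e) hA.pos hs
  have hx : MemLp ((F P).ofFun (radialModel a n e)) 2 (C.hArea ω) :=
    memLp_ofFun_of_bound hω (hA.dist P) (measurable_of_continuousOn_punctured continuousOn_radialModel)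
      (K := K) fun z _ hz => by simpa [Real.rpow_neg_one] using hK z hz
  obtain ⟨y, hy⟩ := (hA.isTestSection_modelLap (P := P) (n := n) (e := e)).exists_toLp hω
  refine ⟨hx.toLp, y, hx.coeFn_toLp, hy, ?_, fun h1 => ?_⟩
  · refine mem_adjoint_of_smooth hω hz (fun p hp => hA.smoothAt_model hp) hx.coeFn_toLp ?_
    filter_upwards [hy, ae_notMem_zeros hω hz (C := C)] with p hp hp0
    rw [hp, hA.laplacian_model hω he hp0]
  · obtain ⟨K, hK0, hK⟩ := exists_bound_radialModel (n := n) (e := e) hA.pos h1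
    obtain ⟨K', hK0', hK'⟩ := exists_bound_wirtDbar_radialModel (n := n) (e := e) hA.pos h1
    obtain ⟨x, y, hx', -, hxy⟩ := mem_closure_of_bound hω hz (hA.dist P) (K := max K K')
      contDiffOn_radialModel
      (hasCompactSupport_radialModel (n := n) (e := e) hA.pos) hA.tsupport_model
      (fun z hz => (hK z hz).trans (by rw [Real.rpow_one]; gcongr; exact le_max_left _ _))
      fun z hz => (hK' z hz).trans (le_max_right _ _)
    have : hx.toLp = x := Lp.ext (hx.coeFn_toLp.trans hx'.symm)
    rw [this]
    exact UnboundedOp.mem_domain_iff_graph.2 ⟨_, hxy⟩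

include hω in
theorem IsAdapted.ip_eq_integral {g h : ℂ → ℂ} (hg : Measurable g) (hh : Measurable h)
    (hs : tsupport h ⊆ {z | a * Complex.normSq z ≤ 2}) :
    C.ip ω ((F P).ofFun g) ((F P).ofFun h) = ∫ z, conj (g z) * h z * ((‖z‖ : ℝ) : ℂ) := by
  rw [(F P).ip_eq hω ((F P).measurable_ofFun hg).aestronglyMeasurable
    ((F P).measurable_ofFun hh).aestronglyMeasurable fun p hp => by rw [Frame.ofFun, if_neg hp]]
  have h1 : ∀ z ∉ (F P).ξ.target, conj (g z) * h z * ((‖z‖ : ℝ) : ℂ) = 0 := fun z hz => by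
    rw [image_eq_zero_of_notMem_tsupport fun h' => hz (hA.disc_subset P (hs h')), mul_zero, zero_mul]
  rw [← setIntegral_eq_integral_of_forall_compl_eq_zero h1]
  refine setIntegral_congr_fun (F P).ξ.open_target.measurableSet fun z hz => ?_
  rw [(F P).rep_ofFun _ hz, (F P).rep_ofFun _ hz, show (F P).f ω z = z from (hA.dist P).2.2.2.2 z hz]

theorem IsAdapted.ofFun_eq_zero {g : ℂ → ℂ} (hs : tsupport g ⊆ {z | a * Complex.normSq z ≤ 2}) {p : X}
    (hp : p ∉ (F P).ξ.symm '' {z | a * Complex.normSq z ≤ 2}) : (F P).ofFun g p = 0 := by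
  by_cases hps : p ∈ (F P).ξ.source
  · rw [Frame.ofFun, if_pos hps, image_eq_zero_of_notMem_tsupport (f := g), mul_zero]
    exact fun h => hp ⟨_, hs h, (F P).ξ.left_inv hps⟩
  · rw [Frame.ofFun, if_neg hps]

theorem IsAdapted.ip_eq_zero (hPQ : P ≠ Q) {g h : ℂ → ℂ}
    (hg : tsupport g ⊆ {z | a * Complex.normSq z ≤ 2}) (hh : tsupport h ⊆ {z | a * Complex.normSq z ≤ 2}) :
    C.ip ω ((F P).ofFun g) ((F Q).ofFun h) = 0 := by
  rw [ip]
  refine integral_eq_zero_of_ae (ae_of_all _ fun p => ?_)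
  simp only [Pi.zero_apply]
  by_cases hp : p ∈ (F P).ξ.symm '' {z | a * Complex.normSq z ≤ 2}
  · rw [hA.ofFun_eq_zero hh (Set.disjoint_left.1 (hA.disj P Q hPQ) hp), mul_zero]
  · rw [hA.ofFun_eq_zero hg hp, map_zero, zero_mul]

include hω in
/-- The boundary form on model sections. -/
theorem IsAdapted.boundary_form (h : P = Q → n = m → e + e' + n = 1 / 2) :
    C.ip ω ((F P).ofFun (radialModelLap a n e)) ((F Q).ofFun (radialModel a m e')) -
      C.ip ω ((F P).ofFun (radialModel a n e)) ((F Q).ofFun (radialModelLap a m e')) =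
      open scoped Classical in if P = Q ∧ n = m then (((e - e') * Real.pi : ℝ) : ℂ) else 0 := by
  have m1 : ∀ (n : ℤ) (e : ℝ), Measurable (radialModel a n e) := fun n e =>
    measurable_of_continuousOn_punctured continuousOn_radialModel
  have m2 : ∀ (n : ℤ) (e : ℝ), Measurable (radialModelLap a n e) := fun n e =>
    contDiff_radialModelLap.continuous.measurable
  by_cases hPQ : P = Q
  · subst hPQ
    rw [hA.ip_eq_integral hω (m2 _ _) (m1 _ _) tsupport_radialModel_subset,
      hA.ip_eq_integral hω (m1 _ _) (m2 _ _) tsupport_radialModelLap_subset]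
    by_cases hnm : n = m
    · subst hnm
      rw [if_pos ⟨rfl, rfl⟩, boundary_integral hA.pos (h rfl rfl)]
    · rw [if_neg fun h => hnm h.2, boundary_integral_left_eq_zero hnm, boundary_integral_right_eq_zero hnm,
        sub_zero]
  · rw [if_neg fun h => hPQ h.1, hA.ip_eq_zero hPQ tsupport_radialModelLap_subset tsupport_radialModel_subset,
      hA.ip_eq_zero hPQ tsupport_radialModel_subset tsupport_radialModelLap_subset, sub_zero]

end SpinBundle

end RiemannSurface

end

noncomputable section

set_option linter.unusedSectionVars false

/-! ### Weyl's lemma in the plane -/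

section Weyl

open Complex

local notation "infty" => ((⊤ : ℕ∞) : WithTop ℕ∞)

/-- The convolution of two functions in the plane. -/
def cconv (U g : ℂ → ℂ) (z : ℂ) : ℂ := ∫ t, U t * g (z - t)

theorem cconv_eq (U g : ℂ → ℂ) : cconv U g = convolution U g (ContinuousLinearMap.mul ℝ ℂ) volume := rfl

variable {U g : ℂ → ℂ} {a b : ℝ} {z : ℂ}

theorem contDiff_cconv (hU : LocallyIntegrable U) (hg : ContDiff ℝ infty g) (hgc : HasCompactSupport g) :
    ContDiff ℝ infty (cconv U g) := by
  rw [cconv_eq]; exact hgc.contDiff_convolution_right _ hU hg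

theorem integrable_cconv (hU : LocallyIntegrable U) (hg : Continuous g) (hgc : HasCompactSupport g) (z : ℂ) :
    Integrable fun t => U t * g (z - t) :=
  hgc.convolutionExists_right (ContinuousLinearMap.mul ℝ ℂ) hU hg z

theorem fderiv_cconv (hU : LocallyIntegrable U) (hg : ContDiff ℝ infty g) (hgc : HasCompactSupport g)
    (z v : ℂ) : fderiv ℝ (cconv U g) z v = cconv U (fun y => fderiv ℝ g y v) z := by
  rw [cconv_eq, (hgc.hasFDerivAt_convolution_right _ hU (hg.of_le (by simp)) z).fderiv,
    convolution_precompR_apply _ hU (hgc.fderiv ℝ) (hg.continuous_fderiv (by simp))]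
  rfl

theorem wirt_cconv_aux (hU : LocallyIntegrable U) (hg : ContDiff ℝ infty g) (hgc : HasCompactSupport g)
    (z c : ℂ) : 1 / 2 * (fderiv ℝ (cconv U g) z 1 + c * fderiv ℝ (cconv U g) z I) =
      cconv U (fun y => 1 / 2 * (fderiv ℝ g y 1 + c * fderiv ℝ g y I)) z := by
  rw [fderiv_cconv hU hg hgc, fderiv_cconv hU hg hgc, cconv, cconv, cconv]
  have h : ∀ v, Integrable fun t => U t * fderiv ℝ g (z - t) v := fun v =>
    integrable_cconv hU ((hg.continuous_fderiv (by simp)).clm_apply continuous_const)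
      (hgc.fderiv_apply ℝ v) z
  rw [← integral_const_mul, ← integral_add (h 1) ((h I).const_mul c), ← integral_const_mul]
  congr 1; ext t; ring

theorem wirtDbar_cconv (hU : LocallyIntegrable U) (hg : ContDiff ℝ infty g) (hgc : HasCompactSupport g)
    (z : ℂ) : wirtDbar (cconv U g) z = cconv U (wirtDbar g) z := wirt_cconv_aux hU hg hgc z I

theorem wirtD_cconv (hU : LocallyIntegrable U) (hg : ContDiff ℝ infty g) (hgc : HasCompactSupport g)
    (z : ℂ) : wirtD (cconv U g) z = cconv U (wirtD g) z := by
  have h := wirt_cconv_aux hU hg hgc z (-I)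
  simp only [neg_mul, ← sub_eq_add_neg] at h
  exact h

theorem contDiff_wirtDbar (hg : ContDiff ℝ infty g) : ContDiff ℝ infty (wirtDbar g) :=
  contDiff_iff_contDiffAt.2 fun _ => hg.contDiffAt.wirtDbar_infty

theorem hasCompactSupport_wirtDbar (hgc : HasCompactSupport g) : HasCompactSupport (wirtDbar g) :=
  HasCompactSupport.intro hgc fun x hx => by
    rw [(notMem_tsupport_iff_eventuallyEq.1 hx).wirtDbar_eq]; exact wirtDbar_const 0

/-- A radial mollifier, supported in the annulus `1 ≤ a |z|² ≤ 2`. -/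
def annMol (a : ℝ) (z : ℂ) : ℝ := -Real.pi⁻¹ * deriv (cutA a) (normSq z)

def annMolC (a : ℝ) (z : ℂ) : ℂ := (annMol a z : ℂ)

/-- Polar coordinates with t = |z|², and the fundamental theorem of calculus. -/
theorem integral_deriv_comp_normSq {H : ℝ → ℝ} (hH : ContDiff ℝ infty H) {T : ℝ} (hT : 0 < T)
    (hs : ∀ t, T < t → deriv H t = 0) (hs' : Tendsto H atTop (𝓝 0)) :
    ∫ z : ℂ, deriv H (normSq z) = -(Real.pi * H 0) := by
  have h1 := integral_fun_norm_addHaar (volume : Measure ℂ) (fun r : ℝ => deriv H (r ^ 2))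
  simp only [← normSq_eq_norm_sq] at h1
  rw [h1, Complex.finrank_real_complex]
  have hd : ∀ r : ℝ, HasDerivAt (fun r : ℝ => H (r ^ 2) / 2) (r ^ (2 - 1) • deriv H (r ^ 2)) r := fun r => by
    have h2 : HasDerivAt (fun r : ℝ => r ^ 2) (2 * r) r := by simpa using hasDerivAt_pow 2 r
    have h3 : HasDerivAt (fun r : ℝ => H (r ^ 2)) (deriv H (r ^ 2) * (2 * r)) r :=
      HasDerivAt.comp (h₂ := H) r (hH.differentiable (by simp) _).hasDerivAt h2
    exact (h3.div_const 2).congr_deriv (by simp; ring)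
  have h6 : ∫ r in Set.Ioi (0 : ℝ), r ^ (2 - 1) • deriv H (r ^ 2) = 0 - H (0 ^ 2) / 2 := by
    refine integral_Ioi_of_hasDerivAt_of_tendsto' (fun r _ => hd r) ?_ ?_
    · have hc : Continuous fun r : ℝ => r ^ (2 - 1) • deriv H (r ^ 2) :=
        (continuous_pow _).smul ((hH.continuous_deriv (by simp)).comp (continuous_pow 2))
      have h7 : IntegrableOn (fun r : ℝ => r ^ (2 - 1) • deriv H (r ^ 2)) (Set.Icc 0 (T + 1)) :=
        hc.continuousOn.integrableOn_Icc
      refine h7.of_forall_sdiff_eq_zero measurableSet_Ioi fun r hr => ?_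
      have h8 : T + 1 < r := by
        by_contra h9
        exact hr.2 ⟨le_of_lt hr.1, not_lt.1 h9⟩
      rw [hs _ (by nlinarith), smul_zero]
    · have := (hs'.comp (tendsto_pow_atTop two_ne_zero)).div_const 2
      simpa using this
  rw [h6]
  simp [Measure.real]
  ring

theorem tendsto_cutA (ha : 0 < a) : Tendsto (cutA a) atTop (𝓝 0) := by
  refine tendsto_const_nhds.congr' ?_
  filter_upwards [eventually_ge_atTop (2 / a)] with t ht
  rw [cutA_of_ge]
  rwa [div_le_iff₀' ha] at ht

theorem deriv_cutA_of_gt (ha : 0 < a) {t : ℝ} (ht : 2 / a < t) : deriv (cutA a) t = 0 :=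
  (deriv_cutA_eventuallyEq_of_gt (by rwa [div_lt_iff₀' ha] at ht)).self_of_nhds

theorem integral_annMol (ha : 0 < a) : ∫ z, annMol a z = 1 := by
  simp only [annMol]
  rw [integral_const_mul, integral_deriv_comp_normSq contDiff_cutA (T := 2 / a) (by positivity)
    (fun t ht => deriv_cutA_of_gt ha ht) (tendsto_cutA ha), cutA_of_le (by simp)]
  have := Real.pi_ne_zero
  field_simp

theorem contDiff_annMolC : ContDiff ℝ infty (annMolC a) :=
  ofRealCLM.contDiff.comp (contDiff_const.mul (contDiff_deriv_cutA.comp contDiff_normSq))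

theorem annMol_of_gt (h : 2 < a * normSq z) : annMol a z = 0 := by
  rw [annMol, (deriv_cutA_eventuallyEq_of_gt h).self_of_nhds, mul_zero]

theorem tsupport_annMolC_subset : tsupport (annMolC a) ⊆ {z | a * normSq z ≤ 2} :=
  closure_minimal (fun _ hz => not_lt.1 fun h => hz (by rw [annMolC, annMol_of_gt h, ofReal_zero]))
    isClosed_normSq_le

theorem hasCompactSupport_annMolC (ha : 0 < a) : HasCompactSupport (annMolC a) :=
  (isCompact_normSq_le ha).of_isClosed_subset (isClosed_tsupport _) tsupport_annMolC_subset

/-- The difference of two radial mollifiers is `∂∂̄ψ` with `ψ` of compact support. -/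
theorem exists_annMolC_sub_eq (ha : 0 < a) (hab : a ≤ b) : ∃ ψ : ℂ → ℂ, ContDiff ℝ infty ψ ∧
    tsupport ψ ⊆ {z | a * normSq z ≤ 2} ∧ ∀ z, wirtD (wirtDbar ψ) z = annMolC a z - annMolC b z := by
  have hb : 0 < b := ha.trans_le hab
  -- For ψ = p(|z|²) with p' = q one has ∂∂̄ψ = (t q)' at t = |z|², so t q must be a primitive of
  -- the difference of the mollifiers. Both cutoffs are 1 near t = 0, so q vanishes there and
  -- division by t does no harm.
  set q : ℝ → ℝ := fun t => Real.pi⁻¹ * (cutA b t - cutA a t) * t⁻¹ with hq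
  have hq0 : ∀ t, t * q t = Real.pi⁻¹ * (cutA b t - cutA a t) := fun t => by
    by_cases ht : t = 0
    · subst ht; rw [cutA_of_le (by simp), cutA_of_le (by simp)]; simp
    · simp only [hq]; field_simp
  have hqs : ContDiff ℝ infty q := contDiff_iff_contDiffAt.2 fun t => by
    by_cases ht : t = 0
    · subst ht
      refine (contDiffAt_const (c := (0 : ℝ))).congr_of_eventuallyEq ?_
      have h1 : ∀ c : ℝ, ∀ᶠ s : ℝ in 𝓝 0, c * s < 1 := fun c =>
        (continuous_const.mul continuous_id).continuousAt.eventually (gt_mem_nhds (by simp))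
      filter_upwards [h1 a, h1 b] with s hs1 hs2
      simp only [hq]
      rw [cutA_of_le hs1.le, cutA_of_le hs2.le]; simp
    · exact (contDiffAt_const.mul (contDiff_cutA.contDiffAt.sub contDiff_cutA.contDiffAt)).mul
        (contDiffAt_inv _ ht)
  have hqT : ∀ t, 2 / a ≤ t → q t = 0 := fun t ht => by
    have h1 : 2 ≤ a * t := by rwa [div_le_iff₀' ha] at ht
    have ht0 : 0 < t := lt_of_lt_of_le (by positivity) ht
    have h2 : 2 ≤ b * t := h1.trans (by gcongr)
    simp only [hq]
    rw [cutA_of_ge h1, cutA_of_ge h2]; simp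
  -- The primitive is based at 2/a, beyond which q vanishes; hence p vanishes there and ψ has
  -- compact support.
  set p : ℝ → ℝ := fun t => ∫ s in (2 / a)..t, q s with hp
  have hpd : ∀ t, HasDerivAt p (q t) t := fun t =>
    intervalIntegral.integral_hasDerivAt_right (hqs.continuous.intervalIntegrable _ _)
      (hqs.continuous.stronglyMeasurableAtFilter _ _) hqs.continuous.continuousAt
  have hps : ContDiff ℝ infty p := contDiff_infty_iff_deriv.2
    ⟨fun t => (hpd t).differentiableAt, by rw [funext fun t => (hpd t).deriv]; exact hqs⟩
  have hpT : ∀ t, 2 / a ≤ t → p t = 0 := fun t ht => by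
    simp only [hp]
    rw [intervalIntegral.integral_congr (g := fun _ => (0 : ℝ))]
    · simp
    · intro s hs
      rw [Set.uIcc_of_le ht] at hs
      exact hqT s hs.1
  refine ⟨fun z => ((p (normSq z) : ℝ) : ℂ), ofRealCLM.contDiff.comp (hps.comp contDiff_normSq), ?_, ?_⟩
  · refine closure_minimal (fun z hz => show a * normSq z ≤ 2 from not_lt.1 fun h => hz ?_) isClosed_normSq_le
    simp only
    rw [hpT _ (by rw [div_le_iff₀' ha]; exact h.le), ofReal_zero]
  · intro z
    have h1 : wirtDbar (fun z => ((p (normSq z) : ℝ) : ℂ)) = fun z => z * ((q (normSq z) : ℝ) : ℂ) := by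
      ext z
      rw [wirtDbar_normSq_comp (p := fun t => ((p t : ℝ) : ℂ)) (hpd _).ofReal_comp, mul_comm]
    have hqd := (hqs.differentiable (by simp) (normSq z)).hasDerivAt
    have h2 : DifferentiableAt ℝ (fun y : ℂ => ((q (normSq y) : ℝ) : ℂ)) z :=
      (ofRealCLM.contDiff.comp (hqs.comp contDiff_normSq)).differentiable (n := infty) (by simp) z
    have h3 : DifferentiableAt ℂ (fun y : ℂ => y) z := differentiableAt_id
    rw [h1, wirtD_mul (h3.restrictScalars ℝ) h2, h3.wirtD_eq,
      wirtD_normSq_comp (p := fun t => ((q t : ℝ) : ℂ)) hqd.ofReal_comp, deriv_id'', one_mul]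
    have h4 : q (normSq z) + normSq z * deriv q (normSq z) =
        Real.pi⁻¹ * (deriv (cutA b) (normSq z) - deriv (cutA a) (normSq z)) := by
      have h5 := (hasDerivAt_id (normSq z)).mul hqd
      have h6 := ((hasDerivAt_cutA (a := b) (normSq z)).sub (hasDerivAt_cutA (a := a) (normSq z))).const_mul
        Real.pi⁻¹
      have h7 : (fun t => Real.pi⁻¹ * (cutA b - cutA a) t) = id * q := by
        ext t; simp only [Pi.mul_apply, id, hq0, Pi.sub_apply]
      rw [h7] at h6
      have := h5.unique h6
      simpa using this
    have h8 := congrArg (fun t : ℝ => (t : ℂ)) h4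
    push_cast at h8
    rw [annMolC, annMolC, annMol, annMol]
    push_cast
    rw [show z * ((deriv q (normSq z) : ℝ) * starRingEnd ℂ z) = (normSq z : ℂ) * deriv q (normSq z) by
      rw [← mul_conj]; ring, h8]
    ring

theorem wirt_comp_sub {ψ : ℂ → ℂ} (hψ : ContDiff ℝ infty ψ) (z w : ℂ) :
    wirtD (wirtDbar fun w => ψ (z - w)) w = wirtD (wirtDbar ψ) (z - w) := by
  have hd : ∀ w : ℂ, HasDerivAt (fun w : ℂ => z - w) (-1) w := fun w => by
    simpa using (hasDerivAt_id w).const_sub z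
  have h1 : (wirtDbar fun w => ψ (z - w)) = fun w => (-1) * wirtDbar ψ (z - w) := by
    ext w
    rw [wirtDbar_comp_holo (hψ.differentiable (by simp) _) (hd w).differentiableAt, (hd w).deriv]
    simp
  have h2 : Differentiable ℝ (wirtDbar ψ) := (contDiff_wirtDbar hψ).differentiable (by simp)
  rw [h1, wirtD_const_mul (-1) (f := fun w => wirtDbar ψ (z - w))
      (DifferentiableAt.comp (g := wirtDbar ψ) w (h2 _) ((hd w).differentiableAt.restrictScalars ℝ)),
    wirtD_comp_holo (h2 _) (hd w).differentiableAt, (hd w).deriv]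
  ring

theorem exists_abs_le_of_zero {h : ℝ → ℝ} (hc : Continuous h) (h0 : ∀ t, 2 < t → h t = 0) :
    ∃ S : ℝ, 0 ≤ S ∧ ∀ t, 0 ≤ t → |h t| ≤ S := by
  obtain ⟨M, hM⟩ := (isCompact_Icc (a := (0 : ℝ)) (b := 2)).exists_bound_of_continuousOn hc.continuousOn
  have hM0 : 0 ≤ M := (norm_nonneg _).trans (hM 0 (by simp))
  refine ⟨M, hM0, fun t ht => ?_⟩
  by_cases h2 : t ≤ 2
  · exact hM t ⟨ht, h2⟩
  · rw [h0 t (not_le.1 h2), abs_zero]; exact hM0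

theorem exists_bound_annMol : ∃ S : ℝ, 0 ≤ S ∧ (∀ a, 0 < a → ∀ z, |annMol a z| ≤ Real.pi⁻¹ * (a * S)) ∧
    ∀ a, 0 < a → ∀ z, ‖wirtDbar (annMolC a) z‖ ≤ Real.pi⁻¹ * (a ^ 2 * S * ‖z‖) := by
  have hc1 := contDiff_infty_iff_deriv.1 contDiff_cutR
  have hc2 := contDiff_infty_iff_deriv.1 hc1.2
  have hev : ∀ t, 2 < t → deriv cutR =ᶠ[𝓝 t] fun _ => 0 := fun t ht => by
    filter_upwards [lt_mem_nhds ht] with s hs using deriv_cutR_of_ge hs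
  obtain ⟨S1, h1, hS1⟩ := exists_abs_le_of_zero hc1.2.continuous fun t ht => (hev t ht).self_of_nhds
  obtain ⟨S2, h2, hS2⟩ := exists_abs_le_of_zero hc2.2.continuous fun t ht => by
    rw [(hev t ht).deriv_eq, deriv_const]
  have d1 : ∀ a : ℝ, deriv (cutA a) = fun t => a * deriv cutR (a * t) := fun a => by
    ext t; exact deriv_comp_mul_left a cutR t
  have hpi := Real.pi_pos
  refine ⟨S1 + S2, by positivity, fun a ha z => ?_, fun a ha z => ?_⟩
  · rw [annMol, abs_mul, abs_neg, abs_of_pos (inv_pos.2 hpi), d1, abs_mul, abs_of_pos ha]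
    gcongr
    exact (hS1 _ (mul_nonneg ha.le (normSq_nonneg z))).trans (by linarith)
  · have hd := (hasDerivAt_deriv_cutA (a := a) (normSq z)).const_mul (-Real.pi⁻¹)
    have d2 : deriv (deriv (cutA a)) (normSq z) = a ^ 2 * deriv (deriv cutR) (a * normSq z) := by
      rw [d1, deriv_const_mul_field, deriv_comp_mul_left a (deriv cutR), smul_eq_mul]; ring
    have h3 : wirtDbar (annMolC a) z = _ :=
      wirtDbar_normSq_comp (p := fun t => ((-Real.pi⁻¹ * deriv (cutA a) t : ℝ) : ℂ)) hd.ofReal_comp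
    rw [h3, norm_mul, norm_real, norm_mul, norm_neg, Real.norm_of_nonneg (inv_pos.2 hpi).le, d2, mul_assoc]
    refine mul_le_mul_of_nonneg_left ?_ (inv_pos.2 hpi).le
    rw [norm_mul, Real.norm_of_nonneg (by positivity)]
    gcongr
    exact (hS2 _ (mul_nonneg ha.le (normSq_nonneg z))).trans (by linarith)

/-- Lebesgue differentiation. With parameter 2(n+1)² the mollifier is supported in the disc of
radius 1/(n+1) and bounded by 2S divided by the area of that disc. -/
theorem tendsto_cconv_annMolC (hU : LocallyIntegrable U) : ∀ᵐ z,
    Tendsto (fun n : ℕ => cconv U (annMolC (2 * ((n : ℝ) + 1) ^ 2)) z) atTop (𝓝 (U z)) := by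
  obtain ⟨S, hS0, hS, -⟩ := exists_bound_annMol
  filter_upwards [(Besicovitch.vitaliFamily volume).ae_tendsto_average_norm_sub hU] with z hz
  have hr : Tendsto (fun n : ℕ => ((n : ℝ) + 1)⁻¹) atTop (𝓝[>] 0) := by
    refine tendsto_nhdsWithin_iff.2 ⟨?_, Eventually.of_forall fun n => ?_⟩
    · simpa using tendsto_one_div_add_atTop_nhds_zero_nat (𝕜 := ℝ)
    · exact Set.mem_Ioi.2 (by positivity)
  have h1 := (hz.comp (Besicovitch.tendsto_filterAt volume z)).comp hr
  have h2 := tendsto_integral_smul_of_tendsto_average_norm_sub (μ := volume) (f := U) (c := U z)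
    (a := fun n : ℕ => Metric.closedBall z ((n : ℝ) + 1)⁻¹)
    (g := fun n t => annMol (2 * ((n : ℝ) + 1) ^ 2) (z - t)) (2 * S) h1 ?_ ?_ ?_ ?_
  · refine h2.congr fun n => ?_
    rw [cconv]
    congr 1; ext t
    rw [real_smul, mul_comm, annMolC]
  · exact Eventually.of_forall fun n => hU.integrableOn_isCompact (isCompact_closedBall _ _)
  · refine tendsto_const_nhds.congr fun n => ?_
    rw [integral_sub_left_eq_self, integral_annMol (by positivity)]
  · refine Eventually.of_forall fun n t ht => ?_
    rw [Metric.mem_closedBall, dist_comm, dist_eq_norm]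
    have h3 : 2 * ((n : ℝ) + 1) ^ 2 * normSq (z - t) ≤ 2 := not_lt.1 fun h => ht (annMol_of_gt h)
    rw [normSq_eq_norm_sq] at h3
    rw [← one_div, le_div_iff₀ (by positivity)]
    nlinarith [norm_nonneg (z - t), mul_nonneg (norm_nonneg (z - t)) (by positivity : (0:ℝ) ≤ n + 1)]
  · refine Eventually.of_forall fun n t => (hS _ (by positivity) _).trans (le_of_eq ?_)
    rw [Measure.real, Complex.volume_closedBall, ENNReal.toReal_mul, ENNReal.toReal_pow,
      ENNReal.toReal_ofReal (by positivity)]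
    simp
    field_simp

/-- Two radial mollifiers differ by ∂∂̄ψ with ψ compactly supported, so the weak equation makes the
convolution of U with them independent of their width. Letting the width tend to 0 recovers U almost
everywhere, so the smooth convolution is equal to U. The estimates at the centre come from sup
bounds on a mollifier of width comparable to R and from ‖U‖₁ ≤ √π R N. -/
theorem exists_weyl : ∃ K : ℝ, 0 ≤ K ∧ ∀ (c : ℂ) (R N : ℝ) (U : ℂ → ℂ), 0 < R → 0 ≤ N →
    AEStronglyMeasurable U (volume.restrict (Metric.ball c R)) →
    ∫⁻ z in Metric.ball c R, ‖U z‖ₑ ^ 2 ≤ ENNReal.ofReal (N ^ 2) →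
    (∀ g : ℂ → ℂ, ContDiff ℝ infty g → HasCompactSupport g → tsupport g ⊆ Metric.ball c R →
      ∫ w in Metric.ball c R, wirtD (wirtDbar g) w * U w = 0) →
    ∃ V : ℂ → ℂ, ContDiff ℝ infty V ∧ (∀ᵐ z, z ∈ Metric.ball c (R / 2) → V z = U z) ∧
      (∀ z ∈ Metric.ball c (R / 2), wirtD (wirtDbar V) z = 0) ∧
      ‖V c‖ ≤ K * N / R ∧ ‖wirtDbar V c‖ ≤ K * N / R ^ 2 := by
  obtain ⟨S, hS0, hS1, hS2⟩ := exists_bound_annMol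
  refine ⟨Real.pi⁻¹ * √Real.pi * (256 * S), by positivity, fun c R N U hR hN hm hL2 hweak => ?_⟩
  set B := Metric.ball c R with hB
  set U' := B.indicator U with hU'
  have hBm : MeasurableSet B := Metric.isOpen_ball.measurableSet
  have hL1 : ∫⁻ z in B, ‖U z‖ₑ ≤ ENNReal.ofReal (√Real.pi * R * N) := by
    have h1 := (sq_lintegral_le (volume.restrict B) hm.enorm).trans (mul_le_mul_right hL2 _)
    have h2 : (volume.restrict B) Set.univ * ENNReal.ofReal (N ^ 2) =
        ENNReal.ofReal (√Real.pi * R * N) ^ 2 := by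
      rw [Measure.restrict_apply_univ, hB, Complex.volume_ball, ← ENNReal.ofReal_pow (by positivity),
        ← ENNReal.ofReal_pow (p := √Real.pi * R * N) (by positivity), mul_pow, mul_pow, Real.sq_sqrt Real.pi_pos.le,
        ENNReal.ofReal_mul (by positivity), ENNReal.ofReal_mul (by positivity),
        mul_comm (ENNReal.ofReal (R ^ 2))]
      congr 2
      exact (ENNReal.ofReal_coe_nnreal (p := NNReal.pi)).symm
    rw [h2] at h1
    exact (ENNReal.pow_le_pow_left_iff two_ne_zero).1 h1
  have hUi : IntegrableOn U B := ⟨hm, by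
    rw [hasFiniteIntegral_iff_enorm]; exact hL1.trans_lt ENNReal.ofReal_lt_top⟩
  have hUi' : Integrable U' := (integrable_indicator_iff hBm).2 hUi
  have hUl : LocallyIntegrable U' := hUi'.locallyIntegrable
  have hUn : ∫ z, ‖U' z‖ ≤ √Real.pi * R * N := by
    have h1 : ∫ z, ‖U' z‖ = ∫ z in B, ‖U z‖ := by
      rw [← integral_indicator hBm]
      congr 1; ext z; exact norm_indicator_eq_indicator_norm _ _
    rw [h1, integral_norm_eq_lintegral_enorm hm]
    exact ENNReal.toReal_le_of_le_ofReal (by positivity) hL1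
  have hbound : ∀ (g : ℂ → ℂ) (s : ℝ), 0 ≤ s → (∀ z, ‖z‖ ≤ R → ‖g z‖ ≤ s) →
      ‖cconv U' g c‖ ≤ s * (√Real.pi * R * N) := fun g s hs hg => by
    refine (norm_integral_le_of_norm_le (hUi'.norm.const_mul s) (ae_of_all _ fun t => ?_)).trans ?_
    · by_cases ht : t ∈ B
      · rw [norm_mul, mul_comm]
        refine mul_le_mul_of_nonneg_right (hg _ ?_) (norm_nonneg _)
        rw [← dist_eq_norm, dist_comm]
        exact (Metric.mem_ball.1 ht).le
      · simp only [hU', Set.indicator_of_notMem ht]; simp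
    · rw [integral_const_mul]; gcongr
  -- The mollifier is supported in |z| ≤ R/√8 < R/2, so its translates to points of the half disc
  -- stay inside the disc. The square of 16 gives the 256 in the constant.
  set a : ℝ := 16 / R ^ 2 with ha
  have ha0 : 0 < a := by positivity
  have htest : ∀ ψ : ℂ → ℂ, ContDiff ℝ infty ψ → tsupport ψ ⊆ {z | a * normSq z ≤ 2} →
      ∀ z ∈ Metric.ball c (R / 2), cconv U' (fun y => wirtD (wirtDbar ψ) y) z = 0 := fun ψ hψ hψs z hz => by
    have hcl : IsClosed {w : ℂ | a * normSq (z - w) ≤ 2} :=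
      isClosed_le (continuous_const.mul (continuous_normSq.comp (continuous_const.sub continuous_id))) continuous_const
    have hts : tsupport (fun w => ψ (z - w)) ⊆ {w | a * normSq (z - w) ≤ 2} :=
      closure_minimal (fun w hw => hψs (subset_tsupport _ hw)) hcl
    have hsub : {w : ℂ | a * normSq (z - w) ≤ 2} ⊆ B := fun w hw => by
      have h1 : a * normSq (z - w) ≤ 2 := hw
      rw [ha, normSq_eq_norm_sq, div_mul_eq_mul_div, div_le_iff₀ (by positivity)] at h1
      have h2 : ‖z - w‖ < R / 2 := by
        refine lt_of_pow_lt_pow_left₀ 2 (by positivity) ?_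
        nlinarith
      rw [hB, Metric.mem_ball]
      rw [Metric.mem_ball] at hz
      have h3 := dist_triangle w z c
      rw [dist_comm w z, dist_eq_norm z w] at h3
      linarith
    have h3 := hweak (fun w => ψ (z - w)) (hψ.comp (contDiff_const.sub contDiff_id))
      ((isCompact_closedBall c R).of_isClosed_subset (isClosed_tsupport _)
        ((hts.trans hsub).trans Metric.ball_subset_closedBall)) (hts.trans hsub)
    rw [← integral_indicator hBm] at h3
    rw [← h3, cconv]
    congr 1; ext w
    by_cases hw : w ∈ B
    · rw [hU', Set.indicator_of_mem hw, Set.indicator_of_mem hw, wirt_comp_sub hψ]; ring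
    · rw [hU', Set.indicator_of_notMem hw, Set.indicator_of_notMem hw, zero_mul]
  refine ⟨cconv U' (annMolC a), contDiff_cconv hUl contDiff_annMolC (hasCompactSupport_annMolC ha0), ?_, ?_, ?_, ?_⟩
  · filter_upwards [tendsto_cconv_annMolC hUl] with z hz hzB
    have hzU : U' z = U z := Set.indicator_of_mem (Metric.ball_subset_ball (by linarith) hzB) _
    rw [← hzU]
    refine tendsto_nhds_unique (tendsto_const_nhds.congr' ?_) hz
    have hlim : Tendsto (fun n : ℕ => 2 * ((n : ℝ) + 1) ^ 2) atTop atTop :=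
      Tendsto.const_mul_atTop two_pos ((tendsto_pow_atTop two_ne_zero).comp
        (tendsto_atTop_add_const_right _ 1 tendsto_natCast_atTop_atTop))
    filter_upwards [hlim.eventually_ge_atTop a] with n hn
    obtain ⟨ψ, hψ, hψs, hψe⟩ := exists_annMolC_sub_eq ha0 hn
    have h1 := htest ψ hψ hψs z hzB
    simp only [hψe] at h1
    rw [cconv] at h1
    simp only [mul_sub] at h1
    rw [integral_sub (integrable_cconv hUl contDiff_annMolC.continuous (hasCompactSupport_annMolC ha0) z)
      (integrable_cconv hUl contDiff_annMolC.continuous (hasCompactSupport_annMolC (by positivity)) z)] at h1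
    exact sub_eq_zero.1 h1
  · intro z hz
    have h1 : wirtDbar (cconv U' (annMolC a)) = cconv U' (wirtDbar (annMolC a)) :=
      funext (wirtDbar_cconv hUl contDiff_annMolC (hasCompactSupport_annMolC ha0))
    rw [h1, wirtD_cconv hUl (contDiff_wirtDbar contDiff_annMolC)
      (hasCompactSupport_wirtDbar (hasCompactSupport_annMolC ha0))]
    exact htest _ contDiff_annMolC tsupport_annMolC_subset z hz
  · refine (hbound _ (Real.pi⁻¹ * (a * S)) (by positivity) fun z _ => ?_).trans (le_of_eq_of_le
      (b := Real.pi⁻¹ * √Real.pi * (16 * S) * N / R) ?_ ?_)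
    · rw [annMolC, norm_real]; exact hS1 a ha0 z
    · rw [ha]; field_simp
    · gcongr; norm_num
  · rw [wirtDbar_cconv hUl contDiff_annMolC (hasCompactSupport_annMolC ha0)]
    refine (hbound _ (Real.pi⁻¹ * (a ^ 2 * S * R)) (by positivity) fun z hz => ?_).trans (le_of_eq ?_)
    · refine (hS2 a ha0 z).trans ?_
      gcongr
    · rw [ha]; field_simp; ring

end Weyl

end

noncomputable section

set_option linter.unusedSectionVars false

namespace RiemannSurface

namespace SpinBundle

local notation "conj" => starRingEnd ℂ
local notation "infty" => ((⊤ : ℕ∞) : WithTop ℕ∞)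

variable {X : Type*} [TopologicalSpace X] [ChartedSpace ℂ X] {C : SpinBundle X}
  {ω : ∀ p : X, TangentSpace 𝓘(ℂ) p →L[ℂ] ℂ}
  [IsManifold 𝓘(ℂ) 1 X] [T2Space X] [CompactSpace X] [MeasurableSpace X] [BorelSpace X]
  (hω : ω ∈ holomorphicOneForms X) (hz : (zeros ω).Finite) {u v : X → ℂ}

/-! ### Regularity of the elements of the kernel of `Δ*` -/

include hω hz in
theorem eq_of_ae_eq_of_smoothAt {W : Set X} (hW : IsOpen W) (hu : ∀ p ∈ W, C.SmoothAt u p)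
    (hv : ∀ p ∈ W, C.SmoothAt v p) (h : ∀ᵐ p ∂(C.hArea ω), p ∈ W → u p = v p) {p : X} (hp : p ∈ W) :
    u p = v p := by
  set F := C.chartFrame (C.idx p) with hF
  have hpF : p ∈ F.ξ.source := mem_source_idx p
  have h1 := F.ae_target_of_ae hω hz (h.mono fun q hq _ => hq)
  set O := F.ξ.target ∩ F.ξ.symm ⁻¹' W with hO
  have hOo : IsOpen O := F.ξ.isOpen_inter_preimage_symm hW
  have h2 : F.rep u =ᵐ[volume.restrict O] F.rep v := by
    rw [EventuallyEq, ae_restrict_iff' hOo.measurableSet]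
    filter_upwards [h1] with z hz1 hz2
    have h3 : u (F.ξ.symm z) = v (F.ξ.symm z) := hz1 hz2.1 hz2.2
    rw [Frame.rep, frameRep, h3, Frame.rep, frameRep]
  have hc : ∀ w : X → ℂ, (∀ p ∈ W, C.SmoothAt w p) → ContinuousOn (F.rep w) O := fun w hw z hz => by
    have := hw _ hz.2 F (F.ξ.map_target hz.1)
    rw [F.ξ.right_inv hz.1] at this
    exact this.continuousAt.continuousWithinAt
  have h3 := Measure.eqOn_open_of_ae_eq h2 hOo (hc u hu) (hc v hv)
  have hpO : F.ξ p ∈ O := ⟨F.ξ.map_source hpF, by rw [Set.mem_preimage, F.ξ.left_inv hpF]; exact hp⟩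
  exact F.eq_of_rep_eq hpF (h3 hpO)

include hω hz in
/-- The weak equation in a flat frame. -/
theorem weak_equation {k : C.L2 ω} (hk : (k, 0) ∈ (C.testOperator ω (C.laplacian ω)).adjoint.graph)
    {F : C.Frame} (hF : F.IsFlat ω) {g : ℂ → ℂ} (hg : ContDiff ℝ infty g) (hgc : HasCompactSupport g)
    (hgs : tsupport g ⊆ F.ξ.target) : ∫ w, wirtD (wirtDbar g) w * F.rep k w = 0 := by
  -- The scalar product is conjugate linear in the test section; testing with the conjugate of g
  -- produces an equation linear in g.
  have hcs : tsupport (fun z => conj (g z)) = tsupport g := by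
    rw [tsupport, tsupport]; congr 1; ext z; simp
  have hcg : ContDiff ℝ infty fun z => conj (g z) := Complex.conjCLE.contDiff.comp hg
  have hcgc : HasCompactSupport fun z => conj (g z) := by rw [HasCompactSupport, hcs]; exact hgc
  have hts := F.isTestSection_ofFun (ω := ω) hcg hcgc (hcs ▸ hgs) fun z hz => by
    rw [hF z (hgs (hcs ▸ hz))]; exact one_ne_zero
  have h1 := (mem_graph_adjoint_testOperator hω hz (flatOp_laplacian hω)).1 hk _ hts
  have h2 : C.ip ω (F.ofFun fun z => conj (g z)) ((0 : C.L2 ω) : X → ℂ) = 0 := by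
    rw [ip]
    refine integral_eq_zero_of_ae ?_
    filter_upwards [Lp.coeFn_zero ℂ 2 (C.hArea ω)] with p hp
    rw [hp]; simp
  have hlap : ∀ z, -wirtD (wirtDbar fun z => conj (g z)) z = -conj (wirtD (wirtDbar g) z) := fun z => by
    have e1 : (wirtDbar fun z => conj (g z)) = fun z => conj (wirtD g z) := funext fun z =>
      wirtDbar_conj (hg.differentiable (by simp) z)
    have e2 : DifferentiableAt ℝ (wirtD g) z :=
      differentiableAt_of_contDiffAt_infty hg.contDiffAt.wirtD_infty
    rw [e1, wirtD_conj e2, wirtDbar_wirtD_comm (hg.contDiffAt.of_le (WithTop.coe_le_coe.2 (le_top : (2 : ℕ∞) ≤ ⊤)))]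
  rw [h2, (flatOp_laplacian hω).ofFun_eq hF hcg hcgc (hcs ▸ hgs), ← conj_ip] at h1
  have hm : Measurable fun z => -wirtD (wirtDbar fun z => conj (g z)) z :=
    (continuous_wirtD (contDiff_wirtDbar hcg)).neg.measurable
  have hs : (tsupport fun z => -wirtD (wirtDbar fun z => conj (g z)) z) ⊆ F.ξ.target := by
    refine subset_trans (closure_minimal (fun z hz => ?_) (isClosed_tsupport g)) hgs
    by_contra h
    have h3 : (fun z => conj (g z)) =ᶠ[𝓝 z] fun _ => 0 := notMem_tsupport_iff_eventuallyEq.1 (hcs ▸ h)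
    have h4 : (wirtDbar fun z => conj (g z)) =ᶠ[𝓝 z] fun _ => 0 := by
      filter_upwards [h3.eventuallyEq_nhds] with y hy
      rw [hy.wirtDbar_eq]; exact wirtDbar_const 0
    refine hz ?_
    simp only
    rw [h4.wirtD_eq, wirtD_const, neg_zero]
  rw [hF.ip_ofFun hω (Lp.aestronglyMeasurable k) hm hs] at h1
  simp only [hlap] at h1
  rw [← integral_conj] at h1
  simp only [map_mul, map_neg, Complex.conj_conj, mul_neg, integral_neg, neg_eq_zero] at h1
  rw [← h1]
  congr 1; ext w; ring

include hω hz in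
-- The constant depends neither on k, nor on the frame, nor on the disc. This uniformity turns
-- interior estimates on shrinking discs into growth bounds at a zero.
theorem exists_local_harmonic_rep : ∃ K : ℝ, 0 ≤ K ∧ ∀ (k : C.L2 ω),
    (k, 0) ∈ (C.testOperator ω (C.laplacian ω)).adjoint.graph → ∀ (F : C.Frame), F.IsFlat ω →
    ∀ p ∈ F.ξ.source, ∀ R > 0, Metric.ball (F.ξ p) R ⊆ F.ξ.target → ∃ V : ℂ → ℂ, ContDiff ℝ infty V ∧
      (∀ᵐ q ∂(C.hArea ω), q ∈ F.ξ.source → F.ξ q ∈ Metric.ball (F.ξ p) (R / 2) → k q = F.ofFun V q) ∧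
      (∀ z ∈ Metric.ball (F.ξ p) (R / 2), wirtD (wirtDbar V) z = 0) ∧
      ‖V (F.ξ p)‖ ≤ K * ‖k‖ / R ∧ ‖wirtDbar V (F.ξ p)‖ ≤ K * ‖k‖ / R ^ 2 := by
  obtain ⟨K, hK0, hK⟩ := exists_weyl
  refine ⟨K, hK0, fun k hk F hF p hp R hR hB => ?_⟩
  have hBm : MeasurableSet (Metric.ball (F.ξ p) R) := Metric.isOpen_ball.measurableSet
  have hL2 : ∫⁻ z in Metric.ball (F.ξ p) R, ‖F.rep k z‖ₑ ^ 2 ≤ ENNReal.ofReal (‖k‖ ^ 2) := by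
    have h1 := F.lintegral_source hω (Lp.aestronglyMeasurable k)
    have h2 : ‖k‖ₑ ^ 2 = C.nsq ω k := enorm_sq_eq_nsq EventuallyEq.rfl
    rw [ENNReal.ofReal_pow (norm_nonneg _), ofReal_norm, h2, nsq]
    refine le_trans ?_ (setLIntegral_le_lintegral F.ξ.source _)
    rw [h1]
    refine le_trans (le_of_eq ?_) (lintegral_mono_set hB)
    refine setLIntegral_congr_fun hBm fun z hz => ?_
    simp only [hF z (hB hz), enorm_one, mul_one]
  obtain ⟨V, hV1, hV2, hV3, hV4, hV5⟩ := hK (F.ξ p) R ‖k‖ (F.rep k) hR (norm_nonneg _)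
    ((F.aestronglyMeasurable_rep hω hz (Lp.aestronglyMeasurable k)).mono_measure
      (Measure.restrict_mono hB le_rfl)) hL2 fun g hg hgc hgs => by
        rw [← weak_equation hω hz hk hF hg hgc (hgs.trans hB)]
        refine setIntegral_eq_integral_of_forall_compl_eq_zero fun z hz => ?_
        have h3 : g =ᶠ[𝓝 z] fun _ => 0 := notMem_tsupport_iff_eventuallyEq.1 fun h => hz (hgs h)
        have h4 : wirtDbar g =ᶠ[𝓝 z] fun _ => 0 := by
          filter_upwards [h3.eventuallyEq_nhds] with y hy
          rw [hy.wirtDbar_eq]; exact wirtDbar_const 0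
        rw [h4.wirtD_eq, wirtD_const, zero_mul]
  refine ⟨V, hV1, ?_, hV3, hV4, hV5⟩
  have h1 : ∀ᵐ z, z ∈ F.ξ.target → (F.ξ (F.ξ.symm z) ∈ Metric.ball (F.ξ p) (R / 2) →
      k (F.ξ.symm z) = F.ofFun V (F.ξ.symm z)) := by
    filter_upwards [hV2] with z hz hzt hzB
    rw [F.ξ.right_inv hzt] at hzB
    refine F.eq_of_rep_eq (v := F.ofFun V) (F.ξ.map_target hzt) ?_
    rw [F.ξ.right_inv hzt, F.rep_ofFun _ hzt, hz hzB]
  exact F.ae_of_ae_target hω (P := fun q => F.ξ q ∈ Metric.ball (F.ξ p) (R / 2) → k q = F.ofFun V q) h1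

include hω hz in
/-- An element of the kernel of `Δ*` has a smooth harmonic representative off the zeros, with
interior estimates. -/
theorem exists_harmonic_rep {k : C.L2 ω}
    (hk : (k, 0) ∈ (C.testOperator ω (C.laplacian ω)).adjoint.graph) : ∃ (κ : X → ℂ) (K : ℝ),
    k =ᵐ[C.hArea ω] κ ∧ (∀ p ∉ zeros ω, C.SmoothAt κ p) ∧ (∀ p ∉ zeros ω, C.laplacian ω κ p = 0) ∧
    ∀ (F : C.Frame), F.IsFlat ω → ∀ p ∈ F.ξ.source, ∀ R > 0, Metric.ball (F.ξ p) R ⊆ F.ξ.target →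
      ‖F.rep κ (F.ξ p)‖ ≤ K / R ∧ ‖wirtDbar (F.rep κ) (F.ξ p)‖ ≤ K / R ^ 2 := by
  classical
  obtain ⟨K, hK0, hK⟩ := exists_local_harmonic_rep (C := C) hω hz
  have hex : ∀ p, ∃ F : C.Frame, p ∉ zeros ω → p ∈ F.ξ.source ∧ F.IsFlat ω ∧
      ∃ R > 0, F.ξ.target = Metric.ball (F.ξ p) R := fun p => by
    by_cases hp : p ∈ zeros ω
    · exact ⟨C.chartFrame (C.idx p), fun h => absurd hp h⟩
    · obtain ⟨F, hF⟩ := exists_flat_frame (C := C) hω hp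
      exact ⟨F, fun _ => hF⟩
  choose G hG using hex
  have hGp := fun p hp => (hG p hp).1
  have hGf := fun p hp => (hG p hp).2.1
  choose! R hR hGt using fun p hp => (hG p hp).2.2
  choose! V hV1 hV2 hV3 hV4 hV5 using fun p (hp : p ∉ zeros ω) =>
    hK k hk (G p) (hGf p hp) p (hGp p hp) (R p) (hR p hp) (hGt p hp).ge
  -- At each p the value is taken from the local representative constructed around p.
  set κ : X → ℂ := fun p => (G p).ofFun (V p) p with hκ
  -- Two smooth local representatives of k agree almost everywhere, hence everywhere, on the
  -- overlap; so κ coincides with each of them and does not depend on the choices.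
  have hloc : ∀ (F : C.Frame) (U : ℂ → ℂ) (p : X) (r : ℝ), F.IsFlat ω → ContDiff ℝ infty U →
      (∀ᵐ q ∂(C.hArea ω), q ∈ F.ξ.source → F.ξ q ∈ Metric.ball (F.ξ p) r → k q = F.ofFun U q) →
      ∀ q ∈ F.ξ.source, F.ξ q ∈ Metric.ball (F.ξ p) r → κ q = F.ofFun U q := by
    intro F U p r hF hU hae q hq hqr
    have hqz := hF.notMem_zeros hq
    set W : Set X := (F.ξ.source ∩ F.ξ ⁻¹' Metric.ball (F.ξ p) r) ∩
      ((G q).ξ.source ∩ (G q).ξ ⁻¹' Metric.ball ((G q).ξ q) (R q / 2)) with hW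
    have hWo : IsOpen W := (F.ξ.isOpen_inter_preimage Metric.isOpen_ball).inter
      ((G q).ξ.isOpen_inter_preimage Metric.isOpen_ball)
    refine eq_of_ae_eq_of_smoothAt (u := (G q).ofFun (V q)) hω hz hWo
      (fun x hx => (G q).smoothAt_ofFun hx.2.1 (hV1 q hqz).contDiffAt)
      (fun x hx => F.smoothAt_ofFun hx.1.1 hU.contDiffAt) ?_
      ⟨⟨hq, hqr⟩, hGp q hqz, Metric.mem_ball_self (by linarith [hR q hqz])⟩
    filter_upwards [hae, hV2 q hqz] with x h1 h2 hx
    rw [← h1 hx.1.1 hx.1.2, h2 hx.2.1 hx.2.2]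
  have hev : ∀ (F : C.Frame) (U : ℂ → ℂ) (p : X) (r : ℝ), F.IsFlat ω → ContDiff ℝ infty U → 0 < r →
      (∀ᵐ q ∂(C.hArea ω), q ∈ F.ξ.source → F.ξ q ∈ Metric.ball (F.ξ p) r → k q = F.ofFun U q) →
      p ∈ F.ξ.source → κ =ᶠ[𝓝 p] F.ofFun U := fun F U p r hF hU hr hae hp => by
    filter_upwards [F.ξ.open_source.mem_nhds hp,
      (F.ξ.continuousAt hp) (Metric.ball_mem_nhds _ hr)] with q hq1 hq2
    exact hloc F U p r hF hU hae q hq1 hq2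
  have hevp : ∀ p ∉ zeros ω, κ =ᶠ[𝓝 p] (G p).ofFun (V p) := fun p hp =>
    hev (G p) (V p) p (R p / 2) (hGf p hp) (hV1 p hp) (by linarith [hR p hp]) (hV2 p hp) (hGp p hp)
  have hsm : ∀ p ∉ zeros ω, C.SmoothAt κ p := fun p hp =>
    ((G p).smoothAt_ofFun (hGp p hp) (hV1 p hp).contDiffAt).congr (hevp p hp)
  have hrepev : ∀ (F : C.Frame) (U : ℂ → ℂ) (p : X), κ =ᶠ[𝓝 p] F.ofFun U → p ∈ F.ξ.source →
      F.rep κ =ᶠ[𝓝 (F.ξ p)] U := fun F U p h hp => by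
    filter_upwards [rep_congr_of_eventuallyEq F hp h, F.ξ.open_target.mem_nhds (F.ξ.map_source hp)] with z h1 h2
    rw [h1, F.rep_ofFun _ h2]
  refine ⟨κ, K * ‖k‖, ?_, hsm, fun p hp => ?_, fun F hF p hp r hr hB => ?_⟩
  · refine ae_of_locally hω hz fun p hp => ⟨(G p).ξ.source ∩ (G p).ξ ⁻¹' Metric.ball ((G p).ξ p) (R p / 2),
      ((G p).ξ.isOpen_inter_preimage Metric.isOpen_ball).mem_nhds
        ⟨hGp p hp, Metric.mem_ball_self (by linarith [hR p hp])⟩, ?_⟩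
    filter_upwards [hV2 p hp] with q h1 h2
    rw [h1 h2.1 h2.2, hloc (G p) (V p) p (R p / 2) (hGf p hp) (hV1 p hp) (hV2 p hp) q h2.1 h2.2]
  · have h1 := (flatOp_laplacian hω).rep_eq (hGf p hp) (hGp p hp) (hsm p hp)
    rw [(flatOp_laplacian (C := C) hω).congr (hrepev _ _ p (hevp p hp) (hGp p hp)),
      hV3 p hp _ (Metric.mem_ball_self (by linarith [hR p hp])), neg_zero] at h1
    exact ((G p).rep_ne_zero_iff (hGp p hp)).1 h1
  · obtain ⟨U, hU1, hU2, -, hU4, hU5⟩ := hK k hk F hF p hp r hr hB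
    have h1 := hrepev F U p (hev F U p (r / 2) hF hU1 (by linarith) hU2 hp) hp
    rw [h1.wirtDbar_eq, h1.self_of_nhds]
    exact ⟨hU4, hU5⟩

end SpinBundle

end RiemannSurface

end

noncomputable section

set_option linter.unusedSectionVars false

/-! ### Asymptotics of harmonic sections at a zero -/

section Asymptotics

open Complex RiemannSurface RiemannSurface.SpinBundle

local notation "infty" => ((⊤ : ℕ∞) : WithTop ℕ∞)

/-- As s < N + 1, the product x^N G is o(|x|⁻¹) and the singularity is removable. The condition N ≠
0 makes the product vanish at 0 whatever value G has there. -/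
theorem exists_extension_of_bound {G : ℂ → ℂ} {δ M s : ℝ} {N : ℕ} (hN : N ≠ 0) (hδ : 0 < δ)
    (hG : ∀ x, x ≠ 0 → ‖x‖ < δ → DifferentiableAt ℂ G x) (hs : s < N + 1)
    (hM : ∀ x, x ≠ 0 → ‖x‖ < δ → ‖G x‖ ≤ M * ‖x‖ ^ (-s)) :
    ∃ B : ℂ → ℂ, DifferentiableOn ℂ B (Metric.ball 0 δ) ∧ ∀ x, x ≠ 0 → ‖x‖ < δ → x ^ N * G x = B x := by
  set f : ℂ → ℂ := fun x => x ^ N * G x with hf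
  have hball : Metric.ball (0 : ℂ) δ ∈ 𝓝 (0 : ℂ) := Metric.ball_mem_nhds _ hδ
  have h1 : DifferentiableOn ℂ f (Metric.ball 0 δ \ {0}) := fun x hx =>
    ((differentiableAt_id.pow N).mul (hG x hx.2 (mem_ball_zero_iff.1 hx.1))).differentiableWithinAt
  have h2 : (fun z => f z - f 0) =o[𝓝[≠] 0] fun z => (z - 0)⁻¹ := by
    have hf0 : f 0 = 0 := by simp [hf, hN]
    simp only [hf0, sub_zero]
    have hlim : Tendsto (fun z : ℂ => |M| * ‖z‖ ^ ((N : ℝ) + 1 - s)) (𝓝[≠] 0) (𝓝 0) := by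
      have h3 : ContinuousAt (fun z : ℂ => |M| * ‖z‖ ^ ((N : ℝ) + 1 - s)) 0 :=
        continuousAt_const.mul (continuous_norm.continuousAt.rpow_const (Or.inr (by linarith)))
      have h4 := h3.tendsto.mono_left (nhdsWithin_le_nhds (s := {0}ᶜ))
      simpa [Real.zero_rpow (by linarith : (N : ℝ) + 1 - s ≠ 0)] using h4
    refine Asymptotics.isLittleO_iff.2 fun c hc => ?_
    filter_upwards [hlim.eventually (gt_mem_nhds hc), self_mem_nhdsWithin, nhdsWithin_le_nhds hball]
      with z hz hz0 hzb
    have hn : 0 < ‖z‖ := norm_pos_iff.2 hz0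
    have h5 := hM z hz0 (mem_ball_zero_iff.1 hzb)
    rw [norm_inv, ← div_eq_mul_inv, le_div_iff₀ hn]
    refine le_trans ?_ hz.le
    have h6 : ‖z‖ ^ ((N : ℝ) + 1 - s) = ‖z‖ ^ N * ‖z‖ ^ (-s) * ‖z‖ := by
      rw [sub_eq_add_neg, Real.rpow_add hn, Real.rpow_add_one hn.ne', Real.rpow_natCast]; ring
    rw [h6, hf, norm_mul, norm_pow]
    calc ‖z‖ ^ N * ‖G z‖ * ‖z‖ ≤ ‖z‖ ^ N * (|M| * ‖z‖ ^ (-s)) * ‖z‖ := by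
          gcongr
          exact h5.trans (by gcongr; exact le_abs_self M)
      _ = _ := by ring
  refine ⟨_, Complex.differentiableOn_update_limUnder_of_isLittleO hball h1 h2, fun x hx _ => ?_⟩
  rw [Function.update_of_ne hx]

theorem exists_eq_add_mul {B : ℂ → ℂ} {δ : ℝ} (hδ : 0 < δ) (hB : DifferentiableOn ℂ B (Metric.ball 0 δ)) :
    ∃ B₁ : ℂ → ℂ, DifferentiableOn ℂ B₁ (Metric.ball 0 δ) ∧ ∀ x, B x = B 0 + x * B₁ x := by
  refine ⟨dslope B 0, (Complex.differentiableOn_dslope (Metric.ball_mem_nhds _ hδ)).2 hB, fun x => ?_⟩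
  have := sub_smul_dslope B 0 x
  rw [sub_zero, smul_eq_mul] at this
  rw [this]; ring

/-- The solution of `x H' + H / 2 = A`. -/
theorem exists_ode_solution {A : ℂ → ℂ} {δ : ℝ} (hA : DifferentiableOn ℂ A (Metric.ball 0 δ)) :
    ∃ H : ℂ → ℂ, ∀ x ∈ Metric.ball (0 : ℂ) δ, DifferentiableAt ℂ H x ∧ x * deriv H x + H x / 2 = A x := by
  have hAd : ∀ x ∈ Metric.ball (0 : ℂ) δ, DifferentiableAt ℂ A x := fun x hx =>
    hA.differentiableAt (Metric.isOpen_ball.mem_nhds hx)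
  have hA' : ContinuousOn (deriv A) (Metric.ball 0 δ) := (hA.deriv Metric.isOpen_ball).continuousOn
  have hmem : ∀ x : ℂ, ∀ r : ℝ, ‖x‖ ≤ r → ∀ τ ∈ Set.Icc (0 : ℝ) 1, ‖(τ : ℂ) ^ 2 * x‖ ≤ r :=
    fun x r hx τ hτ => by
      rw [norm_mul, norm_pow, norm_real, Real.norm_of_nonneg hτ.1]
      exact (mul_le_of_le_one_left (norm_nonneg _) (pow_le_one₀ hτ.1 hτ.2)).trans hx
  -- This is x^{-1/2} ∫₀ˣ s^{-1/2} A(s) ds after the substitution s = τ²x, which removes the square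
  -- roots. The equation follows by integrating the τ-derivative of τ A(τ²x) over [0, 1].
  refine ⟨fun x => 2 * ∫ τ in (0 : ℝ)..1, A ((τ : ℂ) ^ 2 * x), fun x hx => ?_⟩
  have hxn : ‖x‖ < δ := mem_ball_zero_iff.1 hx
  obtain ⟨r, hxr, hrδ⟩ := exists_between hxn
  have hsub : Metric.closedBall (0 : ℂ) r ⊆ Metric.ball 0 δ := Metric.closedBall_subset_ball hrδ
  obtain ⟨M, hM⟩ := (isCompact_closedBall (0 : ℂ) r).exists_bound_of_continuousOn (hA'.mono hsub)
  have hc : ∀ y ∈ Metric.closedBall (0 : ℂ) r, ∀ f : ℂ → ℂ, ContinuousOn f (Metric.ball 0 δ) →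
      ContinuousOn (fun τ : ℝ => f ((τ : ℂ) ^ 2 * y)) (Set.uIcc 0 1) := fun y hy f hf => by
    refine hf.comp ((continuous_ofReal.pow 2).mul continuous_const).continuousOn fun τ hτ => ?_
    rw [Set.uIcc_of_le zero_le_one] at hτ
    exact hsub (mem_closedBall_zero_iff.2 (hmem y r (mem_closedBall_zero_iff.1 hy) τ hτ))
  have hxc : x ∈ Metric.closedBall (0 : ℂ) r := mem_closedBall_zero_iff.2 hxr.le
  have hint : IntervalIntegrable (fun τ : ℝ => A ((τ : ℂ) ^ 2 * x)) volume 0 1 :=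
    (hc x hxc _ hA.continuousOn).intervalIntegrable
  have hcd : ContinuousOn (fun τ : ℝ => (τ : ℂ) ^ 2 * deriv A ((τ : ℂ) ^ 2 * x)) (Set.uIcc 0 1) :=
    (continuous_ofReal.pow 2).continuousOn.mul (hc x hxc _ hA')
  have huIoc : Set.uIoc (0 : ℝ) 1 ⊆ Set.uIcc 0 1 := Set.uIoc_subset_uIcc
  have hnb : Metric.ball (0 : ℂ) r ∈ 𝓝 x := Metric.isOpen_ball.mem_nhds (mem_ball_zero_iff.2 hxr)
  have hd := (intervalIntegral.hasDerivAt_integral_of_dominated_loc_of_deriv_le (μ := volume) (a := 0) (b := 1)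
    (F := fun x (τ : ℝ) => A ((τ : ℂ) ^ 2 * x)) (F' := fun x (τ : ℝ) => (τ : ℂ) ^ 2 * deriv A ((τ : ℂ) ^ 2 * x))
    (bound := fun _ => M) (x₀ := x) hnb ?_ hint
    ((hcd.mono huIoc).aestronglyMeasurable measurableSet_uIoc) ?_ intervalIntegrable_const ?_).2
  · refine ⟨(hd.const_mul 2).differentiableAt, ?_⟩
    rw [(hd.const_mul 2).deriv]
    have hftc : ∀ τ ∈ Set.uIcc (0 : ℝ) 1, HasDerivAt (fun τ : ℝ => (τ : ℂ) * A ((τ : ℂ) ^ 2 * x))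
        (A ((τ : ℂ) ^ 2 * x) + 2 * x * ((τ : ℂ) ^ 2 * deriv A ((τ : ℂ) ^ 2 * x))) τ := fun τ hτ => by
      rw [Set.uIcc_of_le zero_le_one] at hτ
      have e1 : HasDerivAt (fun w : ℂ => w * A (w ^ 2 * x))
          (1 * A ((τ : ℂ) ^ 2 * x) + τ * (deriv A ((τ : ℂ) ^ 2 * x) * (2 * τ * x))) (τ : ℂ) := by
        refine (hasDerivAt_id (τ : ℂ)).mul ?_
        have e2 : HasDerivAt (fun w : ℂ => w ^ 2 * x) (2 * τ * x) (τ : ℂ) := by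
          simpa using (hasDerivAt_pow 2 (τ : ℂ)).mul_const x
        exact HasDerivAt.comp (h₂ := A) (τ : ℂ) (hAd _ (hsub (mem_closedBall_zero_iff.2
          (hmem x r hxr.le τ hτ)))).hasDerivAt e2
      exact e1.comp_ofReal.congr_deriv (by ring)
    have h1 := intervalIntegral.integral_eq_sub_of_hasDerivAt hftc
      (hint.add (hcd.intervalIntegrable.const_mul (2 * x)))
    rw [intervalIntegral.integral_add hint (hcd.intervalIntegrable.const_mul (2 * x)),
      intervalIntegral.integral_const_mul] at h1
    simp only [ofReal_one, one_pow, one_mul, ofReal_zero, zero_mul, sub_zero] at h1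
    rw [← h1]; ring
  · filter_upwards [hnb] with y hy
    exact ((hc y (Metric.ball_subset_closedBall hy) _ hA.continuousOn).mono huIoc).aestronglyMeasurable
      measurableSet_uIoc
  · refine ae_of_all _ fun τ hτ y hy => ?_
    have hτ' := huIoc hτ
    rw [Set.uIcc_of_le zero_le_one] at hτ'
    have h2 := hM _ (mem_closedBall_zero_iff.2 (hmem y r (mem_ball_zero_iff.1 hy).le τ hτ'))
    rw [norm_mul, norm_pow, norm_real, Real.norm_of_nonneg hτ'.1]
    exact (mul_le_of_le_one_left (norm_nonneg _) (pow_le_one₀ hτ'.1 hτ'.2)).trans h2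
  · refine ae_of_all _ fun τ hτ y hy => ?_
    have hτ' := huIoc hτ
    rw [Set.uIcc_of_le zero_le_one] at hτ'
    have e2 : HasDerivAt (fun w : ℂ => (τ : ℂ) ^ 2 * w) ((τ : ℂ) ^ 2) y := by
      simpa using (hasDerivAt_id y).const_mul ((τ : ℂ) ^ 2)
    exact (HasDerivAt.comp (h₂ := A) y (hAd _ (hsub (mem_closedBall_zero_iff.2
      (hmem y r (mem_ball_zero_iff.1 hy).le τ hτ')))).hasDerivAt e2).congr_deriv (mul_comm _ _)

/-- The degrees `n` of the model functions `xⁿ |x|²ᵉ`. -/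
def modelDeg : Fin 4 → ℤ := ![-1, 0, 1, 2]

/-- The exponents `e` of the model functions in the form domain. -/
def regExp : Fin 4 → ℝ := ![3 / 2, 1 / 2, 0, 0]

/-- The complementary exponents, whose model functions are square integrable but not in the form domain. -/
def singExp : Fin 4 → ℝ := ![0, 0, -1 / 2, -3 / 2]

theorem differentiableAt_normSq_rpow {z : ℂ} (hz : z ≠ 0) (e : ℝ) :
    DifferentiableAt ℝ (fun y : ℂ => ((normSq y ^ e : ℝ) : ℂ)) z :=
  ofRealCLM.differentiableAt.comp z ((contDiffAt_normSq_rpow hz e).differentiableAt (by simp))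

theorem wirtDbar_normSq_rpow {z : ℂ} (hz : z ≠ 0) (e : ℝ) :
    wirtDbar (fun y : ℂ => ((normSq y ^ e : ℝ) : ℂ)) z = ((e * normSq z ^ (e - 1) : ℝ) : ℂ) * z :=
  wirtDbar_normSq_comp (p := fun t => ((t ^ e : ℝ) : ℂ))
    (Real.hasDerivAt_rpow_const (Or.inl (normSq_pos.2 hz).ne')).ofReal_comp

theorem normSq_rpow_eq (z : ℂ) (e : ℝ) : normSq z ^ e = ‖z‖ ^ (2 * e) := by
  rw [normSq_eq_norm_sq, ← Real.rpow_natCast, ← Real.rpow_mul (norm_nonneg z)]; norm_num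

theorem eq_normSq_mul_inv_conj {x : ℂ} (hx : x ≠ 0) : x = (‖x‖ : ℂ) ^ 2 * (starRingEnd ℂ x)⁻¹ := by
  have h3 : starRingEnd ℂ x ≠ 0 := by simpa using hx
  have h4 := mul_conj x
  rw [normSq_eq_norm_sq] at h4
  push_cast at h4
  rw [← h4]; field_simp

theorem differentiableAt_zpow_mul_normSq_rpow {x : ℂ} (hx : x ≠ 0) (n : ℤ) (e : ℝ) :
    DifferentiableAt ℝ (fun y : ℂ => y ^ n * ((normSq y ^ e : ℝ) : ℂ)) x :=
  ((contDiffAt_zpow_real hx).differentiableAt (by simp)).mul (differentiableAt_normSq_rpow hx e)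

theorem wirtDbar_zpow_mul_normSq_rpow {x : ℂ} (hx : x ≠ 0) (n : ℤ) (e : ℝ) :
    wirtDbar (fun y : ℂ => y ^ n * ((normSq y ^ e : ℝ) : ℂ)) x =
      x ^ n * (((e * normSq x ^ (e - 1) : ℝ) : ℂ) * x) :=
  wirtDbar_zpow_mul_radial (q := fun t => t ^ e) hx
    (Real.hasDerivAt_rpow_const (Or.inl (normSq_pos.2 hx).ne'))

/-- `|x| conj H`, where `x H' + H / 2 = A`, solves `∂̄ u = |x| x̄⁻¹ conj A`. -/
theorem wirtDbar_norm_mul_conj {H A : ℂ → ℂ} {x : ℂ} (hx : x ≠ 0) (hH : DifferentiableAt ℂ H x)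
    (hA : x * deriv H x + H x / 2 = A x) :
    DifferentiableAt ℝ (fun x => ((normSq x ^ (1 / 2 : ℝ) : ℝ) : ℂ) * starRingEnd ℂ (H x)) x ∧
    wirtDbar (fun x => ((normSq x ^ (1 / 2 : ℝ) : ℝ) : ℂ) * starRingEnd ℂ (H x)) x =
      (‖x‖ : ℂ) * (starRingEnd ℂ x)⁻¹ * starRingEnd ℂ (A x) := by
  have hc : DifferentiableAt ℝ (fun x => starRingEnd ℂ (H x)) x :=
    conjCLE.differentiableAt.comp x (hH.restrictScalars ℝ)
  refine ⟨(differentiableAt_normSq_rpow hx _).mul hc, ?_⟩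
  have hn : ((‖x‖ : ℝ) : ℂ) ≠ 0 := by exact_mod_cast (norm_pos_iff.2 hx).ne'
  have h3 : starRingEnd ℂ x ≠ 0 := by simpa using hx
  have e3 : normSq x ^ (1 / 2 - 1 : ℝ) = ‖x‖⁻¹ := by
    rw [normSq_rpow_eq, ← Real.rpow_neg_one]; norm_num
  rw [wirtDbar_mul (differentiableAt_normSq_rpow hx _) hc, wirtDbar_normSq_rpow hx,
    wirtDbar_conj (hH.restrictScalars ℝ), hH.wirtD_eq, normSq_rpow_half, e3, ← hA]
  simp only [map_add, map_mul, map_div₀, map_ofNat]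
  have h5 := eq_normSq_mul_inv_conj hx
  push_cast
  generalize starRingEnd ℂ (H x) = H0
  generalize starRingEnd ℂ (deriv H x) = H1
  generalize starRingEnd ℂ x = y at h3 h5 ⊢
  generalize (‖x‖ : ℂ) = r at hn h5 ⊢
  rw [h5]
  field_simp
  try ring

/-- The equation says ∂(|x|⁻¹∂̄k) = 0, that is, |x|⁻¹∂̄k is antiholomorphic. -/
theorem differentiableAt_conj_inv_norm_mul_wirtDbar {k : ℂ → ℂ} {x : ℂ} (hx : x ≠ 0)
    (hk : ContDiffAt ℝ infty k x) (hL : localLaplacian id k x = 0) :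
    DifferentiableAt ℂ (fun y => starRingEnd ℂ (((‖y‖⁻¹ : ℝ) : ℂ) * wirtDbar k y)) x := by
  have hm : DifferentiableAt ℝ (fun y => ((‖y‖⁻¹ : ℝ) : ℂ) * wirtDbar k y) x :=
    (ofRealCLM.differentiableAt.comp x (((contDiffAt_norm ℝ hx).inv (norm_ne_zero_iff.2 hx)).differentiableAt
      (n := infty) (by simp))).mul (differentiableAt_of_contDiffAt_infty hk.wirtDbar_infty)
  refine differentiableAt_of_wirtDbar_eq_zero (conjCLE.differentiableAt.comp x hm) ?_
  rw [wirtDbar_conj hm]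
  have hn : ((‖x‖ : ℝ) : ℂ) ≠ 0 := by exact_mod_cast (norm_pos_iff.2 hx).ne'
  rw [localLaplacian] at hL
  simp only [id] at hL
  have h4 : wirtD (fun y => ((‖y‖⁻¹ : ℝ) : ℂ) * wirtDbar k y) x = 0 := by
    push_cast at hL ⊢
    simpa [hn] using hL
  rw [h4, map_zero]

/-- By hypothesis ∂̄k is |x| x̄⁻³ times the conjugate of b + b'x + a x². As ∂̄(x/|x|) =
-(1/2)|x|x̄⁻² and ∂̄(x²/|x|³) = -(3/2)|x|x̄⁻³, the three subtracted terms integrate the three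
summands and leave a holomorphic function. -/
theorem holomorphic_remainder {k L : ℂ → ℂ} {x b b' a : ℂ} (hx : x ≠ 0) (hk : DifferentiableAt ℝ k x)
    (hL : DifferentiableAt ℝ L x)
    (hkw : x ^ 3 * starRingEnd ℂ (((‖x‖⁻¹ : ℝ) : ℂ) * wirtDbar k x) = b + x * (b' + x * a))
    (hLw : wirtDbar L x = (‖x‖ : ℂ) * (starRingEnd ℂ x)⁻¹ * starRingEnd ℂ a) :
    DifferentiableAt ℂ (fun x => k x - (-2 * starRingEnd ℂ b' * (x ^ (1 : ℤ) * ((normSq x ^ (-1 / 2 : ℝ) : ℝ) : ℂ)) +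
      (-(2 / 3) * starRingEnd ℂ b * (x ^ (2 : ℤ) * ((normSq x ^ (-3 / 2 : ℝ) : ℝ) : ℂ)) + L x))) x := by
  have hσ := differentiableAt_zpow_mul_normSq_rpow hx
  have d1 := (hσ 1 (-1 / 2)).const_mul (-2 * starRingEnd ℂ b')
  have d2 := (hσ 2 (-3 / 2)).const_mul (-(2 / 3) * starRingEnd ℂ b)
  refine differentiableAt_of_wirtDbar_eq_zero (hk.sub (d1.add (d2.add hL))) ?_
  have hn : ((‖x‖ : ℝ) : ℂ) ≠ 0 := by exact_mod_cast (norm_pos_iff.2 hx).ne'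
  have h3 : starRingEnd ℂ x ≠ 0 := by simpa using hx
  have e1 : normSq x ^ (-1 / 2 - 1 : ℝ) = (‖x‖ ^ 3)⁻¹ := by
    rw [normSq_rpow_eq, ← Real.rpow_natCast, ← Real.rpow_neg (norm_nonneg x)]; norm_num
  have e2 : normSq x ^ (-3 / 2 - 1 : ℝ) = (‖x‖ ^ 5)⁻¹ := by
    rw [normSq_rpow_eq, ← Real.rpow_natCast, ← Real.rpow_neg (norm_nonneg x)]; norm_num
  have h4 := congrArg (starRingEnd ℂ) hkw
  simp only [map_mul, map_pow, map_add, Complex.conj_conj] at h4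
  have e3 : wirtDbar k x = (‖x‖ : ℂ) * (starRingEnd ℂ b + starRingEnd ℂ x * (starRingEnd ℂ b' +
      starRingEnd ℂ x * starRingEnd ℂ a)) / starRingEnd ℂ x ^ 3 := by
    rw [← h4]; push_cast; field_simp
  have e4 : wirtDbar (fun x => k x - (-2 * starRingEnd ℂ b' * (x ^ (1 : ℤ) * ((normSq x ^ (-1 / 2 : ℝ) : ℝ) : ℂ)) +
      (-(2 / 3) * starRingEnd ℂ b * (x ^ (2 : ℤ) * ((normSq x ^ (-3 / 2 : ℝ) : ℝ) : ℂ)) + L x))) x =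
      wirtDbar k x - (-2 * starRingEnd ℂ b' * (x ^ (1 : ℤ) * (((-1 / 2 * normSq x ^ (-1 / 2 - 1 : ℝ) : ℝ) : ℂ) * x)) +
      (-(2 / 3) * starRingEnd ℂ b * (x ^ (2 : ℤ) * (((-3 / 2 * normSq x ^ (-3 / 2 - 1 : ℝ) : ℝ) : ℂ) * x)) +
      wirtDbar L x)) := by
    rw [← wirtDbar_zpow_mul_normSq_rpow hx, ← wirtDbar_zpow_mul_normSq_rpow hx,
      ← wirtDbar_const_mul _ (hσ 1 _), ← wirtDbar_const_mul _ (hσ 2 _)]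
    exact (wirtDbar_sub hk (d1.add (d2.add hL))).trans
      (congrArg _ ((wirtDbar_add d1 (d2.add hL)).trans (congrArg _ (wirtDbar_add d2 hL))))
  rw [e4, e1, e2, e3, hLw, zpow_one, zpow_ofNat]
  push_cast
  generalize starRingEnd ℂ a = a
  generalize starRingEnd ℂ b = b
  generalize starRingEnd ℂ b' = b'
  have h5 := eq_normSq_mul_inv_conj hx
  generalize starRingEnd ℂ x = y at h3 h5 ⊢
  generalize (‖x‖ : ℂ) = r at hn h5 ⊢
  clear * - h3 hn h5
  subst h5
  field_simp
  ring

/-- The holomorphic function conj(|x|⁻¹∂̄k) is O(|x|^{-7/2}), so it has a pole of order at most 3.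
Its polar terms of order 3 and 2 give x²/|x|³ and x/|x|; the rest integrates to a function L =
O(|x|) with bounded ∂̄. After subtraction a holomorphic function of size |x|^{-3/2} remains, whose
pole is at most simple; it gives x⁻¹, a constant, and a remainder O(|x|). -/
theorem exists_asymptotics {k : ℂ → ℂ} {δ M : ℝ} (hδ : 0 < δ)
    (hk : ∀ x, x ≠ 0 → ‖x‖ < δ → ContDiffAt ℝ infty k x)
    (hL : ∀ x, x ≠ 0 → ‖x‖ < δ → localLaplacian id k x = 0)
    (h1 : ∀ x, x ≠ 0 → ‖x‖ < δ → ‖k x‖ ≤ M * ‖x‖ ^ (-(3 / 2) : ℝ))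
    (h2 : ∀ x, x ≠ 0 → ‖x‖ < δ → ‖wirtDbar k x‖ ≤ M * ‖x‖ ^ (-(5 / 2) : ℝ)) :
    ∃ (c : Fin 4 → ℂ) (K : ℝ), ∀ᶠ x in 𝓝[≠] (0 : ℂ),
      ‖k x - ∑ i, c i * (x ^ modelDeg i * ((normSq x ^ singExp i : ℝ) : ℂ))‖ ≤ K * ‖x‖ ∧
      ‖wirtDbar (fun x => k x - ∑ i, c i * (x ^ modelDeg i * ((normSq x ^ singExp i : ℝ) : ℂ))) x‖ ≤ K := by
  have hGb : ∀ x, x ≠ 0 → ‖x‖ < δ → ‖starRingEnd ℂ (((‖x‖⁻¹ : ℝ) : ℂ) * wirtDbar k x)‖ ≤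
      M * ‖x‖ ^ (-(7 / 2) : ℝ) := fun x hx hxδ => by
    have hn : 0 < ‖x‖ := norm_pos_iff.2 hx
    have e1 : ‖x‖ ^ (-(7 / 2) : ℝ) = ‖x‖⁻¹ * ‖x‖ ^ (-(5 / 2) : ℝ) := by
      rw [← Real.rpow_neg_one, ← Real.rpow_add hn]; norm_num
    rw [RCLike.norm_conj, norm_mul, norm_real, Real.norm_of_nonneg (inv_nonneg.2 hn.le), e1]
    calc ‖x‖⁻¹ * ‖wirtDbar k x‖ ≤ ‖x‖⁻¹ * (M * ‖x‖ ^ (-(5 / 2) : ℝ)) := by gcongr; exact h2 x hx hxδ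
      _ = _ := by ring
  obtain ⟨B, hB, hBG⟩ := exists_extension_of_bound (N := 3) (by norm_num) hδ
    (fun x hx hxδ => differentiableAt_conj_inv_norm_mul_wirtDbar hx (hk x hx hxδ) (hL x hx hxδ))
    (by norm_num : (7 / 2 : ℝ) < (3 : ℕ) + 1) hGb
  obtain ⟨B₁, hB₁, hBB⟩ := exists_eq_add_mul hδ hB
  obtain ⟨A, hA, hBA⟩ := exists_eq_add_mul hδ hB₁
  obtain ⟨H, hH⟩ := exists_ode_solution hA
  obtain ⟨L, hLdef⟩ : ∃ L : ℂ → ℂ, L = fun x => ((normSq x ^ (1 / 2 : ℝ) : ℝ) : ℂ) * starRingEnd ℂ (H x) :=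
    ⟨_, rfl⟩
  have hLd : ∀ x, x ≠ 0 → ‖x‖ < δ → DifferentiableAt ℝ L x ∧
      wirtDbar L x = (‖x‖ : ℂ) * (starRingEnd ℂ x)⁻¹ * starRingEnd ℂ (A x) := fun x hx hxδ => by
    obtain ⟨e1, e2⟩ := hH x (mem_ball_zero_iff.2 hxδ)
    rw [hLdef]
    exact wirtDbar_norm_mul_conj hx e1 e2
  obtain ⟨c₂, hc₂⟩ : ∃ c, c = -2 * starRingEnd ℂ (B₁ 0) := ⟨_, rfl⟩
  obtain ⟨c₃, hc₃⟩ : ∃ c, c = -(2 / 3) * starRingEnd ℂ (B 0) := ⟨_, rfl⟩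
  obtain ⟨k₃, hk₃⟩ : ∃ k₃ : ℂ → ℂ, k₃ = fun x => k x - (c₂ * (x ^ (1 : ℤ) * ((normSq x ^ (-1 / 2 : ℝ) : ℝ) : ℂ)) +
    (c₃ * (x ^ (2 : ℤ) * ((normSq x ^ (-3 / 2 : ℝ) : ℝ) : ℂ)) + L x)) := ⟨_, rfl⟩
  have hk₃d : ∀ x, x ≠ 0 → ‖x‖ < δ → DifferentiableAt ℂ k₃ x := fun x hx hxδ => by
    rw [hk₃, hc₂, hc₃]
    refine holomorphic_remainder hx (differentiableAt_of_contDiffAt_infty (hk x hx hxδ)) (hLd x hx hxδ).1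
      ?_ (hLd x hx hxδ).2
    rw [hBG x hx hxδ, hBB x, hBA x]
  -- Below radius 1 every power of |x| with a larger exponent is dominated by |x|^{-3/2}.
  obtain ⟨ρ, hρ0, hρ⟩ : ∃ ρ, 0 < ρ ∧ ρ < min δ 1 := exists_between (lt_min hδ one_pos)
  have hρδ : ρ < δ := hρ.trans_le (min_le_left _ _)
  have hρ1 : ρ < 1 := hρ.trans_le (min_le_right _ _)
  have hsub : Metric.closedBall (0 : ℂ) ρ ⊆ Metric.ball 0 δ := Metric.closedBall_subset_ball hρδ
  have hHc : ContinuousOn H (Metric.closedBall 0 ρ) := fun x hx =>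
    (hH x (hsub hx)).1.continuousAt.continuousWithinAt
  obtain ⟨MH, hMH⟩ := (isCompact_closedBall (0 : ℂ) ρ).exists_bound_of_continuousOn hHc
  obtain ⟨MA, hMA⟩ := (isCompact_closedBall (0 : ℂ) ρ).exists_bound_of_continuousOn (hA.continuousOn.mono hsub)
  have hLb : ∀ x, ‖x‖ < ρ → ‖L x‖ ≤ ‖x‖ * MH := fun x hx => by
    rw [hLdef]
    simp only [norm_mul, RCLike.norm_conj, normSq_rpow_half, norm_real, norm_norm]
    gcongr
    exact hMH x (mem_closedBall_zero_iff.2 hx.le)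
  have hMH0 : 0 ≤ MH := (norm_nonneg _).trans (hMH 0 (Metric.mem_closedBall_self hρ0.le))
  have hk₃b : ∀ x, x ≠ 0 → ‖x‖ < ρ → ‖k₃ x‖ ≤ (M + (‖c₂‖ + (‖c₃‖ + MH))) * ‖x‖ ^ (-(3 / 2) : ℝ) :=
    fun x hx hxρ => by
    have hn : 0 < ‖x‖ := norm_pos_iff.2 hx
    have hp : ∀ s : ℝ, -(3 / 2) ≤ s → ‖x‖ ^ s ≤ ‖x‖ ^ (-(3 / 2) : ℝ) := fun s hs =>
      Real.rpow_le_rpow_of_exponent_ge hn (hxρ.le.trans hρ1.le) hs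
    have hσb : ∀ (n : ℤ) (e : ℝ), -(3 / 2) ≤ n + 2 * e →
        ‖x ^ n * ((normSq x ^ e : ℝ) : ℂ)‖ ≤ ‖x‖ ^ (-(3 / 2) : ℝ) := fun n e h => by
      rw [norm_mul, norm_zpow, norm_real, Real.norm_of_nonneg (Real.rpow_nonneg (normSq_nonneg x) e),
        norm_zpow_mul_rpow hx]
      exact hp _ h
    rw [add_mul, add_mul, add_mul, hk₃]
    refine (norm_sub_le _ _).trans (add_le_add (h1 x hx (hxρ.trans hρδ)) ((norm_add_le _ _).trans
      (add_le_add ?_ ((norm_add_le _ _).trans (add_le_add ?_ ?_)))))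
    · rw [norm_mul]; gcongr; exact hσb 1 (-1 / 2) (by norm_num)
    · rw [norm_mul]; gcongr; exact hσb 2 (-3 / 2) (by norm_num)
    · refine (hLb x hxρ).trans ?_
      rw [mul_comm]
      gcongr
      simpa using hp 1 (by norm_num)
  obtain ⟨B₃, hB₃, hB₃k⟩ := exists_extension_of_bound (N := 1) (by norm_num) hρ0
    (fun x hx hxρ => hk₃d x hx (hxρ.trans hρδ)) (by norm_num : (3 / 2 : ℝ) < (1 : ℕ) + 1) hk₃b
  obtain ⟨B₄, hB₄, hB₃B⟩ := exists_eq_add_mul hρ0 hB₃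
  obtain ⟨B₅, hB₅, hB₄B⟩ := exists_eq_add_mul hρ0 hB₄
  obtain ⟨ρ', hρ'0, hρ'⟩ := exists_between hρ0
  have hsub' : Metric.closedBall (0 : ℂ) ρ' ⊆ Metric.ball 0 ρ := Metric.closedBall_subset_ball hρ'
  obtain ⟨M₅, hM₅⟩ := (isCompact_closedBall (0 : ℂ) ρ').exists_bound_of_continuousOn (hB₅.continuousOn.mono hsub')
  have hM₅0 : 0 ≤ M₅ := (norm_nonneg _).trans (hM₅ 0 (Metric.mem_closedBall_self hρ'0.le))
  have hMA0 : 0 ≤ MA := (norm_nonneg _).trans (hMA 0 (Metric.mem_closedBall_self hρ0.le))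
  obtain ⟨c, hc⟩ : ∃ c : Fin 4 → ℂ, c = ![B₃ 0, B₄ 0, c₂, c₃] := ⟨_, rfl⟩
  have key : ∀ x, x ≠ 0 → ‖x‖ < ρ →
      k x - ∑ i, c i * (x ^ modelDeg i * ((normSq x ^ singExp i : ℝ) : ℂ)) = L x + x * B₅ x := fun x hx hxρ => by
    have e1 := hB₃k x hx hxρ
    rw [pow_one, hB₃B x, hB₄B x] at e1
    have e2 : k₃ x = B₃ 0 * x⁻¹ + (B₄ 0 + x * B₅ x) := by field_simp; rw [mul_comm, e1]
    have e3 : k x = k₃ x + (c₂ * (x ^ (1 : ℤ) * ((normSq x ^ (-1 / 2 : ℝ) : ℝ) : ℂ)) +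
        (c₃ * (x ^ (2 : ℤ) * ((normSq x ^ (-3 / 2 : ℝ) : ℝ) : ℂ)) + L x)) := by rw [hk₃]; ring
    rw [e3, e2, Fin.sum_univ_four]
    simp only [hc, modelDeg, singExp, Matrix.cons_val_zero, Matrix.cons_val_one, Matrix.cons_val,
      Real.rpow_zero, ofReal_one, zpow_neg_one, zpow_zero, mul_one]
    ring
  refine ⟨c, MH + M₅ + MA, ?_⟩
  filter_upwards [self_mem_nhdsWithin, nhdsWithin_le_nhds (Metric.ball_mem_nhds (0 : ℂ) hρ'0)] with x hx hxb
  have hxρ' : ‖x‖ < ρ' := mem_ball_zero_iff.1 hxb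
  have hxρ : ‖x‖ < ρ := hxρ'.trans hρ'
  have hx0 : x ≠ 0 := hx
  constructor
  · rw [key x hx0 hxρ]
    refine (norm_add_le _ _).trans ?_
    have e1 := hLb x hxρ
    have e2 : ‖x * B₅ x‖ ≤ ‖x‖ * M₅ := by
      rw [norm_mul]; gcongr; exact hM₅ x (mem_closedBall_zero_iff.2 hxρ'.le)
    nlinarith [norm_nonneg x, mul_nonneg hMA0 (norm_nonneg x)]
  · have hev : (fun x => k x - ∑ i, c i * (x ^ modelDeg i * ((normSq x ^ singExp i : ℝ) : ℂ))) =ᶠ[𝓝 x]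
        fun x => L x + x * B₅ x := by
      filter_upwards [isOpen_compl_singleton.mem_nhds hx0, Metric.isOpen_ball.mem_nhds
        (mem_ball_zero_iff.2 hxρ)] with y hy hyρ using key y hy (mem_ball_zero_iff.1 hyρ)
    have hd : DifferentiableAt ℂ (fun x => x * B₅ x) x := differentiableAt_id.mul
      (hB₅.differentiableAt (Metric.isOpen_ball.mem_nhds (mem_ball_zero_iff.2 hxρ)))
    rw [hev.wirtDbar_eq, wirtDbar_add (hLd x hx0 (hxρ.trans hρδ)).1 (hd.restrictScalars ℝ), hd.wirtDbar_eq,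
      add_zero, (hLd x hx0 (hxρ.trans hρδ)).2, norm_mul, norm_mul, norm_inv, RCLike.norm_conj, RCLike.norm_conj,
      norm_real, norm_norm, mul_inv_cancel₀ (norm_pos_iff.2 hx0).ne', one_mul]
    have := hMA x (mem_closedBall_zero_iff.2 hxρ.le)
    linarith

end Asymptotics

end

/-! ### The kernel of the adjoint modulo Dom D̄ -/

noncomputable section

set_option linter.unusedSectionVars false

namespace RiemannSurface

namespace SpinBundle

local notation "conj" => starRingEnd ℂ
local notation "infty" => ((⊤ : ℕ∞) : WithTop ℕ∞)

variable {X : Type*} [TopologicalSpace X] [ChartedSpace ℂ X] {C : SpinBundle X}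
  {ω : ∀ p : X, TangentSpace 𝓘(ℂ) p →L[ℂ] ℂ}
  [IsManifold 𝓘(ℂ) 1 X] [T2Space X] [CompactSpace X] [MeasurableSpace X] [BorelSpace X]
  (hω : ω ∈ holomorphicOneForms X) (hz : (zeros ω).Finite)

/-- At x the flat coordinate x²/2 has a disc of radius |x|²/4, and the ratio of the two frames has
modulus |x|^{-1/2}. The interior estimates K/R and K/R² with R = |x|²/4, translated back to the
distinguished frame, give the exponents -3/2 and -5/2. -/
theorem IsDistinguished.bound_of_flat {P : X} {F : C.Frame} (hF : IsDistinguished ω P F.ξ)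
    {δ : ℝ} (hδ : F.ξ.target = Metric.ball 0 δ) {κ : X → ℂ} (hκ : ∀ p ∉ zeros ω, C.SmoothAt κ p) {K : ℝ}
    (hK : ∀ (F : C.Frame), F.IsFlat ω → ∀ p ∈ F.ξ.source, ∀ R > 0, Metric.ball (F.ξ p) R ⊆ F.ξ.target →
      ‖F.rep κ (F.ξ p)‖ ≤ K / R ∧ ‖wirtDbar (F.rep κ) (F.ξ p)‖ ≤ K / R ^ 2)
    {x : ℂ} (h0 : x ≠ 0) (hx : ‖x‖ < δ / 2) :
    ‖F.rep κ x‖ ≤ 16 * |K| * ‖x‖ ^ (-(3 / 2) : ℝ) ∧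
      ‖wirtDbar (F.rep κ) x‖ ≤ 16 * |K| * ‖x‖ ^ (-(5 / 2) : ℝ) := by
  obtain ⟨F', hflat, htar, hsrc, hp, hcoord, hratio⟩ := exists_flat_frame_of_distinguished hF hδ h0 hx
  set p := F.ξ.symm x with hpdef
  have hn : 0 < ‖x‖ := norm_pos_iff.2 h0
  have hxt : x ∈ F.ξ.target := by rw [hδ, mem_ball_zero_iff]; linarith
  have hpF : p ∈ F.ξ.source := F.ξ.map_target hxt
  have hFp : F.ξ p = x := F.ξ.right_inv hxt
  have hF'p : F'.ξ p = x ^ 2 / 2 := by rw [hcoord p hp, hFp]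
  have hpz : p ∉ zeros ω := IsDistinguished.notMem_zeros hF hxt h0
  obtain ⟨k1, k2⟩ := hK F' hflat p hp (‖x ^ 2 / 2‖ / 2)
    (half_pos (norm_pos_iff.2 (div_ne_zero (pow_ne_zero 2 h0) two_ne_zero))) (by rw [hF'p, htar])
  have hr : ‖F.ratio F' p‖ ^ 2 = ‖x‖⁻¹ := by rw [← norm_pow, hratio p hp, hFp, norm_inv]
  have hrep : ∀ u : X → ℂ, F'.rep u (F'.ξ p) = F.ratio F' p * F.rep u x := fun u => by
    rw [Frame.rep_eq u (F := F) (by rwa [F'.ξ.left_inv hp]), F'.ξ.left_inv hp, hFp]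
  have hd := rep_dbarOmega (ω := ω) F hpF (hκ p hpz)
  have hd' := rep_dbarOmega (ω := ω) F' hp (hκ p hpz)
  rw [localDbar, hFp, show F.f ω x = x from hF.2.2.2.2 x hxt] at hd
  rw [localDbar, hflat _ (F'.ξ.map_source hp), map_one, inv_one, one_mul, hrep, hd] at hd'
  rw [← hd', norm_mul, norm_mul, norm_inv, RCLike.norm_conj] at k2
  rw [hrep, norm_mul] at k1
  have hr' : ‖F.ratio F' p‖ = ‖x‖ ^ (-(1 / 2) : ℝ) := by
    rw [← Real.sqrt_sq (norm_nonneg (F.ratio F' p)), hr, Real.sqrt_eq_rpow, ← Real.rpow_neg_one,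
      ← Real.rpow_mul hn.le]
    norm_num
  have hR : ‖x ^ 2 / 2‖ / 2 = ‖x‖ ^ 2 / 4 := by rw [norm_div, norm_pow]; norm_num; ring
  rw [hR, hr'] at k1 k2
  have hs : ‖x‖ ^ (-(1 / 2) : ℝ) * ‖x‖ ^ (1 / 2 : ℝ) = 1 := by
    rw [← Real.rpow_add hn]; norm_num
  have hs0 : 0 < ‖x‖ ^ (1 / 2 : ℝ) := Real.rpow_pos_of_pos hn _
  have e1 : ‖x‖ ^ (-(3 / 2) : ℝ) = ‖x‖ ^ (1 / 2 : ℝ) / ‖x‖ ^ 2 := by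
    rw [← Real.rpow_natCast, ← Real.rpow_sub hn]; norm_num
  have e2 : ‖x‖ ^ (-(5 / 2) : ℝ) = ‖x‖ ^ (1 / 2 : ℝ) / ‖x‖ ^ 3 := by
    rw [← Real.rpow_natCast, ← Real.rpow_sub hn]; norm_num
  have hK' := le_abs_self K
  rw [e1, e2]
  constructor
  · calc ‖F.rep κ x‖ = ‖x‖ ^ (1 / 2 : ℝ) * (‖x‖ ^ (-(1 / 2) : ℝ) * ‖F.rep κ x‖) := by
          rw [← mul_assoc, mul_comm (‖x‖ ^ (1 / 2 : ℝ)), hs, one_mul]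
      _ ≤ ‖x‖ ^ (1 / 2 : ℝ) * (|K| / (‖x‖ ^ 2 / 4)) := by
          gcongr; exact k1.trans (by gcongr)
      _ = 4 * |K| * (‖x‖ ^ (1 / 2 : ℝ) / ‖x‖ ^ 2) := by field_simp
      _ ≤ _ := by gcongr; norm_num
  · calc ‖wirtDbar (F.rep κ) x‖ = ‖x‖ * ‖x‖ ^ (1 / 2 : ℝ) *
          (‖x‖ ^ (-(1 / 2) : ℝ) * (‖x‖⁻¹ * ‖wirtDbar (F.rep κ) x‖)) := by
          rw [mul_assoc, ← mul_assoc (‖x‖ ^ (1 / 2 : ℝ)), mul_comm (‖x‖ ^ (1 / 2 : ℝ)), hs, one_mul,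
            mul_inv_cancel_left₀ hn.ne']
      _ ≤ ‖x‖ * ‖x‖ ^ (1 / 2 : ℝ) * (|K| / (‖x‖ ^ 2 / 4) ^ 2) := by
          gcongr; exact k2.trans (by gcongr)
      _ = 16 * |K| * (‖x‖ ^ (1 / 2 : ℝ) / ‖x‖ ^ 3) := by field_simp; norm_num

theorem coeFn_sub_sum {ι : Type*} [Fintype ι] {x : C.L2 ω} {y : ι → C.L2 ω} {u : X → ℂ} {f : ι → X → ℂ}
    (hx : x =ᵐ[C.hArea ω] u) (hy : ∀ i, y i =ᵐ[C.hArea ω] f i) (c : ι → ℂ) :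
    (x - ∑ i, c i • y i : C.L2 ω) =ᵐ[C.hArea ω] fun p => u p - ∑ i, c i * f i p := by
  have h1 : ∀ᵐ p ∂(C.hArea ω), ∀ i, (c i • y i : C.L2 ω) p = c i * f i p := by
    refine ae_all_iff.2 fun i => ?_
    filter_upwards [Lp.coeFn_smul (c i) (y i), hy i] with p h1 h2
    rw [h1, Pi.smul_apply, h2, smul_eq_mul]
  filter_upwards [Lp.coeFn_sub x (∑ i, c i • y i), hx, h1, Lp.coeFn_finsetSum Finset.univ fun i => c i • y i]
    with p h1 h2 h3 h4
  rw [h1, Pi.sub_apply, h2, h4]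
  simp [h3]

section Model

variable {F : zeros ω → C.Frame} {a : ℝ} [Fintype (zeros ω)]

theorem IsAdapted.rep_sum (hA : IsAdapted F a) (c : zeros ω × Fin 4 → ℂ) (e : Fin 4 → ℝ) (P : zeros ω)
    {x : ℂ} (hx : a * Complex.normSq x ≤ 1) :
    (F P).rep (fun q => ∑ j, c j * (F j.1).ofFun (radialModel a (modelDeg j.2) (e j.2)) q) x =
      ∑ i, c (P, i) * (x ^ modelDeg i * ((Complex.normSq x ^ e i : ℝ) : ℂ)) := by
  have hx2 : x ∈ {z : ℂ | a * Complex.normSq z ≤ 2} := hx.trans one_le_two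
  have hmem : (F P).ξ.symm x ∈ (F P).ξ.symm '' {z : ℂ | a * Complex.normSq z ≤ 2} := ⟨x, hx2, rfl⟩
  rw [Frame.rep, frameRep, Fintype.sum_prod_type, Finset.sum_eq_single P]
  · rw [Finset.mul_sum]
    refine Finset.sum_congr rfl fun i _ => ?_
    have := (F P).rep_ofFun (radialModel a (modelDeg i) (e i)) (hA.disc_subset P hx2)
    rw [Frame.rep, frameRep] at this
    rw [← radialModel_of_le hx, ← this]
    ring
  · intro Q _ hQ
    refine Finset.sum_eq_zero fun i _ => ?_
    rw [hA.ofFun_eq_zero tsupport_radialModel_subset (Set.disjoint_left.1 (hA.disj P Q hQ.symm) hmem), mul_zero]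
  · simp

include hω hz in
/-- The kernel of the adjoint is spanned by the singular models, up to the form domain. -/
theorem IsAdapted.exists_sub_mem_dbarOp (hA : IsAdapted F a) {σ : zeros ω × Fin 4 → C.L2 ω}
    (hσ : ∀ j, σ j =ᵐ[C.hArea ω] (F j.1).ofFun (radialModel a (modelDeg j.2) (singExp j.2))) {k : C.L2 ω}
    (hk : (k, 0) ∈ (C.testOperator ω (C.laplacian ω)).adjoint.graph) :
    ∃ c : zeros ω × Fin 4 → ℂ, k - ∑ j, c j • σ j ∈ (C.dbarOp ω).domain := by
  obtain ⟨κ, K, hkκ, hκ, hκ0, hK⟩ := exists_harmonic_rep hω hz hk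
  have hasym : ∀ P : zeros ω, ∃ (c : Fin 4 → ℂ) (K : ℝ), ∀ᶠ x in 𝓝[≠] (0 : ℂ),
      ‖(F P).rep κ x - ∑ i, c i * (x ^ modelDeg i * ((Complex.normSq x ^ singExp i : ℝ) : ℂ))‖ ≤ K * ‖x‖ ∧
      ‖wirtDbar (fun x => (F P).rep κ x -
        ∑ i, c i * (x ^ modelDeg i * ((Complex.normSq x ^ singExp i : ℝ) : ℂ))) x‖ ≤ K := fun P => by
    have hF := hA.dist P
    obtain ⟨δ, hδ0, hδ⟩ := hF.2.2.2.1
    have hmem : ∀ x : ℂ, ‖x‖ < δ / 2 → x ∈ (F P).ξ.target := fun x hx => by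
      rw [hδ, mem_ball_zero_iff]; linarith
    have hsm : ∀ x : ℂ, x ≠ 0 → ‖x‖ < δ / 2 → C.SmoothAt κ ((F P).ξ.symm x) := fun x h0 hx =>
      hκ _ (IsDistinguished.notMem_zeros hF (hmem x hx) h0)
    refine exists_asymptotics (half_pos hδ0) (M := 16 * |K|) (fun x h0 hx => ?_) (fun x h0 hx => ?_)
      (fun x h0 hx => (IsDistinguished.bound_of_flat hF hδ hκ hK h0 hx).1)
      (fun x h0 hx => (IsDistinguished.bound_of_flat hF hδ hκ hK h0 hx).2)
    · have := hsm x h0 hx (F P) ((F P).ξ.map_target (hmem x hx))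
      rwa [(F P).ξ.right_inv (hmem x hx)] at this
    · have hpz := IsDistinguished.notMem_zeros hF (hmem x hx) h0
      have h1 := rep_laplacian hω (F P) ((F P).ξ.map_target (hmem x hx)) hpz (hsm x h0 hx)
      rw [(F P).ξ.right_inv (hmem x hx), Frame.rep, frameRep, hκ0 _ hpz, mul_zero] at h1
      rw [h1]
      refine localLaplacian_congr ?_ EventuallyEq.rfl
      filter_upwards [(F P).ξ.open_target.mem_nhds (hmem x hx)] with y hy using (hF.2.2.2.2 y hy).symm
  choose c K' hc using hasym
  refine ⟨fun j => c j.1 j.2, mem_dbarOp_domain_of_bound hω hz hA.dist (u := fun p => κ p -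
    ∑ j : zeros ω × Fin 4, c j.1 j.2 * (F j.1).ofFun (radialModel a (modelDeg j.2) (singExp j.2)) p)
    (fun p hp => (hκ p hp).sub (SmoothAt.sum fun j _ => (hA.smoothAt_model hp).const_mul _)) (fun P => ?_)
    (coeFn_sub_sum hkκ hσ _)⟩
  have hdisc : ∀ᶠ x in 𝓝 (0 : ℂ), a * Complex.normSq x ≤ 1 := by
    have h1 : Tendsto (fun x : ℂ => a * Complex.normSq x) (𝓝 0) (𝓝 0) := by
      have := (contDiff_normSq.continuous.const_mul a).tendsto (0 : ℂ)
      simpa using this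
    exact h1.eventually (Iic_mem_nhds one_pos)
  have hev : (F P).rep (fun p => κ p -
      ∑ j : zeros ω × Fin 4, c j.1 j.2 * (F j.1).ofFun (radialModel a (modelDeg j.2) (singExp j.2)) p)
      =ᶠ[𝓝 0] fun x => (F P).rep κ x -
        ∑ i, c P i * (x ^ modelDeg i * ((Complex.normSq x ^ singExp i : ℝ) : ℂ)) := by
    filter_upwards [hdisc] with x hx
    rw [← hA.rep_sum (fun j => c j.1 j.2) singExp P hx]
    simp only [Frame.rep, frameRep, mul_sub]
  refine ⟨K' P, ?_⟩
  filter_upwards [hc P, nhdsWithin_le_nhds hev.eventuallyEq_nhds] with x hx hxev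
  rwa [hxev.self_of_nhds, hxev.wirtDbar_eq]

end Model

end SpinBundle

end RiemannSurface

end

/-! ### The domain of the Friedrichs extension -/

noncomputable section

set_option linter.unusedSectionVars false

namespace RiemannSurface

namespace SpinBundle

local notation "conj" => starRingEnd ℂ
local notation "infty" => ((⊤ : ℕ∞) : WithTop ℕ∞)

variable {X : Type*} [TopologicalSpace X] [ChartedSpace ℂ X] {C : SpinBundle X}
  {ω : ∀ p : X, TangentSpace 𝓘(ℂ) p →L[ℂ] ℂ}
  [IsManifold 𝓘(ℂ) 1 X] [T2Space X] [CompactSpace X] [MeasurableSpace X] [BorelSpace X]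
  (hω : ω ∈ holomorphicOneForms X) (hz : (zeros ω).Finite)

theorem continuous_of_smoothFunAt {β : X → ℂ} (hβ : ∀ q, C.SmoothFunAt β q) : Continuous β := by
  refine continuous_iff_continuousAt.2 fun p => ?_
  set F := C.chartFrame (C.idx p) with hF
  have hp : p ∈ F.ξ.source := mem_source_idx p
  have h1 := ContinuousAt.comp (f := F.ξ) (hβ p F hp).continuousAt (F.ξ.continuousAt hp)
  refine h1.congr ?_
  filter_upwards [F.ξ.open_source.mem_nhds hp] with q hq
  rw [Function.comp_apply, F.ξ.left_inv hq]

include hω hz in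
/-- The adjoint of the Laplacian is local. -/
theorem ae_eq_zero_of_mem_adjoint {z z' : C.L2 ω}
    (h : (z, z') ∈ (C.testOperator ω (C.laplacian ω)).adjoint.graph) {P : X} {W : Set X} (hW : W ∈ 𝓝 P)
    (h0 : ∀ᵐ p ∂(C.hArea ω), p ∈ W → z p = 0) : ∃ U ∈ 𝓝 P, ∀ᵐ p ∂(C.hArea ω), p ∈ U → z' p = 0 := by
  obtain ⟨β, hβ, hβ1, hβW⟩ := exists_smoothFun_bump C hW
  have hβc := continuous_of_smoothFunAt hβ
  obtain ⟨M, hM⟩ := isCompact_univ.exists_bound_of_continuousOn hβc.continuousOn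
  have hm : MemLp (fun p => conj (β p) * z' p) 2 (C.hArea ω) := by
    refine (Lp.memLp z').of_le_mul (c := M)
      ((Complex.continuous_conj.comp hβc).aestronglyMeasurable.mul (Lp.aestronglyMeasurable z'))
      (ae_of_all _ fun p => ?_)
    rw [norm_mul, RCLike.norm_conj]
    gcongr
    exact hM p (Set.mem_univ p)
  -- For a test section v, the pairing of β̄z' with v is the conjugate of (L*z tested on βv), equal
  -- to the conjugate of the pairing of L(βv) with z. The support of L(βv) lies in W, where z = 0.
  have hzero := eq_zero_of_ip_eq_zero hω hz hm fun v hv => by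
    have h1 := (mem_graph_adjoint_testOperator hω hz (flatOp_laplacian hω)).1 h _ (hv.smul_fun hβ)
    have h2 : C.ip ω (C.laplacian ω fun q => β q * v q) z = 0 := by
      rw [ip]
      refine integral_eq_zero_of_ae ?_
      filter_upwards [h0] with p hp
      by_cases hpW : p ∈ W
      · rw [hp hpW, mul_zero]; rfl
      · have : C.laplacian ω (fun q => β q * v q) p = 0 :=
          image_eq_zero_of_notMem_tsupport fun h' => hpW (hβW (tsupport_mul_subset_left
            ((flatOp_laplacian hω).tsupport_subset h')))
        rw [this, map_zero, zero_mul]; rfl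
    rw [h2, ← conj_ip, eq_comm, map_eq_zero] at h1
    rw [← h1, ip, ip]
    refine integral_congr_ae (ae_of_all _ fun p => ?_)
    simp only [map_mul, Complex.conj_conj]
    ring
  refine ⟨_, hβ1, ?_⟩
  filter_upwards [hzero] with p hp (hp1 : β p = 1)
  simpa [hp1] using hp

section Model

variable {F : zeros ω → C.Frame} {a : ℝ} [Fintype (zeros ω)]

include hω hz in
-- The four regular and four singular models at each zero satisfy the hypotheses of the two abstract
-- duality lemmas, whose conclusions are collected here in terms of the regular models only.
theorem IsAdapted.exists_regular [ConnectedSpace X] (hs : HasSimpleZeros ω) (hne : (zeros ω).Nonempty)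
    (hA : IsAdapted F a) : ∃ w w' : zeros ω × Fin 4 → C.L2 ω,
    (∀ j, w j =ᵐ[C.hArea ω] (F j.1).ofFun (radialModel a (modelDeg j.2) (regExp j.2))) ∧
    (∀ j, w' j =ᵐ[C.hArea ω] (F j.1).ofFun (radialModelLap a (modelDeg j.2) (regExp j.2))) ∧
    (∀ j, w j ∈ (C.dbarOp ω).domain) ∧
    (∀ j, (w j, w' j) ∈ (C.testOperator ω (C.laplacian ω)).adjoint.graph) ∧
    (∀ u f, (u, f) ∈ (UnboundedOp.prod (C.dbarOp ω).adjoint (C.dbarOp ω)).graph →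
      ∃ c : zeros ω × Fin 4 → ℂ, u - ∑ j, c j • w j ∈ (C.laplaceMin ω).domain) ∧
    ∀ z z', (z, z') ∈ (C.testOperator ω (C.laplacian ω)).adjoint.graph →
      (∀ j, inner ℂ z' (w j) = inner ℂ z (w' j)) → z ∈ (C.dbarOp ω).domain := by
  have h := isCoerciveFactor hω hz hs hne (C := C)
  have hw := fun j : zeros ω × Fin 4 => hA.exists_model hω hz (n := modelDeg j.2) (e := regExp j.2)
    (by obtain ⟨P, i⟩ := j; fin_cases i <;> norm_num [modelDeg, regExp])
    (by obtain ⟨P, i⟩ := j; fin_cases i <;> norm_num [modelDeg, regExp]) j.1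
  have hσ := fun j : zeros ω × Fin 4 => hA.exists_model hω hz (n := modelDeg j.2) (e := singExp j.2)
    (by obtain ⟨P, i⟩ := j; fin_cases i <;> norm_num [modelDeg, singExp])
    (by obtain ⟨P, i⟩ := j; fin_cases i <;> norm_num [modelDeg, singExp]) j.1
  choose w w' hw1 hw2 hw3 hw4 using hw
  choose σ σ' hσ1 hσ2 hσ3 hσ4 using hσ
  have hreg : ∀ j, w j ∈ (C.dbarOp ω).domain := fun j => hw4 j (by
    obtain ⟨P, i⟩ := j; fin_cases i <;> norm_num [modelDeg, regExp])
  have hinj : ∀ {i j : Fin 4}, modelDeg i = modelDeg j ↔ i = j := fun {i j} => by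
    fin_cases i <;> fin_cases j <;> simp [modelDeg]
  -- Distinct zeros decouple by disjointness of the discs and distinct degrees by rotation. For
  -- equal indices `regExp` and `singExp` add up to 1/2 - n and are different, so the diagonal value
  -- is a nonzero multiple of π.
  have hpair : ∀ i j, inner ℂ (σ' i) (w j) - inner ℂ (σ i) (w' j) ≠ 0 ↔ i = j := fun i j => by
    rw [inner_eq_ip (hσ2 i) (hw1 j), inner_eq_ip (hσ1 i) (hw2 j), hA.boundary_form hω fun _ hn => by
      rw [hinj] at hn
      obtain ⟨P, i⟩ := i; obtain ⟨Q, j⟩ := j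
      subst hn
      fin_cases i <;> norm_num [modelDeg, regExp, singExp]]
    have hiff : (i.1 = j.1 ∧ modelDeg i.2 = modelDeg j.2) ↔ i = j := by
      rw [hinj, Prod.ext_iff]
    split_ifs with hij
    · refine iff_of_true ?_ (hiff.1 hij)
      obtain rfl := hiff.1 hij
      rw [Complex.ofReal_ne_zero]
      refine mul_ne_zero ?_ Real.pi_ne_zero
      obtain ⟨P, i⟩ := i
      fin_cases i <;> norm_num [regExp, singExp]
    · exact iff_of_false (not_not.2 rfl) fun h' => hij (hiff.2 h')
  have hker := fun k hk => hA.exists_sub_mem_dbarOp hω hz hσ1 (k := k) hk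
  exact ⟨w, w', hw1, hw2, hreg, hw3, fun u f hu => h.exists_sub_mem_closure hreg hw3 hpair hker hσ3 hu,
    fun z z' hzz hj => h.dom_of_pairing hreg hw3 hpair hker hσ3 hzz hj⟩

theorem sum_regular (c : Fin 4 → ℂ) (x : ℂ) :
    ∑ i, c i * (x ^ modelDeg i * ((Complex.normSq x ^ regExp i : ℝ) : ℂ)) =
      c 0 * (conj x * ((‖x‖ : ℝ) : ℂ)) + c 1 * ((‖x‖ : ℝ) : ℂ) + c 2 * x + c 3 * x ^ 2 := by
  have h1 : x ^ (-1 : ℤ) * ((Complex.normSq x ^ (3 / 2 : ℝ) : ℝ) : ℂ) = conj x * ((‖x‖ : ℝ) : ℂ) := by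
    rcases eq_or_ne x 0 with rfl | hx
    · simp
    · have h2 : Complex.normSq x ^ (3 / 2 : ℝ) = Complex.normSq x * ‖x‖ := by
        rw [← normSq_rpow_half, ← Real.rpow_one_add' (Complex.normSq_nonneg x) (by norm_num)]
        norm_num
      rw [h2, Complex.ofReal_mul, ← Complex.mul_conj, zpow_neg_one, mul_assoc, inv_mul_cancel_left₀ hx]
  rw [Fin.sum_univ_four, ← h1]
  simp only [modelDeg, regExp, Matrix.cons_val_zero, Matrix.cons_val_one, Matrix.cons_val, normSq_rpow_half,
    Real.rpow_zero, Complex.ofReal_one, mul_one]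
  simp

theorem IsAdapted.frameRep_sum (hA : IsAdapted F a) (c : zeros ω × Fin 4 → ℂ) (P : zeros ω) {p : X}
    (hp : p ∈ (F P).ξ.source) (hx : a * Complex.normSq ((F P).ξ p) ≤ 1) :
    C.frameRep (F P).s
      (fun q => ∑ j, c j * (F j.1).ofFun (radialModel a (modelDeg j.2) (regExp j.2)) q) p =
      c (P, 0) * (conj ((F P).ξ p) * ((‖(F P).ξ p‖ : ℝ) : ℂ)) + c (P, 1) * ((‖(F P).ξ p‖ : ℝ) : ℂ) +
        c (P, 2) * (F P).ξ p + c (P, 3) * (F P).ξ p ^ 2 := by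
  have := hA.rep_sum c regExp P hx
  rwa [Frame.rep, (F P).ξ.left_inv hp, sum_regular] at this

theorem IsAdapted.disc_mem_nhds (hA : IsAdapted F a) (P : zeros ω) :
    (F P).ξ.source ∩ (F P).ξ ⁻¹' {x | a * Complex.normSq x ≤ 1} ∈ 𝓝 P.1 := by
  have hF := hA.dist P
  refine inter_mem ((F P).ξ.open_source.mem_nhds hF.2.1) (((F P).ξ.continuousAt hF.2.1) ?_)
  rw [hF.2.2.1]
  have h1 : Tendsto (fun x : ℂ => a * Complex.normSq x) (𝓝 0) (𝓝 0) := by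
    have := (contDiff_normSq.continuous.const_mul a).tendsto (0 : ℂ)
    simpa using this
  exact h1.eventually (Iic_mem_nhds one_pos)

include hω hz in
-- The element of Dom Δ_min that remains after subtracting regular models serves as ũ. Near a zero
-- the cutoffs are 1 and only the four models at that zero are present.
theorem hasFriedrichsAsymptotics [ConnectedSpace X] (hs : HasSimpleZeros ω) (hne : (zeros ω).Nonempty)
    {u f : C.L2 ω} (hu : (u, f) ∈ (UnboundedOp.prod (C.dbarOp ω).adjoint (C.dbarOp ω)).graph) :
    C.HasFriedrichsAsymptotics ω u := by
  choose F hF using fun P : zeros ω => exists_distinguished_frame (C := C) hω hs P.2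
  obtain ⟨a, hA, -⟩ := exists_isAdapted hz hF (V := fun _ => Set.univ) fun _ => univ_mem
  obtain ⟨w, w', hw, -, -, -, hdec, -⟩ := hA.exists_regular hω hz hs hne
  obtain ⟨c, hc⟩ := hdec u f hu
  have hπ : (Real.pi : ℂ) ≠ 0 := by exact_mod_cast Real.pi_ne_zero
  refine ⟨_, hc, fun P hP => ⟨(F ⟨P, hP⟩).ξ, (F ⟨P, hP⟩).s, hF ⟨P, hP⟩, (F ⟨P, hP⟩).spin,
    -(Real.pi / 2) * c (⟨P, hP⟩, 1), c (⟨P, hP⟩, 2), c (⟨P, hP⟩, 3), -(3 * Real.pi / 2) * c (⟨P, hP⟩, 0),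
    _, hA.disc_mem_nhds ⟨P, hP⟩, Set.inter_subset_left, ?_⟩⟩
  filter_upwards [coeFn_sub_sum (x := u) EventuallyEq.rfl hw c] with p hp hpV
  have h1 := hA.frameRep_sum c ⟨P, hP⟩ hpV.1 hpV.2
  rw [frameRep] at h1
  rw [frameRep, frameRep, hp, mul_sub, h1]
  field_simp
  ring

include hω hz in
-- Subtracting ũ and the regular models with the given coefficients leaves z in Dom L* which
-- vanishes near the zeros. By locality L*z vanishes there too, so the boundary form of z with
-- regular models supported close enough to the zeros is trivially zero, and duality gives z ∈ Dom
-- D̄.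
theorem mem_domain_of_hasFriedrichsAsymptotics [ConnectedSpace X] (hs : HasSimpleZeros ω)
    (hne : (zeros ω).Nonempty) {u u' : C.L2 ω}
    (hu : (u, u') ∈ (C.testOperator ω (C.laplacian ω)).adjoint.graph)
    (h : C.HasFriedrichsAsymptotics ω u) : u ∈ (C.dbarOp ω).domain := by
  have hcf := isCoerciveFactor hω hz hs hne (C := C)
  obtain ⟨v, hv, hasym⟩ := h
  obtain ⟨v', hv'⟩ := UnboundedOp.mem_domain_iff_graph.1 hv
  have hvF := hcf.mem_graph_prod_iff.1 (LinearPMap.le_graph_iff.2 hcf.closure_le_prod hv')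
  choose ξ s hξ hspin c₀ c₁ c₂ d V hV hVξ hae using fun P : zeros ω => hasym P.1 P.2
  set F : zeros ω → C.Frame := fun P => ⟨ξ P, s P, (hξ P).1, hspin P⟩ with hF
  obtain ⟨a, hA, -⟩ := exists_isAdapted hz (F := F) hξ (V := fun _ => Set.univ) fun _ => univ_mem
  obtain ⟨w, w', hw, hw', hwD, hwL, -, -⟩ := hA.exists_regular hω hz hs hne
  -- The order is that of the degrees -1, 0, 1, 2, that is of x̄|x|, |x|, x, x², with the
  -- normalising factors of the expansion absorbed.
  set c : zeros ω × Fin 4 → ℂ := fun j =>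
    ![-(2 / (3 * (Real.pi : ℂ))) * d j.1, -(2 / (Real.pi : ℂ)) * c₀ j.1, c₁ j.1, c₂ j.1] j.2 with hc
  have hzL : (u - v - ∑ j, c j • w j, u' - v' - ∑ j, c j • w' j) ∈
      (C.testOperator ω (C.laplacian ω)).adjoint.graph := by
    have := ((C.testOperator ω (C.laplacian ω)).adjoint.graph.sub_mem
      ((C.testOperator ω (C.laplacian ω)).adjoint.graph.sub_mem hu hvF.2)
      ((C.testOperator ω (C.laplacian ω)).adjoint.graph.sum_mem (t := Finset.univ) fun j _ =>
        (C.testOperator ω (C.laplacian ω)).adjoint.graph.smul_mem (c j) (hwL j)))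
    convert this using 1
    ext <;> simp [Prod.fst_sum, Prod.snd_sum]
  set z := u - v - ∑ j, c j • w j with hzdef
  set z' := u' - v' - ∑ j, c j • w' j with hzdef'
  have hz0 : ∀ P, ∀ᵐ p ∂(C.hArea ω),
      p ∈ V P ∩ ((F P).ξ.source ∩ (F P).ξ ⁻¹' {x | a * Complex.normSq x ≤ 1}) → z p = 0 := fun P => by
    filter_upwards [coeFn_sub_sum (Lp.coeFn_sub u v) hw c, hae P] with p hp hpa hpV
    have h1 := hA.frameRep_sum c P hpV.2.1 hpV.2.2
    have h2 := hpa hpV.1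
    have h3 : C.frameRep (F P).s z p = 0 := by
      rw [frameRep] at h1 h2 ⊢
      rw [hp, mul_sub, h1, Pi.sub_apply, mul_sub]
      rw [frameRep] at h2
      simp only [hF, h2, hc, Matrix.cons_val_zero, Matrix.cons_val_one, Matrix.cons_val]
      ring
    rw [frameRep] at h3
    exact (mul_eq_zero.1 h3).resolve_left ((F P).s_idx_ne_zero hpV.2.1)
  have hnh := fun P => inter_mem (hV P) (hA.disc_mem_nhds P)
  choose U hU hU0 using fun P => ae_eq_zero_of_mem_adjoint hω hz hzL (hnh P) (hz0 P)
  -- A second, smaller family of discs, on which both z and L*z vanish; the test models for the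
  -- boundary form are supported there.
  obtain ⟨b, hB, hbV⟩ := exists_isAdapted hz (F := F) hξ (V := fun P => _) fun P => inter_mem (hnh P) (hU P)
  obtain ⟨y, y', hy, hy', -, -, -, hmem⟩ := hB.exists_regular hω hz hs hne
  have hzD : z ∈ (C.dbarOp ω).domain := hmem z z' hzL fun j => by
    have h1 : ∀ {x : C.L2 ω} {g : ℂ → ℂ} {t : C.L2 ω}, x =ᵐ[C.hArea ω] (F j.1).ofFun g →
        tsupport g ⊆ {z | b * Complex.normSq z ≤ 2} →
        (∀ᵐ p ∂(C.hArea ω), p ∈ (F j.1).ξ.symm '' {z | b * Complex.normSq z ≤ 2} → t p = 0) →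
        inner ℂ t x = 0 := fun {x g t} hx hg ht => by
      rw [inner_eq_ip EventuallyEq.rfl hx, ip]
      refine integral_eq_zero_of_ae ?_
      filter_upwards [ht] with p hp
      by_cases hpd : p ∈ (F j.1).ξ.symm '' {z | b * Complex.normSq z ≤ 2}
      · rw [hp hpd, map_zero, zero_mul]; rfl
      · rw [hB.ofFun_eq_zero hg hpd, mul_zero]; rfl
    rw [h1 (hy j) tsupport_radialModel_subset ((hU0 j.1).mono fun p hp hpd => hp (hbV j.1 hpd).2),
      h1 (hy' j) tsupport_radialModelLap_subset ((hz0 j.1).mono fun p hp hpd => hp (hbV j.1 hpd).1)]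
  have hu' : u = z + v + ∑ j, c j • w j := by rw [hzdef]; abel
  rw [hu']
  exact (C.dbarOp ω).domain.add_mem ((C.dbarOp ω).domain.add_mem hzD hvF.1)
    ((C.dbarOp ω).domain.sum_mem fun j _ => (C.dbarOp ω).domain.smul_mem _ (hwD j))

end Model

end SpinBundle

end RiemannSurface

/-! ### The main theorem -/

theorem mainTheorem6 {X : Type*} [TopologicalSpace X] [ChartedSpace ℂ X] [IsManifold 𝓘(ℂ) 1 X]
    [T2Space X] [CompactSpace X] [ConnectedSpace X] [MeasurableSpace X] [BorelSpace X]
    (hg : 1 < RiemannSurface.genus X)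
    (ω : ∀ p : X, TangentSpace 𝓘(ℂ) p →L[ℂ] ℂ)
    (hω : ω ∈ RiemannSurface.holomorphicOneForms X)
    (hsimple : RiemannSurface.HasSimpleZeros ω)
    (hcard : (RiemannSurface.zeros ω).ncard = 2 * RiemannSurface.genus X - 2)
    (C : RiemannSurface.SpinBundle X) :
    (C.laplaceMin ω ≤ C.laplaceF ω ∧ IsSelfAdjoint (C.laplaceF ω)) ∧
    (∀ u : C.L2 ω, u ∈ (C.laplaceF ω).domain ↔
      u ∈ (C.laplaceMin ω).adjoint.domain ∧ C.HasFriedrichsAsymptotics ω u) ∧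
    C.laplaceF ω = UnboundedOp.prod (C.dbarOp ω).adjoint (C.dbarOp ω) ∧
    ∃ c : ℝ, 0 < c ∧ ∀ u : (C.laplaceF ω).domain,
      c * ‖(u : C.L2 ω)‖ ^ 2 ≤ (inner ℂ (u : C.L2 ω) (C.laplaceF ω u)).re := by
  -- Genus greater than 1 forces 2g - 2 ≥ 2, so the cardinality is genuine: the zero set is finite
  -- and nonempty.
  have hpos : (RiemannSurface.zeros ω).ncard ≠ 0 := by omega
  have hz : (RiemannSurface.zeros ω).Finite := Set.finite_of_ncard_ne_zero hpos
  have hne : (RiemannSurface.zeros ω).Nonempty := Set.nonempty_of_ncard_ne_zero hpos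
  have : Fintype (RiemannSurface.zeros ω) := hz.fintype
  have h := RiemannSurface.SpinBundle.isCoerciveFactor hω hz hsimple hne (C := C)
  have hF : C.laplaceF ω = UnboundedOp.prod (C.dbarOp ω).adjoint (C.dbarOp ω) := h.friedrichs_eq
  have hadj : (C.laplaceMin ω).adjoint = (C.testOperator ω (C.laplacian ω)).adjoint := h.adjoint_closure
  rw [hF]
  refine ⟨⟨h.closure_le_prod, h.isSelfAdjoint_prod⟩, fun u => ?_, rfl, ?_⟩
  · rw [hadj]
    constructor
    · intro hu
      obtain ⟨f, hf⟩ := UnboundedOp.mem_domain_iff_graph.1 hu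
      exact ⟨UnboundedOp.mem_domain_iff_graph.2 ⟨f, (h.mem_graph_prod_iff.1 hf).2⟩,
        RiemannSurface.SpinBundle.hasFriedrichsAsymptotics hω hz hsimple hne hf⟩
    · rintro ⟨hu, hasym⟩
      obtain ⟨f, hf⟩ := UnboundedOp.mem_domain_iff_graph.1 hu
      exact UnboundedOp.mem_domain_iff_graph.2 ⟨f, h.mem_graph_prod_iff.2
        ⟨RiemannSurface.SpinBundle.mem_domain_of_hasFriedrichsAsymptotics hω hz hsimple hne hf hasym, hf⟩⟩
  · obtain ⟨c, hc, hcoer⟩ := h.coercive_prod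
    exact ⟨c, hc, fun u => hcoer (LinearPMap.mem_graph _ u)⟩

end
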